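/- Let $\mathcal A$ be a unital locally convex $*$-algebra over $\mathbb C$ (the product and the involution are continuous) and let $(\mathcal A,\mathcal H,D)_\sigma$ be a smooth twisted spectral triple. That is: - $\mathcal H=\mathcal H^+\oplus\mathcal H^-$ is a $\mathbb Z_2$-graded Hilbert space with grading operator $\gamma$, and $\mathcal A$ is represented on $\mathcal H$ by a unital $*$-representation by even bounded operators; - $\sigma$ is an algebra automorphism of $\mathcal A$ with $\sigma(a)^*=\sigma^{-1}(a^*)$; - $D$ is an odd selfadjoint operator with $(D+i)^{-1}$ compact, each $a\in\mathcal A$ preserves $\operatorname{dom}D$, and $[D,a]_\sigma:=Da-\sigma(a)D$ is bounded; - (smoothness) the representation $\mathcal A\to\mathcal L(\mathcal H)$ and the map $a\mapsto[D,a]_\sigma\in\mathcal L(\mathcal H)$ are continuous, and $\sigma$ is a homeomorphism. Assume that it is $p$-summable for a real $p\ge1$: $\operatorname{Tr}|D|^{-p}<\infty$, with $|D|^{-1}:=0$ on $\ker D$. For integers $q\ge\frac12(p-1)$ put $c_q=\frac12(-1)^q\frac{q!}{(2q)!}$ and, when $D$ is invertible, $$\tau_{2q}(a^0,\dots,a^{2q})=c_q\operatorname{Tr}\big(\gamma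 D^{-1}[D,a^0]_\sigma\cdots D^{-1}[D,a^{2q}]_\sigma\big).$$ In general let $\bar\tau_{2q}$ be given by the same formula on $\mathcal H\oplus\mathcal H$ with $\gamma$, $D$ and $a$ replaced by $$\tilde\gamma=\begin{pmatrix}\gamma&0\\0&-\gamma\end{pmatrix},\quad \tilde D=\begin{pmatrix}D&1\\1&-D\end{pmatrix},\quad \pi(a)=\begin{pmatrix}a&0\\0&0\end{pmatrix},\quad[\tilde D,\pi(a)]_\sigma=\tilde D\pi(a)-\pi(\sigma(a))\tilde D .$$ Let $HP^0(\mathcal A)$ be the even cohomology of the complex of finitely supported periodic cochains of $\mathcal A$ with differential $b+B$, let $\mathbf{HP}^0(\mathcal A)$ be that of the subcomplex of continuous cochains, and let $\mathbf{HP}_0(\mathcal A)$ be the even homology of the periodic complex of topological chains (products of completed projective tensor powers of $\mathcal A$). Then: 1. $\tilde D$ is invertible with bounded inverse, the twisted commutators $[\tilde D,\pi(a)]_\sigma$ are bounded, and for every $q\ge\frac12(p-1)$ the operators under the traces are trace-class. The cochains $\bar\tau_{2q}$, and also $\tau_{2q}$ if $D$ is invertible, are continuous cyclic cocycles, and all of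 them, for all $q\ge\frac12(p-1)$, have one common class $\mathbf{Ch}(D)_\sigma$ in $\mathbf{HP}^0(\mathcal A)$. Likewise they have one common class $\mathrm{Ch}(D)_\sigma$ in $HP^0(\mathcal A)$ (the usual Connes–Chern character). 2. The natural map $\mathbf{HP}^0(\mathcal A)\to HP^0(\mathcal A)$ sends $\mathbf{Ch}(D)_\sigma$ to $\mathrm{Ch}(D)_\sigma$. 3. Let $\mathcal E$ be a finitely generated projective right $\mathcal A$-module, and let $\mathcal E^\sigma$ be a $\sigma$-translate of $\mathcal E$: a right module with a linear isomorphism $\sigma^{\mathcal E}:\mathcal E\to\mathcal E^\sigma$ that corresponds to $\sigma:e\mathcal A^N\to\sigma(e)\mathcal A^N$ under module isomorphisms $\mathcal E\simeq e\mathcal A^N$ and $\mathcal E^\sigma\simeq\sigma(e)\mathcal A^N$, for some idempotent $e\in M_N(\mathcal A)$. Let $\nabla$ be a $\sigma$-connection on $\mathcal E$: a linear map $\nabla:\mathcal E\to\mathcal E^\sigma\otimes_{\mathcal A}\Omega^1_{D,\sigma}(\mathcal A)$ with $\nabla(\xi a)=(\nabla\xi)a+\sigma^{\mathcal E}(\xi)\otimes[D,a]_\sigma$,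 where $\Omega^1_{D,\sigma}(\mathcal A)=\{\sum a^i[D,b^i]_\sigma\}\subset\mathcal L(\mathcal H)$. Define $$D_\nabla:\mathcal E\otimes_{\mathcal A}\operatorname{dom}D\to\mathcal E^\sigma\otimes_{\mathcal A}\mathcal H,\qquad D_\nabla(\xi\otimes\zeta)=\sigma^{\mathcal E}(\xi)\otimes D\zeta+(\nabla\xi)\zeta,$$ where $(\eta\otimes\omega)\zeta=\eta\otimes\omega(\zeta)$, with odd components $D_\nabla^\pm:\mathcal E\otimes_{\mathcal A}\operatorname{dom}D^\pm\to\mathcal E^\sigma\otimes_{\mathcal A}\mathcal H^\mp$. Then $D_\nabla^\pm$ have finite-dimensional kernels and cokernels, and $$\operatorname{ind}D_\nabla:=\tfrac12\big(\operatorname{ind}D_\nabla^+-\operatorname{ind}D_\nabla^-\big)=\langle\mathbf{Ch}(D)_\sigma,\mathbf{Ch}(\mathcal E)\rangle .$$ Here $\mathbf{Ch}(\mathcal E)\in\mathbf{HP}_0(\mathcal A)$ is the image of the class in periodic cyclic homology of the Chern character of any idempotent $e\in M_N(\mathcal A)$ with $\mathcal E\simeq e\mathcal A^N$. This Chern character is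 the class whose normalized components are $\mathrm{Ch}_0(e)=\operatorname{tr}e$ and $\mathrm{Ch}_{2q}(e)=(-1)^q\frac{(2q)!}{q!}\operatorname{tr}[(e-\frac12)\otimes e^{\otimes 2q}]$ for $q\ge1$. In particular the formula holds for every Hermitian finitely generated projective module and every $\sigma$-connection on it. -/

import Mathlib

open scoped TensorProduct InnerProductSpace Matrix
open MulOpposite (op)

noncomputable section

namespace CyclicTheory

variable {A : Type*} [Ring A] [Algebra ℂ A]
variable {F G : Type*} [AddCommGroup F] [Module ℂ F] [AddCommGroup G] [Module ℂ G]

/-- `(m + 1)`-linear maps on `A` with values in `F`. -/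
abbrev MultiForm (A : Type*) [Ring A] [Algebra ℂ A] (m : ℕ) (F : Type*) [AddCommGroup F]
    [Module ℂ F] := MultilinearMap ℂ (fun _ : Fin (m + 1) => A) F

theorem contractNth_update {m : ℕ} (j : Fin (m + 1)) (a : Fin (m + 2) → A) (i : Fin (m + 2)) :
    ∃ (k : Fin (m + 1)) (L : A →ₗ[ℂ] A), ∀ x : A,
      Fin.contractNth j.castSucc (· * ·) (Function.update a i x) =
        Function.update (Fin.contractNth j.castSucc (· * ·) a) k (L x) := by
  rcases lt_trichotomy (i : ℕ) (j : ℕ) with h | h | h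
  · refine ⟨⟨i, by omega⟩, LinearMap.id, fun x => ?_⟩
    funext k
    simp only [Fin.contractNth, Function.update_apply, Fin.ext_iff, Fin.val_castSucc,
      Fin.val_succ, LinearMap.id_apply]
    grind
  · refine ⟨j, LinearMap.mulRight ℂ (a j.succ), fun x => ?_⟩
    funext k
    simp only [Fin.contractNth, Function.update_apply, Fin.ext_iff, Fin.val_castSucc,
      Fin.val_succ, LinearMap.mulRight_apply]
    grind
  · rcases Nat.lt_or_ge (j + 1 : ℕ) (i : ℕ) with h' | h'
    · refine ⟨⟨i - 1, by omega⟩, LinearMap.id, fun x => ?_⟩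
      funext k
      simp only [Fin.contractNth, Function.update_apply, Fin.ext_iff, Fin.val_castSucc,
        Fin.val_succ, LinearMap.id_apply]
      grind
    · refine ⟨j, LinearMap.mulLeft ℂ (a j.castSucc), fun x => ?_⟩
      funext k
      simp only [Fin.contractNth, Function.update_apply, Fin.ext_iff, Fin.val_castSucc,
        Fin.val_succ, LinearMap.mulLeft_apply]
      grind

/-- `(a⁰, …, aᵐ⁺¹) ↦ φ(a⁰, …, aʲaʲ⁺¹, …, aᵐ⁺¹)`, for `0 ≤ j ≤ m`. -/
def face {m : ℕ} (j : Fin (m + 1)) : MultiForm A m F →ₗ[ℂ] MultiForm A (m + 1) F where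
  toFun φ :=
    { toFun := fun a => φ (Fin.contractNth j.castSucc (· * ·) a)
      map_update_add' := by
        intro inst a i x y
        obtain rfl : inst = instDecidableEqFin _ := Subsingleton.elim _ _
        obtain ⟨k, L, h⟩ := contractNth_update j a i
        simp only [h, map_add, MultilinearMap.map_update_add]
      map_update_smul' := by
        intro inst a i c x
        obtain rfl : inst = instDecidableEqFin _ := Subsingleton.elim _ _
        obtain ⟨k, L, h⟩ := contractNth_update j a i
        simp only [h, map_smul, MultilinearMap.map_update_smul] }
  map_add' _ _ := rfl
  map_smul' _ _ := rfl

/-- `(a⁰, …, aᵐ) ↦ φ(aᵐ, a⁰, …, aᵐ⁻¹)`. -/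
def rot (m : ℕ) : MultiForm A m F →ₗ[ℂ] MultiForm A m F :=
  (MultilinearMap.domDomCongrLinearEquiv ℂ ℂ A F (finRotate (m + 1)).symm).toLinearMap

theorem rot_apply (m : ℕ) (φ : MultiForm A m F) (a : Fin (m + 1) → A) :
    rot m φ a = φ (fun i => a ((finRotate (m + 1)).symm i)) := rfl

/-- The cyclic operator `Tφ(a⁰, …, aᵐ) = (-1)ᵐ φ(aᵐ, a⁰, …, aᵐ⁻¹)`. -/
def opT (m : ℕ) : MultiForm A m F →ₗ[ℂ] MultiForm A m F := (-1 : ℂ) ^ m • rot m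

/-- The Hochschild coboundary `b`; the last term is
`(a⁰, …, aᵐ⁺¹) ↦ (-1)ᵐ⁺¹ φ(aᵐ⁺¹a⁰, a¹, …, aᵐ)`. -/
def opb (m : ℕ) : MultiForm A m F →ₗ[ℂ] MultiForm A (m + 1) F :=
  (∑ j : Fin (m + 1), (-1 : ℂ) ^ (j : ℕ) • face j) +
    (-1 : ℂ) ^ (m + 1) • (rot (m + 1) ∘ₗ face 0)

/-- The cyclic symmetrization `1 + T + ⋯ + Tᵐ`. -/
def opA (m : ℕ) : MultiForm A m F →ₗ[ℂ] MultiForm A m F := ∑ i ∈ Finset.range (m + 1), opT m ^ i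

/-- `B₀φ(a⁰, …, aᵐ) = φ(1, a⁰, …, aᵐ)`. -/
def opB₀ (m : ℕ) : MultiForm A (m + 1) F →ₗ[ℂ] MultiForm A m F where
  toFun φ := φ.curryLeft 1
  map_add' _ _ := rfl
  map_smul' _ _ := rfl

/-- `B = A B₀ (1 - T)`. -/
def opB (m : ℕ) : MultiForm A (m + 1) F →ₗ[ℂ] MultiForm A m F :=
  opA m ∘ₗ opB₀ m ∘ₗ (LinearMap.id - opT (m + 1))

/-- `(x⁰, …, xᵐ) ↦ ∑ φ(x⁰_{i₀i₁}, x¹_{i₁i₂}, …, xᵐ_{iₘi₀})` on `M_N(A)`. On elementary tensors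
this is `(a⁰ ⊗ μ⁰, …, aᵐ ⊗ μᵐ) ↦ tr(μ⁰⋯μᵐ) φ(a⁰, …, aᵐ)`. -/
def matTrace (N m : ℕ) : MultiForm A m F →ₗ[ℂ] MultiForm (Matrix (Fin N) (Fin N) A) m F where
  toFun φ := ∑ i : Fin (m + 1) → Fin N, φ.compLinearMap
    (fun k => Matrix.entryLinearMap ℂ A (i k) (i (finRotate (m + 1) k)))
  map_add' φ ψ := by
    rw [← Finset.sum_add_distrib]
    rfl
  map_smul' c φ := by
    rw [Finset.smul_sum]
    rfl

/-! ### Periodic cyclic cohomology -/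

/-- Even sequences of cochains; the finitely supported ones are singled out below. -/
abbrev EvenForms (A : Type*) [Ring A] [Algebra ℂ A] := ∀ q : ℕ, MultiForm A (2 * q) ℂ

/-- Odd sequences of cochains. -/
abbrev OddForms (A : Type*) [Ring A] [Algebra ℂ A] := ∀ q : ℕ, MultiForm A (2 * q + 1) ℂ

/-- `b + B` on even cochains: `(φ_{2q}) ↦ (bφ_{2q} + Bφ_{2q+2})`. -/
def dEven : EvenForms A →ₗ[ℂ] OddForms A :=
  LinearMap.pi fun q => opb (2 * q) ∘ₗ LinearMap.proj q + opB (2 * q + 1) ∘ₗ LinearMap.proj (q + 1)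

/-- `b + B` on odd cochains: `(ψ_{2q+1}) ↦ (bψ_{2q-1} + Bψ_{2q+1})`. -/
def dOdd : OddForms A →ₗ[ℂ] EvenForms A :=
  LinearMap.pi fun q => match q with
    | 0 => opB 0 ∘ₗ LinearMap.proj 0
    | q + 1 => opb (2 * q + 1) ∘ₗ LinearMap.proj q + opB (2 * q + 2) ∘ₗ LinearMap.proj (q + 1)

/-- The even periodic cochains with components in the spaces `S m`: finitely supported sequences. -/
def evenCochains (S : ∀ m, Submodule ℂ (MultiForm A m ℂ)) : Submodule ℂ (EvenForms A) where
  carrier := {φ | (∀ q, φ q ∈ S (2 * q)) ∧ ∃ Q, ∀ q, Q ≤ q → φ q = 0}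
  add_mem' := by
    rintro φ ψ ⟨h, Q, hQ⟩ ⟨h', Q', hQ'⟩
    refine ⟨fun q => add_mem (h q) (h' q), max Q Q', fun q hq => ?_⟩
    simp [hQ q (le_trans (le_max_left _ _) hq), hQ' q (le_trans (le_max_right _ _) hq)]
  zero_mem' := ⟨fun q => zero_mem _, 0, fun _ _ => rfl⟩
  smul_mem' := by
    rintro c φ ⟨h, Q, hQ⟩
    exact ⟨fun q => Submodule.smul_mem _ _ (h q), Q, fun q hq => by simp [hQ q hq]⟩

/-- The odd periodic cochains with components in the spaces `S m`. -/
def oddCochains (S : ∀ m, Submodule ℂ (MultiForm A m ℂ)) : Submodule ℂ (OddForms A) where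
  carrier := {φ | (∀ q, φ q ∈ S (2 * q + 1)) ∧ ∃ Q, ∀ q, Q ≤ q → φ q = 0}
  add_mem' := by
    rintro φ ψ ⟨h, Q, hQ⟩ ⟨h', Q', hQ'⟩
    refine ⟨fun q => add_mem (h q) (h' q), max Q Q', fun q hq => ?_⟩
    simp [hQ q (le_trans (le_max_left _ _) hq), hQ' q (le_trans (le_max_right _ _) hq)]
  zero_mem' := ⟨fun q => zero_mem _, 0, fun _ _ => rfl⟩
  smul_mem' := by
    rintro c φ ⟨h, Q, hQ⟩
    exact ⟨fun q => Submodule.smul_mem _ _ (h q), Q, fun q hq => by simp [hQ q hq]⟩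

def evenCocycles (S : ∀ m, Submodule ℂ (MultiForm A m ℂ)) : Submodule ℂ (EvenForms A) :=
  evenCochains S ⊓ LinearMap.ker dEven

def evenCoboundaries (S : ∀ m, Submodule ℂ (MultiForm A m ℂ)) : Submodule ℂ (EvenForms A) :=
  (oddCochains S).map dOdd

/-- The even periodic cyclic cohomology of the complex of cochains with components in `S`. -/
abbrev PeriodicCohomology (S : ∀ m, Submodule ℂ (MultiForm A m ℂ)) :=
  evenCocycles S ⧸ (evenCoboundaries S).submoduleOf (evenCocycles S)

/-- All cochains. -/
def allForms (A : Type*) [Ring A] [Algebra ℂ A] (m : ℕ) : Submodule ℂ (MultiForm A m ℂ) := ⊤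

/-- The continuous cochains. -/
def contForms (A : Type*) [Ring A] [Algebra ℂ A] [TopologicalSpace A] (m : ℕ) :
    Submodule ℂ (MultiForm A m ℂ) where
  carrier := {φ | Continuous φ}
  add_mem' {φ ψ} (hφ : Continuous φ) (hψ : Continuous ψ) := hφ.add hψ
  zero_mem' := continuous_const (y := (0 : ℂ))
  smul_mem' c φ (hφ : Continuous φ) := hφ.const_smul c

/-- `HP⁰(A)`. -/
abbrev HPUpper (A : Type*) [Ring A] [Algebra ℂ A] := PeriodicCohomology (allForms A)

/-- `𝐇𝐏⁰(A)`, the periodic cyclic cohomology of continuous cochains. -/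
abbrev ContHPUpper (A : Type*) [Ring A] [Algebra ℂ A] [TopologicalSpace A] :=
  PeriodicCohomology (contForms A)

theorem evenCocycles_mono [TopologicalSpace A] :
    evenCocycles (contForms A) ≤ evenCocycles (allForms A) :=
  fun _ h => ⟨⟨fun _ => Submodule.mem_top, h.1.2⟩, h.2⟩

/-- The map `𝐇𝐏⁰(A) → HP⁰(A)` induced by the inclusion of continuous cochains into cochains. -/
def forgetContinuity (A : Type*) [Ring A] [Algebra ℂ A] [TopologicalSpace A] :
    ContHPUpper A →ₗ[ℂ] HPUpper A :=
  Submodule.mapQ _ _ (Submodule.inclusion evenCocycles_mono) (by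
    rintro ⟨x, hx⟩ ⟨ψ, hψ, h⟩
    exact ⟨ψ, ⟨fun _ => Submodule.mem_top, hψ.2⟩, h⟩)

/-- Cyclic cocycles: `Tφ = φ` and `bφ = 0`. -/
def IsCyclicCocycle {m : ℕ} (φ : MultiForm A m ℂ) : Prop := opT m φ = φ ∧ opb m φ = 0

theorem IsCyclicCocycle.single_mem {S : ∀ m, Submodule ℂ (MultiForm A m ℂ)} {q : ℕ}
    {φ : MultiForm A (2 * q) ℂ} (h : IsCyclicCocycle φ) (hS : φ ∈ S (2 * q)) :
    (Pi.single q φ : EvenForms A) ∈ evenCocycles S := by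
  refine ⟨⟨fun r => ?_, q + 1, fun r hr => Pi.single_eq_of_ne (by omega) _⟩, ?_⟩
  · rcases eq_or_ne r q with rfl | hr
    · simpa using hS
    · rw [Pi.single_eq_of_ne hr]
      exact zero_mem _
  · refine LinearMap.mem_ker.mpr ?_
    funext r
    have h1 : opb (2 * r) ((Pi.single q φ : EvenForms A) r) = 0 := by
      rcases eq_or_ne r q with rfl | hr
      · simpa using h.2
      · rw [Pi.single_eq_of_ne hr, map_zero]
    have h2 : opB (2 * r + 1) ((Pi.single q φ : EvenForms A) (r + 1)) = 0 := by
      rcases eq_or_ne (r + 1) q with rfl | hr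
      · rw [Pi.single_eq_same]
        have : (LinearMap.id - opT (2 * r + 1 + 1) :
            MultiForm A (2 * r + 1 + 1) ℂ →ₗ[ℂ] MultiForm A (2 * r + 1 + 1) ℂ) φ = 0 := by
          exact sub_eq_zero.mpr h.1.symm
        exact (congrArg (opA (2 * r + 1) ∘ₗ opB₀ (2 * r + 1)) this).trans (map_zero _)
      · rw [Pi.single_eq_of_ne hr]
        exact map_zero _
    exact (congrArg₂ (· + ·) h1 h2).trans (add_zero 0)

/-- The periodic class of a cyclic cocycle `φ` of even degree, i.e. the class of the sequence
`(0, …, 0, φ, 0, …)`. -/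
def cyclicClass {S : ∀ m, Submodule ℂ (MultiForm A m ℂ)} {q : ℕ}
    (φ : MultiForm A (2 * q) ℂ) (h : IsCyclicCocycle φ) (hS : φ ∈ S (2 * q)) :
    PeriodicCohomology S :=
  Submodule.Quotient.mk ⟨Pi.single q φ, h.single_mem hS⟩

/-! ### Periodic cyclic homology -/

/-- `m`-chains: `A ⊗ ⋯ ⊗ A` with `m + 1` factors. -/
def Chain (A : Type*) [Ring A] [Algebra ℂ A] (m : ℕ) : Type _ := ⨂[ℂ] _ : Fin (m + 1), A

instance (m : ℕ) : AddCommGroup (Chain A m) :=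
  inferInstanceAs (AddCommGroup (⨂[ℂ] _ : Fin (m + 1), A))

instance (m : ℕ) : Module ℂ (Chain A m) :=
  inferInstanceAs (Module ℂ (⨂[ℂ] _ : Fin (m + 1), A))

/-- `(a⁰, …, aᵐ) ↦ a⁰ ⊗ ⋯ ⊗ aᵐ`. -/
def tens (A : Type*) [Ring A] [Algebra ℂ A] (m : ℕ) : MultiForm A m (Chain A m) :=
  PiTensorProduct.tprod ℂ

/-- The linear map on chains that corresponds to a multilinear map. -/
def linearize {m : ℕ} : MultiForm A m F →ₗ[ℂ] Chain A m →ₗ[ℂ] F :=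
  (PiTensorProduct.lift (R := ℂ) (s := fun _ : Fin (m + 1) => A) (E := F)).toLinearMap

@[simp] theorem linearize_tens {m : ℕ} (φ : MultiForm A m F) (a : Fin (m + 1) → A) :
    linearize φ (tens A m a) = φ a := PiTensorProduct.lift.tprod a

theorem chain_hom_ext {m : ℕ} {f g : Chain A m →ₗ[ℂ] F}
    (h : ∀ a, f (tens A m a) = g (tens A m a)) : f = g :=
  PiTensorProduct.ext (MultilinearMap.ext h)

/-- The Hochschild boundary `b` on chains: the operator whose transpose is `b` on cochains,
`b(a⁰ ⊗ ⋯ ⊗ aᵐ⁺¹) = ∑ (-1)ʲ a⁰ ⊗ ⋯ ⊗ aʲaʲ⁺¹ ⊗ ⋯ + (-1)ᵐ⁺¹ aᵐ⁺¹a⁰ ⊗ ⋯ ⊗ aᵐ`. -/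
def chainb (m : ℕ) : Chain A (m + 1) →ₗ[ℂ] Chain A m := linearize (opb m (tens A m))

/-- The cyclic operator `T(a⁰ ⊗ ⋯ ⊗ aᵐ) = (-1)ᵐ aᵐ ⊗ a⁰ ⊗ ⋯ ⊗ aᵐ⁻¹` on chains. -/
def chainT (m : ℕ) : Chain A m →ₗ[ℂ] Chain A m := linearize (opT m (tens A m))

/-- `B₀(a⁰ ⊗ ⋯ ⊗ aᵐ) = 1 ⊗ a⁰ ⊗ ⋯ ⊗ aᵐ`. -/
def chainB₀ (m : ℕ) : Chain A m →ₗ[ℂ] Chain A (m + 1) := linearize (opB₀ m (tens A (m + 1)))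

/-- `B = (1 - T) B₀ (1 + T + ⋯ + Tᵐ)` on chains. -/
def chainB (m : ℕ) : Chain A m →ₗ[ℂ] Chain A (m + 1) :=
  (LinearMap.id - chainT (m + 1)) ∘ₗ chainB₀ m ∘ₗ ∑ i ∈ Finset.range (m + 1), chainT m ^ i

/-! The chain operators are the transposes of the cochain operators. -/

theorem face_comp (f : F →ₗ[ℂ] G) {m : ℕ} (j : Fin (m + 1)) (φ : MultiForm A m F) :
    face j (f.compMultilinearMap φ) = f.compMultilinearMap (face j φ) := rfl

theorem rot_comp (f : F →ₗ[ℂ] G) {m : ℕ} (φ : MultiForm A m F) :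
    rot m (f.compMultilinearMap φ) = f.compMultilinearMap (rot m φ) := rfl

theorem linearize_comp (f : F →ₗ[ℂ] G) {m : ℕ} (φ : MultiForm A m F) :
    linearize (f.compMultilinearMap φ) = f ∘ₗ linearize φ :=
  chain_hom_ext fun a => by simp

theorem comp_tens {m : ℕ} (f : Chain A m →ₗ[ℂ] F) : linearize (f.compMultilinearMap (tens A m)) = f :=
  chain_hom_ext fun a => by simp

theorem linearize_comp_tens {m : ℕ} (φ : MultiForm A m F) :
    (linearize φ).compMultilinearMap (tens A m) = φ := by
  ext a; simp

theorem opT_comp (f : F →ₗ[ℂ] G) {m : ℕ} (φ : MultiForm A m F) :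
    opT m (f.compMultilinearMap φ) = f.compMultilinearMap (opT m φ) := by
  ext a; simp [opT, rot_comp]

theorem opb_comp (f : F →ₗ[ℂ] G) {m : ℕ} (φ : MultiForm A m F) :
    opb m (f.compMultilinearMap φ) = f.compMultilinearMap (opb m φ) := by
  ext a; simp [opb, face_comp, rot_comp, sum_apply, map_sum]

theorem linearize_opb {m : ℕ} (φ : MultiForm A m F) :
    linearize (opb m φ) = linearize φ ∘ₗ chainb m := by
  rw [chainb, ← linearize_comp, ← opb_comp, linearize_comp_tens]

theorem linearize_opT {m : ℕ} (φ : MultiForm A m F) :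
    linearize (opT m φ) = linearize φ ∘ₗ chainT m := by
  rw [chainT, ← linearize_comp, ← opT_comp, linearize_comp_tens]

theorem linearize_opB₀ {m : ℕ} (φ : MultiForm A (m + 1) F) :
    linearize (opB₀ m φ) = linearize φ ∘ₗ chainB₀ m := by
  rw [chainB₀, ← linearize_comp]
  refine chain_hom_ext fun a => ?_
  simp only [linearize_tens, LinearMap.compMultilinearMap_apply]
  exact (linearize_tens φ _).symm

theorem linearize_opT_pow {m : ℕ} (φ : MultiForm A m F) (i : ℕ) :
    linearize ((opT m ^ i) φ) = linearize φ ∘ₗ chainT m ^ i := by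
  induction i with
  | zero => rfl
  | succ i ih =>
    rw [pow_succ', Module.End.mul_apply, linearize_opT, ih, pow_succ]
    rfl

theorem linearize_opA {m : ℕ} (φ : MultiForm A m F) :
    linearize (opA m φ) = linearize φ ∘ₗ ∑ i ∈ Finset.range (m + 1), chainT m ^ i := by
  rw [opA, LinearMap.sum_apply, map_sum]
  ext x
  simp [linearize_opT_pow]

theorem linearize_opB {m : ℕ} (φ : MultiForm A (m + 1) F) :
    linearize (opB m φ) = linearize φ ∘ₗ chainB m := by
  rw [opB, LinearMap.comp_apply, LinearMap.comp_apply, linearize_opA, linearize_opB₀,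
    LinearMap.sub_apply, map_sub, linearize_opT, chainB]
  ext x
  simp

/-- `b + B` on sequences of even chains (which need not be finitely supported). -/
def bdEven : (∀ q, Chain A (2 * q)) →ₗ[ℂ] (∀ q, Chain A (2 * q + 1)) :=
  LinearMap.pi fun q => chainb (2 * q + 1) ∘ₗ LinearMap.proj (q + 1) +
    chainB (2 * q) ∘ₗ LinearMap.proj q

/-- `b + B` on sequences of odd chains. -/
def bdOdd : (∀ q, Chain A (2 * q + 1)) →ₗ[ℂ] (∀ q, Chain A (2 * q)) :=
  LinearMap.pi fun q => match q with
    | 0 => chainb 0 ∘ₗ LinearMap.proj 0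
    | q + 1 => chainb (2 * q + 2) ∘ₗ LinearMap.proj (q + 1) + chainB (2 * q + 1) ∘ₗ LinearMap.proj q

/-- `HP₀(A)`. -/
abbrev HPLower (A : Type*) [Ring A] [Algebra ℂ A] :=
  LinearMap.ker (bdEven (A := A)) ⧸
    (LinearMap.range (bdOdd (A := A))).submoduleOf (LinearMap.ker (bdEven (A := A)))

/-! ### The Chern character of an idempotent -/

/-- The trace map `C_m(M_N(A)) → C_m(A)`. -/
def trChain (N m : ℕ) : Chain (Matrix (Fin N) (Fin N) A) m →ₗ[ℂ] Chain A m :=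
  linearize (matTrace N m (tens A m))

theorem matTrace_comp (f : F →ₗ[ℂ] G) {m N : ℕ} (φ : MultiForm A m F) :
    matTrace N m (f.compMultilinearMap φ) = f.compMultilinearMap (matTrace N m φ) := by
  apply MultilinearMap.ext
  intro x
  simp only [matTrace, LinearMap.coe_mk, AddHom.coe_mk, sum_apply,
    LinearMap.compMultilinearMap_apply, MultilinearMap.compLinearMap_apply, map_sum]

theorem matTrace_apply (N m : ℕ) (φ : MultiForm A m F)
    (x : Fin (m + 1) → Matrix (Fin N) (Fin N) A) :
    matTrace N m φ x =
      ∑ i : Fin (m + 1) → Fin N, φ (fun k => x k (i k) (i (finRotate (m + 1) k))) := by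
  simp only [matTrace, LinearMap.coe_mk, AddHom.coe_mk, sum_apply,
    MultilinearMap.compLinearMap_apply, Matrix.entryLinearMap_apply]

theorem matTrace_rot (N m : ℕ) (φ : MultiForm A m F) :
    matTrace N m (rot m φ) = rot m (matTrace N m φ) := by
  apply MultilinearMap.ext
  intro x
  rw [rot_apply, matTrace_apply, matTrace_apply]
  refine Fintype.sum_equiv (Equiv.arrowCongr (finRotate (m + 1)) (Equiv.refl _)) _ _ fun i => ?_
  rw [rot_apply]
  congr 1
  funext k
  simp [Equiv.arrowCongr]

theorem val_finRotate {m : ℕ} (k : Fin (m + 1)) :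
    ((finRotate (m + 1) k : Fin (m + 1)) : ℕ) = (if (k : ℕ) = m then 0 else (k : ℕ) + 1 : ℕ) := by
  split_ifs with h
  · rw [show k = Fin.last m from Fin.ext h, finRotate_last, Fin.val_zero]
  · exact coe_finRotate_of_ne_last fun h' => h (by rw [h', Fin.val_last])

theorem matTrace_face (N m : ℕ) (j : Fin (m + 1)) (φ : MultiForm A m F) :
    matTrace N (m + 1) (face j φ) = face j (matTrace N m φ) := by
  apply MultilinearMap.ext
  intro x
  change _ = matTrace N m φ (Fin.contractNth j.castSucc (· * ·) x)
  rw [matTrace_apply, matTrace_apply]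
  rw [← (Fin.insertNthEquiv (fun _ : Fin (m + 2) => Fin N) j.succ).sum_comp,
    Fintype.sum_prod_type_right]
  refine Finset.sum_congr rfl fun i _ => ?_
  have hI : ∀ (l : Fin N) (p : Fin (m + 2)) (k : Fin (m + 1)),
      ((p : ℕ) ≤ j ∧ (k : ℕ) = p) ∨ ((j : ℕ) + 1 < p ∧ (k : ℕ) + 1 = p) →
      (Fin.insertNthEquiv (fun _ : Fin (m + 2) => Fin N) j.succ) (l, i) p = i k := by
    intro l p k h
    have : p = j.succ.succAbove k := by
      rw [Fin.ext_iff, Fin.succAbove]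
      split_ifs with h' <;> simp only [Fin.lt_def, Fin.val_castSucc, Fin.val_succ] at * <;> omega
    rw [this]
    simp [Fin.insertNthEquiv]
  have hJ : ∀ l : Fin N,
      (Fin.insertNthEquiv (fun _ : Fin (m + 2) => Fin N) j.succ) (l, i) j.succ = l := by
    intro l; simp [Fin.insertNthEquiv]
  set R : Fin (m + 1) → A := fun k =>
    Fin.contractNth j.castSucc (· * ·) x k (i k) (i (finRotate (m + 1) k)) with hR
  have h1 : R = Function.update R j
      (∑ l, x j.castSucc (i j) l * x j.succ l (i (finRotate (m + 1) j))) := by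
    rw [eq_comm, Function.update_eq_self_iff, hR]
    simp [Fin.contractNth, Matrix.mul_apply]
  rw [h1, MultilinearMap.map_update_sum]
  refine Finset.sum_congr rfl fun l _ => ?_
  change φ (Fin.contractNth j.castSucc (· * ·) _) = _
  congr 1
  funext k
  have hk := val_finRotate k
  have hk1 := val_finRotate k.castSucc
  have hk2 := val_finRotate k.succ
  have hkm := k.2
  have hjm := j.2
  simp only [Fin.val_castSucc, Fin.val_succ] at hk1 hk2
  rcases lt_trichotomy (k : ℕ) (j : ℕ) with h | h | h
  · rw [Fin.contractNth_apply_of_lt _ _ _ _ (by simpa using h),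
      Function.update_of_ne (by rintro rfl; omega), hR]
    simp only
    rw [Fin.contractNth_apply_of_lt _ _ _ _ (by simpa using h), hI l k.castSucc k,
      hI l _ (finRotate (m + 1) k)]
    · left; grind
    · left; simp; omega
  · obtain rfl : k = j := Fin.ext h
    rw [Fin.contractNth_apply_of_eq _ _ _ _ (by simp), Function.update_self, hI l k.castSucc k,
      show finRotate (m + 1 + 1) k.castSucc = k.succ by
        apply Fin.ext; rw [hk1, Fin.val_succ, if_neg (by omega)],
      hJ, hI l _ (finRotate (m + 1) k)]
    · grind
    · left; simp
  · rw [Fin.contractNth_apply_of_gt _ _ _ _ (by simpa using h),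
      Function.update_of_ne (by rintro rfl; omega), hR]
    simp only
    rw [Fin.contractNth_apply_of_gt _ _ _ _ (by simpa using h), hI l k.succ k,
      hI l _ (finRotate (m + 1) k)]
    · grind
    · right; simp; omega

theorem matTrace_opB₀ (N m : ℕ) (φ : MultiForm A (m + 1) F) :
    matTrace N m (opB₀ m φ) = opB₀ m (matTrace N (m + 1) φ) := by
  apply MultilinearMap.ext
  intro x
  change _ = matTrace N (m + 1) φ (Fin.cons 1 x)
  rw [matTrace_apply, matTrace_apply]
  rw [← (Fin.consEquiv (fun _ : Fin (m + 2) => Fin N)).sum_comp, Fintype.sum_prod_type_right]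
  refine Finset.sum_congr rfl fun i _ => ?_
  rw [Finset.sum_eq_single (i 0)]
  · change φ (Fin.cons 1 _) = _
    congr 1
    funext k
    refine Fin.cases ?_ (fun k => ?_) k
    · have : finRotate (m + 1 + 1) 0 = (0 : Fin (m + 1)).succ := by
        apply Fin.ext; rw [val_finRotate]; simp
      rw [this]
      simp [Fin.consEquiv]
    · simp only [Fin.cons_succ, Fin.consEquiv, Equiv.coe_fn_mk]
      congr 1
      have hk := val_finRotate k
      have hk2 := val_finRotate k.succ
      simp only [Fin.val_succ] at hk2
      rcases eq_or_ne (k : ℕ) m with h | h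
      · have h1 : finRotate (m + 1) k = 0 := Fin.ext (by rw [hk, if_pos h, Fin.val_zero])
        have h2 : finRotate (m + 1 + 1) k.succ = 0 := Fin.ext (by rw [hk2, if_pos (by omega), Fin.val_zero])
        rw [h1, h2, Fin.cons_zero]
      · have h2 : finRotate (m + 1 + 1) k.succ = (finRotate (m + 1) k).succ :=
          Fin.ext (by rw [hk2, if_neg (by omega), Fin.val_succ, hk, if_neg h])
        rw [h2, Fin.cons_succ]
  · intro l _ hl
    refine φ.map_coord_zero 0 ?_
    have : finRotate (m + 1 + 1) 0 = (0 : Fin (m + 1)).succ := by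
      apply Fin.ext; rw [val_finRotate]; simp
    rw [this]
    simp [Fin.consEquiv, Matrix.one_apply_ne hl]
  · simp

theorem matTrace_opb (N m : ℕ) (φ : MultiForm A m F) :
    matTrace N (m + 1) (opb m φ) = opb m (matTrace N m φ) := by
  simp [opb, matTrace_face, matTrace_rot]

theorem matTrace_opT (N m : ℕ) (φ : MultiForm A m F) :
    matTrace N m (opT m φ) = opT m (matTrace N m φ) := by
  simp [opT, matTrace_rot]

theorem chainb_trChain (N m : ℕ) :
    chainb m ∘ₗ trChain (A := A) N (m + 1) = trChain N m ∘ₗ chainb m := by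
  rw [trChain, ← linearize_comp, ← matTrace_comp, trChain, ← linearize_opb, ← matTrace_opb, chainb,
    linearize_comp_tens]

theorem chainT_trChain (N m : ℕ) :
    chainT m ∘ₗ trChain (A := A) N m = trChain N m ∘ₗ chainT m := by
  rw [trChain, ← linearize_comp, ← matTrace_comp, ← linearize_opT, ← matTrace_opT, chainT,
    linearize_comp_tens]

theorem chainB₀_trChain (N m : ℕ) :
    chainB₀ m ∘ₗ trChain (A := A) N m = trChain N (m + 1) ∘ₗ chainB₀ m := by
  rw [trChain, ← linearize_comp, ← matTrace_comp, trChain, ← linearize_opB₀, ← matTrace_opB₀,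
    chainB₀, linearize_comp_tens]

end CyclicTheory

end

noncomputable section

namespace CyclicTheory

variable {A : Type*} [Ring A] [Algebra ℂ A]
variable {F G : Type*} [AddCommGroup F] [Module ℂ F] [AddCommGroup G] [Module ℂ G]

/-- `e ⊗ ⋯ ⊗ e`. -/
def powChain (e : A) (m : ℕ) : Chain A m := tens A m fun _ => e

/-- `1 ⊗ e ⊗ ⋯ ⊗ e`. -/
def onePowChain (e : A) (m : ℕ) : Chain A m := tens A m (Function.update (fun _ => e) 0 1)

/-- The degree `2q` component
`(-1)^q (2q)!/q! tr[e ⊗ ⋯ ⊗ e - ½ (1 - T)(1 ⊗ e ⊗ ⋯ ⊗ e)]` of the Chern character of the idempotent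
`e`. Up to degenerate chains it is `(-1)^q (2q)!/q! tr[(e - ½) ⊗ e ⊗ ⋯ ⊗ e]` for `q ≥ 1`, and it is
`tr e` for `q = 0`; see `chernChain_zero` and `chernChain_sub_mem_degenerate` below. -/
def chernChain {N : ℕ} (e : Matrix (Fin N) (Fin N) A) (q : ℕ) : Chain A (2 * q) :=
  ((-1 : ℂ) ^ q * ((2 * q).factorial / q.factorial)) • trChain N (2 * q)
    (powChain e (2 * q) - (1 / 2 : ℂ) •
      (onePowChain e (2 * q) - chainT (2 * q) (onePowChain e (2 * q))))

theorem chainb_tens (m : ℕ) (a : Fin (m + 2) → A) : chainb m (tens A (m + 1) a) =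
    ∑ j : Fin (m + 1), (-1 : ℂ) ^ (j : ℕ) • tens A m (Fin.contractNth j.castSucc (· * ·) a) +
      (-1 : ℂ) ^ (m + 1) • tens A m (Fin.contractNth 0 (· * ·)
        fun i => a ((finRotate (m + 2)).symm i)) := by
  rw [chainb, linearize_tens, opb, LinearMap.add_apply, LinearMap.sum_apply, add_apply, sum_apply]
  rfl

theorem chainT_tens (m : ℕ) (a : Fin (m + 1) → A) :
    chainT m (tens A m a) = (-1 : ℂ) ^ m • tens A m fun i => a ((finRotate (m + 1)).symm i) := by
  rw [chainT, linearize_tens]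
  rfl

theorem chainB₀_tens (m : ℕ) (a : Fin (m + 1) → A) :
    chainB₀ m (tens A m a) = tens A (m + 1) (Fin.cons 1 a) := by
  rw [chainB₀, linearize_tens]
  rfl

theorem rot_update (m : ℕ) (e x : A) (j : Fin (m + 1)) :
    (fun i => Function.update (fun _ => e) j x ((finRotate (m + 1)).symm i)) =
      Function.update (fun _ => e) (finRotate (m + 1) j) x := by
  funext i
  simp only [Function.update_apply, Equiv.symm_apply_eq]

theorem sum_sign (m : ℕ) : ∑ j : Fin (2 * m), (-1 : ℂ) ^ (j : ℕ) = 0 := by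
  rw [Fin.sum_univ_eq_sum_range (fun j => (-1 : ℂ) ^ j)]
  induction m with
  | zero => simp
  | succ q ih => rw [Nat.mul_succ, Finset.sum_range_succ, Finset.sum_range_succ, ih]; simp [pow_succ]

theorem contract_const {e : A} (he : e * e = e) {m : ℕ} (j : Fin (m + 1)) :
    Fin.contractNth j (· * ·) (fun _ => e) = fun _ => e := by
  funext k
  simp [Fin.contractNth, he]

theorem contract_update_eq {e : A} {m : ℕ} (i j : Fin (m + 2)) (hj : (j : ℕ) < m + 1)
    (he : e * e = e) (h : (i : ℕ) = j ∨ (i : ℕ) = j + 1) :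
    Fin.contractNth j (· * ·) (Function.update (fun _ => e) i 1) = fun _ => e := by
  funext k
  have h1 : (1 : A) * e = e := one_mul e
  have h2 : e * (1 : A) = e := mul_one e
  simp only [Fin.contractNth, Function.update_apply, Fin.ext_iff, Fin.val_castSucc, Fin.val_succ]
  grind

theorem contract_update_lt {e : A} {m : ℕ} (i : Fin (m + 2)) (i' : Fin (m + 1)) (j : Fin (m + 2))
    (he : e * e = e) (h : (i : ℕ) < j) (hi : (i' : ℕ) = i) :
    Fin.contractNth j (· * ·) (Function.update (fun _ => e) i 1) =
      Function.update (fun _ => e) i' 1 := by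
  funext k
  simp only [Fin.contractNth, Function.update_apply, Fin.ext_iff, Fin.val_castSucc, Fin.val_succ]
  grind

theorem contract_update_gt {e : A} {m : ℕ} (i : Fin (m + 2)) (i' : Fin (m + 1)) (j : Fin (m + 2))
    (he : e * e = e) (h : (j : ℕ) + 1 < i) (hi : (i' : ℕ) + 1 = i) :
    Fin.contractNth j (· * ·) (Function.update (fun _ => e) i 1) =
      Function.update (fun _ => e) i' 1 := by
  funext k
  simp only [Fin.contractNth, Function.update_apply, Fin.ext_iff, Fin.val_castSucc, Fin.val_succ]
  grind

theorem chainb_powChain {e : A} (he : e * e = e) (q : ℕ) :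
    chainb (2 * q + 1) (powChain e (2 * q + 2)) = powChain e (2 * q + 1) := by
  rw [powChain, chainb_tens]
  simp only [contract_const he]
  rw [← Finset.sum_smul]
  have h : ∑ j : Fin (2 * q + 1 + 1), (-1 : ℂ) ^ (j : ℕ) = 0 := sum_sign (q + 1)
  have h' : (-1 : ℂ) ^ (2 * q + 1 + 1) = 1 := by rw [pow_succ, pow_succ, pow_mul]; simp
  rw [h, h', zero_smul, zero_add, one_smul, powChain]

theorem chainb_onePowChain {e : A} (he : e * e = e) (q : ℕ) :
    chainb (2 * q + 1) (onePowChain e (2 * q + 2)) =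
      (2 : ℂ) • powChain e (2 * q + 1) - onePowChain e (2 * q + 1) := by
  rw [onePowChain, chainb_tens, rot_update, contract_update_eq _ _ (by simp) he
    (Or.inr (by rw [val_finRotate]; simp)), Fin.sum_univ_succ,
    contract_update_eq _ _ (by simp) he (Or.inl (by simp))]
  have h2 : ∀ j : Fin (2 * q + 1), Fin.contractNth (j.succ.castSucc : Fin (2 * q + 3)) (· * ·)
      (Function.update (fun _ => e) 0 1) = Function.update (fun _ => e) 0 1 :=
    fun j => contract_update_lt _ _ _ he (by simp) (by simp)
  simp only [h2]
  rw [← Finset.sum_smul]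
  have h : ∑ j : Fin (2 * q + 1), (-1 : ℂ) ^ (j.succ : ℕ) = -1 := by
    have := sum_sign (q + 1)
    rw [show 2 * (q + 1) = (2 * q + 1) + 1 by ring, Fin.sum_univ_succ] at this
    simp only [Fin.val_zero, pow_zero] at this
    linear_combination this
  have h' : (-1 : ℂ) ^ (2 * q + 1 + 1) = 1 := by rw [pow_succ, pow_succ, pow_mul]; simp
  rw [h, h', powChain, onePowChain]
  simp only [Fin.val_zero, pow_zero]
  module

theorem chainT_onePowChain (e : A) (m : ℕ) : chainT m (onePowChain e m) =
    (-1 : ℂ) ^ m • tens A m (Function.update (fun _ => e) (finRotate (m + 1) 0) 1) := by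
  rw [onePowChain, chainT_tens, rot_update]

theorem chainb_chainT_onePowChain {e : A} (he : e * e = e) (q : ℕ) :
    chainb (2 * q + 1) (chainT (2 * q + 2) (onePowChain e (2 * q + 2))) =
      - chainT (2 * q + 1) (onePowChain e (2 * q + 1)) := by
  have hr : ((finRotate (2 * q + 2 + 1) 0 : Fin (2 * q + 2 + 1)) : ℕ) = 1 := by
    rw [val_finRotate]; simp
  have hr' : ((finRotate (2 * q + 1 + 1) 0 : Fin (2 * q + 1 + 1)) : ℕ) = 1 := by
    rw [val_finRotate]; simp
  have hr2 : ((finRotate (2 * q + 2 + 1) (finRotate (2 * q + 2 + 1) 0) :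
      Fin (2 * q + 2 + 1)) : ℕ) = 2 := by
    rw [val_finRotate, hr]; simp
  rw [chainT_onePowChain, chainT_onePowChain, map_smul, chainb_tens, rot_update,
    contract_update_gt _ (finRotate (2 * q + 1 + 1) 0) _ he (by rw [hr2]; simp) (by rw [hr', hr2]),
    Fin.sum_univ_succ, Fin.sum_univ_succ, contract_update_eq _ _ (by simp) he (Or.inr (by rw [hr]; simp)),
    contract_update_eq _ _ (by simp) he (Or.inl (by rw [hr]; simp))]
  have h2 : ∀ j : Fin (2 * q), Fin.contractNth (j.succ.succ.castSucc : Fin (2 * q + 3)) (· * ·)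
      (Function.update (fun _ => e) (finRotate (2 * q + 2 + 1) 0) 1) =
        Function.update (fun _ => e) (finRotate (2 * q + 1 + 1) 0) 1 :=
    fun j => contract_update_lt _ _ _ he (by rw [hr]; simp) (by rw [hr, hr'])
  simp only [h2]
  rw [← Finset.sum_smul]
  have h : ∑ j : Fin (2 * q), (-1 : ℂ) ^ (j.succ.succ : ℕ) = 0 := by
    simp only [Fin.val_succ, pow_succ, mul_neg, mul_one, neg_neg]
    exact sum_sign q
  have h' : (-1 : ℂ) ^ (2 * q + 1 + 1) = 1 := by rw [pow_succ, pow_succ, pow_mul]; simp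
  have h4 : (-1 : ℂ) ^ (2 * q + 1) = -1 := by rw [pow_succ, pow_mul]; simp
  rw [h, h', h4]
  simp only [Fin.val_zero, pow_zero, Fin.val_succ, zero_add, pow_one]
  module

theorem chainT_pow_tens (m i : ℕ) (a : Fin (m + 1) → A) :
    (chainT m ^ i) (tens A m a) =
      ((-1 : ℂ) ^ m) ^ i • tens A m fun k => a (((finRotate (m + 1)).symm ^ i) k) := by
  induction i with
  | zero => simp
  | succ i ih =>
    rw [pow_succ', Module.End.mul_apply, ih, map_smul, chainT_tens, smul_smul, pow_succ]
    rfl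

theorem finRotate_pow (m : ℕ) : (finRotate (m + 1)) ^ (m + 1) = 1 := by
  have h : ∀ (i : ℕ) (k : Fin (m + 1)),
      (((finRotate (m + 1) ^ i) k : Fin (m + 1)) : ℕ) = ((k : ℕ) + i) % (m + 1) := by
    intro i
    induction i with
    | zero => intro k; simp [Nat.mod_eq_of_lt k.2]
    | succ i ih =>
      intro k
      rw [pow_succ', Equiv.Perm.mul_apply, finRotate_apply, Fin.val_add, ih]
      simp [← add_assoc]
  refine Equiv.ext fun k => Fin.ext ?_
  rw [h]
  simp [Nat.mod_eq_of_lt k.2]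

theorem chainT_pow_eq_one (q : ℕ) : (chainT (A := A) (2 * q)) ^ (2 * q + 1) = 1 := by
  refine chain_hom_ext fun a => ?_
  have : ((finRotate (2 * q + 1)).symm) ^ (2 * q + 1) = 1 := by
    change (finRotate (2 * q + 1))⁻¹ ^ (2 * q + 1) = 1
    rw [inv_pow, finRotate_pow, inv_one]
  rw [chainT_pow_tens, this, pow_mul (-1 : ℂ)]
  simp

theorem chainB_powChain (e : A) (q : ℕ) : chainB (2 * q) (powChain e (2 * q)) =
    (2 * q + 1 : ℂ) • (onePowChain e (2 * q + 1) - chainT (2 * q + 1) (onePowChain e (2 * q + 1))) := by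
  have hT : ∀ i, (chainT (2 * q) ^ i) (powChain e (2 * q)) = powChain e (2 * q) := by
    intro i
    rw [powChain, chainT_pow_tens, pow_mul (-1 : ℂ)]
    simp
  have hB : chainB₀ (2 * q) (powChain e (2 * q)) = onePowChain e (2 * q + 1) := by
    rw [powChain, chainB₀_tens, onePowChain]
    congr 1
    funext k
    refine Fin.cases ?_ (fun k => ?_) k <;> simp
  rw [chainB, LinearMap.comp_apply, LinearMap.comp_apply, LinearMap.sum_apply,
    Finset.sum_congr rfl fun i _ => hT i, Finset.sum_const, Finset.card_range, map_nsmul, hB, map_nsmul,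
    ← Nat.cast_smul_eq_nsmul ℂ]
  push_cast
  rfl

theorem chainB_sub_chainT (q : ℕ) (x : Chain A (2 * q)) :
    chainB (2 * q) (x - chainT (2 * q) x) = 0 := by
  have h : (∑ i ∈ Finset.range (2 * q + 1), chainT (2 * q) ^ i) (x - chainT (2 * q) x) = 0 := by
    have := Commute.geom_sum₂_mul (Commute.one_right (chainT (A := A) (2 * q))) (2 * q + 1)
    simp only [one_pow, mul_one, chainT_pow_eq_one, sub_self] at this
    have h2 := congrArg (fun f => f x) this
    simp only [Module.End.mul_apply, LinearMap.sub_apply, Module.End.one_apply,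
      LinearMap.zero_apply] at h2
    rw [← neg_sub, map_neg, h2, neg_zero]
  rw [chainB, LinearMap.comp_apply, LinearMap.comp_apply, h, map_zero, map_zero]

theorem chainB_trChain (N m : ℕ) (x : Chain (Matrix (Fin N) (Fin N) A) m) :
    chainB m (trChain N m x) = trChain N (m + 1) (chainB m x) := by
  have hT : ∀ (n : ℕ) (y : Chain (Matrix (Fin N) (Fin N) A) n),
      chainT n (trChain N n y) = trChain N n (chainT n y) :=
    fun n y => LinearMap.congr_fun (chainT_trChain N n) y
  have hTi : ∀ (i : ℕ), (chainT m ^ i) (trChain N m x) = trChain N m ((chainT m ^ i) x) := by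
    intro i
    induction i with
    | zero => rfl
    | succ i ih => rw [pow_succ', pow_succ', Module.End.mul_apply, ih, hT]; rfl
  have hB : ∀ (y : Chain (Matrix (Fin N) (Fin N) A) m),
      chainB₀ m (trChain N m y) = trChain N (m + 1) (chainB₀ m y) :=
    fun y => LinearMap.congr_fun (chainB₀_trChain N m) y
  simp only [chainB, LinearMap.comp_apply, LinearMap.sum_apply, hTi, ← map_sum, hB,
    LinearMap.sub_apply, LinearMap.id_apply, hT, map_sub]

/-- The chain `(Ch_{2q}(e))` is a cycle. -/
theorem chernChain_mem_ker {N : ℕ} {e : Matrix (Fin N) (Fin N) A} (he : e * e = e) :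
    (chernChain e : ∀ q, Chain A (2 * q)) ∈ LinearMap.ker (bdEven (A := A)) := by
  rw [LinearMap.mem_ker]
  funext q
  change chainb (2 * q + 1) (chernChain e (q + 1)) + chainB (2 * q) (chernChain e q) = 0
  have h1 : chainb (2 * q + 1) (chernChain e (q + 1)) =
      ((-1 : ℂ) ^ (q + 1) * ((2 * (q + 1)).factorial / (q + 1).factorial)) • trChain N (2 * q + 1)
        ((1 / 2 : ℂ) • (onePowChain e (2 * q + 1) - chainT (2 * q + 1) (onePowChain e (2 * q + 1)))) := by
    have hb : ∀ y, chainb (2 * q + 1) (trChain N (2 * q + 2) y) =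
        trChain N (2 * q + 1) (chainb (2 * q + 1) y) :=
      fun y => LinearMap.congr_fun (chainb_trChain (A := A) N (2 * q + 1)) y
    have : chernChain e (q + 1) =
      ((-1 : ℂ) ^ (q + 1) * ((2 * (q + 1)).factorial / (q + 1).factorial)) • trChain N (2 * q + 2)
        (powChain e (2 * q + 2) - (1 / 2 : ℂ) • (onePowChain e (2 * q + 2) -
          chainT (2 * q + 2) (onePowChain e (2 * q + 2)))) := rfl
    rw [this, map_smul, hb, map_sub (chainb _), chainb_powChain he, map_smul (chainb _),
      map_sub (chainb _), chainb_onePowChain he, chainb_chainT_onePowChain he]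
    congr 2
    module
  have h2 : chainB (2 * q) (chernChain e q) =
      ((-1 : ℂ) ^ q * ((2 * q).factorial / q.factorial)) • trChain N (2 * q + 1)
        ((2 * q + 1 : ℂ) • (onePowChain e (2 * q + 1) -
          chainT (2 * q + 1) (onePowChain e (2 * q + 1)))) := by
    rw [chernChain, map_smul, chainB_trChain, map_sub, map_smul, chainB_sub_chainT, chainB_powChain,
      smul_zero, sub_zero]
  rw [h1, h2, map_smul, map_smul, smul_smul, smul_smul, ← add_smul]
  have hq : (q.factorial : ℂ) ≠ 0 := by exact_mod_cast q.factorial_ne_zero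
  have hq1 : (q + 1 : ℂ) ≠ 0 := by exact_mod_cast q.succ_ne_zero
  have : (-1 : ℂ) ^ (q + 1) * ((2 * (q + 1)).factorial / (q + 1).factorial) * (1 / 2) +
      (-1 : ℂ) ^ q * ((2 * q).factorial / q.factorial) * (2 * q + 1) = 0 := by
    rw [show 2 * (q + 1) = 2 * q + 1 + 1 by ring, Nat.factorial_succ (2 * q + 1),
      Nat.factorial_succ (2 * q), Nat.factorial_succ q]
    push_cast
    field_simp
    ring
  rw [this, zero_smul]

/-- The Chern character `Ch(e) ∈ HP₀(A)` of an idempotent `e ∈ M_N(A)`. -/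
def chernClass {N : ℕ} (e : Matrix (Fin N) (Fin N) A) (he : e * e = e) : HPLower A :=
  Submodule.Quotient.mk ⟨chernChain e, chernChain_mem_ker he⟩

/-- The degenerate chains: those spanned by the `a⁰ ⊗ ⋯ ⊗ aᵐ` with `aʲ = 1` for some `j ≥ 1`. The
normalized complex is the quotient of the chains by the degenerate chains. -/
def degenerateChains (A : Type*) [Ring A] [Algebra ℂ A] (m : ℕ) : Submodule ℂ (Chain A m) :=
  Submodule.span ℂ {x | ∃ (a : Fin (m + 1) → A) (j : Fin (m + 1)), j ≠ 0 ∧ a j = 1 ∧ x = tens A m a}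

theorem chernChain_zero {N : ℕ} (e : Matrix (Fin N) (Fin N) A) :
    chernChain e 0 = trChain N 0 (tens _ 0 fun _ => e) := by
  have : chainT 0 (onePowChain e 0) = onePowChain e 0 := by
    rw [chainT_onePowChain, onePowChain]
    simp
  have h : chernChain e 0 = ((-1 : ℂ) ^ 0 * ((2 * 0).factorial / (0 : ℕ).factorial)) •
    trChain N 0 (powChain e 0 - (1 / 2 : ℂ) • (onePowChain e 0 - chainT 0 (onePowChain e 0))) := rfl
  rw [h, this]
  simp [powChain]

theorem trChain_mem_degenerate {N m : ℕ} (a : Fin (m + 1) → Matrix (Fin N) (Fin N) A)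
    (j : Fin (m + 1)) (hj : j ≠ 0) (ha : a j = 1) :
    trChain N m (tens _ m a) ∈ degenerateChains A m := by
  rw [trChain, linearize_tens, matTrace_apply]
  refine Submodule.sum_mem _ fun i _ => ?_
  rcases eq_or_ne (i j) (i (finRotate (m + 1) j)) with h | h
  · exact Submodule.subset_span ⟨_, j, hj, by rw [ha, h, Matrix.one_apply_eq], rfl⟩
  · rw [MultilinearMap.map_coord_zero _ j (by rw [ha, Matrix.one_apply_ne h])]
    exact zero_mem _

/-- In positive degree, `Ch_{2q}(e)` and `(-1)^q (2q)!/q! tr[(e - ½) ⊗ e ⊗ ⋯ ⊗ e]` define the same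
normalized chain. -/
theorem chernChain_sub_mem_degenerate {N : ℕ} (e : Matrix (Fin N) (Fin N) A) (q : ℕ) (hq : 1 ≤ q) :
    chernChain e q - ((-1 : ℂ) ^ q * ((2 * q).factorial / q.factorial)) • trChain N (2 * q)
      (tens _ (2 * q) (Function.update (fun _ => e) 0 (e - (1 / 2 : ℂ) • 1))) ∈
        degenerateChains A (2 * q) := by
  have h : tens _ (2 * q) (Function.update (fun _ => e) 0 (e - (1 / 2 : ℂ) • 1)) =
      powChain e (2 * q) - (1 / 2 : ℂ) • onePowChain e (2 * q) := by
    rw [MultilinearMap.map_update_sub, MultilinearMap.map_update_smul, powChain, onePowChain,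
      Function.update_eq_self_iff.mpr rfl]
  have h2 : chernChain e q - ((-1 : ℂ) ^ q * ((2 * q).factorial / q.factorial)) • trChain N (2 * q)
      (tens _ (2 * q) (Function.update (fun _ => e) 0 (e - (1 / 2 : ℂ) • 1))) =
      ((-1 : ℂ) ^ q * ((2 * q).factorial / q.factorial) * (1 / 2)) •
        trChain N (2 * q) (chainT (2 * q) (onePowChain e (2 * q))) := by
    rw [h, chernChain, map_sub, map_sub, map_smul, map_smul, map_sub]
    module
  rw [h2, chainT_onePowChain, map_smul]
  refine Submodule.smul_mem _ _ (Submodule.smul_mem _ _ (trChain_mem_degenerate _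
    (finRotate (2 * q + 1) 0) ?_ (by simp)))
  intro h0
  have := congrArg Fin.val h0
  rw [val_finRotate] at this
  simp at this
  omega

end CyclicTheory

end

noncomputable section

namespace CyclicTheory

variable {A : Type*} [Ring A] [Algebra ℂ A] [TopologicalSpace A]

/-! ### Periodic cyclic homology of locally convex algebras -/

/-- The projective tensor product topology on `A ⊗ ⋯ ⊗ A`: the finest locally convex vector space
topology for which `(a⁰, …, aᵐ) ↦ a⁰ ⊗ ⋯ ⊗ aᵐ` is (jointly) continuous. -/
instance projectiveTopology (m : ℕ) : TopologicalSpace (Chain A m) :=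
  sInf {t | @IsTopologicalAddGroup _ t _ ∧ @ContinuousSMul ℂ _ _ _ t ∧
    @LocallyConvexSpace ℝ _ _ _ _ _ t ∧ @Continuous _ _ _ t (tens A m)}

instance (m : ℕ) : IsTopologicalAddGroup (Chain A m) := topologicalAddGroup_sInf fun _ h => h.1

instance (m : ℕ) : ContinuousSMul ℂ (Chain A m) := continuousSMul_sInf fun _ h => h.2.1

instance (m : ℕ) : LocallyConvexSpace ℝ (Chain A m) := LocallyConvexSpace.sInf fun _ h => h.2.2.1

theorem continuous_tens (m : ℕ) : Continuous (tens A m) := continuous_sInf_rng.2 fun _ h => h.2.2.2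

/-- A continuous multilinear map into a locally convex space is continuous as a linear map on
`A ⊗ ⋯ ⊗ A`. -/
theorem continuous_linearize {F : Type*} [AddCommGroup F] [Module ℂ F] [TopologicalSpace F]
    [IsTopologicalAddGroup F] [ContinuousSMul ℂ F] [LocallyConvexSpace ℝ F] {m : ℕ}
    (φ : MultiForm A m F) (hφ : Continuous φ) : Continuous (linearize φ) := by
  rw [continuous_iff_le_induced]
  refine sInf_le ⟨topologicalAddGroup_induced _, continuousSMul_induced _,
    LocallyConvexSpace.induced ((linearize φ).restrictScalars ℝ), ?_⟩
  rw [continuous_induced_rng]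
  convert hφ using 1
  funext a
  exact linearize_tens φ a

instance (m : ℕ) : UniformSpace (Chain A m) := IsTopologicalAddGroup.rightUniformSpace _

instance (m : ℕ) : IsUniformAddGroup (Chain A m) := isUniformAddGroup_of_addCommGroup

instance (m : ℕ) : UniformContinuousConstSMul ℂ (Chain A m) :=
  uniformContinuousConstSMul_of_continuousConstSMul ℂ _

/-- Topological `m`-chains: the completed projective tensor product of `m + 1` copies of `A`. -/
abbrev TopChain (A : Type*) [Ring A] [Algebra ℂ A] [TopologicalSpace A] (m : ℕ) :=
  UniformSpace.Completion (Chain A m)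

section Continuity

variable [IsTopologicalRing A] {F : Type*} [AddCommGroup F] [Module ℂ F] [TopologicalSpace F]
  [IsTopologicalAddGroup F] [ContinuousSMul ℂ F]

theorem continuous_face {m : ℕ} (j : Fin (m + 1)) (φ : MultiForm A m F) (h : Continuous φ) :
    Continuous (face j φ) := by
  refine h.comp (continuous_pi fun k => ?_)
  unfold Fin.contractNth
  split_ifs <;> fun_prop

theorem continuous_rot {m : ℕ} (φ : MultiForm A m F) (h : Continuous φ) : Continuous (rot m φ) :=
  h.comp (continuous_pi fun k => continuous_apply _)

theorem continuous_opT {m : ℕ} (φ : MultiForm A m F) (h : Continuous φ) : Continuous (opT m φ) :=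
  (continuous_rot φ h).const_smul ((-1 : ℂ) ^ m)

theorem continuous_opb {m : ℕ} (φ : MultiForm A m F) (h : Continuous φ) : Continuous (opb m φ) := by
  have : ⇑(opb m φ) = fun a => ∑ j : Fin (m + 1), (-1 : ℂ) ^ (j : ℕ) • face j φ a +
      (-1 : ℂ) ^ (m + 1) • rot (m + 1) (face 0 φ) a := by
    funext a
    simp [opb, sum_apply]
  rw [this]
  exact (continuous_finsetSum _ fun j _ => (continuous_face j φ h).const_smul _).add
    ((continuous_rot _ (continuous_face 0 φ h)).const_smul _)

theorem continuous_opB₀ {m : ℕ} (φ : MultiForm A (m + 1) F) (h : Continuous φ) :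
    Continuous (opB₀ m φ) :=
  h.comp (continuous_pi fun k => by
    refine Fin.cases ?_ (fun k => ?_) k
    · simpa using continuous_const
    · simpa using continuous_apply k)

theorem continuous_opA {m : ℕ} (φ : MultiForm A m F) (h : Continuous φ) : Continuous (opA m φ) := by
  have hi : ∀ i, Continuous ((opT m ^ i) φ) := by
    intro i
    induction i with
    | zero => exact h
    | succ i ih => rw [pow_succ']; exact continuous_opT _ ih
  have : ⇑(opA m φ) = fun a => ∑ i ∈ Finset.range (m + 1), (opT m ^ i) φ a := by
    funext a
    simp [opA, sum_apply]
  rw [this]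
  exact continuous_finsetSum _ fun i _ => hi i

theorem continuous_opB {m : ℕ} (φ : MultiForm A (m + 1) F) (h : Continuous φ) :
    Continuous (opB m φ) :=
  continuous_opA _ (continuous_opB₀ _ (h.sub (continuous_opT φ h)))

end Continuity

variable [IsTopologicalRing A]

/-- The chain operator `b` as a continuous linear map. -/
def chainbCLM (m : ℕ) : Chain A (m + 1) →L[ℂ] Chain A m :=
  ⟨chainb m, continuous_linearize _ (continuous_opb _ (continuous_tens m))⟩

theorem continuous_chainT (m : ℕ) : Continuous (chainT (A := A) m) :=
  continuous_linearize _ (continuous_opT _ (continuous_tens m))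

theorem continuous_chainB₀ (m : ℕ) : Continuous (chainB₀ (A := A) m) :=
  continuous_linearize _ (continuous_opB₀ _ (continuous_tens (m + 1)))

theorem continuous_chainB (m : ℕ) : Continuous (chainB (A := A) m) := by
  have hi : ∀ i, Continuous ⇑(chainT (A := A) m ^ i) := by
    intro i
    induction i with
    | zero => exact continuous_id
    | succ i ih => rw [pow_succ']; exact (continuous_chainT m).comp ih
  have hA : Continuous ⇑(∑ i ∈ Finset.range (m + 1), chainT (A := A) m ^ i) := by
    have : ⇑(∑ i ∈ Finset.range (m + 1), chainT (A := A) m ^ i) =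
        fun x => ∑ i ∈ Finset.range (m + 1), (chainT (A := A) m ^ i) x := by
      funext x
      simp [LinearMap.sum_apply]
    rw [this]
    exact continuous_finsetSum _ fun i _ => hi i
  exact (continuous_id.sub (continuous_chainT (m + 1))).comp ((continuous_chainB₀ m).comp hA)

/-- The chain operator `B` as a continuous linear map. -/
def chainBCLM (m : ℕ) : Chain A m →L[ℂ] Chain A (m + 1) := ⟨chainB m, continuous_chainB m⟩

/-- The extension by continuity of `b` to topological chains. -/
def topb (m : ℕ) : TopChain A (m + 1) →L[ℂ] TopChain A m := (chainbCLM m).completion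

/-- The extension by continuity of `B` to topological chains. -/
def topB (m : ℕ) : TopChain A m →L[ℂ] TopChain A (m + 1) := (chainBCLM m).completion

/-- `b + B` on sequences of even topological chains. -/
def topBdEven : (∀ q, TopChain A (2 * q)) →ₗ[ℂ] (∀ q, TopChain A (2 * q + 1)) :=
  LinearMap.pi fun q => (topb (2 * q + 1)).toLinearMap ∘ₗ LinearMap.proj (q + 1) +
    (topB (2 * q)).toLinearMap ∘ₗ LinearMap.proj q

/-- `b + B` on sequences of odd topological chains. -/
def topBdOdd : (∀ q, TopChain A (2 * q + 1)) →ₗ[ℂ] (∀ q, TopChain A (2 * q)) :=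
  LinearMap.pi fun q => match q with
    | 0 => (topb 0).toLinearMap ∘ₗ LinearMap.proj 0
    | q + 1 => (topb (2 * q + 2)).toLinearMap ∘ₗ LinearMap.proj (q + 1) +
        (topB (2 * q + 1)).toLinearMap ∘ₗ LinearMap.proj q

/-- `𝐇𝐏₀(A)`, the periodic cyclic homology of topological chains. -/
abbrev ContHPLower (A : Type*) [Ring A] [Algebra ℂ A] [TopologicalSpace A] [IsTopologicalRing A] :=
  LinearMap.ker (topBdEven (A := A)) ⧸
    (LinearMap.range (topBdOdd (A := A))).submoduleOf (LinearMap.ker (topBdEven (A := A)))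

/-- The canonical map from chains to topological chains. -/
def toTop (m : ℕ) : Chain A m →ₗ[ℂ] TopChain A m where
  toFun x := x
  map_add' := UniformSpace.Completion.coe_add
  map_smul' := UniformSpace.Completion.coe_smul

theorem toTop_apply (m : ℕ) (x : Chain A m) :
    toTop m x = ((x : Chain A m) : UniformSpace.Completion (Chain A m)) := rfl

theorem topb_toTop (m : ℕ) (x : Chain A (m + 1)) : topb m (toTop (m + 1) x) = toTop m (chainb m x) := by
  rw [toTop_apply, toTop_apply, topb, ContinuousLinearMap.completion_apply_coe]
  rfl

theorem topB_toTop (m : ℕ) (x : Chain A m) : topB m (toTop m x) = toTop (m + 1) (chainB m x) := by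
  rw [toTop_apply, toTop_apply, topB, ContinuousLinearMap.completion_apply_coe]
  rfl

/-- The canonical map from even sequences of chains to even sequences of topological chains. -/
def toTopEven : (∀ q, Chain A (2 * q)) →ₗ[ℂ] (∀ q, TopChain A (2 * q)) :=
  LinearMap.pi fun q => toTop (2 * q) ∘ₗ LinearMap.proj q

theorem toTopEven_mem_ker (x : ∀ q, Chain A (2 * q)) (hx : x ∈ LinearMap.ker (bdEven (A := A))) :
    toTopEven x ∈ LinearMap.ker (topBdEven (A := A)) := by
  refine LinearMap.mem_ker.mpr (funext fun q => ?_)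
  have h : chainb (2 * q + 1) (x (q + 1)) + chainB (2 * q) (x q) = 0 := congrFun hx q
  change topb (2 * q + 1) (toTop (2 * q + 2) (x (q + 1))) + topB (2 * q) (toTop (2 * q) (x q)) = 0
  rw [topb_toTop, topB_toTop, ← map_add, h, map_zero]

/-- The canonical map `HP₀(A) → 𝐇𝐏₀(A)`. -/
def homologyToTop (A : Type*) [Ring A] [Algebra ℂ A] [TopologicalSpace A] [IsTopologicalRing A] :
    HPLower A →ₗ[ℂ] ContHPLower A :=
  Submodule.mapQ _ _ (toTopEven.restrict toTopEven_mem_ker) (by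
    rintro ⟨x, hx⟩ ⟨y, hy⟩
    refine ⟨fun q => toTop (2 * q + 1) (y q), ?_⟩
    change bdOdd y = x at hy
    change topBdOdd (fun q => toTop (2 * q + 1) (y q)) = toTopEven x
    rw [← hy]
    funext q
    cases q with
    | zero => exact topb_toTop 0 (y 0)
    | succ q =>
      change topb (2 * q + 2) (toTop (2 * q + 3) (y (q + 1))) +
        topB (2 * q + 1) (toTop (2 * q + 1) (y q)) =
        toTop (2 * q + 2) (chainb (2 * q + 2) (y (q + 1)) + chainB (2 * q + 1) (y q))
      rw [topb_toTop, topB_toTop, map_add])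

end CyclicTheory

end

noncomputable section

namespace CyclicTheory

variable {A : Type*} [Ring A] [Algebra ℂ A] [TopologicalSpace A] [IsTopologicalRing A]

/-! ### The duality pairing -/

theorem mem_contForms {m : ℕ} {φ : MultiForm A m ℂ} : φ ∈ contForms A m ↔ Continuous φ := Iff.rfl

/-- The components of an even continuous periodic cochain. -/
def evenComp (φ : evenCochains (contForms A)) (q : ℕ) : contForms A (2 * q) := ⟨φ.1 q, φ.2.1 q⟩

/-- `b` on continuous cochains. -/
def contb {m : ℕ} (φ : contForms A m) : contForms A (m + 1) := ⟨opb m φ.1, continuous_opb _ φ.2⟩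

/-- `B` on continuous cochains. -/
def contB {m : ℕ} (φ : contForms A (m + 1)) : contForms A m := ⟨opB m φ.1, continuous_opB _ φ.2⟩

/-- A continuous cochain, as a continuous linear form on topological chains. -/
def topEval {m : ℕ} (φ : contForms A m) : TopChain A m →L[ℂ] ℂ :=
  ContinuousLinearMap.fromCompletion ⟨linearize φ.1, continuous_linearize φ.1 (mem_contForms.1 φ.2)⟩

theorem topEval_toTop {m : ℕ} (φ : contForms A m) (x : Chain A m) :
    topEval φ (toTop m x) = linearize φ.1 x :=
  ContinuousLinearMap.fromCompletion_apply_coe _ x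

theorem top_hom_ext {m : ℕ} {f g : TopChain A m → ℂ} (hf : Continuous f) (hg : Continuous g)
    (h : ∀ x, f (toTop m x) = g (toTop m x)) (x : TopChain A m) : f x = g x :=
  UniformSpace.Completion.induction_on x (isClosed_eq hf hg) h

theorem topEval_add {m : ℕ} (φ ψ : contForms A m) (x : TopChain A m) :
    topEval (φ + ψ) x = topEval φ x + topEval ψ x :=
  top_hom_ext (topEval (φ + ψ)).continuous
    ((topEval φ).continuous.add (topEval ψ).continuous) (fun x => by
      rw [Pi.add_apply]
      rw [topEval_toTop, topEval_toTop, topEval_toTop, Submodule.coe_add, map_add,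
        LinearMap.add_apply]) x

theorem topEval_smul {m : ℕ} (c : ℂ) (φ : contForms A m) (x : TopChain A m) :
    topEval (c • φ) x = c * topEval φ x :=
  top_hom_ext (topEval (c • φ)).continuous
    (continuous_const.mul (topEval φ).continuous) (fun x => by
      rw [Pi.mul_apply]
      rw [topEval_toTop, topEval_toTop, Submodule.coe_smul, map_smul, LinearMap.smul_apply,
        smul_eq_mul]) x

theorem topEval_zero {m : ℕ} (x : TopChain A m) : topEval (0 : contForms A m) x = 0 := by
  have := topEval_smul 0 (0 : contForms A m) x
  rwa [zero_smul, zero_mul] at this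

theorem topEval_opb {m : ℕ} (φ : contForms A m) (x : TopChain A (m + 1)) :
    topEval (contb φ) x = topEval φ (topb m x) :=
  top_hom_ext (ContinuousLinearMap.continuous _)
    ((topEval φ).continuous.comp (topb m).continuous) (fun x => by
      rw [Function.comp_apply, topb_toTop, topEval_toTop, topEval_toTop, contb, linearize_opb]; rfl) x

theorem topEval_opB {m : ℕ} (φ : contForms A (m + 1)) (x : TopChain A m) :
    topEval (contB φ) x = topEval φ (topB m x) :=
  top_hom_ext (ContinuousLinearMap.continuous _)
    ((topEval φ).continuous.comp (topB m).continuous) (fun x => by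
      rw [Function.comp_apply, topB_toTop, topEval_toTop, topEval_toTop, contB, linearize_opB]; rfl) x

theorem support_topEval_finite (φ : evenCochains (contForms A)) (η : ∀ q, TopChain A (2 * q)) :
    (Function.support fun q => topEval (evenComp φ q) (η q)).Finite := by
  obtain ⟨Q, hQ⟩ := φ.2.2
  refine (Set.finite_Iio Q).subset fun q hq => ?_
  by_contra h
  refine hq ?_
  have : ((evenComp φ q) : contForms A (2 * q)) = 0 := Subtype.ext (hQ q (not_lt.1 h))
  simp only [this, topEval_zero]

/-- The pairing `⟨φ, η⟩ = ∑ ⟨φ_{2q}, η_{2q}⟩` (a finite sum) of even continuous periodic cochains and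
even sequences of topological chains. -/
def pairCochain : evenCochains (contForms A) →ₗ[ℂ] (∀ q, TopChain A (2 * q)) →ₗ[ℂ] ℂ :=
  LinearMap.mk₂ ℂ (fun φ η => ∑ᶠ q, topEval (evenComp φ q) (η q))
    (fun φ ψ η => by
      rw [← finsum_add_distrib (support_topEval_finite φ η) (support_topEval_finite ψ η)]
      exact finsum_congr fun q => topEval_add (evenComp φ q) (evenComp ψ q) (η q))
    (fun c φ η => by
      rw [smul_eq_mul, mul_finsum' _ _ (support_topEval_finite φ η)]
      exact finsum_congr fun q => topEval_smul c (evenComp φ q) (η q))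
    (fun φ η η' => by
      rw [← finsum_add_distrib (support_topEval_finite φ η) (support_topEval_finite φ η')]
      exact finsum_congr fun q => map_add _ _ _)
    (fun c φ η => by
      rw [smul_eq_mul, mul_finsum' _ _ (support_topEval_finite φ η)]
      exact finsum_congr fun q => by rw [Pi.smul_apply, map_smul, smul_eq_mul])

theorem pairCochain_eq (φ : evenCochains (contForms A)) (η : ∀ q, TopChain A (2 * q)) (Q : ℕ)
    (hQ : ∀ q, Q ≤ q → φ.1 q = 0) :
    pairCochain φ η = ∑ q ∈ Finset.range Q, topEval (evenComp φ q) (η q) := by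
  refine finsum_eq_sum_of_support_subset _ fun q hq => ?_
  by_contra h
  refine hq ?_
  have : ((evenComp φ q) : contForms A (2 * q)) = 0 :=
    Subtype.ext (hQ q (by simpa using h))
  simp only [this, topEval_zero]

/-- The pairing vanishes on (coboundary, cycle). -/
theorem pair_coboundary (φ : evenCochains (contForms A)) (h : φ.1 ∈ evenCoboundaries (contForms A))
    (η : ∀ q, TopChain A (2 * q)) (hη : topBdEven η = 0) : pairCochain φ η = 0 := by
  obtain ⟨ψ, ⟨hψ, Q, hQ⟩, hφ⟩ := h
  have hb : ∀ q, topEval ⟨ψ q, hψ q⟩ (topb (2 * q + 1) (η (q + 1))) +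
      topEval ⟨ψ q, hψ q⟩ (topB (2 * q) (η q)) = 0 := by
    intro q
    have : topb (2 * q + 1) (η (q + 1)) + topB (2 * q) (η q) = 0 := congrFun hη q
    rw [← map_add, this, map_zero]
  have h0 : topEval (evenComp φ 0) (η 0) = topEval ⟨ψ 0, hψ 0⟩ (topB 0 (η 0)) := by
    rw [← topEval_opB]
    congr 2
    exact Subtype.ext (congrFun hφ 0).symm
  have hs : ∀ q, topEval (evenComp φ (q + 1)) (η (q + 1)) =
      topEval ⟨ψ q, hψ q⟩ (topb (2 * q + 1) (η (q + 1))) +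
        topEval ⟨ψ (q + 1), hψ (q + 1)⟩ (topB (2 * q + 2) (η (q + 1))) := by
    intro q
    have h1 := topEval_opb ⟨ψ q, hψ q⟩ (η (q + 1))
    have h2 := topEval_opB (m := 2 * q + 2) ⟨ψ (q + 1), hψ (q + 1)⟩ (η (q + 1))
    refine Eq.trans ?_ (congrArg₂ (· + ·) h1 h2)
    refine Eq.trans ?_ (topEval_add _ _ _)
    congr 2
    exact Subtype.ext (congrFun hφ (q + 1)).symm
  have hφQ : ∀ q, Q + 1 ≤ q → φ.1 q = 0 := by
    intro q hq
    obtain ⟨r, rfl⟩ : ∃ r, q = r + 1 := ⟨q - 1, by omega⟩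
    rw [← hφ]
    change opb (2 * r + 1) (ψ r) + opB (2 * r + 2) (ψ (r + 1)) = 0
    rw [hQ r (by omega), hQ (r + 1) (by omega), map_zero, map_zero, add_zero]
  have hlast : topEval ⟨ψ Q, hψ Q⟩ (topB (2 * Q) (η Q)) = 0 := by
    have : (⟨ψ Q, hψ Q⟩ : contForms A (2 * Q + 1)) = 0 := Subtype.ext (hQ Q le_rfl)
    rw [this, topEval_zero]
  rw [pairCochain_eq φ η (Q + 1) hφQ, Finset.sum_range_succ', h0]
  have key : ∀ n, ∑ q ∈ Finset.range n, topEval (evenComp φ (q + 1)) (η (q + 1)) +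
      topEval ⟨ψ 0, hψ 0⟩ (topB 0 (η 0)) = topEval ⟨ψ n, hψ n⟩ (topB (2 * n) (η n)) := by
    intro n
    induction n with
    | zero => simp
    | succ n ih =>
      rw [Finset.sum_range_succ, hs]
      have h3 := hb n
      change _ = topEval ⟨ψ (n + 1), hψ (n + 1)⟩ (topB (2 * n + 2) (η (n + 1)))
      linear_combination ih + h3
  rw [key, hlast]

/-- The pairing vanishes on (cocycle, boundary). -/
theorem pair_boundary (φ : evenCochains (contForms A)) (h : dEven φ.1 = 0)
    (θ : ∀ q, TopChain A (2 * q + 1)) : pairCochain φ (topBdOdd θ) = 0 := by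
  obtain ⟨Q, hQ⟩ := φ.2.2
  have hb : ∀ q, topEval (evenComp φ q) (topb (2 * q) (θ q)) +
      topEval (evenComp φ (q + 1)) (topB (2 * q + 1) (θ q)) = 0 := by
    intro q
    have h1 := topEval_opb (evenComp φ q) (θ q)
    have h2 := topEval_opB (m := 2 * q + 1) (evenComp φ (q + 1)) (θ q)
    rw [← h1]
    refine (congrArg₂ (· + ·) rfl h2.symm).trans ((topEval_add _ _ _).symm.trans ?_)
    rw [← topEval_zero (θ q)]
    congr 2
    exact Subtype.ext (congrFun h q)
  have hs : ∀ q, topEval (evenComp φ (q + 1)) (topBdOdd θ (q + 1)) =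
      topEval (evenComp φ (q + 1)) (topb (2 * q + 2) (θ (q + 1))) +
      topEval (evenComp φ (q + 1)) (topB (2 * q + 1) (θ q)) := fun q => map_add _ _ _
  have hlast : topEval (evenComp φ Q) (topb (2 * Q) (θ Q)) = 0 := by
    have : ((evenComp φ Q) : contForms A (2 * Q)) = 0 := Subtype.ext (hQ Q le_rfl)
    rw [this, topEval_zero]
  rw [pairCochain_eq φ _ (Q + 1) fun q hq => hQ q (by omega), Finset.sum_range_succ']
  have key : ∀ n, ∑ q ∈ Finset.range n,
      topEval (evenComp φ (q + 1)) (topBdOdd θ (q + 1)) +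
        topEval (evenComp φ 0) (topBdOdd θ 0) = topEval (evenComp φ n) (topb (2 * n) (θ n)) := by
    intro n
    induction n with
    | zero => simp only [Finset.range_zero, Finset.sum_empty, zero_add]; rfl
    | succ n ih =>
      rw [Finset.sum_range_succ, hs]
      have h3 := hb n
      change _ = topEval (evenComp φ (n + 1)) (topb (2 * n + 2) (θ (n + 1)))
      linear_combination ih + h3
  rw [key, hlast]

/-- The pairing of continuous periodic cocycles and topological periodic cycles. -/
def pairCycle : LinearMap.ker (topBdEven (A := A)) →ₗ[ℂ] evenCocycles (contForms A) →ₗ[ℂ] ℂ :=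
  (pairCochain ∘ₗ Submodule.inclusion inf_le_left).flip ∘ₗ
    (LinearMap.ker (topBdEven (A := A))).subtype

theorem pairCycle_apply (η : LinearMap.ker (topBdEven (A := A)))
    (z : evenCocycles (contForms A)) : pairCycle η z = pairCochain ⟨z.1, z.2.1⟩ η.1 := rfl

/-- The pairing of continuous periodic cocycles with classes in `𝐇𝐏₀(A)`. -/
def pairClass : ContHPLower A →ₗ[ℂ] evenCocycles (contForms A) →ₗ[ℂ] ℂ :=
  Submodule.liftQ _ pairCycle (by
    intro η hη
    obtain ⟨θ, hθ⟩ : ∃ θ, topBdOdd θ = η.1 := hη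
    refine LinearMap.mem_ker.2 (LinearMap.ext fun z => ?_)
    rw [pairCycle_apply, ← hθ]
    exact pair_boundary ⟨z.1, z.2.1⟩ z.2.2 θ)

theorem pairClass_mk (η : LinearMap.ker (topBdEven (A := A))) :
    pairClass (Submodule.Quotient.mk η) = pairCycle η := Submodule.liftQ_apply _ _ _

/-- The duality pairing `𝐇𝐏⁰(A) × 𝐇𝐏₀(A) → ℂ` induced by the pairing of cochains and chains. -/
def duality (A : Type*) [Ring A] [Algebra ℂ A] [TopologicalSpace A] [IsTopologicalRing A] :
    ContHPUpper A →ₗ[ℂ] ContHPLower A →ₗ[ℂ] ℂ :=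
  Submodule.liftQ _ pairClass.flip (by
    intro z hz
    refine LinearMap.mem_ker.2 (LinearMap.ext fun y => ?_)
    obtain ⟨η, rfl⟩ := Submodule.Quotient.mk_surjective _ y
    rw [LinearMap.flip_apply, pairClass_mk, pairCycle_apply]
    exact pair_coboundary ⟨z.1, z.2.1⟩ hz η.1 η.2)

end CyclicTheory

end

noncomputable section

namespace CyclicTheory

/-! ### Trace-class operators -/

section Operators

variable {H : Type*} [NormedAddCommGroup H] [InnerProductSpace ℂ H] [CompleteSpace H]

/-- The index set of a chosen Hilbert basis of `H`. -/
def basisIndex (H : Type*) [NormedAddCommGroup H] [InnerProductSpace ℂ H] [CompleteSpace H] :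
    Set H := (exists_hilbertBasis ℂ H).choose

/-- A chosen Hilbert basis of `H`. -/
def stdBasis (H : Type*) [NormedAddCommGroup H] [InnerProductSpace ℂ H] [CompleteSpace H] :
    HilbertBasis (basisIndex H) ℂ H := (exists_hilbertBasis ℂ H).choose_spec.choose

/-- `Tr |P|ᵖ < ∞`. -/
def IsSchatten (p : ℝ) (P : H →L[ℂ] H) : Prop :=
  Summable fun i => (⟪stdBasis H i, ((CFC.abs P) ^ p) (stdBasis H i)⟫_ℂ).re

/-- Trace-class operators. -/
def IsTraceClass (P : H →L[ℂ] H) : Prop :=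
  Summable fun i => (⟪stdBasis H i, (CFC.abs P) (stdBasis H i)⟫_ℂ).re

/-- The trace of a trace-class operator. -/
def opTrace (P : H →L[ℂ] H) : ℂ := ∑' i, ⟪stdBasis H i, P (stdBasis H i)⟫_ℂ

/-! ### Unbounded operators -/

/-- `P` is a bounded inverse of `D`. -/
def IsBoundedInverse (D : H →ₗ.[ℂ] H) (P : H →L[ℂ] H) : Prop :=
  (∀ x, ∃ hx : P x ∈ D.domain, D ⟨P x, hx⟩ = x) ∧ ∀ x : D.domain, P (D x) = x

open Classical in
/-- `D⁻¹`, for an invertible `D`. -/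
def boundedInverse (D : H →ₗ.[ℂ] H) : H →L[ℂ] H :=
  if h : ∃ P, IsBoundedInverse D P then h.choose else 0

/-- `P` inverts `D` on the orthogonal complement of `ker D` and vanishes on `ker D`. -/
def IsPartialInverse (D : H →ₗ.[ℂ] H) (P : H →L[ℂ] H) : Prop :=
  (∀ z : D.domain, D z = 0 → P z = 0) ∧
    ∀ x : D.domain, (∀ z : D.domain, D z = 0 → ⟪(z : H), (x : H)⟫_ℂ = 0) → P (D x) = x

/-- The operator `D + z`, with the domain of `D`. -/
def addScalar (D : H →ₗ.[ℂ] H) (z : ℂ) : H →ₗ.[ℂ] H :=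
  ⟨D.domain, D.toFun + z • D.domain.subtype⟩

/-- `C` is a bounded extension of `D a - b D`, where `a` preserves the domain of `D`. -/
def IsTwComm (D : H →ₗ.[ℂ] H) (a b C : H →L[ℂ] H) : Prop :=
  ∀ x : D.domain, ∃ hx : a x ∈ D.domain, C x = D ⟨a x, hx⟩ - b (D x)

open Classical in
/-- The bounded closure of `D a - b D`. -/
def twComm (D : H →ₗ.[ℂ] H) (a b : H →L[ℂ] H) : H →L[ℂ] H :=
  if h : ∃ C, IsTwComm D a b C then h.choose else 0

theorem isTwComm_twComm {D : H →ₗ.[ℂ] H} {a b : H →L[ℂ] H} (h : ∃ C, IsTwComm D a b C) :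
    IsTwComm D a b (twComm D a b) := by
  rw [twComm, dif_pos h]
  exact h.choose_spec

/-- Two bounded operators that agree on a dense subspace are equal. -/
theorem ext_dense {V : Submodule ℂ H} (hV : Dense (V : Set H)) {S T : H →L[ℂ] H}
    (h : ∀ x : V, S x = T x) : S = T :=
  ContinuousLinearMap.ext fun x =>
    congrFun (Continuous.ext_on hV S.continuous T.continuous fun y hy => h ⟨y, hy⟩) x

end Operators

/-! ### Twisted spectral triples -/

/-- A twisted spectral triple `(A, H, D)_σ`. The `ℤ/2`-grading of `H` is given by the operator
`γ = 1_{H⁺} - 1_{H⁻}`. -/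
structure TwistedSpectralTriple (A : Type*) [Ring A] [Algebra ℂ A] [StarRing A]
    (H : Type*) [NormedAddCommGroup H] [InnerProductSpace ℂ H] [CompleteSpace H] where
  γ : H →L[ℂ] H
  γ_sq : γ * γ = 1
  γ_selfAdjoint : IsSelfAdjoint γ
  π : A →⋆ₐ[ℂ] (H →L[ℂ] H)
  π_even : ∀ a, γ * π a = π a * γ
  σ : A ≃ₐ[ℂ] A
  star_σ : ∀ a, star (σ a) = σ.symm (star a)
  D : H →ₗ.[ℂ] H
  D_selfAdjoint : IsSelfAdjoint D
  D_odd : ∀ x : D.domain, ∃ hx : γ x ∈ D.domain, D ⟨γ x, hx⟩ = -γ (D x)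
  compact_resolvent : ∃ R : H →L[ℂ] H, IsCompactOperator R ∧
    IsBoundedInverse (addScalar D Complex.I) R
  bounded_comm : ∀ a, ∃ C, IsTwComm D (π a) (π (σ a)) C

/-- The normalization constant `c_q = (1/2) (-1)^q q!/(2q)!`. -/
def cst (q : ℕ) : ℂ := 1 / 2 * (-1) ^ q * (Nat.factorial q / Nat.factorial (2 * q))

namespace TwistedSpectralTriple

variable {A : Type*} [Ring A] [Algebra ℂ A] [StarRing A]
variable {H : Type*} [NormedAddCommGroup H] [InnerProductSpace ℂ H] [CompleteSpace H]
variable (T : TwistedSpectralTriple A H)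

/-- `[D, a]_σ = D a - σ(a) D`. -/
def comm (a : A) : H →L[ℂ] H := twComm T.D (T.π a) (T.π (T.σ a))

theorem isTwComm_comm (a : A) : IsTwComm T.D (T.π a) (T.π (T.σ a)) (T.comm a) :=
  isTwComm_twComm (T.bounded_comm a)

theorem mapsTo (a : A) (x : H) (hx : x ∈ T.D.domain) : T.π a x ∈ T.D.domain :=
  (T.isTwComm_comm a ⟨x, hx⟩).1

theorem comm_apply (a : A) (x : T.D.domain) :
    T.comm a x = T.D ⟨T.π a x, T.mapsTo a x x.2⟩ - T.π (T.σ a) (T.D x) :=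
  (T.isTwComm_comm a x).2

theorem dense_domain : Dense (T.D.domain : Set H) := T.D_selfAdjoint.dense_domain

/-- `D` is invertible. -/
def IsInvertible : Prop := ∃ P, IsBoundedInverse T.D P

/-- `p`-summability: `Tr |D|⁻ᵖ < ∞`, where `|D|⁻¹` is zero on the kernel of `D`. -/
def IsSummable (p : ℝ) : Prop := ∃ P, IsPartialInverse T.D P ∧ IsSchatten p P

/-- Smooth twisted spectral triples over a topological algebra. -/
structure IsSmooth [TopologicalSpace A] : Prop where
  continuous_π : Continuous T.π
  continuous_comm : Continuous T.comm
  continuous_σ : Continuous T.σ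
  continuous_σ_symm : Continuous T.σ.symm

/-! ### The cochains `τ_{2q}` and `τ̄_{2q}` -/

/-- `D⁻¹[D, a⁰]_σ ⋯ D⁻¹[D, a^{2q}]_σ`. -/
def tauProd (q : ℕ) (a : Fin (2 * q + 1) → A) : H →L[ℂ] H :=
  (List.ofFn fun j => boundedInverse T.D * T.comm (a j)).prod

/-- `τ_{2q}(a⁰, …, a^{2q}) = c_q Str(D⁻¹[D, a⁰]_σ ⋯ D⁻¹[D, a^{2q}]_σ)`, for invertible `D`. -/
def tau (q : ℕ) (a : Fin (2 * q + 1) → A) : ℂ := cst q * opTrace (T.γ * T.tauProd q a)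

/-- Diagonal bounded operators on the Hilbert space `H ⊕ H`. -/
def diag (S₁ S₂ : H →L[ℂ] H) : WithLp 2 (H × H) →L[ℂ] WithLp 2 (H × H) :=
  (WithLp.prodContinuousLinearEquiv 2 ℂ H H).symm.toContinuousLinearMap ∘L (S₁.prodMap S₂) ∘L
    (WithLp.prodContinuousLinearEquiv 2 ℂ H H).toContinuousLinearMap

/-- The grading `γ ⊕ (-γ)` of the double. -/
def doubleγ : WithLp 2 (H × H) →L[ℂ] WithLp 2 (H × H) := diag T.γ (-T.γ)

/-- The action `a ⊕ 0` of `A` on the double. -/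
def doubleπ (a : A) : WithLp 2 (H × H) →L[ℂ] WithLp 2 (H × H) := diag (T.π a) 0

/-- The domain `dom D ⊕ dom D`. -/
def doubleDomain : Submodule ℂ (WithLp 2 (H × H)) :=
  (T.D.domain.prod T.D.domain).comap (WithLp.linearEquiv 2 ℂ (H × H)).toLinearMap

/-- The operator `D̃ (x, y) = (D x + y, x - D y)` on `dom D ⊕ dom D`. -/
def doubleD : WithLp 2 (H × H) →ₗ.[ℂ] WithLp 2 (H × H) where
  domain := T.doubleDomain
  toFun :=
    { toFun := fun x => WithLp.toLp 2
        (T.D ⟨x.1.fst, x.2.1⟩ + x.1.snd, x.1.fst - T.D ⟨x.1.snd, x.2.2⟩)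
      map_add' := fun x y => by
        have h1 := T.D.map_add ⟨x.1.fst, x.2.1⟩ ⟨y.1.fst, y.2.1⟩
        have h2 := T.D.map_add ⟨x.1.snd, x.2.2⟩ ⟨y.1.snd, y.2.2⟩
        rw [← WithLp.toLp_add]
        refine congrArg (WithLp.toLp 2) (Prod.ext ?_ ?_)
        · refine (congrArg (· + (x + y).1.snd) h1).trans ?_
          exact add_add_add_comm _ _ _ _
        · refine (congrArg ((x + y).1.fst - ·) h2).trans ?_
          exact add_sub_add_comm _ _ _ _
      map_smul' := fun c x => by
        have h1 := T.D.map_smul c ⟨x.1.fst, x.2.1⟩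
        have h2 := T.D.map_smul c ⟨x.1.snd, x.2.2⟩
        rw [RingHom.id_apply, ← WithLp.toLp_smul]
        refine congrArg (WithLp.toLp 2) (Prod.ext ?_ ?_)
        · refine (congrArg (· + (c • x).1.snd) h1).trans ?_
          exact (smul_add _ _ _).symm
        · refine (congrArg ((c • x).1.fst - ·) h2).trans ?_
          exact (smul_sub _ _ _).symm }

/-- `[D̃, a]_σ`. -/
def doubleComm (a : A) : WithLp 2 (H × H) →L[ℂ] WithLp 2 (H × H) :=
  twComm T.doubleD (T.doubleπ a) (T.doubleπ (T.σ a))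

/-- `D̃⁻¹[D̃, a⁰]_σ ⋯ D̃⁻¹[D̃, a^{2q}]_σ`. -/
def tauBarProd (q : ℕ) (a : Fin (2 * q + 1) → A) : WithLp 2 (H × H) →L[ℂ] WithLp 2 (H × H) :=
  (List.ofFn fun j => boundedInverse T.doubleD * T.doubleComm (a j)).prod

/-- `τ̄_{2q}(a⁰, …, a^{2q}) = c_q Str(D̃⁻¹[D̃, a⁰]_σ ⋯ D̃⁻¹[D̃, a^{2q}]_σ)`. -/
def tauBar (q : ℕ) (a : Fin (2 * q + 1) → A) : ℂ := cst q * opTrace (T.doubleγ * T.tauBarProd q a)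

/-- The operators that enter the definition of `τ̄_{2q}` (and of `τ_{2q}`, for invertible `D`)
exist, and the operators of which one takes the supertrace are trace-class, for `q ≥ (p-1)/2`. -/
def TauWellDefined (p : ℝ) : Prop :=
  (∃ P, IsBoundedInverse T.doubleD P) ∧
  (∀ a, ∃ C, IsTwComm T.doubleD (T.doubleπ a) (T.doubleπ (T.σ a)) C) ∧
  ∀ q : ℕ, (p - 1) / 2 ≤ q →
    (∀ a, IsTraceClass (T.tauBarProd q a)) ∧ (T.IsInvertible → ∀ a, IsTraceClass (T.tauProd q a))

/-- `c` is the common periodic class of all the cyclic cocycles `τ̄_{2q}`, `q ≥ (p-1)/2`, and, when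
`D` is invertible, of all the cyclic cocycles `τ_{2q}`, `q ≥ (p-1)/2`. Here the cocycles and the
periodic classes are those of the complex of cochains with components in `S`. -/
def IsConnesChern (p : ℝ) (S : ∀ m, Submodule ℂ (MultiForm A m ℂ)) (c : PeriodicCohomology S) :
    Prop :=
  ∀ q : ℕ, (p - 1) / 2 ≤ q →
    (∃ (φ : MultiForm A (2 * q) ℂ) (h : IsCyclicCocycle φ) (hS : φ ∈ S (2 * q)),
      ⇑φ = T.tauBar q ∧ cyclicClass φ h hS = c) ∧
    (T.IsInvertible → ∃ (φ : MultiForm A (2 * q) ℂ) (h : IsCyclicCocycle φ) (hS : φ ∈ S (2 * q)),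
      ⇑φ = T.tau q ∧ cyclicClass φ h hS = c)

end TwistedSpectralTriple

end CyclicTheory

end

noncomputable section

namespace CyclicTheory

/-! ### Tensor products over noncommutative algebras -/

section Balanced

variable {A : Type*} [Ring A] [Algebra ℂ A]
variable {E : Type*} [AddCommGroup E] [Module ℂ E] [Module Aᵐᵒᵖ E]
variable {V W X : Type*} [AddCommGroup V] [Module ℂ V] [AddCommGroup W] [Module ℂ W]
  [AddCommGroup X] [Module ℂ X]

/-- The subspace spanned by the vectors `ξa ⊗ v - ξ ⊗ av`. -/
def balancedRel (E : Type*) [AddCommGroup E] [Module ℂ E] [Module Aᵐᵒᵖ E]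
    (ρ : A →ₐ[ℂ] Module.End ℂ V) : Submodule ℂ (E ⊗[ℂ] V) :=
  Submodule.span ℂ {t | ∃ (ξ : E) (a : A) (v : V), t = (op a • ξ) ⊗ₜ v - ξ ⊗ₜ ρ a v}

/-- The tensor product `E ⊗_A V` of a right `A`-module `E` and a left `A`-module `V`, the action of
`A` on `V` being given by `ρ`. -/
abbrev BalTensor (E : Type*) [AddCommGroup E] [Module ℂ E] [Module Aᵐᵒᵖ E]
    (ρ : A →ₐ[ℂ] Module.End ℂ V) := (E ⊗[ℂ] V) ⧸ balancedRel E ρ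

namespace BalTensor

/-- `ξ ⊗ v`. -/
def mk (ρ : A →ₐ[ℂ] Module.End ℂ V) : E →ₗ[ℂ] V →ₗ[ℂ] BalTensor E ρ :=
  (TensorProduct.mk ℂ E V).compr₂ (balancedRel E ρ).mkQ

theorem mk_smul (ρ : A →ₐ[ℂ] Module.End ℂ V) (ξ : E) (a : A) (v : V) :
    mk ρ (op a • ξ) v = mk ρ ξ (ρ a v) :=
  (Submodule.Quotient.eq _).2 (Submodule.subset_span ⟨ξ, a, v, rfl⟩)

/-- Balanced bilinear maps induce linear maps on `E ⊗_A V`. -/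
def lift (ρ : A →ₐ[ℂ] Module.End ℂ V) (f : E →ₗ[ℂ] V →ₗ[ℂ] X)
    (hf : ∀ ξ a v, f (op a • ξ) v = f ξ (ρ a v)) : BalTensor E ρ →ₗ[ℂ] X :=
  (balancedRel E ρ).liftQ (TensorProduct.lift f) (by
    refine Submodule.span_le.2 ?_
    rintro _ ⟨ξ, a, v, rfl⟩
    refine LinearMap.mem_ker.2 ?_
    rw [map_sub, TensorProduct.lift.tmul, TensorProduct.lift.tmul, hf, sub_self])

@[simp] theorem lift_mk (ρ : A →ₐ[ℂ] Module.End ℂ V) (f : E →ₗ[ℂ] V →ₗ[ℂ] X)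
    (hf : ∀ ξ a v, f (op a • ξ) v = f ξ (ρ a v)) (ξ : E) (v : V) :
    lift ρ f hf (mk ρ ξ v) = f ξ v := TensorProduct.lift.tmul ξ v

theorem hom_ext {ρ : A →ₐ[ℂ] Module.End ℂ V} {f g : BalTensor E ρ →ₗ[ℂ] X}
    (h : ∀ ξ v, f (mk ρ ξ v) = g (mk ρ ξ v)) : f = g :=
  Submodule.linearMap_qext _ (TensorProduct.ext' h)

/-- `1 ⊗ f : E ⊗_A V → E ⊗_A W`, for an `A`-linear map `f : V → W`. -/
def map (E : Type*) [AddCommGroup E] [Module ℂ E] [Module Aᵐᵒᵖ E]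
    {ρ : A →ₐ[ℂ] Module.End ℂ V} {ρ' : A →ₐ[ℂ] Module.End ℂ W} (f : V →ₗ[ℂ] W)
    (hf : ∀ a v, f (ρ a v) = ρ' a (f v)) : BalTensor E ρ →ₗ[ℂ] BalTensor E ρ' :=
  lift ρ ((mk ρ').compl₂ f) fun ξ a v => by
    rw [LinearMap.compl₂_apply, LinearMap.compl₂_apply, mk_smul, hf]

@[simp] theorem map_mk {ρ : A →ₐ[ℂ] Module.End ℂ V} {ρ' : A →ₐ[ℂ] Module.End ℂ W} (f : V →ₗ[ℂ] W)
    (hf : ∀ a v, f (ρ a v) = ρ' a (f v)) (ξ : E) (v : V) :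
    map E f hf (mk ρ ξ v) = mk ρ' ξ (f v) := lift_mk _ _ _ _ _

end BalTensor

end Balanced

/-! ### Projective modules and `σ`-translates -/

section Modules

variable {A : Type*} [Ring A] [Algebra ℂ A]

/-- The right module `eA^N`. -/
def eModule {N : ℕ} (e : Matrix (Fin N) (Fin N) A) : Submodule Aᵐᵒᵖ (Fin N → A) where
  carrier := {w | ∃ v, e *ᵥ v = w}
  add_mem' := by
    rintro _ _ ⟨v, rfl⟩ ⟨w, rfl⟩
    exact ⟨v + w, Matrix.mulVec_add _ _ _⟩
  zero_mem' := ⟨0, Matrix.mulVec_zero _⟩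
  smul_mem' := by
    rintro a _ ⟨v, rfl⟩
    exact ⟨a • v, Matrix.mulVec_smul _ _ _⟩

/-- A `σ`-translate `F = E^σ` of the right module `E`. -/
structure SigmaTranslate (σ : A ≃ₐ[ℂ] A) (E F : Type*)
    [AddCommGroup E] [Module ℂ E] [Module Aᵐᵒᵖ E] [AddCommGroup F] [Module ℂ F] [Module Aᵐᵒᵖ F]
    where
  /-- The linear isomorphism `σ^E`. -/
  tr : E ≃ₗ[ℂ] F
  N : ℕ
  e : Matrix (Fin N) (Fin N) A
  idem : e * e = e
  φ : E ≃ₗ[Aᵐᵒᵖ] eModule e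
  φσ : F ≃ₗ[Aᵐᵒᵖ] eModule (e.map σ)
  φ_tr : ∀ ξ i, (φσ (tr ξ) : Fin N → A) i = σ ((φ ξ : Fin N → A) i)

theorem SigmaTranslate.tr_smul {σ : A ≃ₐ[ℂ] A} {E F : Type*}
    [AddCommGroup E] [Module ℂ E] [Module Aᵐᵒᵖ E] [AddCommGroup F] [Module ℂ F] [Module Aᵐᵒᵖ F]
    (t : SigmaTranslate σ E F) (ξ : E) (a : A) :
    t.tr (op a • ξ) = op (σ a) • t.tr ξ := by
  apply t.φσ.injective
  apply Subtype.ext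
  funext i
  rw [t.φ_tr, map_smul, map_smul]
  change σ ((t.φ ξ : Fin t.N → A) i * a) = (t.φσ (t.tr ξ) : Fin t.N → A) i * σ a
  rw [map_mul, t.φ_tr]

end Modules

/-! ### Twisted forms, connections and coupled operators -/

namespace TwistedSpectralTriple

variable {A : Type*} [Ring A] [Algebra ℂ A] [StarRing A]
variable {H : Type*} [NormedAddCommGroup H] [InnerProductSpace ℂ H] [CompleteSpace H]
variable (T : TwistedSpectralTriple A H)

theorem comm_mul (a b : A) : T.comm (a * b) = T.comm a * T.π b + T.π (T.σ a) * T.comm b := by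
  refine ext_dense T.dense_domain fun x => ?_
  have h1 := T.comm_apply (a * b) x
  have h2 := T.comm_apply b x
  have h3 := T.comm_apply a ⟨T.π b x, T.mapsTo b x x.2⟩
  have h4 : T.D ⟨T.π (a * b) x, T.mapsTo (a * b) x x.2⟩ =
      T.D ⟨T.π a (T.π b x), T.mapsTo a _ (T.mapsTo b x x.2)⟩ := by
    congr 1
    exact Subtype.ext (congrArg (fun S : H →L[ℂ] H => S x) (map_mul T.π a b))
  rw [add_apply, mul_apply_eq_comp, mul_apply_eq_comp,
    h1, h2, h3, h4, map_mul T.σ, map_mul T.π, mul_apply_eq_comp, map_sub]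
  abel

theorem comm_odd (a : A) : T.γ * T.comm a = -(T.comm a * T.γ) := by
  refine ext_dense T.dense_domain fun x => ?_
  have hev : ∀ (c : A) (y : H), T.γ (T.π c y) = T.π c (T.γ y) := fun c y =>
    congrArg (fun S : H →L[ℂ] H => S y) (T.π_even c)
  obtain ⟨hx, h1⟩ := T.D_odd x
  obtain ⟨hy, h2⟩ := T.D_odd ⟨T.π a x, T.mapsTo a x x.2⟩
  have h3 := T.comm_apply a x
  have h4 := T.comm_apply a ⟨T.γ x, hx⟩
  have h5 : T.D ⟨T.π a (T.γ x), T.mapsTo a _ hx⟩ = T.D ⟨T.γ (T.π a x), hy⟩ := by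
    congr 1
    exact Subtype.ext (hev a x).symm
  rw [neg_apply, mul_apply_eq_comp, mul_apply_eq_comp,
    h3, h4, h5, h1, h2, map_sub, hev, map_neg]
  abel

/-- The bimodule `Ω¹_{D,σ}(A)` of twisted `1`-forms `∑ aⁱ [D, bⁱ]_σ`. -/
def forms : Submodule ℂ (H →L[ℂ] H) :=
  Submodule.span ℂ {ω | ∃ a b, ω = T.π a * T.comm b}

theorem mul_mem_forms (a : A) {ω : H →L[ℂ] H} (hω : ω ∈ T.forms) : T.π a * ω ∈ T.forms := by
  induction hω using Submodule.span_induction with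
  | mem ω h =>
    obtain ⟨b, c, rfl⟩ := h
    exact Submodule.subset_span ⟨a * b, c, by rw [map_mul, mul_assoc]⟩
  | zero => rw [mul_zero]; exact zero_mem _
  | add x y _ _ hx hy => rw [mul_add]; exact add_mem hx hy
  | smul z x _ hx => rw [mul_smul_comm]; exact Submodule.smul_mem _ _ hx

theorem mem_forms_mul (a : A) {ω : H →L[ℂ] H} (hω : ω ∈ T.forms) : ω * T.π a ∈ T.forms := by
  induction hω using Submodule.span_induction with
  | mem ω h =>
    obtain ⟨b, c, rfl⟩ := h
    have : T.π b * T.comm c * T.π a =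
        T.π b * T.comm (c * a) - T.π (b * T.σ c) * T.comm a := by
      rw [comm_mul, mul_add, map_mul, mul_assoc, mul_assoc, add_sub_cancel_right]
    rw [this]
    exact sub_mem (Submodule.subset_span ⟨_, _, rfl⟩) (Submodule.subset_span ⟨_, _, rfl⟩)
  | zero => rw [zero_mul]; exact zero_mem _
  | add x y _ _ hx hy => rw [add_mul]; exact add_mem hx hy
  | smul z x _ hx => rw [smul_mul_assoc]; exact Submodule.smul_mem _ _ hx

theorem forms_odd {ω : H →L[ℂ] H} (hω : ω ∈ T.forms) : T.γ * ω = -(ω * T.γ) := by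
  induction hω using Submodule.span_induction with
  | mem ω h =>
    obtain ⟨b, c, rfl⟩ := h
    rw [← mul_assoc, T.π_even, mul_assoc, comm_odd, mul_neg, mul_assoc]
  | zero => simp
  | add x y _ _ hx hy => rw [mul_add, add_mul, hx, hy, neg_add]
  | smul z x _ hx => rw [mul_smul_comm, smul_mul_assoc, hx, smul_neg]

/-- The differential `d_σ a = [D, a]_σ`. -/
def dσ (a : A) : T.forms := ⟨T.comm a, Submodule.subset_span ⟨1, a, by rw [map_one, one_mul]⟩⟩

/-- The left action of `A` on `H`. -/
def repH : A →ₐ[ℂ] Module.End ℂ H where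
  toFun a := (T.π a).toLinearMap
  map_one' := by rw [map_one]; rfl
  map_mul' a b := by rw [map_mul]; rfl
  map_zero' := by rw [map_zero]; rfl
  map_add' a b := by rw [map_add]; rfl
  commutes' c := by
    ext x
    change T.π (algebraMap ℂ A c) x = c • x
    rw [AlgHomClass.commutes, Algebra.algebraMap_eq_smul_one]
    rfl

/-- The left action of `A` on the domain of `D`. -/
def repDom : A →ₐ[ℂ] Module.End ℂ T.D.domain where
  toFun a := (T.repH a).restrict (T.mapsTo a)
  map_one' := by ext x; exact congrArg (fun f => f (x : H)) (map_one T.repH)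
  map_mul' a b := by ext x; exact congrArg (fun f => f (x : H)) (map_mul T.repH a b)
  map_zero' := by ext x; exact congrArg (fun f => f (x : H)) (map_zero T.repH)
  map_add' a b := by ext x; exact congrArg (fun f => f (x : H)) (map_add T.repH a b)
  commutes' c := by ext x; exact congrArg (fun f => f (x : H)) (AlgHomClass.commutes T.repH c)

/-- The left action of `A` on twisted forms. -/
def repForms : A →ₐ[ℂ] Module.End ℂ T.forms where
  toFun a := (LinearMap.mulLeft ℂ (T.π a)).restrict fun _ h => T.mul_mem_forms a h
  map_one' := by ext ω : 2; exact (congrArg (· * (ω : H →L[ℂ] H)) (map_one T.π)).trans (one_mul _)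
  map_mul' a b := by
    ext ω : 2; exact (congrArg (· * (ω : H →L[ℂ] H)) (map_mul T.π a b)).trans (mul_assoc _ _ _)
  map_zero' := by ext ω : 2; exact (congrArg (· * (ω : H →L[ℂ] H)) (map_zero T.π)).trans (zero_mul _)
  map_add' a b := by
    ext ω : 2; exact (congrArg (· * (ω : H →L[ℂ] H)) (map_add T.π a b)).trans (add_mul _ _ _)
  commutes' c := by
    ext ω : 2
    change T.π (algebraMap ℂ A c) * (ω : H →L[ℂ] H) = c • (ω : H →L[ℂ] H)
    rw [AlgHomClass.commutes, Algebra.algebraMap_eq_smul_one, smul_one_mul]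

/-- The right action of `A` on twisted forms. -/
def formsRight (a : A) : T.forms →ₗ[ℂ] T.forms :=
  (LinearMap.mulRight ℂ (T.π a)).restrict fun _ h => T.mem_forms_mul a h

section Connection

variable {E F : Type*} [AddCommGroup E] [Module ℂ E] [Module Aᵐᵒᵖ E]
  [AddCommGroup F] [Module ℂ F] [Module Aᵐᵒᵖ F]

/-- The right action of `A` on `F ⊗_A Ω¹`. -/
def tensorFormsRight (F : Type*) [AddCommGroup F] [Module ℂ F] [Module Aᵐᵒᵖ F] (a : A) :
    BalTensor F T.repForms →ₗ[ℂ] BalTensor F T.repForms :=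
  BalTensor.map F (T.formsRight a) fun _ _ => Subtype.ext (mul_assoc _ _ _)

/-- A `σ`-connection on `E`: a linear map `∇ : E → E^σ ⊗_A Ω¹` such that
`∇(ξa) = (∇ξ)a + σ^E(ξ) ⊗ d_σ a`. -/
structure SigmaConnection (t : SigmaTranslate T.σ E F) where
  nabla : E →ₗ[ℂ] BalTensor F T.repForms
  leibniz : ∀ ξ a, nabla (op a • ξ) =
    T.tensorFormsRight F a (nabla ξ) + BalTensor.mk T.repForms (t.tr ξ) (T.dσ a)

/-- The map `F ⊗_A Ω¹ → F ⊗_A H`, `ξ ⊗ ω ↦ ξ ⊗ ω(ζ)`. -/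
def clifford (F : Type*) [AddCommGroup F] [Module ℂ F] [Module Aᵐᵒᵖ F] (ζ : H) :
    BalTensor F T.repForms →ₗ[ℂ] BalTensor F T.repH :=
  BalTensor.map F ((ContinuousLinearMap.apply ℂ H ζ).toLinearMap ∘ₗ T.forms.subtype)
    fun _ _ => rfl

theorem clifford_mk (ξ : F) (ω : T.forms) (ζ : H) :
    T.clifford F ζ (BalTensor.mk T.repForms ξ ω) =
      BalTensor.mk T.repH ξ ((ω : H →L[ℂ] H) ζ) := BalTensor.map_mk _ _ _ _

theorem clifford_right (a : A) (ζ : H) (t : BalTensor F T.repForms) :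
    T.clifford F ζ (T.tensorFormsRight F a t) = T.clifford F (T.π a ζ) t := by
  have : T.clifford F ζ ∘ₗ T.tensorFormsRight F a = T.clifford F (T.π a ζ) :=
    BalTensor.hom_ext fun ξ ω => by
      rw [LinearMap.comp_apply, tensorFormsRight, BalTensor.map_mk, clifford_mk, clifford_mk]
      rfl
  exact congrArg (fun f => f t) this

theorem clifford_add (ζ ζ' : H) (t : BalTensor F T.repForms) :
    T.clifford F (ζ + ζ') t = T.clifford F ζ t + T.clifford F ζ' t := by
  have : T.clifford F (ζ + ζ') = T.clifford F ζ + T.clifford F ζ' :=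
    BalTensor.hom_ext fun ξ ω => by
      rw [LinearMap.add_apply, clifford_mk, clifford_mk, clifford_mk, map_add, map_add]
  exact congrArg (fun f => f t) this

theorem clifford_smul (c : ℂ) (ζ : H) (t : BalTensor F T.repForms) :
    T.clifford F (c • ζ) t = c • T.clifford F ζ t := by
  have : T.clifford F (c • ζ) = c • T.clifford F ζ :=
    BalTensor.hom_ext fun ξ ω => by
      rw [LinearMap.smul_apply, clifford_mk, clifford_mk, map_smul, map_smul]
  exact congrArg (fun f => f t) this

variable {T}
variable {t : SigmaTranslate T.σ E F} (nab : T.SigmaConnection t)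

/-- `(ξ, ζ) ↦ σ^E(ξ) ⊗ Dζ + c(∇)(ξ ⊗ ζ)`. -/
def coupledBilin : E →ₗ[ℂ] T.D.domain →ₗ[ℂ] BalTensor F T.repH :=
  LinearMap.mk₂ ℂ
    (fun ξ ζ => BalTensor.mk T.repH (t.tr ξ) (T.D ζ) + T.clifford F ζ (nab.nabla ξ))
    (fun ξ ξ' ζ => by simp only [map_add, LinearMap.add_apply]; abel)
    (fun c ξ ζ => by simp only [map_smul, LinearMap.smul_apply, smul_add])
    (fun ξ ζ ζ' => by
      rw [Submodule.coe_add, clifford_add, LinearPMap.map_add, map_add]; abel)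
    (fun c ξ ζ => by
      rw [Submodule.coe_smul, clifford_smul, LinearPMap.map_smul, map_smul, smul_add])

/-- The operator `D_∇ : E ⊗_A dom D → E^σ ⊗_A H`,
`D_∇(ξ ⊗ ζ) = σ^E(ξ) ⊗ Dζ + c(∇)(ξ ⊗ ζ)`. -/
def coupled : BalTensor E T.repDom →ₗ[ℂ] BalTensor F T.repH :=
  BalTensor.lift T.repDom (coupledBilin nab) fun ξ a ζ => by
    have h := T.comm_apply a ζ
    change BalTensor.mk T.repH (t.tr (op a • ξ)) (T.D ζ) +
        T.clifford F ζ (nab.nabla (op a • ξ)) =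
      BalTensor.mk T.repH (t.tr ξ) (T.D (T.repDom a ζ)) +
        T.clifford F (T.π a ζ) (nab.nabla ξ)
    rw [t.tr_smul, BalTensor.mk_smul, nab.leibniz, map_add, clifford_right, clifford_mk]
    have h' : T.D (T.repDom a ζ) = ((T.dσ a : T.forms) : H →L[ℂ] H) ζ + T.repH (T.σ a) (T.D ζ) :=
      (sub_eq_iff_eq_add.1 h.symm)
    rw [h', map_add]
    abel

theorem coupled_mk (ξ : E) (ζ : T.D.domain) :
    coupled nab (BalTensor.mk T.repDom ξ ζ) =
      BalTensor.mk T.repH (t.tr ξ) (T.D ζ) + T.clifford F ζ (nab.nabla ξ) :=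
  BalTensor.lift_mk _ _ _ _ _

variable (T)

/-- The grading operator on the domain of `D`. -/
def γDom : T.D.domain →ₗ[ℂ] T.D.domain :=
  T.γ.toLinearMap.restrict fun x hx => (T.D_odd ⟨x, hx⟩).1

theorem γ_π (a : A) (x : H) : T.γ (T.π a x) = T.π a (T.γ x) :=
  congrArg (fun S : H →L[ℂ] H => S x) (T.π_even a)

/-- The grading operator `1 ⊗ γ` of `F ⊗_A H`. -/
def gradH (F : Type*) [AddCommGroup F] [Module ℂ F] [Module Aᵐᵒᵖ F] :
    Module.End ℂ (BalTensor F T.repH) :=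
  BalTensor.map F T.γ.toLinearMap fun a x => T.γ_π a x

/-- The grading operator `1 ⊗ γ` of `E ⊗_A dom D`. -/
def gradDom (E : Type*) [AddCommGroup E] [Module ℂ E] [Module Aᵐᵒᵖ E] :
    Module.End ℂ (BalTensor E T.repDom) :=
  BalTensor.map E T.γDom fun a x => Subtype.ext (T.γ_π a x)

theorem gradH_mk (ξ : F) (x : H) :
    T.gradH F (BalTensor.mk T.repH ξ x) = BalTensor.mk T.repH ξ (T.γ x) :=
  BalTensor.map_mk _ _ _ _

theorem gradDom_mk (ξ : E) (x : T.D.domain) :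
    T.gradDom E (BalTensor.mk T.repDom ξ x) = BalTensor.mk T.repDom ξ (T.γDom x) :=
  BalTensor.map_mk _ _ _ _

theorem gradH_clifford (ζ : H) (s : BalTensor F T.repForms) :
    T.gradH F (T.clifford F ζ s) = -T.clifford F (T.γ ζ) s := by
  have : T.gradH F ∘ₗ T.clifford F ζ = -T.clifford F (T.γ ζ) :=
    BalTensor.hom_ext fun ξ ω => by
      rw [LinearMap.comp_apply, LinearMap.neg_apply, clifford_mk, clifford_mk,
        gradH_mk, ← map_neg]
      congr 1
      exact congrArg (fun S : H →L[ℂ] H => S ζ) (T.forms_odd ω.2)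
  exact congrArg (fun f => f s) this

variable {T}

/-- `D_∇` is odd. -/
theorem coupled_odd (x : BalTensor E T.repDom) :
    coupled nab (T.gradDom E x) = -T.gradH F (coupled nab x) := by
  have : coupled nab ∘ₗ T.gradDom E = -(T.gradH F ∘ₗ coupled nab) :=
    BalTensor.hom_ext fun ξ ζ => by
      rw [LinearMap.comp_apply, LinearMap.neg_apply, LinearMap.comp_apply,
        gradDom_mk, coupled_mk, coupled_mk, map_add, gradH_clifford, gradH_mk, neg_add, neg_neg, ← map_neg]
      congr 2
      exact (T.D_odd ζ).2
  exact congrArg (fun f => f x) this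

/-- The operators `D_∇^±` (for `ε = ±1`) between the eigenspaces of the grading operators:
`D_∇^± : E ⊗_A dom D^± → E^σ ⊗_A H^∓`. -/
def coupledPart (ε : ℂ) : (T.gradDom E).eigenspace ε →ₗ[ℂ] (T.gradH F).eigenspace (-ε) :=
  (coupled nab).restrict fun x hx => by
    rw [Module.End.mem_eigenspace_iff] at hx ⊢
    have h := coupled_odd nab x
    rw [hx, map_smul] at h
    rw [neg_smul, h, neg_neg]

/-- `D_∇^±` has finite-dimensional kernel and cokernel. -/
def SigmaConnection.IsFredholmPart (ε : ℂ) : Prop :=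
  FiniteDimensional ℂ (LinearMap.ker (coupledPart nab ε)) ∧
    FiniteDimensional ℂ (_ ⧸ LinearMap.range (coupledPart nab ε))

/-- `ind D_∇^±`. -/
def indexPart (ε : ℂ) : ℤ :=
  Module.finrank ℂ (LinearMap.ker (coupledPart nab ε)) -
    Module.finrank ℂ (_ ⧸ LinearMap.range (coupledPart nab ε))

/-- `ind D_∇ = (ind D_∇⁺ - ind D_∇⁻) / 2`. -/
def SigmaConnection.index : ℚ := (indexPart nab 1 - indexPart nab (-1)) / 2

end Connection

end TwistedSpectralTriple

end CyclicTheory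

end

/-!
The proof replaces the unbounded operator `D` by its bounded inverse and reduces the theorem to
identities between traces of products of bounded operators.

*Traces.* By a spectral cutoff (`IsSchatten.exists_rank_le`), an operator of Schatten class `p ≤ n`
is approximated up to `2⁻ᵏ` by operators of rank `Nₖ` with `∑ Nₖ 2⁻ⁿᵏ < ∞`. Such bounds multiply, which
gives a filtration `schattenPow n r` of the bounded operators that plays the role of the powers of
the Schatten ideal: for `r ≥ n` its members are nuclear, hence of trace class, and
`Tr(TS) = Tr(ST)` as soon as the degrees of `T` and `S` add up to `n`
(`opTrace_comm_of_mem_schattenPow`). Since `D̃² = D² + 1`, the operator `D̃` has the bounded inverse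
`D̃(D² + 1)⁻¹`, which lies in degree `1` of the filtration if the triple is `p`-summable.

*The Connes–Chern character.* Suppose that `D` has a bounded inverse. Both `ρ₀(a) = a` and
`ρ₁(a) = D⁻¹σ(a)D` are homomorphisms, and their difference `ω(a) = D⁻¹[D, a]_σ` has degree `1`. For
such a pair (`QuasiHom`), the trace property and `ω(ab) = ρ₀(a)ω(b) + ω(a)ρ₁(b)` imply that the
supertrace of `ω(a⁰) ⋯ ω(a²ᑫ)` is a cyclic cocycle, and that the cochain
`(ρ₀ + ρ₁)(a⁰) ω(a¹) ⋯ ω(a²ᑫ⁺¹)` has as its images under `B` and `b` the cocycles of degrees `2q` and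
`2q + 2`, up to the factors for which the constants `c_q` are made (`QuasiHom.cyclicClass_succ`).
So the periodic class does not depend on `q`. If `D` is invertible, the operators
`(D, t; t, -D)` with `0 ≤ t ≤ 1` are invertible and join `D ⊕ -D`, whose cocycle is that of `D`, to
`D̃`. Along this path the derivative of `ω` is a commutator of `ρ₁` with an operator of degree `1`,
the derivative of the cocycle is therefore `b` of a cyclic cochain, and integration over `t` shows
that the classes of `τ` and `τ̄` agree (`BddTriple.exists_homotopy`, `exists_isConnesChern`). All
cochains that occur are continuous, so the argument is the same for continuous cochains and for all
cochains, and the natural map respects the classes.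

*The index formula.* In the coordinates of an isomorphism `E ≃ eAᴺ`, the graph map `v ↦ (Dv, v)`
identifies `E ⊗ dom D` with the range of the idempotent `g = D̃eD̃⁻¹` on `(H ⊕ H)ᴺ`, and `w ↦ (w, 0)`
identifies `E^σ ⊗ H` with the range of `h = σ(e)`. Then `D_∇` becomes the restriction of
`h(1 + ∇D̃⁻¹)` to the range of `g` (`codEquiv_coupled`), a small perturbation of `h : ran g → ran h`.
As `g - h = [D̃, e]_σ D̃⁻¹` is small as well, and its square commutes with `g` and `h`, this operator is
Fredholm with index `Tr (g - h)²ᑫ⁺¹` (`index_of_idempotents`); with gradings, the supertrace appears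
(`index_of_graded_idempotents`). Moving one factor `[D̃, e]_σ` around the trace turns `(g - h)²ᑫ⁺¹`
into `(D̃⁻¹[D̃, e]_σ)²ᑫ⁺¹`, and the supertrace of the latter, written as a sum over closed paths of
matrix indices, is the pairing of `τ̄` with the Chern character of `e`
(`BddTriple.matTrace_character`, `duality_cyclicClass`). A `σ`-translate with its `σ`-connection may
be presented by any idempotent `e` with `E ≃ eAᴺ` (`SigmaTranslate.changeIdem`), so the formula holds
for all of them.
-/

open scoped TensorProduct InnerProductSpace Matrix
open MulOpposite (op)

noncomputable section

set_option linter.unusedSectionVars false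

namespace CyclicTheory

/-! ### Nuclear operators and their trace -/

section Nuclear

open InnerProductSpace (rankOne)

variable {H₁ H₂ H₃ : Type*}
  [NormedAddCommGroup H₁] [InnerProductSpace ℂ H₁] [CompleteSpace H₁]
  [NormedAddCommGroup H₂] [InnerProductSpace ℂ H₂] [CompleteSpace H₂]
  [NormedAddCommGroup H₃] [InnerProductSpace ℂ H₃] [CompleteSpace H₃]

/-- `T = ∑ xᵢ ⊗ yᵢ*` for vectors with `∑ ‖xᵢ‖ ‖yᵢ‖ ≤ c`. -/
def HasNuc (T : H₁ →L[ℂ] H₂) (c : ℝ) : Prop :=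
  ∃ (ι : Type) (x : ι → H₂) (y : ι → H₁), Summable (fun i => ‖x i‖ * ‖y i‖) ∧
    ∑' i, ‖x i‖ * ‖y i‖ ≤ c ∧ HasSum (fun i => rankOne ℂ (x i) (y i)) T

/-- Nuclear operators between Hilbert spaces. -/
def IsNuc (T : H₁ →L[ℂ] H₂) : Prop := ∃ c, HasNuc T c

theorem HasNuc.isNuc {T : H₁ →L[ℂ] H₂} {c : ℝ} (h : HasNuc T c) : IsNuc T := ⟨c, h⟩

theorem HasNuc.mono {T : H₁ →L[ℂ] H₂} {c d : ℝ} (h : HasNuc T c) (hcd : c ≤ d) : HasNuc T d := by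
  obtain ⟨ι, x, y, h1, h2, h3⟩ := h
  exact ⟨ι, x, y, h1, h2.trans hcd, h3⟩

/-- Countable subadditivity of the nuclear norm. -/
theorem HasNuc.hasSum {κ : Type} {T : κ → H₁ →L[ℂ] H₂} {c : κ → ℝ} (h : ∀ k, HasNuc (T k) (c k))
    (hc : Summable c) {S : H₁ →L[ℂ] H₂} (hS : HasSum T S) : HasNuc S (∑' k, c k) := by
  choose ι x y h1 h2 h3 using h
  have hle : ∀ k, 0 ≤ ∑' i, ‖x k i‖ * ‖y k i‖ := fun k => tsum_nonneg fun i => by positivity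
  have hs : Summable fun k => ∑' i, ‖x k i‖ * ‖y k i‖ := hc.of_nonneg_of_le hle h2
  have hsig : Summable fun p : Σ k, ι k => ‖x p.1 p.2‖ * ‖y p.1 p.2‖ :=
    (summable_sigma_of_nonneg fun p => by positivity).2 ⟨h1, hs⟩
  refine ⟨Σ k, ι k, fun p => x p.1 p.2, fun p => y p.1 p.2, hsig, ?_, ?_⟩
  · rw [hsig.tsum_sigma' h1]
    exact hs.tsum_le_tsum h2 hc
  · have hsum : Summable fun p : Σ k, ι k => rankOne ℂ (x p.1 p.2) (y p.1 p.2) :=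
      Summable.of_norm (by simpa only [InnerProductSpace.norm_rankOne] using hsig)
    have := hsum.hasSum.sigma h3
    rw [hS.unique this]
    exact hsum.hasSum

theorem HasNuc.add {T S : H₁ →L[ℂ] H₂} {c d : ℝ} (hT : HasNuc T c) (hS : HasNuc S d) :
    HasNuc (T + S) (c + d) := by
  have := HasNuc.hasSum (κ := Bool) (T := fun b => cond b T S) (c := fun b => cond b c d)
    (by rintro (_ | _) <;> assumption) (hasSum_fintype _).summable (S := T + S)
    (by simpa using hasSum_fintype (fun b : Bool => cond b T S))
  simpa using this

theorem HasNuc.comp_left {T : H₁ →L[ℂ] H₂} {c : ℝ} (h : HasNuc T c) (S : H₂ →L[ℂ] H₃) :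
    HasNuc (S ∘L T) (‖S‖ * c) := by
  obtain ⟨ι, x, y, h1, h2, h3⟩ := h
  have hb : ∀ i, ‖S (x i)‖ * ‖y i‖ ≤ ‖S‖ * (‖x i‖ * ‖y i‖) := fun i => by
    rw [← mul_assoc]
    exact mul_le_mul_of_nonneg_right (S.le_opNorm _) (norm_nonneg _)
  have hs : Summable fun i => ‖S (x i)‖ * ‖y i‖ :=
    (h1.mul_left ‖S‖).of_nonneg_of_le (fun i => by positivity) hb
  refine ⟨ι, fun i => S (x i), y, hs, ?_, ?_⟩
  · refine (hs.tsum_le_tsum hb (h1.mul_left _)).trans ?_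
    rw [tsum_mul_left]
    exact mul_le_mul_of_nonneg_left h2 (norm_nonneg _)
  · have := h3.mapL (ContinuousLinearMap.compL ℂ H₁ H₂ H₃ S)
    simpa [InnerProductSpace.comp_rankOne] using this

theorem HasNuc.comp_right {T : H₂ →L[ℂ] H₃} {c : ℝ} (h : HasNuc T c) (S : H₁ →L[ℂ] H₂) :
    HasNuc (T ∘L S) (c * ‖S‖) := by
  obtain ⟨ι, x, y, h1, h2, h3⟩ := h
  have hb : ∀ i, ‖x i‖ * ‖ContinuousLinearMap.adjoint S (y i)‖ ≤ (‖x i‖ * ‖y i‖) * ‖S‖ :=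
      fun i => by
    rw [mul_assoc, mul_comm ‖y i‖]
    refine mul_le_mul_of_nonneg_left ?_ (norm_nonneg _)
    refine ((ContinuousLinearMap.adjoint S).le_opNorm _).trans_eq ?_
    rw [LinearIsometryEquiv.norm_map]
  have hs : Summable fun i => ‖x i‖ * ‖ContinuousLinearMap.adjoint S (y i)‖ :=
    (h1.mul_right ‖S‖).of_nonneg_of_le (fun i => by positivity) hb
  refine ⟨ι, x, fun i => ContinuousLinearMap.adjoint S (y i), hs, ?_, ?_⟩
  · refine (hs.tsum_le_tsum hb (h1.mul_right _)).trans ?_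
    rw [tsum_mul_right]
    exact mul_le_mul_of_nonneg_right h2 (norm_nonneg _)
  · have := h3.mapL ((ContinuousLinearMap.compL ℂ H₁ H₂ H₃).flip S)
    simpa [InnerProductSpace.rankOne_comp] using this

/-- Rank `r` operators are nuclear, with nuclear norm at most `r` times the operator norm. -/
theorem hasNuc_of_rank_le {T : H₁ →L[ℂ] H₂} {r : ℕ} (h : LinearMap.rank (T : H₁ →ₗ[ℂ] H₂) ≤ r) :
    HasNuc T (r * ‖T‖) := by
  have hfin : FiniteDimensional ℂ (LinearMap.range (T : H₁ →ₗ[ℂ] H₂)) :=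
    Module.rank_lt_aleph0_iff.1 (h.trans_lt (Cardinal.natCast_lt_aleph0))
  have hr : Module.finrank ℂ (LinearMap.range (T : H₁ →ₗ[ℂ] H₂)) ≤ r :=
    Module.finrank_le_of_rank_le h
  set V := LinearMap.range (T : H₁ →ₗ[ℂ] H₂) with hV
  let u := stdOrthonormalBasis ℂ V
  have hu : ∀ i, ‖(u i : H₂)‖ = 1 := fun i => u.orthonormal.1 i
  have hb : ∀ i, ‖(u i : H₂)‖ * ‖ContinuousLinearMap.adjoint T (u i)‖ ≤ ‖T‖ := fun i => by
    rw [hu, one_mul]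
    refine ((ContinuousLinearMap.adjoint T).le_opNorm _).trans_eq ?_
    rw [LinearIsometryEquiv.norm_map, hu, mul_one]
  refine ⟨Fin (Module.finrank ℂ V), fun i => (u i : H₂),
    fun i => ContinuousLinearMap.adjoint T (u i),
    (hasSum_fintype _).summable, ?_, ?_⟩
  · rw [tsum_fintype]
    refine (Finset.sum_le_sum fun i _ => hb i).trans ?_
    rw [Finset.sum_const, Finset.card_univ, Fintype.card_fin, nsmul_eq_mul]
    exact mul_le_mul_of_nonneg_right (by exact_mod_cast hr) (norm_nonneg _)
  · convert hasSum_fintype _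
    ext v
    have hv : T v ∈ V := ⟨v, rfl⟩
    have := congrArg (Subtype.val) (u.sum_repr' ⟨T v, hv⟩)
    rw [sum_apply]
    simp only [InnerProductSpace.rankOne_apply, ContinuousLinearMap.adjoint_inner_left]
    rw [AddSubmonoidClass.coe_finsetSum] at this
    exact this.symm

section Trace

variable {H : Type*} [NormedAddCommGroup H] [InnerProductSpace ℂ H] [CompleteSpace H]

/-- The matrix of a rank one operator has a diagonal of `ℓ¹`-norm at most `‖x‖ ‖y‖`, by
Cauchy–Schwarz and Bessel. -/
theorem sum_norm_inner_mul_le {κ : Type*} {b : κ → H} (hb : Orthonormal ℂ b) (s : Finset κ)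
    (x y : H) : ∑ i ∈ s, ‖⟪y, b i⟫_ℂ‖ * ‖⟪b i, x⟫_ℂ‖ ≤ ‖x‖ * ‖y‖ := by
  refine (Real.sum_mul_le_sqrt_mul_sqrt s _ _).trans ?_
  rw [mul_comm]
  refine mul_le_mul ?_ ?_ (Real.sqrt_nonneg _) (norm_nonneg _)
  · exact Real.sqrt_le_iff.2 ⟨norm_nonneg _, hb.sum_inner_products_le x⟩
  · refine Real.sqrt_le_iff.2 ⟨norm_nonneg _, ?_⟩
    simp only [norm_inner_symm y]
    exact hb.sum_inner_products_le y

/-- The trace of a nuclear operator, computed in any Hilbert basis. -/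
theorem hasSum_trace {κ : Type*} (b : HilbertBasis κ ℂ H) {T : H →L[ℂ] H} {ι : Type} {x y : ι → H}
    (h1 : Summable fun i => ‖x i‖ * ‖y i‖) (h3 : HasSum (fun i => rankOne ℂ (x i) (y i)) T) :
    HasSum (fun i => ⟪b i, T (b i)⟫_ℂ) (∑' k, ⟪y k, x k⟫_ℂ) := by
  -- The double series of the `⟪yₖ, bᵢ⟫ ⟪bᵢ, xₖ⟫` converges absolutely and can be summed in either
  -- order.
  let F : ι × κ → ℂ := fun p => ⟪y p.1, b p.2⟫_ℂ * ⟪b p.2, x p.1⟫_ℂ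
  have hF1 : ∀ k, Summable fun i => ‖F (k, i)‖ := fun k =>
    summable_of_sum_le (fun _ => norm_nonneg _) (c := ‖x k‖ * ‖y k‖) fun s => by
      simpa [F] using sum_norm_inner_mul_le b.orthonormal s (x k) (y k)
  have hF2 : Summable fun k => ∑' i, ‖F (k, i)‖ :=
    h1.of_nonneg_of_le (fun k => tsum_nonneg fun _ => norm_nonneg _) fun k =>
      Real.tsum_le_of_sum_le (fun _ => norm_nonneg _) fun s => by
        simpa [F] using sum_norm_inner_mul_le b.orthonormal s (x k) (y k)
  have hF : Summable F :=
      Summable.of_norm ((summable_prod_of_nonneg fun _ => norm_nonneg _).2 ⟨hF1, hF2⟩)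
  have e1 := hF.hasSum.prod_fiberwise fun k => b.hasSum_inner_mul_inner (y k) (x k)
  have e2 : HasSum (F ∘ Prod.swap) (∑' p, F p) := (Equiv.prodComm κ ι).hasSum_iff.2 hF.hasSum
  rw [e1.tsum_eq]
  refine e2.prod_fiberwise fun i => ?_
  have := (h3.mapL ((ContinuousLinearMap.apply ℂ H (b i)))).mapL (innerSL ℂ (b i))
  simpa [F, inner_smul_right] using this

theorem summable_trace {T : H →L[ℂ] H} (h : IsNuc T) :
    Summable fun i => ⟪stdBasis H i, T (stdBasis H i)⟫_ℂ := by
  obtain ⟨c, ι, x, y, h1, h2, h3⟩ := h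
  exact (hasSum_trace _ h1 h3).summable

theorem opTrace_eq {T : H →L[ℂ] H} {ι : Type} {x y : ι → H}
    (h1 : Summable fun i => ‖x i‖ * ‖y i‖) (h3 : HasSum (fun i => rankOne ℂ (x i) (y i)) T) :
    opTrace T = ∑' k, ⟪y k, x k⟫_ℂ := (hasSum_trace _ h1 h3).tsum_eq

theorem opTrace_add {T S : H →L[ℂ] H} (hT : IsNuc T) (hS : IsNuc S) :
    opTrace (T + S) = opTrace T + opTrace S := by
  rw [opTrace, opTrace, opTrace, ← (summable_trace hT).tsum_add (summable_trace hS)]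
  simp

theorem opTrace_smul (z : ℂ) (T : H →L[ℂ] H) : opTrace (z • T) = z * opTrace T := by
  rw [opTrace, opTrace, ← tsum_mul_left]
  simp

theorem opTrace_neg (T : H →L[ℂ] H) : opTrace (-T) = -opTrace T := by
  simpa using opTrace_smul (-1) T

theorem opTrace_zero : opTrace (0 : H →L[ℂ] H) = 0 := by
  simpa using opTrace_smul 0 (0 : H →L[ℂ] H)

theorem opTrace_norm_le {T : H →L[ℂ] H} {c : ℝ} (h : HasNuc T c) : ‖opTrace T‖ ≤ c := by
  obtain ⟨ι, x, y, h1, h2, h3⟩ := h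
  rw [opTrace_eq h1 h3]
  refine le_trans ?_ h2
  refine tsum_of_norm_bounded h1.hasSum fun k => ?_
  rw [mul_comm]
  exact norm_inner_le_norm _ _

end Trace

/-- `Tr(ST) = Tr(TS)`, for a nuclear operator `T` between two Hilbert spaces. -/
theorem opTrace_comp_comm {T : H₁ →L[ℂ] H₂} (hT : IsNuc T) (S : H₂ →L[ℂ] H₁) :
    opTrace (S ∘L T) = opTrace (T ∘L S) := by
  obtain ⟨c, ι, x, y, h1, h2, h3⟩ := hT
  have hs1 : Summable fun i => ‖S (x i)‖ * ‖y i‖ := by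
    refine (h1.mul_left ‖S‖).of_nonneg_of_le (fun i => by positivity) fun i => ?_
    rw [← mul_assoc]
    exact mul_le_mul_of_nonneg_right (S.le_opNorm _) (norm_nonneg _)
  have hs2 : Summable fun i => ‖x i‖ * ‖ContinuousLinearMap.adjoint S (y i)‖ := by
    refine (h1.mul_right ‖S‖).of_nonneg_of_le (fun i => by positivity) fun i => ?_
    rw [mul_assoc, mul_comm ‖y i‖]
    refine mul_le_mul_of_nonneg_left ?_ (norm_nonneg _)
    refine ((ContinuousLinearMap.adjoint S).le_opNorm _).trans_eq ?_
    rw [LinearIsometryEquiv.norm_map]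
  have e1 : HasSum (fun i => rankOne ℂ (S (x i)) (y i)) (S ∘L T) := by
    simpa [InnerProductSpace.comp_rankOne] using h3.mapL (ContinuousLinearMap.compL ℂ H₁ H₂ H₁ S)
  have e2 : HasSum (fun i => rankOne ℂ (x i) (ContinuousLinearMap.adjoint S (y i))) (T ∘L S) := by
    simpa [InnerProductSpace.rankOne_comp] using
      h3.mapL ((ContinuousLinearMap.compL ℂ H₂ H₁ H₂).flip S)
  rw [opTrace_eq hs1 e1, opTrace_eq hs2 e2]
  simp only [ContinuousLinearMap.adjoint_inner_left]

theorem IsNuc.comp_left {T : H₁ →L[ℂ] H₂} (h : IsNuc T) (S : H₂ →L[ℂ] H₃) : IsNuc (S ∘L T) :=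
  let ⟨_, hc⟩ := h
  ⟨_, hc.comp_left S⟩

theorem IsNuc.comp_right {T : H₂ →L[ℂ] H₃} (h : IsNuc T) (S : H₁ →L[ℂ] H₂) : IsNuc (T ∘L S) :=
  let ⟨_, hc⟩ := h
  ⟨_, hc.comp_right S⟩

theorem IsNuc.add {T S : H₁ →L[ℂ] H₂} (hT : IsNuc T) (hS : IsNuc S) : IsNuc (T + S) :=
  let ⟨_, hc⟩ := hT
  let ⟨_, hd⟩ := hS
  ⟨_, hc.add hd⟩

theorem IsNuc.neg {T : H₁ →L[ℂ] H₂} (hT : IsNuc T) : IsNuc (-T) := by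
  simpa using hT.comp_left (-ContinuousLinearMap.id ℂ H₂)

theorem IsNuc.sub {T S : H₁ →L[ℂ] H₂} (hT : IsNuc T) (hS : IsNuc S) : IsNuc (T - S) := by
  rw [sub_eq_add_neg]
  exact hT.add hS.neg

theorem isNuc_zero : IsNuc (0 : H₁ →L[ℂ] H₂) :=
  (hasNuc_of_rank_le (r := 0) (by simp)).isNuc

theorem IsNuc.sum {κ : Type*} (s : Finset κ) {T : κ → H₁ →L[ℂ] H₂} (h : ∀ k ∈ s, IsNuc (T k)) :
    IsNuc (∑ k ∈ s, T k) := by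
  classical
  induction s using Finset.induction_on with
  | empty => simpa using isNuc_zero
  | insert k s hk ih =>
    rw [Finset.sum_insert hk]
    exact (h k (by simp)).add (ih fun j hj => h j (by simp [hj]))

theorem opTrace_sum {κ : Type*} (s : Finset κ) {T : κ → H₁ →L[ℂ] H₁} (h : ∀ k ∈ s, IsNuc (T k)) :
    opTrace (∑ k ∈ s, T k) = ∑ k ∈ s, opTrace (T k) := by
  classical
  induction s using Finset.induction_on with
  | empty => simpa using opTrace_zero
  | insert k s hk ih =>
    rw [Finset.sum_insert hk, Finset.sum_insert hk, opTrace_add (h k (by simp))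
      (IsNuc.sum s fun j hj => h j (by simp [hj])), ih fun j hj => h j (by simp [hj])]

theorem opTrace_sub {T S : H₁ →L[ℂ] H₁} (hT : IsNuc T) (hS : IsNuc S) :
    opTrace (T - S) = opTrace T - opTrace S := by
  rw [sub_eq_add_neg, opTrace_add hT hS.neg, opTrace_neg, sub_eq_add_neg]

end Nuclear

/-! ### Nuclear operators are of trace class -/

section TraceClass

open InnerProductSpace (rankOne)

variable {H : Type*} [NormedAddCommGroup H] [InnerProductSpace ℂ H] [CompleteSpace H]

/-- The diagonal of a nuclear operator in an orthonormal system is bounded in `ℓ¹` by the nuclear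
norm, since this holds for each summand `xₖ ⊗ yₖ*`. -/
theorem HasNuc.sum_norm_inner_le {κ : Type*} {b : κ → H} (hb : Orthonormal ℂ b) (s : Finset κ)
    {T : H →L[ℂ] H} {c : ℝ} (h : HasNuc T c) : ∑ i ∈ s, ‖⟪b i, T (b i)⟫_ℂ‖ ≤ c := by
  obtain ⟨ι, x, y, h1, h2, h3⟩ := h
  have hs : ∀ i, Summable fun k => ‖⟪y k, b i⟫_ℂ‖ * ‖⟪b i, x k⟫_ℂ‖ := fun i =>
    h1.of_nonneg_of_le (fun k => by positivity) fun k => by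
      simpa using sum_norm_inner_mul_le hb {i} (x k) (y k)
  have hle : ∀ i, ‖⟪b i, T (b i)⟫_ℂ‖ ≤ ∑' k, ‖⟪y k, b i⟫_ℂ‖ * ‖⟪b i, x k⟫_ℂ‖ := fun i => by
    have := (h3.mapL (ContinuousLinearMap.apply ℂ H (b i))).mapL (innerSL ℂ (b i))
    have h4 : HasSum (fun k => ⟪y k, b i⟫_ℂ * ⟪b i, x k⟫_ℂ) ⟪b i, T (b i)⟫_ℂ := by
      simpa [inner_smul_right] using this
    rw [← h4.tsum_eq]
    exact tsum_of_norm_bounded (hs i).hasSum fun k => by rw [norm_mul]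
  refine (Finset.sum_le_sum fun i _ => hle i).trans ?_
  rw [← Summable.tsum_finsetSum fun i _ => hs i]
  refine le_trans ?_ h2
  exact (summable_sum fun i _ => hs i).tsum_le_tsum
    (fun k => sum_norm_inner_mul_le hb s (x k) (y k)) h1

/-- `|T|` lies within `ε` of `W T` for a contraction `W`, namely `W = (T (|T| + ε)⁻¹)*`; this
replaces the polar decomposition. -/
theorem exists_contraction_abs (T : H →L[ℂ] H) {ε : ℝ} (hε : 0 < ε) :
    ∃ W : H →L[ℂ] H, ‖W‖ ≤ 1 ∧ ‖CFC.abs T - W * T‖ ≤ ε := by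
  set a := CFC.abs T with ha
  have ha0 : 0 ≤ a := CFC.abs_nonneg T
  have hsa : IsSelfAdjoint a := IsSelfAdjoint.of_nonneg ha0
  have hsp : ∀ x ∈ spectrum ℝ a, 0 ≤ x := fun x hx => spectrum_nonneg_of_nonneg ha0 hx
  have hc : ContinuousOn (fun x : ℝ => (x + ε)⁻¹) (spectrum ℝ a) := by
    refine ContinuousOn.inv₀ (by fun_prop) fun x hx => ?_
    have := hsp x hx
    positivity
  set r := cfc (fun x : ℝ => (x + ε)⁻¹) a with hr
  have hrs : star r = r := (cfc_predicate (fun x : ℝ => (x + ε)⁻¹) a : IsSelfAdjoint r)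
  have hid : cfc (fun x : ℝ => x) a = a := cfc_id' ℝ a
  -- `(T r)* T = r |T|²`, a function of `|T|`; likewise `(T r)* (T r) = r |T|² r`.
  have e1 : star (T * r) * T = cfc (fun x : ℝ => (x + ε)⁻¹ * (x * x)) a := by
    rw [cfc_mul _ _ a hc (by fun_prop), cfc_mul _ _ a (by fun_prop) (by fun_prop), hid, star_mul,
      hrs,
      mul_assoc, ← CFC.abs_mul_abs]
  have hc2 : ContinuousOn (fun x : ℝ => (x + ε)⁻¹ * (x * x)) (spectrum ℝ a) :=
    hc.mul (by fun_prop)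
  have e2 : star (T * r) * (T * r) = cfc (fun x : ℝ => (x + ε)⁻¹ * (x * x) * (x + ε)⁻¹) a := by
    rw [cfc_mul (fun x : ℝ => (x + ε)⁻¹ * (x * x)) _ a hc2 hc, ← e1, mul_assoc]
  refine ⟨star (T * r), ?_, ?_⟩
  · rw [norm_star]
    have h1 : ‖star (T * r) * (T * r)‖ ≤ 1 := by
      rw [e2]
      refine norm_cfc_le zero_le_one fun x hx => ?_
      have h0 := hsp x hx
      rw [Real.norm_of_nonneg (by positivity)]
      have : (x + ε)⁻¹ * (x * x) * (x + ε)⁻¹ = (x / (x + ε)) ^ 2 := by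
        field_simp
      rw [this]
      refine pow_le_one₀ (by positivity) ?_
      rw [div_le_one (by positivity)]
      linarith
    rw [CStarRing.norm_star_mul_self] at h1
    nlinarith [norm_nonneg (T * r)]
  · rw [e1]
    nth_rewrite 1 [← hid]
    rw [← cfc_sub (fun x : ℝ => x) (fun x : ℝ => (x + ε)⁻¹ * (x * x)) a (by fun_prop) hc2]
    refine norm_cfc_le hε.le fun x hx => ?_
    have h0 := hsp x hx
    have : x - (x + ε)⁻¹ * (x * x) = ε * (x / (x + ε)) := by
      field_simp
      ring
    rw [this, Real.norm_of_nonneg (by positivity)]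
    refine mul_le_of_le_one_right hε.le ?_
    rw [div_le_one (by positivity)]
    linarith

theorem IsNuc.isTraceClass {T : H →L[ℂ] H} (h : IsNuc T) : IsTraceClass T := by
  obtain ⟨c, hc⟩ := h
  have hpos : ∀ v : H, 0 ≤ (⟪v, CFC.abs T v⟫_ℂ).re := fun v =>
    ((ContinuousLinearMap.nonneg_iff_isPositive _).1 (CFC.abs_nonneg T)).re_inner_nonneg_right v
  -- The sum of `⟨eᵢ, |T| eᵢ⟩` over a finite set `s` is compared with that of `⟨eᵢ, W T eᵢ⟩`; the
  -- error is at most `δ`, and `W T` has nuclear norm at most `c`.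
  refine summable_of_sum_le (c := c) (fun i => hpos _) fun s => ?_
  have hb := (stdBasis H).orthonormal
  refine le_of_forall_pos_le_add fun δ hδ => ?_
  obtain ⟨W, hW, hWT⟩ := exists_contraction_abs T (ε := δ / (s.card + 1)) (by positivity)
  have hN := (hc.comp_left W).sum_norm_inner_le hb s
  have hc0 : 0 ≤ c := (by
    obtain ⟨ι, x, y, h1, h2, h3⟩ := hc
    exact (tsum_nonneg fun _ => by positivity).trans h2)
  have h1 : ∀ i, (⟪stdBasis H i, CFC.abs T (stdBasis H i)⟫_ℂ).re ≤
      ‖⟪stdBasis H i, (W ∘L T) (stdBasis H i)⟫_ℂ‖ + δ / (s.card + 1) := fun i => by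
    have e : CFC.abs T (stdBasis H i) = (W ∘L T) (stdBasis H i) +
        (CFC.abs T - W * T) (stdBasis H i) := by
      rw [sub_apply]; exact (add_sub_cancel _ _).symm
    rw [e, inner_add_right, Complex.add_re]
    refine add_le_add (Complex.re_le_norm _) ((Complex.re_le_norm _).trans ?_)
    refine (norm_inner_le_norm _ _).trans ?_
    rw [hb.1 i, one_mul]
    refine (ContinuousLinearMap.le_opNorm _ _).trans ?_
    rw [hb.1 i, mul_one]
    exact hWT
  refine (Finset.sum_le_sum fun i _ => h1 i).trans ?_
  rw [Finset.sum_add_distrib, Finset.sum_const, nsmul_eq_mul]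
  refine add_le_add (hN.trans (mul_le_of_le_one_left hc0 hW)) ?_
  rw [mul_div_assoc', div_le_iff₀ (by positivity)]
  nlinarith

end TraceClass

/-! ### Approximation numbers of operators of Schatten class -/

section Schatten

variable {H : Type*} [NormedAddCommGroup H] [InnerProductSpace ℂ H] [CompleteSpace H]

/-- The powers `2⁻ᵏ` that are smaller than `y` add up to at most `2y`. -/
theorem sum_half_pow_indicator_le (K : ℕ) : ∀ y : ℝ, 0 ≤ y →
    ∑ k ∈ Finset.range K, (if (1 / 2 : ℝ) ^ k < y then (1 / 2 : ℝ) ^ k else 0) ≤ 2 * y := by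
  induction K with
  | zero => intro y hy; simpa using hy
  | succ K ih =>
    intro y hy
    rcases lt_or_ge 1 y with h | h
    · refine (Finset.sum_le_sum (g := fun k => (1 / 2 : ℝ) ^ k) fun k _ => ?_).trans ?_
      · split_ifs
        · exact le_rfl
        · positivity
      · rw [geom_sum_eq (by norm_num)]
        have h1 : (0 : ℝ) < (1 / 2) ^ (K + 1) := by positivity
        have h2 : ((1 / 2 : ℝ) ^ (K + 1) - 1) / (1 / 2 - 1) = 2 - 2 * (1 / 2) ^ (K + 1) := by ring
        rw [h2]
        linarith
    · rw [Finset.sum_range_succ', pow_zero, if_neg (not_lt.2 h), add_zero]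
      have := ih (2 * y) (by linarith)
      have e : ∀ k, (if (1 / 2 : ℝ) ^ (k + 1) < y then (1 / 2 : ℝ) ^ (k + 1) else 0) =
          1 / 2 * (if (1 / 2 : ℝ) ^ k < 2 * y then (1 / 2 : ℝ) ^ k else 0) := fun k => by
        have h2 : (1 / 2 : ℝ) ^ (k + 1) < y ↔ (1 / 2 : ℝ) ^ k < 2 * y := by
          rw [pow_succ]; constructor <;> intro h <;> linarith
        by_cases h3 : (1 / 2 : ℝ) ^ k < 2 * y
        · rw [if_pos h3, if_pos (h2.2 h3), pow_succ]; ring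
        · rw [if_neg h3, if_neg (mt h2.1 h3), mul_zero]
      simp only [e]
      rw [← Finset.mul_sum]
      linarith

/-- A continuous cut-off function: `0` on `[0, 2⁻ᵏ⁻¹]` and `1` on `[2⁻ᵏ, ∞)`. -/
def cutoff (k : ℕ) (x : ℝ) : ℝ := max 0 (min 1 (2 ^ (k + 1) * x - 1))

theorem continuous_cutoff (k : ℕ) : Continuous (cutoff k) := by unfold cutoff; fun_prop

theorem cutoff_nonneg (k : ℕ) (x : ℝ) : 0 ≤ cutoff k x := le_max_left _ _

theorem cutoff_le_one (k : ℕ) (x : ℝ) : cutoff k x ≤ 1 := max_le zero_le_one (min_le_left _ _)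

theorem cutoff_eq_one {k : ℕ} {x : ℝ} (h : (1 / 2 : ℝ) ^ k ≤ x) : cutoff k x = 1 := by
  have h1 : (2 : ℝ) ^ k * (1 / 2) ^ k = 1 := by rw [← mul_pow]; norm_num
  have h2 : (0 : ℝ) < 2 ^ k := by positivity
  have : 1 ≤ 2 ^ (k + 1) * x - 1 := by rw [pow_succ]; nlinarith
  rw [cutoff, min_eq_left this, max_eq_right zero_le_one]

theorem cutoff_eq_zero {k : ℕ} {x : ℝ} (h : x ≤ (1 / 2 : ℝ) ^ (k + 1)) : cutoff k x = 0 := by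
  have h1 : (2 : ℝ) ^ (k + 1) * (1 / 2) ^ (k + 1) = 1 := by rw [← mul_pow]; norm_num
  have h2 : (0 : ℝ) < 2 ^ (k + 1) := by positivity
  have : 2 ^ (k + 1) * x - 1 ≤ 0 := by nlinarith
  rw [cutoff, max_eq_left ((min_le_right _ _).trans this)]

theorem cutoff_succ_mul (k : ℕ) (x : ℝ) : cutoff (k + 1) x * cutoff k x = cutoff k x := by
  rcases le_or_gt x ((1 / 2 : ℝ) ^ (k + 1)) with h | h
  · rw [cutoff_eq_zero h, mul_zero]
  · rw [cutoff_eq_one h.le, one_mul]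

/-- The cutoffs, squared and weighted by `2⁻ⁿᵏ`, are dominated by the function `xᵖ`: the cutoff of
index `k + 1` vanishes unless `2⁻ᵏ < 4x`, and then `2⁻ⁿᵏ ≤ 2⁻ᵖᵏ ≤ (4x)ᵖ⁻¹ 2⁻ᵏ`. -/
theorem sum_cutoff_le {p : ℝ} (hp : 1 ≤ p) {n : ℕ} (hn : p ≤ n) (K : ℕ) {x : ℝ} (hx : 0 ≤ x) :
    ∑ k ∈ Finset.range K, (1 / 2 : ℝ) ^ (n * k) * (cutoff (k + 1) x * cutoff (k + 1) x) ≤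
      2 * 4 ^ p * x ^ p := by
  have h1 : ∀ k, (1 / 2 : ℝ) ^ (n * k) * (cutoff (k + 1) x * cutoff (k + 1) x) ≤
      (4 * x) ^ (p - 1) * (if (1 / 2 : ℝ) ^ k < 4 * x then (1 / 2 : ℝ) ^ k else 0) := fun k => by
    split_ifs with h
    · have hb : (0 : ℝ) < (1 / 2) ^ k := by positivity
      have hb1 : (1 / 2 : ℝ) ^ k ≤ 1 := pow_le_one₀ (by norm_num) (by norm_num)
      have e1 : (1 / 2 : ℝ) ^ (n * k) ≤ ((1 / 2 : ℝ) ^ k) ^ p := by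
        rw [mul_comm, pow_mul, ← Real.rpow_natCast _ n]
        exact Real.rpow_le_rpow_of_exponent_ge hb hb1 hn
      have e2 : ((1 / 2 : ℝ) ^ k) ^ p ≤ (4 * x) ^ (p - 1) * (1 / 2) ^ k := by
        have : ((1 / 2 : ℝ) ^ k) ^ p = ((1 / 2 : ℝ) ^ k) ^ (p - 1) * (1 / 2) ^ k := by
          rw [← Real.rpow_add_one hb.ne', sub_add_cancel]
        rw [this]
        exact mul_le_mul_of_nonneg_right
          (Real.rpow_le_rpow hb.le h.le (by linarith)) hb.le
      refine le_trans ?_ (e1.trans e2)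
      refine mul_le_of_le_one_right (by positivity) ?_
      exact mul_le_one₀ (cutoff_le_one _ _) (cutoff_nonneg _ _) (cutoff_le_one _ _)
    · have : x ≤ (1 / 2 : ℝ) ^ (k + 1 + 1) := by
        rw [pow_succ, pow_succ]; linarith
      rw [cutoff_eq_zero this]
      simp
  refine (Finset.sum_le_sum fun k _ => h1 k).trans ?_
  rw [← Finset.mul_sum]
  refine (mul_le_mul_of_nonneg_left (sum_half_pow_indicator_le K (4 * x) (by linarith))
    (by positivity)).trans_eq ?_
  rcases hx.eq_or_lt with rfl | hx
  · have : p ≠ 0 := by linarith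
    simp [Real.zero_rpow this]
  · have : (4 * x) ^ p = (4 * x) ^ (p - 1) * (4 * x) := by
      rw [← Real.rpow_add_one (by positivity), sub_add_cancel]
    rw [mul_assoc 2, ← Real.mul_rpow (by norm_num) hx.le, this]
    ring

/-- If `S` fixes the range of `G`, then the rank of `G` is at most the squared Hilbert–Schmidt norm
of the selfadjoint operator `S`. -/
theorem rank_le_of_fix {κ : Type*} (b : HilbertBasis κ ℂ H) {S G : H →L[ℂ] H}
    (hS : IsSelfAdjoint S) (hSG : S * G = G) (hsum : Summable fun i => ‖S (b i)‖ ^ 2) :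
    LinearMap.rank (G : H →ₗ[ℂ] H) ≤ ⌊∑' i, ‖S (b i)‖ ^ 2⌋₊ := by
  refine rank_le fun s hs => Nat.le_floor ?_
  let V : Submodule ℂ H :=
      Submodule.span ℂ (Set.range fun i : s => ((i : LinearMap.range (G : H →ₗ[ℂ] H)) : H))
  have hli : LinearIndependent ℂ fun i : s => ((i : LinearMap.range (G : H →ₗ[ℂ] H)) : H) :=
    hs.map' (Submodule.subtype _) (Submodule.ker_subtype _)
  have hV : Module.finrank ℂ V = s.card := by
    rw [finrank_span_eq_card hli, Fintype.card_coe]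
  have hfin : FiniteDimensional ℂ V := FiniteDimensional.span_of_finite ℂ (Set.finite_range _)
  have hfix : ∀ v ∈ V, S v = v := fun v hv => by
    have hle : V ≤ LinearMap.range (G : H →ₗ[ℂ] H) := by
      refine Submodule.span_le.2 ?_
      rintro _ ⟨i, rfl⟩
      exact i.1.2
    obtain ⟨w, rfl⟩ := hle hv
    exact congrArg (fun X : H →L[ℂ] H => X w) hSG
  let f := stdOrthonormalBasis ℂ V
  have hfo : Orthonormal ℂ fun j => (f j : H) := f.orthonormal.comp_linearIsometry V.subtypeₗᵢ
  -- A unit vector `f` fixed by `S` contributes `∑ |⟨f, S bᵢ⟩|² = ‖S f‖² = 1`, and by Bessel the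
  -- contributions of orthonormal vectors add up to at most `∑ ‖S bᵢ‖²`.
  have h1 : ∀ j, HasSum (fun i => ‖⟪(f j : H), S (b i)⟫_ℂ‖ ^ 2) 1 := fun j => by
    have := Complex.hasSum_re (b.hasSum_inner_mul_inner (f j : H) (f j : H))
    have e : (⟪(f j : H), (f j : H)⟫_ℂ).re = 1 := by
      have := hfo.1 j
      rw [inner_self_eq_norm_sq_to_K, this]; simp
    rw [e] at this
    convert this using 2 with i
    have e2 : ⟪(f j : H), S (b i)⟫_ℂ = ⟪(f j : H), b i⟫_ℂ := by
      rw [← ContinuousLinearMap.adjoint_inner_left, ← ContinuousLinearMap.star_eq_adjoint,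
        hS.star_eq,
        hfix _ (f j).2]
    rw [e2, ← inner_conj_symm (b i), Complex.mul_conj, Complex.normSq_eq_norm_sq, Complex.ofReal_re]
  have h2 := hasSum_sum (s := Finset.univ) fun j (_ : j ∈ Finset.univ) => h1 j
  rw [Finset.sum_const, Finset.card_univ, Fintype.card_fin, nsmul_eq_mul, mul_one] at h2
  rw [← hV]
  exact hasSum_le (fun i => hfo.sum_inner_products_le (S (b i))) h2 hsum.hasSum

/-- An operator of Schatten class `p` is approximated up to `2⁻ᵏ` by operators of rank at most `Nₖ`,
with `∑ Nₖ 2⁻ⁿᵏ < ∞` for each integer `n ≥ p`. -/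
theorem IsSchatten.exists_rank_le {p : ℝ} (hp : 1 ≤ p) {P : H →L[ℂ] H} (h : IsSchatten p P) {n : ℕ}
    (hn : p ≤ n) : ∃ N : ℕ → ℕ, (Summable fun k => (N k : ℝ) * (1 / 2) ^ (n * k)) ∧
      ∀ k, ∃ X : H →L[ℂ] H, LinearMap.rank (X : H →ₗ[ℂ] H) ≤ N k ∧ ‖P - X‖ ≤ (1 / 2) ^ k := by
  set a := CFC.abs P with ha
  have ha0 : 0 ≤ a := CFC.abs_nonneg P
  have hsa : IsSelfAdjoint a := IsSelfAdjoint.of_nonneg ha0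
  have hsp : ∀ x ∈ spectrum ℝ a, 0 ≤ x := fun x hx => spectrum_nonneg_of_nonneg ha0 hx
  have hid : cfc (fun x : ℝ => x) a = a := cfc_id' ℝ a
  have hcc : ∀ k, ContinuousOn (cutoff k) (spectrum ℝ a) :=
      fun k => (continuous_cutoff k).continuousOn
  set b := stdBasis H
  -- The approximation is `P · cutoff k (|P|)`. Its rank is bounded by the squared Hilbert–Schmidt
  -- norm of the next cutoff `S k`, which fixes the range of `cutoff k (|P|)`.
  set S : ℕ → H →L[ℂ] H := fun k => cfc (cutoff (k + 1)) a with hS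
  have hSs : ∀ k, IsSelfAdjoint (S k) := fun k => cfc_predicate _ a
  set w : _ → ℝ := fun i => (⟪b i, (a ^ p) (b i)⟫_ℂ).re with hw
  have hws : Summable w := h
  have hC : (0 : ℝ) ≤ 2 * 4 ^ p := by positivity
  -- Diagonal entries of the operator inequality obtained from `sum_cutoff_le` by functional
  -- calculus.
  have key : ∀ K i, ∑ k ∈ Finset.range K, (1 / 2 : ℝ) ^ (n * k) * ‖S k (b i)‖ ^ 2 ≤
      2 * 4 ^ p * w i := by
    intro K i
    have hcp : ContinuousOn (fun x : ℝ => x ^ p) (spectrum ℝ a) :=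
      (Real.continuous_rpow_const (by linarith)).continuousOn
    have hmono : cfc (∑ k ∈ Finset.range K, fun x : ℝ =>
        (1 / 2 : ℝ) ^ (n * k) * (cutoff (k + 1) x * cutoff (k + 1) x)) a ≤
          cfc (fun x : ℝ => 2 * 4 ^ p * x ^ p) a := by
      refine cfc_mono (fun x hx => ?_) ?_ (continuousOn_const.mul hcp)
      · rw [Finset.sum_apply]
        exact sum_cutoff_le hp hn K (hsp x hx)
      · rw [Finset.sum_fn]
        exact continuousOn_finsetSum _ fun k _ =>
          continuousOn_const.mul ((hcc _).mul (hcc _))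
    have hf : ∀ k, ContinuousOn (fun x : ℝ =>
        (1 / 2 : ℝ) ^ (n * k) * (cutoff (k + 1) x * cutoff (k + 1) x)) (spectrum ℝ a) :=
      fun k => continuousOn_const.mul ((hcc _).mul (hcc _))
    rw [cfc_sum (fun k (x : ℝ) => (1 / 2 : ℝ) ^ (n * k) * (cutoff (k + 1) x * cutoff (k + 1) x))
        a _ fun k _ => hf k,
      cfc_const_mul _ _ a hcp, ← CFC.rpow_eq_cfc_real ha0] at hmono
    have hpos := ((ContinuousLinearMap.le_def _ _).1 hmono).re_inner_nonneg_right (b i)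
    rw [sub_apply, inner_sub_right, map_sub, sub_nonneg, sum_apply, inner_sum, map_sum] at hpos
    have e2 : RCLike.re ⟪b i, ((2 * 4 ^ p : ℝ) • a ^ p) (b i)⟫_ℂ = 2 * 4 ^ p * w i := by
      rw [_root_.smul_apply, ← Complex.coe_smul, inner_smul_right]
      exact Complex.re_ofReal_mul _ _
    rw [e2] at hpos
    refine le_trans (Finset.sum_le_sum fun k _ => le_of_eq ?_) hpos
    rw [cfc_const_mul ((1 / 2 : ℝ) ^ (n * k)) (fun x => cutoff (k + 1) x * cutoff (k + 1) x) a
        ((hcc _).mul (hcc _)), cfc_mul (cutoff (k + 1)) (cutoff (k + 1)) a (hcc _) (hcc _),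
      _root_.smul_apply, ← Complex.coe_smul, inner_smul_right]
    have e3 : ⟪b i, (S k * S k) (b i)⟫_ℂ = ((‖S k (b i)‖ ^ 2 : ℝ) : ℂ) := by
      rw [mul_apply_eq_comp, ← ContinuousLinearMap.adjoint_inner_left,
        ← ContinuousLinearMap.star_eq_adjoint, (hSs k).star_eq, inner_self_eq_norm_sq_to_K]
      simp
    have e4 : ⟪b i, (cfc (cutoff (k + 1)) a * cfc (cutoff (k + 1)) a) (b i)⟫_ℂ =
      ((‖S k (b i)‖ ^ 2 : ℝ) : ℂ) := e3
    rw [e4, ← Complex.ofReal_mul]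
    exact (Complex.ofReal_re _).symm
  have hu : ∀ k, Summable fun i => ‖S k (b i)‖ ^ 2 := fun k => by
    refine ((hws.mul_left (2 * 4 ^ p)).mul_left (2 ^ (n * k))).of_nonneg_of_le
      (fun i => by positivity) fun i => ?_
    have h1 := (Finset.single_le_sum (f := fun k => (1 / 2 : ℝ) ^ (n * k) * ‖S k (b i)‖ ^ 2)
      (fun k _ => by positivity) (Finset.self_mem_range_succ k)).trans (key (k + 1) i)
    have h2 : (2 : ℝ) ^ (n * k) * (1 / 2) ^ (n * k) = 1 := by rw [← mul_pow]; norm_num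
    calc ‖S k (b i)‖ ^ 2 = 2 ^ (n * k) * ((1 / 2 : ℝ) ^ (n * k) * ‖S k (b i)‖ ^ 2) := by
          rw [← mul_assoc, h2, one_mul]
      _ ≤ _ := mul_le_mul_of_nonneg_left h1 (by positivity)
  refine ⟨fun k => ⌊∑' i, ‖S k (b i)‖ ^ 2⌋₊, ?_, fun k => ⟨P * cfc (cutoff k) a, ?_, ?_⟩⟩
  · refine summable_of_sum_range_le (c := 2 * 4 ^ p * ∑' i, w i)
      (fun k => by positivity) fun K => ?_
    have h1 : ∀ k, ((⌊∑' i, ‖S k (b i)‖ ^ 2⌋₊ : ℕ) : ℝ) * (1 / 2) ^ (n * k) ≤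
        ∑' i, (1 / 2 : ℝ) ^ (n * k) * ‖S k (b i)‖ ^ 2 := fun k => by
      rw [tsum_mul_left, mul_comm]
      exact mul_le_mul_of_nonneg_left (Nat.floor_le (tsum_nonneg fun _ => by positivity))
        (by positivity)
    refine (Finset.sum_le_sum fun k _ => h1 k).trans ?_
    rw [← Summable.tsum_finsetSum fun k _ => (hu k).mul_left _, ← tsum_mul_left]
    exact (summable_sum fun k _ => (hu k).mul_left _).tsum_le_tsum (key K) (hws.mul_left _)
  · refine (LinearMap.rank_comp_le_right _ _).trans (rank_le_of_fix b (hSs k) ?_ (hu k))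
    rw [hS, ← cfc_mul (cutoff (k + 1)) (cutoff k) a (hcc _) (hcc _)]
    congr 1
    funext x
    exact cutoff_succ_mul k x
  · have e1 : P - P * cfc (cutoff k) a = P * cfc (fun x => 1 - cutoff k x) a := by
      rw [cfc_sub (fun _ => (1 : ℝ)) (cutoff k) a continuousOn_const (hcc _), cfc_const_one ℝ a,
        mul_sub, mul_one]
    set Z := cfc (fun x => 1 - cutoff k x) a
    have hc1 : ContinuousOn (fun x => 1 - cutoff k x) (spectrum ℝ a) :=
        continuousOn_const.sub (hcc _)
    -- `|P| = a`, so `P` may be replaced by `a` when computing norms; the norm of `x (1 - cutoff k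
    -- x)` is at most `2⁻ᵏ`.
    have e2 : ‖P * Z‖ = ‖a * Z‖ := by
      have h1 : star (P * Z) * (P * Z) = star (a * Z) * (a * Z) := by
        rw [star_mul, star_mul, hsa.star_eq, mul_assoc, ← mul_assoc (star P), ← CFC.abs_mul_abs,
          mul_assoc, mul_assoc]
      have h2 := CStarRing.norm_star_mul_self (x := P * Z)
      rw [h1, CStarRing.norm_star_mul_self] at h2
      exact ((mul_self_inj (norm_nonneg _) (norm_nonneg _)).1 h2).symm
    have e3 : a * Z = cfc (fun x => x * (1 - cutoff k x)) a := by
      rw [cfc_mul (fun x : ℝ => x) (fun x => 1 - cutoff k x) a (by fun_prop) hc1, hid]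
    rw [e1, e2, e3]
    refine norm_cfc_le (by positivity) fun x hx => ?_
    have h0 := hsp x hx
    rw [Real.norm_of_nonneg (mul_nonneg h0 (sub_nonneg.2 (cutoff_le_one _ _)))]
    rcases le_or_gt ((1 / 2 : ℝ) ^ k) x with h | h
    · rw [cutoff_eq_one h, sub_self, mul_zero]
      positivity
    · exact (mul_le_of_le_one_right h0 (sub_le_self _ (cutoff_nonneg _ _))).trans h.le

end Schatten

/-! ### Approximation by operators of finite rank -/

section Approximable

variable {H₁ H₂ H₃ : Type*}
  [NormedAddCommGroup H₁] [InnerProductSpace ℂ H₁] [CompleteSpace H₁]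
  [NormedAddCommGroup H₂] [InnerProductSpace ℂ H₂] [CompleteSpace H₂]
  [NormedAddCommGroup H₃] [InnerProductSpace ℂ H₃] [CompleteSpace H₃]

/-- For each `k`, the operator `T` lies at distance at most `c 2⁻ʳᵏ` of the operators of rank at
most `N k`; moreover `‖T‖ ≤ c`. -/
structure Approximable (r : ℕ) (N : ℕ → ℕ) (c : ℝ) (T : H₁ →L[ℂ] H₂) : Prop where
  norm_le : ‖T‖ ≤ c
  exists_rank_le : ∀ k, ∃ X : H₁ →L[ℂ] H₂, LinearMap.rank (X : H₁ →ₗ[ℂ] H₂) ≤ N k ∧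
    ‖T - X‖ ≤ c * (1 / 2) ^ (r * k)

/-- The rank bounds `N` are summable at exponent `n`. -/
def RankWeight (n : ℕ) (N : ℕ → ℕ) : Prop := Summable fun k => (N k : ℝ) * (1 / 2) ^ (n * k)

theorem RankWeight.add {n : ℕ} {N M : ℕ → ℕ} (hN : RankWeight n N) (hM : RankWeight n M) :
    RankWeight n (N + M) := by
  refine (Summable.add hN hM).congr fun k => ?_
  rw [Pi.add_apply, Nat.cast_add, add_mul]

theorem rankWeight_const {n : ℕ} (hn : 1 ≤ n) (r : ℕ) : RankWeight n fun _ => r := by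
  refine Summable.mul_left _ ?_
  refine (summable_geometric_of_lt_one (r := (1 / 2 : ℝ) ^ n) (by positivity) ?_).congr fun k => ?_
  · exact pow_lt_one₀ (by norm_num) (by norm_num) (by omega)
  · rw [pow_mul]

theorem rankWeight_zero (n : ℕ) : RankWeight n 0 := by
  refine summable_zero.congr fun k => ?_
  simp

theorem Approximable.nonneg {r : ℕ} {N : ℕ → ℕ} {c : ℝ} {T : H₁ →L[ℂ] H₂}
    (h : Approximable r N c T) : 0 ≤ c := (norm_nonneg T).trans h.norm_le

theorem Approximable.anti {r s : ℕ} {N : ℕ → ℕ} {c : ℝ} {T : H₁ →L[ℂ] H₂}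
    (h : Approximable r N c T) (hs : s ≤ r) : Approximable s N c T :=
  ⟨h.norm_le, fun k => let ⟨X, h1, h2⟩ := h.exists_rank_le k
    ⟨X, h1, h2.trans (mul_le_mul_of_nonneg_left (pow_le_pow_of_le_one (by norm_num) (by norm_num)
      (Nat.mul_le_mul_right k hs)) h.nonneg)⟩⟩

theorem Approximable.mono {r : ℕ} {N : ℕ → ℕ} {c d : ℝ} {T : H₁ →L[ℂ] H₂}
    (h : Approximable r N c T) (hd : c ≤ d) : Approximable r N d T :=
  ⟨h.norm_le.trans hd, fun k => let ⟨X, h1, h2⟩ := h.exists_rank_le k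
    ⟨X, h1, h2.trans (mul_le_mul_of_nonneg_right hd (by positivity))⟩⟩

theorem approximable_zero (T : H₁ →L[ℂ] H₂) : Approximable 0 0 ‖T‖ T :=
  ⟨le_rfl, fun k => ⟨0, by simp, by simp⟩⟩

theorem approximable_of_rank_le {T : H₁ →L[ℂ] H₂} {m : ℕ}
    (h : LinearMap.rank (T : H₁ →ₗ[ℂ] H₂) ≤ m) (r : ℕ) : Approximable r (fun _ => m) ‖T‖ T :=
  ⟨le_rfl, fun k => ⟨T, h, by simp⟩⟩

theorem Approximable.add {r : ℕ} {N M : ℕ → ℕ} {c d : ℝ} {T S : H₁ →L[ℂ] H₂}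
    (hT : Approximable r N c T) (hS : Approximable r M d S) :
    Approximable r (N + M) (c + d) (T + S) := by
  refine ⟨(norm_add_le _ _).trans (add_le_add hT.norm_le hS.norm_le), fun k => ?_⟩
  obtain ⟨X, h1, h2⟩ := hT.exists_rank_le k
  obtain ⟨Y, h3, h4⟩ := hS.exists_rank_le k
  refine ⟨X + Y, ?_, ?_⟩
  · rw [Pi.add_apply, Nat.cast_add]
    exact (LinearMap.rank_add_le _ _).trans (add_le_add h1 h3)
  · rw [add_sub_add_comm, add_mul]
    exact (norm_add_le _ _).trans (add_le_add h2 h4)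

/-- Approximations `X` of `T` and `Y` of `S` give the approximation `X S + (T - X) Y` of `T S`, with
error `(T - X) (S - Y)`. -/
theorem Approximable.exists_comp {r s : ℕ} {N M : ℕ → ℕ} {c d : ℝ} {T : H₂ →L[ℂ] H₃}
    {S : H₁ →L[ℂ] H₂} (hT : Approximable r N c T) (hS : Approximable s M d S) (k : ℕ) :
    ∃ (X : H₂ →L[ℂ] H₃) (Y : H₁ →L[ℂ] H₂),
      LinearMap.rank (X : H₂ →ₗ[ℂ] H₃) ≤ N k ∧ LinearMap.rank (Y : H₁ →ₗ[ℂ] H₂) ≤ M k ∧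
      ‖T - X‖ * ‖S - Y‖ ≤ c * d * (1 / 2) ^ ((r + s) * k) := by
  obtain ⟨X, h1, h2⟩ := hT.exists_rank_le k
  obtain ⟨Y, h3, h4⟩ := hS.exists_rank_le k
  refine ⟨X, Y, h1, h3, (mul_le_mul h2 h4 (norm_nonneg _) ((norm_nonneg _).trans h2)).trans
    (le_of_eq ?_)⟩
  rw [add_mul, pow_add]
  ring

theorem rank_comp_add_comp_le {N M : ℕ} {X T : H₂ →L[ℂ] H₃} {S Y : H₁ →L[ℂ] H₂}
    (hX : LinearMap.rank (X : H₂ →ₗ[ℂ] H₃) ≤ N) (hY : LinearMap.rank (Y : H₁ →ₗ[ℂ] H₂) ≤ M) :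
    LinearMap.rank (((X ∘L S + T ∘L Y : H₁ →L[ℂ] H₃)) : H₁ →ₗ[ℂ] H₃) ≤
      ((N + M : ℕ) : Cardinal) := by
  rw [Nat.cast_add]
  refine (LinearMap.rank_add_le _ _).trans (add_le_add ?_ ?_)
  · exact (LinearMap.rank_comp_le_left _ _).trans hX
  · have h := LinearMap.lift_rank_comp_le_right (Y : H₁ →ₗ[ℂ] H₂) (T : H₂ →ₗ[ℂ] H₃)
    exact Cardinal.lift_le_nat_iff.1 (h.trans (Cardinal.lift_le_nat_iff.2 hY))

theorem Approximable.comp {r s : ℕ} {N M : ℕ → ℕ} {c d : ℝ} {T : H₂ →L[ℂ] H₃} {S : H₁ →L[ℂ] H₂}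
    (hT : Approximable r N c T) (hS : Approximable s M d S) :
    Approximable (r + s) (N + M) (c * d) (T ∘L S) := by
  refine ⟨(T.opNorm_comp_le S).trans
    (mul_le_mul hT.norm_le hS.norm_le (norm_nonneg _) hT.nonneg), fun k => ?_⟩
  obtain ⟨X, Y, h1, h2, h3⟩ := hT.exists_comp hS k
  refine ⟨X ∘L S + (T - X) ∘L Y, rank_comp_add_comp_le h1 h2, ?_⟩
  have : T ∘L S - (X ∘L S + (T - X) ∘L Y) = (T - X) ∘L (S - Y) := by
    ext x; simp; abel
  rw [this]
  exact (ContinuousLinearMap.opNorm_comp_le _ _).trans h3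

/-- The error of approximations of rank `≤ N k` within `c 2⁻ⁿᵏ` is small in nuclear norm, since it
is the sum of the successive differences. -/
theorem hasNuc_sub {n : ℕ} (hn : 1 ≤ n) {N : ℕ → ℕ} (hN : RankWeight n N) {c : ℝ} {T : H₁ →L[ℂ] H₂}
    {X : ℕ → H₁ →L[ℂ] H₂} (hX : ∀ k, LinearMap.rank (X k : H₁ →ₗ[ℂ] H₂) ≤ N k)
    (hc : ∀ k, ‖T - X k‖ ≤ c * (1 / 2) ^ (n * k)) (k : ℕ) :
    HasNuc (T - X k) (∑' j, 2 * c * ((N (j + k) : ℝ) * (1 / 2) ^ (n * (j + k)) +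
      2 ^ n * ((N (j + k + 1) : ℝ) * (1 / 2) ^ (n * (j + k + 1))))) := by
  have h0 : 0 ≤ c := by simpa using (norm_nonneg _).trans (hc 0)
  -- The difference of successive approximations has rank at most `N j + N (j + 1)` and norm at most
  -- `2 c 2⁻ⁿʲ`.
  have hd : ∀ j, HasNuc (X (j + 1) - X j) (2 * c * ((N j : ℝ) * (1 / 2) ^ (n * j) +
      2 ^ n * ((N (j + 1) : ℝ) * (1 / 2) ^ (n * (j + 1))))) := fun j => by
    have h1 : LinearMap.rank ((X (j + 1) - X j : H₁ →L[ℂ] H₂) : H₁ →ₗ[ℂ] H₂) ≤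
        ((N j + N (j + 1) : ℕ) : Cardinal) := by
      have e : ((X (j + 1) - X j : H₁ →L[ℂ] H₂) : H₁ →ₗ[ℂ] H₂) =
        (X (j + 1) : H₁ →ₗ[ℂ] H₂) + (-1 : ℂ) • (X j : H₁ →ₗ[ℂ] H₂) := by
        ext x; simp [sub_eq_add_neg]
      rw [e, add_comm (N j), Nat.cast_add]
      refine (LinearMap.rank_add_le _ _).trans (add_le_add (hX _) ((le_trans ?_ (hX j))))
      have := LinearMap.rank_comp_le_left ((-1 : ℂ) • LinearMap.id) (X j : H₁ →ₗ[ℂ] H₂)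
      refine le_trans (le_of_eq ?_) this
      congr 1
      ext x; simp
    refine (hasNuc_of_rank_le h1).mono ?_
    have h2 : ‖X (j + 1) - X j‖ ≤ 2 * c * (1 / 2) ^ (n * j) := by
      have e : X (j + 1) - X j = (T - X j) - (T - X (j + 1)) := by abel
      rw [e]
      refine (norm_sub_le _ _).trans ((add_le_add (hc j) (hc (j + 1))).trans ?_)
      have : c * (1 / 2) ^ (n * (j + 1)) ≤ c * (1 / 2 : ℝ) ^ (n * j) :=
        mul_le_mul_of_nonneg_left (pow_le_pow_of_le_one (by norm_num) (by norm_num)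
          (Nat.mul_le_mul_left n (Nat.le_succ j))) h0
      linarith
    refine (mul_le_mul_of_nonneg_left h2 (by positivity)).trans (le_of_eq ?_)
    have e : (2 : ℝ) ^ n * (1 / 2) ^ (n * (j + 1)) = (1 / 2) ^ (n * j) := by
      rw [mul_add, mul_one, pow_add, mul_comm, mul_assoc, ← mul_pow]; norm_num
    rw [mul_left_comm (2 ^ n : ℝ), e]
    push_cast
    ring
  have hs : Summable fun j => 2 * c * ((N j : ℝ) * (1 / 2) ^ (n * j) +
      2 ^ n * ((N (j + 1) : ℝ) * (1 / 2) ^ (n * (j + 1)))) :=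
    (Summable.add hN (((summable_nat_add_iff 1).2 hN).mul_left _)).mul_left _
  have hs' := (summable_nat_add_iff k).2 hs
  have ht : Filter.Tendsto (fun j => X (j + k)) Filter.atTop (nhds T) := by
    rw [tendsto_iff_norm_sub_tendsto_zero]
    have hg : Filter.Tendsto (fun j => c * ((1 / 2 : ℝ) ^ n) ^ (j + k)) Filter.atTop (nhds 0) := by
      have := ((tendsto_pow_atTop_nhds_zero_of_lt_one (r := (1 / 2 : ℝ) ^ n) (by positivity)
        (pow_lt_one₀ (by norm_num) (by norm_num) (by omega))).comp
        (Filter.tendsto_add_atTop_nat k)).const_mul c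
      simpa using this
    refine squeeze_zero (fun _ => norm_nonneg _) (fun j => ?_) hg
    rw [norm_sub_rev, ← pow_mul]
    exact hc _
  have hnorm : Summable fun j => ‖X (j + k + 1) - X (j + k)‖ := by
    have h2 : ∀ j, ‖X (j + 1) - X j‖ ≤ 2 * c * ((1 / 2) ^ n) ^ j := fun j => by
      have e : X (j + 1) - X j = (T - X j) - (T - X (j + 1)) := by abel
      rw [e, ← pow_mul]
      refine (norm_sub_le _ _).trans ((add_le_add (hc j) (hc (j + 1))).trans ?_)
      have : c * (1 / 2) ^ (n * (j + 1)) ≤ c * (1 / 2 : ℝ) ^ (n * j) :=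
        mul_le_mul_of_nonneg_left (pow_le_pow_of_le_one (by norm_num) (by norm_num)
          (Nat.mul_le_mul_left n (Nat.le_succ j))) h0
      linarith
    refine Summable.of_nonneg_of_le (fun _ => norm_nonneg _) (fun j => h2 (j + k)) ?_
    exact ((summable_nat_add_iff k).2 (summable_geometric_of_lt_one (r := (1 / 2 : ℝ) ^ n)
      (by positivity) (pow_lt_one₀ (by norm_num) (by norm_num) (by omega)))).mul_left _
  have hsum : HasSum (fun j => X (j + k + 1) - X (j + k)) (T - X k) := by
    have h1 : Summable fun j => X (j + k + 1) - X (j + k) := hnorm.of_norm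
    refine (h1.hasSum_iff_tendsto_nat).2 ?_
    have e : ∀ m, ∑ j ∈ Finset.range m, (X (j + k + 1) - X (j + k)) = X (m + k) - X k := fun m => by
      have := Finset.sum_range_sub (fun j => X (j + k)) m
      rw [zero_add] at this
      rw [← this]
      exact Finset.sum_congr rfl fun j _ => by rw [add_right_comm]
    simp only [e]
    exact ht.sub_const _
  exact HasNuc.hasSum (fun j => hd (j + k)) hs' hsum

/-- The bound of `hasNuc_sub` is the tail of a convergent series. -/
theorem tendsto_hasNuc_sub (n : ℕ) (N : ℕ → ℕ) (c : ℝ) :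
    Filter.Tendsto (fun k => ∑' j, 2 * c * ((N (j + k) : ℝ) * (1 / 2) ^ (n * (j + k)) +
      2 ^ n * ((N (j + k + 1) : ℝ) * (1 / 2) ^ (n * (j + k + 1))))) Filter.atTop (nhds 0) :=
  tendsto_sum_nat_add fun j => 2 * c * ((N j : ℝ) * (1 / 2) ^ (n * j) +
      2 ^ n * ((N (j + 1) : ℝ) * (1 / 2) ^ (n * (j + 1))))

/-- The constant by which the nuclear norm is controlled in terms of rank bounds. -/
def nucConst (n : ℕ) (N : ℕ → ℕ) : ℝ := 2 * N 0 + ∑' j, 2 * ((N j : ℝ) * (1 / 2) ^ (n * j) +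
      2 ^ n * ((N (j + 1) : ℝ) * (1 / 2) ^ (n * (j + 1))))

/-- In the nuclear norm estimate for `X₀ + (T - X₀)`, the constant depends on `T` only through `c`.
-/
theorem Approximable.hasNuc {n : ℕ} (hn : 1 ≤ n) {N : ℕ → ℕ} (hN : RankWeight n N) {c : ℝ}
    {T : H₁ →L[ℂ] H₂} (h : Approximable n N c T) : HasNuc T (c * nucConst n N) := by
  choose X h1 h2 using h.exists_rank_le
  have h3 := hasNuc_sub hn hN h1 h2 0
  have h4 := (hasNuc_of_rank_le (h1 0)).add h3
  rw [add_sub_cancel] at h4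
  refine h4.mono ?_
  have h5 : ‖X 0‖ ≤ 2 * c := by
    have := norm_sub_le T (T - X 0)
    rw [sub_sub_cancel] at this
    have h6 := h2 0
    simp only [mul_zero, pow_zero, mul_one] at h6
    linarith [h.norm_le]
  rw [nucConst, mul_add, ← tsum_mul_left]
  refine add_le_add ?_ (le_of_eq (tsum_congr fun j => ?_))
  · calc (N 0 : ℝ) * ‖X 0‖ ≤ N 0 * (2 * c) := mul_le_mul_of_nonneg_left h5 (by positivity)
      _ = _ := by ring
  · simp only [add_zero]
    ring

/-- The operators whose approximation numbers decay like those of a product of `r` operators of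
Schatten class `n`; it contains the finite-rank operators if `n ≥ 1`, and consists of nuclear
operators if `r ≥ n ≥ 1`. -/
def schattenPow (n r : ℕ) (H₁ H₂ : Type*) [NormedAddCommGroup H₁] [InnerProductSpace ℂ H₁]
    [CompleteSpace H₁] [NormedAddCommGroup H₂] [InnerProductSpace ℂ H₂] [CompleteSpace H₂] :
    Submodule ℂ (H₁ →L[ℂ] H₂) where
  carrier := {T | ∃ N c, RankWeight n N ∧ Approximable r N c T}
  add_mem' := by
    rintro T S ⟨N, c, hN, hT⟩ ⟨M, d, hM, hS⟩
    exact ⟨_, _, hN.add hM, hT.add hS⟩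
  zero_mem' := ⟨0, ‖(0 : H₁ →L[ℂ] H₂)‖, rankWeight_zero n,
    approximable_of_rank_le (m := 0) (by simp) r⟩
  smul_mem' := by
    rintro z T ⟨N, c, hN, hT⟩
    have := (approximable_zero (z • ContinuousLinearMap.id ℂ H₂)).comp hT
    rw [zero_add, zero_add] at this
    have e : (z • ContinuousLinearMap.id ℂ H₂) ∘L T = z • T := by ext x; simp
    rw [e] at this
    exact ⟨N, _, hN, this⟩

theorem mem_schattenPow_zero (n : ℕ) (T : H₁ →L[ℂ] H₂) : T ∈ schattenPow n 0 H₁ H₂ :=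
  ⟨0, _, rankWeight_zero n, approximable_zero T⟩

theorem schattenPow_anti {n r s : ℕ} (h : s ≤ r) {T : H₁ →L[ℂ] H₂}
    (hT : T ∈ schattenPow n r H₁ H₂) :
    T ∈ schattenPow n s H₁ H₂ :=
  let ⟨N, c, hN, hc⟩ := hT
  ⟨N, c, hN, hc.anti h⟩

theorem comp_mem_schattenPow {n r s : ℕ} {T : H₂ →L[ℂ] H₃} {S : H₁ →L[ℂ] H₂}
    (hT : T ∈ schattenPow n r H₂ H₃) (hS : S ∈ schattenPow n s H₁ H₂) :
    T ∘L S ∈ schattenPow n (r + s) H₁ H₃ :=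
  let ⟨_, _, hN, hc⟩ := hT
  let ⟨_, _, hM, hd⟩ := hS
  ⟨_, _, hN.add hM, hc.comp hd⟩

theorem comp_left_mem_schattenPow {n r : ℕ} (T : H₂ →L[ℂ] H₃) {S : H₁ →L[ℂ] H₂}
    (hS : S ∈ schattenPow n r H₁ H₂) : T ∘L S ∈ schattenPow n r H₁ H₃ := by
  simpa using comp_mem_schattenPow (mem_schattenPow_zero n T) hS

theorem comp_right_mem_schattenPow {n r : ℕ} {T : H₂ →L[ℂ] H₃} (S : H₁ →L[ℂ] H₂)
    (hT : T ∈ schattenPow n r H₂ H₃) : T ∘L S ∈ schattenPow n r H₁ H₃ := by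
  simpa using comp_mem_schattenPow hT (mem_schattenPow_zero n S)

theorem mem_schattenPow_of_finite {n : ℕ} (hn : 1 ≤ n) (r : ℕ) {T : H₁ →L[ℂ] H₂}
    (h : FiniteDimensional ℂ (LinearMap.range (T : H₁ →ₗ[ℂ] H₂))) : T ∈ schattenPow n r H₁ H₂ :=
  ⟨_, _, rankWeight_const hn _, approximable_of_rank_le
    (m := Module.finrank ℂ (LinearMap.range (T : H₁ →ₗ[ℂ] H₂))) (Module.finrank_eq_rank _ _).ge r⟩

theorem isNuc_of_mem_schattenPow {n r : ℕ} (hn : 1 ≤ n) (hr : n ≤ r) {T : H₁ →L[ℂ] H₂}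
    (h : T ∈ schattenPow n r H₁ H₂) : IsNuc T :=
  let ⟨_, _, hN, hc⟩ := h
  ((hc.anti hr).hasNuc hn hN).isNuc

/-- `Tr(TS) = Tr(ST)` when the approximation numbers of `T` and `S` together are summable; neither
factor has to be nuclear. -/
theorem opTrace_comm_of_mem_schattenPow {n r s : ℕ} (hn : 1 ≤ n) (hrs : n ≤ r + s)
    {T : H₁ →L[ℂ] H₂} {S : H₂ →L[ℂ] H₁} (hT : T ∈ schattenPow n r H₁ H₂)
    (hS : S ∈ schattenPow n s H₂ H₁) : opTrace (T ∘L S) = opTrace (S ∘L T) := by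
  obtain ⟨N, c, hN, hc⟩ := hT
  obtain ⟨M, d, hM, hd⟩ := hS
  choose X Y h1 h2 h3 using hc.exists_comp hd
  have hX : ∀ k, IsNuc (X k) := fun k => (hasNuc_of_rank_le (h1 k)).isNuc
  have hY : ∀ k, IsNuc (Y k) := fun k => (hasNuc_of_rank_le (h2 k)).isNuc
  have h0 : 0 ≤ c * d := mul_nonneg hc.nonneg hd.nonneg
  have hp : ∀ k, c * d * (1 / 2 : ℝ) ^ ((r + s) * k) ≤ c * d * (1 / 2) ^ (n * k) := fun k =>
    mul_le_mul_of_nonneg_left (pow_le_pow_of_le_one (by norm_num) (by norm_num)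
      (Nat.mul_le_mul_right k hrs)) h0
  -- The approximations `U k` of `T S` and `V k` of `S T` have the same trace, since `X k` and `Y k`
  -- are nuclear, and converge in nuclear norm, since the errors are `(T - X) (S - Y)` and `(S - Y)
  -- (T - X)`.
  set U : ℕ → H₂ →L[ℂ] H₂ := fun k => X k ∘L S + (T - X k) ∘L Y k
  set V : ℕ → H₁ →L[ℂ] H₁ := fun k => Y k ∘L (T - X k) + S ∘L X k
  have hU := hasNuc_sub hn (hN.add hM) (T := T ∘L S) (X := U)
    (fun k => rank_comp_add_comp_le (h1 k) (h2 k)) (c := c * d) fun k => by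
      have : T ∘L S - U k = (T - X k) ∘L (S - Y k) := by
        ext x; simp [U]; abel
      rw [this]
      exact (ContinuousLinearMap.opNorm_comp_le _ _).trans ((h3 k).trans (hp k))
  have hV := hasNuc_sub hn (hN.add hM) (T := S ∘L T) (X := V)
    (fun k => by
      rw [Pi.add_apply, add_comm]
      exact rank_comp_add_comp_le (h2 k) (h1 k)) (c := c * d) fun k => by
      have : S ∘L T - V k = (S - Y k) ∘L (T - X k) := by
        ext x; simp [V]; abel
      rw [this]
      refine (ContinuousLinearMap.opNorm_comp_le _ _).trans ?_
      rw [mul_comm]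
      exact (h3 k).trans (hp k)
  have hUn : ∀ k, IsNuc (U k) := fun k => ((hX k).comp_right S).add ((hY k).comp_left _)
  have hVn : ∀ k, IsNuc (V k) := fun k => ((hY k).comp_right _).add ((hX k).comp_left S)
  have hUV : ∀ k, opTrace (U k) = opTrace (V k) := fun k => by
    rw [opTrace_add ((hX k).comp_right S) ((hY k).comp_left _),
      opTrace_add ((hY k).comp_right _) ((hX k).comp_left S), opTrace_comp_comm (hX k),
      opTrace_comp_comm (hY k), add_comm]
  have hlim := tendsto_hasNuc_sub n (N + M) (c * d)
  have hTS : IsNuc (T ∘L S) := by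
    have := (hU 0).isNuc.add (hUn 0)
    rwa [sub_add_cancel] at this
  have hST : IsNuc (S ∘L T) := by
    have := (hV 0).isNuc.add (hVn 0)
    rwa [sub_add_cancel] at this
  have t1 : Filter.Tendsto (fun k => opTrace (U k)) Filter.atTop (nhds (opTrace (T ∘L S))) := by
    rw [tendsto_iff_norm_sub_tendsto_zero]
    refine squeeze_zero (fun _ => norm_nonneg _) (fun k => ?_) hlim
    rw [norm_sub_rev, ← opTrace_sub hTS (hUn k)]
    exact opTrace_norm_le (hU k)
  have t2 : Filter.Tendsto (fun k => opTrace (U k)) Filter.atTop (nhds (opTrace (S ∘L T))) := by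
    simp only [hUV]
    rw [tendsto_iff_norm_sub_tendsto_zero]
    refine squeeze_zero (fun _ => norm_nonneg _) (fun k => ?_) hlim
    rw [norm_sub_rev, ← opTrace_sub hST (hVn k)]
    exact opTrace_norm_le (hV k)
  exact tendsto_nhds_unique t1 t2

end Approximable

/-! ### Unbounded operators through their graphs -/

section Unbounded

variable {H : Type*} [NormedAddCommGroup H] [InnerProductSpace ℂ H] [CompleteSpace H]

theorem mem_graph_iff_exists {D : H →ₗ.[ℂ] H} {x y : H} :
    (x, y) ∈ D.graph ↔ ∃ hx : x ∈ D.domain, D ⟨x, hx⟩ = y := by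
  rw [LinearPMap.mem_graph_iff]
  constructor
  · rintro ⟨z, rfl, h⟩
    exact ⟨z.2, h⟩
  · rintro ⟨hx, h⟩
    exact ⟨⟨x, hx⟩, rfl, h⟩

theorem isBoundedInverse_iff {D : H →ₗ.[ℂ] H} {P : H →L[ℂ] H} :
    IsBoundedInverse D P ↔ (∀ x, (P x, x) ∈ D.graph) ∧ ∀ x y, (x, y) ∈ D.graph → P y = x := by
  simp only [mem_graph_iff_exists]
  refine and_congr Iff.rfl ⟨fun h x y ⟨hx, hy⟩ => ?_, fun h x => h x _ ⟨x.2, rfl⟩⟩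
  rw [← hy, h ⟨x, hx⟩]

theorem isTwComm_iff {D : H →ₗ.[ℂ] H} {a b C : H →L[ℂ] H} :
    IsTwComm D a b C ↔ ∀ x y, (x, y) ∈ D.graph → (a x, C x + b y) ∈ D.graph := by
  simp only [mem_graph_iff_exists]
  constructor
  · rintro h x y ⟨hx, rfl⟩
    obtain ⟨h1, h2⟩ := h ⟨x, hx⟩
    exact ⟨h1, by rw [h2, sub_add_cancel]⟩
  · intro h x
    obtain ⟨h1, h2⟩ := h x _ ⟨x.2, rfl⟩
    exact ⟨h1, by rw [h2, add_sub_cancel_right]⟩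

theorem boundedInverse_eq {D : H →ₗ.[ℂ] H} {P : H →L[ℂ] H} (h : IsBoundedInverse D P) :
    boundedInverse D = P := by
  have hex : ∃ P, IsBoundedInverse D P := ⟨P, h⟩
  rw [boundedInverse, dif_pos hex]
  refine ContinuousLinearMap.ext fun x => ?_
  exact (isBoundedInverse_iff.1 hex.choose_spec).2 _ _ ((isBoundedInverse_iff.1 h).1 x)

theorem twComm_eq {D : H →ₗ.[ℂ] H} (hD : Dense (D.domain : Set H)) {a b C : H →L[ℂ] H}
    (h : IsTwComm D a b C) : twComm D a b = C := by
  refine ext_dense hD fun x => ?_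
  rw [(isTwComm_twComm ⟨C, h⟩ x).2, (h x).2]

theorem graph_symmetric {D : H →ₗ.[ℂ] H} (hD : IsSelfAdjoint D) {x y u v : H}
    (h1 : (x, y) ∈ D.graph) (h2 : (u, v) ∈ D.graph) : ⟪y, u⟫_ℂ = ⟪x, v⟫_ℂ := by
  obtain ⟨hx, rfl⟩ := mem_graph_iff_exists.1 h1
  obtain ⟨hu, rfl⟩ := mem_graph_iff_exists.1 h2
  have h : D.adjoint.IsFormalAdjoint D := LinearPMap.adjoint_isFormalAdjoint hD.dense_domain
  rw [LinearPMap.isSelfAdjoint_def.1 hD] at h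
  exact h ⟨x, hx⟩ ⟨u, hu⟩

theorem mem_graph_of_forall_inner {D : H →ₗ.[ℂ] H} (hD : IsSelfAdjoint D) {x y : H}
    (h : ∀ u v, (u, v) ∈ D.graph → ⟪y, u⟫_ℂ = ⟪x, v⟫_ℂ) : (x, y) ∈ D.graph := by
  have h' : ∀ u : D.domain, ⟪y, (u : H)⟫_ℂ = ⟪x, D u⟫_ℂ := fun u => h u _ (LinearPMap.mem_graph D u)
  have h1 : x ∈ D.adjoint.domain := LinearPMap.mem_adjoint_domain_of_exists x ⟨y, h'⟩
  have h2 : D.adjoint ⟨x, h1⟩ = y := LinearPMap.adjoint_apply_eq hD.dense_domain _ h'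
  have h3 : (x, y) ∈ D.adjoint.graph := mem_graph_iff_exists.2 ⟨h1, h2⟩
  rwa [LinearPMap.isSelfAdjoint_def.1 hD] at h3

/-- A bounded inverse of a selfadjoint operator is selfadjoint. -/
theorem isSelfAdjoint_of_isBoundedInverse {D : H →ₗ.[ℂ] H} (hD : IsSelfAdjoint D) {P : H →L[ℂ] H}
    (h : IsBoundedInverse D P) : IsSelfAdjoint P := by
  rw [ContinuousLinearMap.isSelfAdjoint_iff_isSymmetric]
  intro x y
  have h1 := (isBoundedInverse_iff.1 h).1
  exact (graph_symmetric hD (h1 x) (h1 y)).symm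

/-! ### The resolvent of a selfadjoint operator -/

variable {D : H →ₗ.[ℂ] H} (hD : IsSelfAdjoint D) {R : H →L[ℂ] H}
  (hR : IsBoundedInverse (addScalar D Complex.I) R)

theorem mem_graph_resolvent (hR : IsBoundedInverse (addScalar D Complex.I) R) (x : H) :
    (R x, x - Complex.I • R x) ∈ D.graph := by
  obtain ⟨h1, h2⟩ := hR.1 x
  refine mem_graph_iff_exists.2 ⟨h1, ?_⟩
  rw [eq_sub_iff_add_eq]
  exact h2

theorem resolvent_apply (hR : IsBoundedInverse (addScalar D Complex.I) R) {x y : H}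
    (h : (x, y) ∈ D.graph) : R (y + Complex.I • x) = x := by
  obtain ⟨hx, rfl⟩ := mem_graph_iff_exists.1 h
  exact hR.2 ⟨x, hx⟩

theorem mem_graph_resolvent_adjoint (hD : IsSelfAdjoint D)
    (hR : IsBoundedInverse (addScalar D Complex.I) R) (x : H) :
    (ContinuousLinearMap.adjoint R x, x + Complex.I • ContinuousLinearMap.adjoint R x) ∈
      D.graph := by
  refine mem_graph_of_forall_inner hD fun u v huv => ?_
  have h1 := resolvent_apply hR huv
  rw [inner_add_left, inner_smul_left, ContinuousLinearMap.adjoint_inner_left,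
    ContinuousLinearMap.adjoint_inner_left]
  nth_rewrite 1 [← h1]
  rw [← inner_smul_right, map_add, map_smul, inner_add_right, inner_smul_right, inner_smul_right,
    Complex.conj_I]
  ring

/-- `(D² + 1)⁻¹ = (D + i)⁻¹(D - i)⁻¹`. -/
def sqResolvent (R : H →L[ℂ] H) : H →L[ℂ] H := R * ContinuousLinearMap.adjoint R

/-- `D (D² + 1)⁻¹`. -/
def mulSqResolvent (R : H →L[ℂ] H) : H →L[ℂ] H :=
  ContinuousLinearMap.adjoint R - Complex.I • sqResolvent R

theorem mem_graph_sqResolvent (hR : IsBoundedInverse (addScalar D Complex.I) R) (x : H) :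
    (sqResolvent R x, mulSqResolvent R x) ∈ D.graph :=
  mem_graph_resolvent hR (ContinuousLinearMap.adjoint R x)

theorem mem_graph_mulSqResolvent (hD : IsSelfAdjoint D)
    (hR : IsBoundedInverse (addScalar D Complex.I) R) (x : H) :
    (mulSqResolvent R x, x - sqResolvent R x) ∈ D.graph := by
  have h := D.graph.sub_mem (mem_graph_resolvent_adjoint hD hR x)
    (D.graph.smul_mem Complex.I (mem_graph_sqResolvent hR x))
  convert h using 1
  refine Prod.ext rfl ?_
  change x - sqResolvent R x = x + Complex.I • ContinuousLinearMap.adjoint R x -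
    Complex.I • (ContinuousLinearMap.adjoint R x - Complex.I • sqResolvent R x)
  rw [smul_sub, smul_smul, Complex.I_mul_I, neg_one_smul]
  abel

/-- If `S` maps into the domain of `D` and `D S` is bounded, then `S` is the sum of `P D S` and of
the projection of `S` to the finite-dimensional kernel of `D`, where `P` is the partial inverse of
`D`. -/
theorem mem_schattenPow_of_graph (hc : IsCompactOperator R)
    (hR : IsBoundedInverse (addScalar D Complex.I) R) {P : H →L[ℂ] H} (hP : IsPartialInverse D P)
    {n : ℕ} (hn : 1 ≤ n) (hPn : P ∈ schattenPow n 1 H H) {S S' : H →L[ℂ] H}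
    (hS : ∀ x, (S x, S' x) ∈ D.graph) : S ∈ schattenPow n 1 H H := by
  -- The kernel of `D` is the eigenspace of the compact resolvent `(D + i)⁻¹` for `-i = i⁻¹`.
  let V : Submodule ℂ H := Module.End.eigenspace R.toLinearMap (-Complex.I)
  have hV : FiniteDimensional ℂ V :=
    ContinuousLinearMap.finite_dimensional_eigenspace hc _ (neg_ne_zero.2 Complex.I_ne_zero)
  have hmem : ∀ z, z ∈ V ↔ R z = -Complex.I • z := fun z => Module.End.mem_eigenspace_iff
  have h0 : ∀ z ∈ V, (z, (0 : H)) ∈ D.graph := fun z hz => by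
    have h1 := D.graph.smul_mem Complex.I (mem_graph_resolvent hR z)
    rw [(hmem z).1 hz] at h1
    convert h1 using 1
    refine Prod.ext ?_ ?_
    · change z = Complex.I • -Complex.I • z
      rw [smul_smul, mul_neg, Complex.I_mul_I, neg_neg, one_smul]
    · change (0 : H) = Complex.I • (z - Complex.I • -Complex.I • z)
      rw [smul_smul, mul_neg, Complex.I_mul_I, neg_neg, one_smul, sub_self, smul_zero]
  have h1 : ∀ z, (z, (0 : H)) ∈ D.graph → z ∈ V := fun z hz => by
    have h2 := resolvent_apply hR hz
    rw [zero_add, map_smul] at h2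
    rw [hmem]
    conv_rhs => rw [← h2]
    rw [smul_smul, neg_mul, Complex.I_mul_I, neg_neg, one_smul]
  -- `S x` minus its projection to the kernel is orthogonal to the kernel, so `P` inverts `D` on it.
  have key : S = V.starProjection ∘L S + P ∘L S' := by
    refine ContinuousLinearMap.ext fun x => ?_
    have h2 : (S x - V.starProjection (S x), S' x) ∈ D.graph := by
      have := D.graph.sub_mem (hS x) (h0 _ (V.starProjection_apply_mem (S x)))
      simpa using this
    obtain ⟨h3, h4⟩ := mem_graph_iff_exists.1 h2
    have h5 := hP.2 ⟨_, h3⟩ fun z hz =>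
      Submodule.sub_starProjection_mem_orthogonal (K := V) (S x) z
        (h1 _ (mem_graph_iff_exists.2 ⟨z.2, hz⟩))
    rw [h4] at h5
    simp only [add_apply, ContinuousLinearMap.comp_apply, h5]
    abel
  rw [key]
  refine add_mem (comp_right_mem_schattenPow _ (mem_schattenPow_of_finite hn 1 ?_))
    (comp_right_mem_schattenPow _ hPn)
  refine Submodule.finiteDimensional_of_le (S₂ := V) ?_
  rintro _ ⟨x, rfl⟩
  exact V.starProjection_apply_mem x

theorem IsSchatten.mem_schattenPow {p : ℝ} (hp : 1 ≤ p) {P : H →L[ℂ] H} (h : IsSchatten p P) {n : ℕ}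
    (hn : p ≤ n) : P ∈ schattenPow n 1 H H := by
  obtain ⟨N, h1, h2⟩ := h.exists_rank_le hp hn
  refine ⟨N, max 1 ‖P‖, h1, le_max_right _ _, fun k => ?_⟩
  obtain ⟨X, h3, h4⟩ := h2 k
  refine ⟨X, h3, h4.trans ?_⟩
  rw [one_mul]
  exact le_mul_of_one_le_left (by positivity) (le_max_left _ _)

end Unbounded

/-! ### Block operators -/

section Block

variable {H : Type*} [NormedAddCommGroup H] [InnerProductSpace ℂ H] [CompleteSpace H]

/-- The operator on `H ⊕ H` with the given matrix of operators. -/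
def block (a b c d : H →L[ℂ] H) : WithLp 2 (H × H) →L[ℂ] WithLp 2 (H × H) :=
  (WithLp.prodContinuousLinearEquiv 2 ℂ H H).symm.toContinuousLinearMap ∘L
    ((a.coprod b).prod (c.coprod d)) ∘L
    (WithLp.prodContinuousLinearEquiv 2 ℂ H H).toContinuousLinearMap

theorem block_apply (a b c d : H →L[ℂ] H) (x : WithLp 2 (H × H)) : block a b c d x =
    WithLp.toLp 2 (a x.fst + b x.snd, c x.fst + d x.snd) := rfl

theorem diag_eq_block (a d : H →L[ℂ] H) : TwistedSpectralTriple.diag a d = block a 0 0 d := by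
  refine ContinuousLinearMap.ext fun x => ?_
  rw [block_apply, zero_apply, zero_apply, zero_add, add_zero]
  rfl

theorem block_mul (a b c d a' b' c' d' : H →L[ℂ] H) : block a b c d * block a' b' c' d' =
    block (a * a' + b * c') (a * b' + b * d') (c * a' + d * c') (c * b' + d * d') := by
  refine ContinuousLinearMap.ext fun x => ?_
  simp only [mul_apply_eq_comp, block_apply, add_apply, WithLp.toLp_fst,
    WithLp.toLp_snd, map_add]
  refine congrArg (WithLp.toLp 2) (Prod.ext ?_ ?_) <;> exact add_add_add_comm _ _ _ _

theorem block_add (a b c d a' b' c' d' : H →L[ℂ] H) : block a b c d + block a' b' c' d' =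
    block (a + a') (b + b') (c + c') (d + d') := by
  refine ContinuousLinearMap.ext fun x => ?_
  simp only [add_apply, block_apply, ← WithLp.toLp_add]
  refine congrArg (WithLp.toLp 2) (Prod.ext ?_ ?_) <;> exact add_add_add_comm _ _ _ _

theorem block_smul (z : ℂ) (a b c d : H →L[ℂ] H) :
    z • block a b c d = block (z • a) (z • b) (z • c) (z • d) := by
  refine ContinuousLinearMap.ext fun x => ?_
  simp only [_root_.smul_apply, block_apply, ← WithLp.toLp_smul, ← smul_add, Prod.smul_mk]

theorem block_neg (a b c d : H →L[ℂ] H) : -block a b c d = block (-a) (-b) (-c) (-d) := by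
  refine ContinuousLinearMap.ext fun x => ?_
  simp only [neg_apply, block_apply, ← WithLp.toLp_neg, Prod.neg_mk, neg_add]

theorem block_one : block (1 : H →L[ℂ] H) 0 0 1 = 1 := by
  refine ContinuousLinearMap.ext fun x => ?_
  simp only [block_apply, one_apply_eq_self, zero_apply, add_zero, zero_add]
  rfl

/-- The inclusion of the first summand of `H ⊕ H`. -/
def blockInl : H →L[ℂ] WithLp 2 (H × H) :=
  (WithLp.prodContinuousLinearEquiv 2 ℂ H H).symm.toContinuousLinearMap ∘L
    ContinuousLinearMap.inl ℂ H H

/-- The inclusion of the second summand of `H ⊕ H`. -/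
def blockInr : H →L[ℂ] WithLp 2 (H × H) :=
  (WithLp.prodContinuousLinearEquiv 2 ℂ H H).symm.toContinuousLinearMap ∘L
    ContinuousLinearMap.inr ℂ H H

/-- The projection of `H ⊕ H` to the first summand. -/
def blockFst : WithLp 2 (H × H) →L[ℂ] H :=
  ContinuousLinearMap.fst ℂ H H ∘L
    (WithLp.prodContinuousLinearEquiv 2 ℂ H H).toContinuousLinearMap

/-- The projection of `H ⊕ H` to the second summand. -/
def blockSnd : WithLp 2 (H × H) →L[ℂ] H :=
  ContinuousLinearMap.snd ℂ H H ∘L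
    (WithLp.prodContinuousLinearEquiv 2 ℂ H H).toContinuousLinearMap

theorem block_eq_sum (a b c d : H →L[ℂ] H) : block a b c d =
    blockInl ∘L a ∘L blockFst + blockInl ∘L b ∘L blockSnd +
      (blockInr ∘L c ∘L blockFst + blockInr ∘L d ∘L blockSnd) := by
  refine ContinuousLinearMap.ext fun x => ?_
  change WithLp.toLp 2 (a x.fst + b x.snd, c x.fst + d x.snd) =
    WithLp.toLp 2 (a x.fst, 0) + WithLp.toLp 2 (b x.snd, 0) +
      (WithLp.toLp 2 (0, c x.fst) + WithLp.toLp 2 (0, d x.snd))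
  simp only [← WithLp.toLp_add, Prod.mk_add_mk, add_zero, zero_add]

theorem block_mem_schattenPow {n r : ℕ} {a b c d : H →L[ℂ] H} (ha : a ∈ schattenPow n r H H)
    (hb : b ∈ schattenPow n r H H) (hc : c ∈ schattenPow n r H H) (hd : d ∈ schattenPow n r H H) :
    block a b c d ∈ schattenPow n r (WithLp 2 (H × H)) (WithLp 2 (H × H)) := by
  rw [block_eq_sum]
  refine add_mem (add_mem ?_ ?_) (add_mem ?_ ?_) <;>
    exact comp_left_mem_schattenPow _ (comp_right_mem_schattenPow _ (by assumption))

theorem block_adjoint (a b c d : H →L[ℂ] H) : star (block a b c d) =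
    block (star a) (star c) (star b) (star d) := by
  rw [ContinuousLinearMap.star_eq_adjoint, eq_comm, ContinuousLinearMap.eq_adjoint_iff]
  intro x y
  simp only [WithLp.prod_inner_apply, block_apply, inner_add_left, inner_add_right,
    ContinuousLinearMap.star_eq_adjoint, ContinuousLinearMap.adjoint_inner_left]
  exact add_add_add_comm _ _ _ _

end Block

/-! ### The bounded data of a twisted spectral triple with invertible operator -/

section BddTriple

variable {A : Type*} [Ring A] [Algebra ℂ A]
variable {K : Type*} [NormedAddCommGroup K] [InnerProductSpace ℂ K] [CompleteSpace K]

/-- The bounded operators that come with an odd operator `D` with bounded inverse `Q`: the grading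
`γ`, the actions `π` and `π' = π ∘ σ`, and the twisted commutators `C a = D π(a) - π'(a) D`. The
relation between them is stated after multiplication by `Q` on both sides, so that `D` does not
occur. The actions need not be unital. -/
structure BddTriple (A : Type*) [Ring A] [Algebra ℂ A] (K : Type*) [NormedAddCommGroup K]
    [InnerProductSpace ℂ K] [CompleteSpace K] where
  γ : K →L[ℂ] K
  Q : K →L[ℂ] K
  π : A →ₗ[ℂ] (K →L[ℂ] K)
  π' : A →ₗ[ℂ] (K →L[ℂ] K)
  C : A →ₗ[ℂ] (K →L[ℂ] K)
  π_mul : ∀ a b, π (a * b) = π a * π b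
  π'_mul : ∀ a b, π' (a * b) = π' a * π' b
  C_mul : ∀ a b, C (a * b) = C a * π b + π' a * C b
  rel : ∀ a, π a * Q - Q * C a * Q = Q * π' a
  γ_sq : γ * γ = 1
  γ_π : ∀ a, γ * π a = π a * γ
  γ_π' : ∀ a, γ * π' a = π' a * γ
  γ_Q : γ * Q = -(Q * γ)
  γ_C : ∀ a, γ * C a = -(C a * γ)

/-- The relation `a Q - Q C Q = Q b` is `C = D a - b D` multiplied by `Q = D⁻¹` on both sides. -/
theorem rel_of_isTwComm {D : K →ₗ.[ℂ] K} {Q : K →L[ℂ] K} (hQ : IsBoundedInverse D Q)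
    {a b C : K →L[ℂ] K} (h : IsTwComm D a b C) : a * Q - Q * C * Q = Q * b := by
  refine ContinuousLinearMap.ext fun y => ?_
  have hQ' := isBoundedInverse_iff.1 hQ
  have h1 := hQ'.2 _ _ (isTwComm_iff.1 h _ _ (hQ'.1 y))
  rw [map_add] at h1
  simp only [sub_apply, mul_apply_eq_comp]
  rw [← h1, add_sub_cancel_left]

theorem odd_inverse {D : K →ₗ.[ℂ] K} {Q γ : K →L[ℂ] K} (hQ : IsBoundedInverse D Q)
    (h : ∀ x y, (x, y) ∈ D.graph → (γ x, -γ y) ∈ D.graph) : γ * Q = -(Q * γ) := by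
  refine ContinuousLinearMap.ext fun y => ?_
  have hQ' := isBoundedInverse_iff.1 hQ
  have h1 := hQ'.2 _ _ (h _ _ (hQ'.1 y))
  rw [neg_apply, mul_apply_eq_comp, mul_apply_eq_comp, ← h1, map_neg]

namespace BddTriple

variable (X : BddTriple A K)

/-- `D + z M` in place of `D`, where `M` is bounded and odd and `1 + z M D⁻¹` has the inverse `V`.
-/
def perturb (M : K →L[ℂ] K) (hM : X.γ * M = -(M * X.γ)) (z : ℂ) (V : K →L[ℂ] K)
    (hV : (1 + z • (M * X.Q)) * V = 1) (hV' : V * (1 + z • (M * X.Q)) = 1) : BddTriple A K where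
  γ := X.γ
  Q := X.Q * V
  π := X.π
  π' := X.π'
  C := X.C + z • (LinearMap.mulLeft ℂ M ∘ₗ X.π - LinearMap.mulRight ℂ M ∘ₗ X.π')
  π_mul := X.π_mul
  π'_mul := X.π'_mul
  C_mul a b := by
    simp only [LinearMap.add_apply, LinearMap.smul_apply, LinearMap.sub_apply,
      LinearMap.comp_apply, LinearMap.mulLeft_apply, LinearMap.mulRight_apply, X.C_mul, X.π_mul,
      X.π'_mul, add_mul, mul_add, smul_mul_assoc, mul_smul_comm, sub_mul, mul_sub, mul_assoc]
    module
  rel a := by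
    have h : X.π a * X.Q = X.Q * (X.C a * X.Q + X.π' a) := by
      rw [mul_add, ← X.rel, mul_assoc]; abel
    simp only [LinearMap.add_apply, LinearMap.smul_apply, LinearMap.sub_apply,
      LinearMap.comp_apply, LinearMap.mulLeft_apply, LinearMap.mulRight_apply]
    have h2 : X.π a * X.Q - X.Q * V * (X.C a + z • (M * X.π a - X.π' a * M)) * X.Q =
        X.Q * V * X.π' a * (1 + z • (M * X.Q)) := by
      have h3 : X.C a * X.Q + X.π' a + z • (M * (X.π a * X.Q)) =
          (1 + z • (M * X.Q)) * (X.C a * X.Q + X.π' a) := by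
        rw [h, add_mul, one_mul, smul_mul_assoc, mul_assoc]
      have h4 : X.Q * V * (X.C a * X.Q + X.π' a + z • (M * (X.π a * X.Q))) = X.π a * X.Q := by
        rw [h3, mul_assoc X.Q V, ← mul_assoc V, hV', one_mul, h]
      rw [← h4]
      simp only [add_mul, mul_add, smul_mul_assoc, mul_smul_comm, sub_mul, mul_sub, mul_assoc,
        mul_one, smul_sub]
      abel
    have h5 := congrArg (· * V) h2
    simp only [mul_assoc, hV, mul_one] at h5
    simp only [sub_mul, mul_assoc] at h5
    simp only [mul_assoc]
    exact h5
  γ_sq := X.γ_sq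
  γ_π := X.γ_π
  γ_π' := X.γ_π'
  γ_Q := by
    have h1 : X.γ * (1 + z • (M * X.Q)) = (1 + z • (M * X.Q)) * X.γ := by
      rw [mul_add, add_mul, mul_one, one_mul, mul_smul_comm, smul_mul_assoc, ← mul_assoc, hM,
        neg_mul, mul_assoc M, X.γ_Q, mul_neg, neg_neg, mul_assoc]
    have h2 : X.γ * V = V * X.γ := by
      calc X.γ * V = V * (1 + z • (M * X.Q)) * X.γ * V := by rw [hV', one_mul]
        _ = V * (X.γ * (1 + z • (M * X.Q)) * V) := by rw [h1]; simp only [mul_assoc]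
        _ = V * X.γ := by rw [mul_assoc X.γ, hV, mul_one]
    rw [← mul_assoc, X.γ_Q, neg_mul, mul_assoc, h2, mul_assoc]
  γ_C a := by
    simp only [LinearMap.add_apply, LinearMap.smul_apply, LinearMap.sub_apply,
      LinearMap.comp_apply, LinearMap.mulLeft_apply, LinearMap.mulRight_apply]
    have h1 : X.γ * (M * X.π a) = -(M * X.π a * X.γ) := by
      rw [← mul_assoc, hM, neg_mul, mul_assoc, X.γ_π, mul_assoc]
    have h2 : X.γ * (X.π' a * M) = -(X.π' a * M * X.γ) := by
      rw [← mul_assoc, X.γ_π', mul_assoc, hM, mul_neg, mul_assoc]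
    rw [mul_add, add_mul, X.γ_C, mul_smul_comm, smul_mul_assoc, mul_sub, sub_mul, h1, h2]
    module

end BddTriple

end BddTriple

namespace TwistedSpectralTriple

variable {A : Type*} [Ring A] [Algebra ℂ A] [StarRing A]
variable {H : Type*} [NormedAddCommGroup H] [InnerProductSpace ℂ H] [CompleteSpace H]
variable (T : TwistedSpectralTriple A H)

theorem graph_comm (a : A) {x y : H} (h : (x, y) ∈ T.D.graph) :
    (T.π a x, T.comm a x + T.π (T.σ a) y) ∈ T.D.graph :=
  isTwComm_iff.1 (T.isTwComm_comm a) x y h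

theorem graph_odd {x y : H} (h : (x, y) ∈ T.D.graph) : (T.γ x, -T.γ y) ∈ T.D.graph := by
  obtain ⟨hx, rfl⟩ := mem_graph_iff_exists.1 h
  exact mem_graph_iff_exists.2 (T.D_odd ⟨x, hx⟩)

theorem comm_add (a b : A) : T.comm (a + b) = T.comm a + T.comm b := by
  refine twComm_eq T.dense_domain (isTwComm_iff.2 fun x y h => ?_)
  have h1 := T.D.graph.add_mem (T.graph_comm a h) (T.graph_comm b h)
  convert h1 using 1
  refine Prod.ext ?_ ?_
  · simp
  · simp only [map_add, Prod.snd_add, add_apply]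
    abel

theorem comm_smul (z : ℂ) (a : A) : T.comm (z • a) = z • T.comm a := by
  refine twComm_eq T.dense_domain (isTwComm_iff.2 fun x y h => ?_)
  have h1 := T.D.graph.smul_mem z (T.graph_comm a h)
  convert h1 using 1
  refine Prod.ext ?_ ?_
  · simp
  · simp

/-- The linear map `a ↦ [D, a]_σ`. -/
def commLin : A →ₗ[ℂ] (H →L[ℂ] H) where
  toFun := T.comm
  map_add' := T.comm_add
  map_smul' := T.comm_smul

/-- The linear map underlying the representation. -/
def piLin : A →ₗ[ℂ] (H →L[ℂ] H) where
  toFun := T.π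
  map_add' := map_add T.π
  map_smul' := map_smul T.π

/-- The representation composed with `σ`. -/
def piσLin : A →ₗ[ℂ] (H →L[ℂ] H) := T.piLin ∘ₗ T.σ.toLinearMap

/-- The bounded data of a twisted spectral triple with invertible `D`. -/
def baseTriple {P : H →L[ℂ] H} (hP : IsBoundedInverse T.D P) : BddTriple A H where
  γ := T.γ
  Q := P
  π := T.piLin
  π' := T.piσLin
  C := T.commLin
  π_mul := map_mul T.π
  π'_mul a b := (congrArg T.π (map_mul T.σ a b)).trans (map_mul T.π _ _)
  C_mul := T.comm_mul
  rel a := rel_of_isTwComm hP (T.isTwComm_comm a)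
  γ_sq := T.γ_sq
  γ_π := T.π_even
  γ_π' a := T.π_even _
  γ_Q := odd_inverse hP fun _ _ h => T.graph_odd h
  γ_C := T.comm_odd

/-! ### The double of a twisted spectral triple -/

theorem mem_graph_doubleD {x y : WithLp 2 (H × H)} : (x, y) ∈ T.doubleD.graph ↔
    (x.fst, y.fst - x.snd) ∈ T.D.graph ∧ (x.snd, x.fst - y.snd) ∈ T.D.graph := by
  simp only [mem_graph_iff_exists]
  constructor
  · rintro ⟨hx, rfl⟩
    refine ⟨⟨hx.1, ?_⟩, ⟨hx.2, ?_⟩⟩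
    · exact (add_sub_cancel_right _ _).symm
    · exact (sub_sub_cancel _ _).symm
  · rintro ⟨⟨h1, h2⟩, ⟨h3, h4⟩⟩
    refine ⟨⟨h1, h3⟩, ?_⟩
    change WithLp.toLp 2 (T.D ⟨x.fst, h1⟩ + x.snd, x.fst - T.D ⟨x.snd, h3⟩) = y
    rw [h2, h4, sub_add_cancel, sub_sub_cancel]
    rfl

/-- A resolvent `(D + i)⁻¹`. -/
def resolvent : H →L[ℂ] H := T.compact_resolvent.choose

theorem isCompactOperator_resolvent : IsCompactOperator T.resolvent :=
  T.compact_resolvent.choose_spec.1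

theorem isBoundedInverse_resolvent : IsBoundedInverse (addScalar T.D Complex.I) T.resolvent :=
  T.compact_resolvent.choose_spec.2

/-- The inverse `D̃⁻¹ = D̃ (D̃²)⁻¹` of `D̃`. Since `D̃² = D² + 1` on both summands, it is
`(D (D² + 1)⁻¹, (D² + 1)⁻¹; (D² + 1)⁻¹, - D (D² + 1)⁻¹)`. -/
def doubleInv : WithLp 2 (H × H) →L[ℂ] WithLp 2 (H × H) :=
  block (mulSqResolvent T.resolvent) (sqResolvent T.resolvent) (sqResolvent T.resolvent)
    (-mulSqResolvent T.resolvent)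

/-- If `D x + y = 0` and `x = D y`, then `-‖y‖² = ⟨D x, y⟩ = ⟨x, D y⟩ = ‖x‖²`. -/
theorem doubleD_injective {x : WithLp 2 (H × H)} (h : (x, 0) ∈ T.doubleD.graph) : x = 0 := by
  obtain ⟨h1, h2⟩ := T.mem_graph_doubleD.1 h
  have h3 := graph_symmetric T.D_selfAdjoint h1 h2
  simp only [WithLp.zero_fst, WithLp.zero_snd, zero_sub, sub_zero, inner_neg_left] at h3
  have h4 : (‖x.fst‖ : ℝ) ^ 2 + ‖x.snd‖ ^ 2 = 0 := by
    rw [inner_self_eq_norm_sq_to_K, inner_self_eq_norm_sq_to_K, neg_eq_iff_add_eq_zero] at h3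
    rw [add_comm]
    have h4 : ((‖x.snd‖ ^ 2 + ‖x.fst‖ ^ 2 : ℝ) : ℂ) = 0 := by
      push_cast
      exact h3
    exact Complex.ofReal_eq_zero.1 h4
  have h5 : ‖x.fst‖ = 0 := by nlinarith [sq_nonneg ‖x.fst‖, sq_nonneg ‖x.snd‖]
  have h6 : ‖x.snd‖ = 0 := by nlinarith [sq_nonneg ‖x.fst‖, sq_nonneg ‖x.snd‖]
  exact (WithLp.equiv 2 (H × H)).injective (Prod.ext (norm_eq_zero.1 h5) (norm_eq_zero.1 h6))

theorem isBoundedInverse_doubleInv : IsBoundedInverse T.doubleD T.doubleInv := by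
  have h : ∀ x, (T.doubleInv x, x) ∈ T.doubleD.graph := fun x => by
    rw [T.mem_graph_doubleD, doubleInv, block_apply]
    simp only [WithLp.toLp_fst, WithLp.toLp_snd, neg_apply]
    have hR := T.isBoundedInverse_resolvent
    constructor
    · have := T.D.graph.add_mem (mem_graph_mulSqResolvent T.D_selfAdjoint hR x.fst)
        (mem_graph_sqResolvent hR x.snd)
      convert this using 1
      refine Prod.ext rfl ?_
      simp only [Prod.snd_add]
      abel
    · have := T.D.graph.sub_mem (mem_graph_sqResolvent hR x.fst)
        (mem_graph_mulSqResolvent T.D_selfAdjoint hR x.snd)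
      convert this using 1
      refine Prod.ext ?_ ?_
      · simp only [Prod.fst_sub]
        abel
      · simp only [Prod.snd_sub]
        abel
  refine isBoundedInverse_iff.2 ⟨h, fun x y hxy => ?_⟩
  have h1 := T.doubleD.graph.sub_mem (h y) hxy
  rw [Prod.mk_sub_mk, sub_self] at h1
  exact sub_eq_zero.1 (T.doubleD_injective h1)

theorem boundedInverse_doubleD : boundedInverse T.doubleD = T.doubleInv :=
  boundedInverse_eq T.isBoundedInverse_doubleInv

theorem doubleInv_mem_schattenPow {p : ℝ} (hp : 1 ≤ p) (h : T.IsSummable p) {n : ℕ} (hn : p ≤ n) :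
    T.doubleInv ∈ schattenPow n 1 (WithLp 2 (H × H)) (WithLp 2 (H × H)) := by
  obtain ⟨P, hP, hPs⟩ := h
  have hn1 : 1 ≤ n := by exact_mod_cast hp.trans hn
  have hR := T.isBoundedInverse_resolvent
  have hPn := hPs.mem_schattenPow hp hn
  have h1 : mulSqResolvent T.resolvent ∈ schattenPow n 1 H H :=
    mem_schattenPow_of_graph T.isCompactOperator_resolvent hR hP hn1 hPn
      (S' := 1 - sqResolvent T.resolvent) (mem_graph_mulSqResolvent T.D_selfAdjoint hR)
  have h2 : sqResolvent T.resolvent ∈ schattenPow n 1 H H :=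
    mem_schattenPow_of_graph T.isCompactOperator_resolvent hR hP hn1 hPn (mem_graph_sqResolvent hR)
  exact block_mem_schattenPow h1 h2 h2 (neg_mem h1)

theorem inverse_mem_schattenPow {P : H →L[ℂ] H} (hP : IsBoundedInverse T.D P) {p : ℝ} (hp : 1 ≤ p)
    (h : T.IsSummable p) {n : ℕ} (hn : p ≤ n) : P ∈ schattenPow n 1 H H := by
  obtain ⟨P', hP', hPs⟩ := h
  have h0 : ∀ z : T.D.domain, T.D z = 0 → (z : H) = 0 := fun z hz => by
    have := hP.2 z
    rw [hz, map_zero] at this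
    exact this.symm
  have : P = P' := by
    refine ContinuousLinearMap.ext fun x => ?_
    obtain ⟨h1, h2⟩ := hP.1 x
    have h3 := hP'.2 ⟨P x, h1⟩ fun z hz => by rw [h0 z hz, inner_zero_left]
    rw [h2] at h3
    exact h3.symm
  rw [this]
  exact hPs.mem_schattenPow hp hn

theorem dense_doubleDomain : Dense (T.doubleD.domain : Set (WithLp 2 (H × H))) := by
  have h := T.dense_domain.prod T.dense_domain
  have e := (WithLp.prodContinuousLinearEquiv 2 ℂ H H).toHomeomorph
  have h2 := h.preimage (WithLp.prodContinuousLinearEquiv 2 ℂ H H).toHomeomorph.isOpenMap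
  exact h2

/-- The twisted commutator of the double is `([D, a]_σ, -σ(a); a, 0)`. -/
theorem isTwComm_double (a : A) : IsTwComm T.doubleD (T.doubleπ a) (T.doubleπ (T.σ a))
    (block (T.comm a) (-T.π (T.σ a)) (T.π a) 0) := by
  refine isTwComm_iff.2 fun x y h => ?_
  obtain ⟨h1, h2⟩ := T.mem_graph_doubleD.1 h
  rw [T.mem_graph_doubleD, doubleπ, doubleπ, diag_eq_block, diag_eq_block, block_apply, block_apply,
    block_apply]
  simp only [WithLp.toLp_fst, WithLp.toLp_snd, WithLp.add_fst, WithLp.add_snd, zero_apply,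
    neg_apply,
    add_zero, sub_zero, sub_self]
  refine ⟨?_, T.D.graph.zero_mem⟩
  have h3 := T.graph_comm a h1
  convert h3 using 2
  rw [map_sub]
  abel

theorem doubleComm_eq (a : A) :
    T.doubleComm a = block (T.comm a) (-T.π (T.σ a)) (T.π a) 0 :=
  twComm_eq T.dense_doubleDomain (T.isTwComm_double a)

theorem doubleComm_mul (a b : A) : T.doubleComm (a * b) =
    T.doubleComm a * T.doubleπ b + T.doubleπ (T.σ a) * T.doubleComm b := by
  simp only [doubleComm_eq, doubleπ, diag_eq_block, block_mul, block_add, map_mul, T.comm_mul]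
  congr 1 <;> simp

/-- The linear map `a ↦ [D̃, a]_σ`. -/
def doubleCommLin : A →ₗ[ℂ] (WithLp 2 (H × H) →L[ℂ] WithLp 2 (H × H)) where
  toFun := T.doubleComm
  map_add' a b := by
    simp only [doubleComm_eq, block_add, map_add, T.comm_add, add_zero, neg_add]
  map_smul' z a := by
    simp only [doubleComm_eq, block_smul, map_smul, T.comm_smul, smul_zero, smul_neg,
      RingHom.id_apply]

/-- The linear map underlying the representation on the double. -/
def doublePiLin : A →ₗ[ℂ] (WithLp 2 (H × H) →L[ℂ] WithLp 2 (H × H)) where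
  toFun := T.doubleπ
  map_add' a b := by
    simp only [doubleπ, diag_eq_block, block_add, map_add, add_zero]
  map_smul' z a := by
    simp only [doubleπ, diag_eq_block, block_smul, map_smul, smul_zero, RingHom.id_apply]

theorem doubleπ_mul (a b : A) : T.doubleπ (a * b) = T.doubleπ a * T.doubleπ b := by
  simp only [doubleπ, diag_eq_block, block_mul, map_mul]
  congr 1 <;> simp

theorem doubleγ_doubleπ (a : A) : T.doubleγ * T.doubleπ a = T.doubleπ a * T.doubleγ := by
  simp only [doubleγ, doubleπ, diag_eq_block, block_mul, T.π_even]
  congr 1 <;> simp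

/-- The bounded data of the double. -/
def doubleTriple : BddTriple A (WithLp 2 (H × H)) where
  γ := T.doubleγ
  Q := T.doubleInv
  π := T.doublePiLin
  π' := T.doublePiLin ∘ₗ T.σ.toLinearMap
  C := T.doubleCommLin
  π_mul := T.doubleπ_mul
  π'_mul a b := (congrArg T.doubleπ (map_mul T.σ a b)).trans (T.doubleπ_mul _ _)
  C_mul := T.doubleComm_mul
  rel a := rel_of_isTwComm T.isBoundedInverse_doubleInv
    (isTwComm_twComm ⟨_, T.isTwComm_double a⟩)
  γ_sq := by
    simp only [doubleγ, diag_eq_block, block_mul, neg_mul_neg, T.γ_sq]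
    rw [← block_one]
    congr 1 <;> simp
  γ_π := T.doubleγ_doubleπ
  γ_π' a := T.doubleγ_doubleπ _
  γ_Q := by
    refine odd_inverse T.isBoundedInverse_doubleInv fun x y h => ?_
    obtain ⟨h1, h2⟩ := T.mem_graph_doubleD.1 h
    rw [T.mem_graph_doubleD, doubleγ, diag_eq_block, block_apply, block_apply]
    simp only [WithLp.toLp_fst, WithLp.toLp_snd, WithLp.neg_fst, WithLp.neg_snd, zero_apply,
      neg_apply,
      add_zero, zero_add, neg_neg]
    constructor
    · convert T.graph_odd h1 using 2
      rw [map_sub]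
      abel
    · convert T.D.graph.neg_mem (T.graph_odd h2) using 1
      rw [Prod.neg_mk, neg_neg, map_sub]
  γ_C a := by
    change T.doubleγ * T.doubleComm a = -(T.doubleComm a * T.doubleγ)
    simp only [doubleγ, doubleComm_eq, diag_eq_block, block_mul, block_neg]
    congr 1 <;> simp [T.comm_odd, T.π_even]

end TwistedSpectralTriple

/-! ### The operators `b`, `A` and `B` on cochains -/

section Operators

variable {A : Type*} [Ring A] [Algebra ℂ A] {F : Type*} [AddCommGroup F] [Module ℂ F]

theorem comp_finRotate_symm {α : Type*} {m : ℕ} (a : Fin (m + 1) → α) :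
    (fun i => a ((finRotate (m + 1)).symm i)) = Fin.cons (a (Fin.last m)) (Fin.init a) := by
  funext i
  refine Fin.cases ?_ (fun i => ?_) i
  · rw [Fin.cons_zero]
    refine congrArg a ?_
    rw [Equiv.symm_apply_eq]
    simp
  · rw [Fin.cons_succ]
    refine congrArg a ?_
    rw [Equiv.symm_apply_eq]
    apply Fin.ext
    rw [val_finRotate]
    simp [i.2.ne]

theorem contractNth_zero {α : Type*} (op : α → α → α) {m : ℕ} (a : Fin (m + 2) → α) :
    Fin.contractNth 0 op a = Fin.cons (op (a 0) (a 1)) (Fin.tail (Fin.tail a)) := by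
  funext i
  refine Fin.cases ?_ (fun i => ?_) i
  · rw [Fin.cons_zero, Fin.contractNth_apply_of_eq _ _ _ _ (by simp)]
    rfl
  · rw [Fin.cons_succ, Fin.contractNth_apply_of_gt _ _ _ _ (by simp)]
    rfl

theorem contractNth_succ {α : Type*} (op : α → α → α) {m : ℕ} (j : Fin (m + 1))
    (a : Fin (m + 3) → α) : Fin.contractNth (j.succ.castSucc : Fin (m + 3)) op a =
      Fin.cons (a 0) (Fin.contractNth (j.castSucc : Fin (m + 2)) op (Fin.tail a)) := by
  funext i
  refine Fin.cases ?_ (fun i => ?_) i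
  · rw [Fin.cons_zero, Fin.contractNth_apply_of_lt _ _ _ _ (by simp)]
    rfl
  · rw [Fin.cons_succ]
    rcases lt_trichotomy (i : ℕ) (j : ℕ) with h | h | h
    · rw [Fin.contractNth_apply_of_lt _ _ _ _ (by simpa using h),
        Fin.contractNth_apply_of_lt _ _ _ _ (by simpa using h)]
      rfl
    · rw [Fin.contractNth_apply_of_eq _ _ _ _ (by simpa using h),
        Fin.contractNth_apply_of_eq _ _ _ _ (by simpa using h)]
      rfl
    · rw [Fin.contractNth_apply_of_gt _ _ _ _ (by simpa using h),
        Fin.contractNth_apply_of_gt _ _ _ _ (by simpa using h)]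
      rfl

theorem opT_apply {m : ℕ} (φ : MultiForm A m F) (a : Fin (m + 1) → A) :
    opT m φ a = (-1 : ℂ) ^ m • φ (Fin.cons (a (Fin.last m)) (Fin.init a)) := by
  rw [← comp_finRotate_symm]
  rfl

/-- The last term of `b φ` multiplies the last letter into the first one. -/
theorem opb_apply {m : ℕ} (φ : MultiForm A m F) (a : Fin (m + 2) → A) : opb m φ a =
    ∑ j : Fin (m + 1), (-1 : ℂ) ^ (j : ℕ) • φ (Fin.contractNth j.castSucc (· * ·) a) +
      (-1 : ℂ) ^ (m + 1) • φ (Fin.cons (a (Fin.last (m + 1)) * a 0) (Fin.tail (Fin.init a))) := by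
  have h : rot (m + 1) (face 0 φ) a =
      φ (Fin.cons (a (Fin.last (m + 1)) * a 0) (Fin.tail (Fin.init a))) := by
    rw [rot_apply, comp_finRotate_symm]
    change φ (Fin.contractNth 0 (· * ·) _) = _
    rw [contractNth_zero]
    rfl
  rw [opb, LinearMap.add_apply, add_apply, LinearMap.sum_apply, sum_apply, ← h]
  rfl

theorem opB₀_apply {m : ℕ} (φ : MultiForm A (m + 1) F) (a : Fin (m + 1) → A) :
    opB₀ m φ a = φ (Fin.cons 1 a) := rfl

theorem opT_pow_apply {m : ℕ} (φ : MultiForm A m F) (i : ℕ) (a : Fin (m + 1) → A) :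
    (opT m ^ i) φ a = ((-1 : ℂ) ^ m) ^ i • φ (fun k => a (((finRotate (m + 1)).symm ^ i) k)) := by
  induction i generalizing a with
  | zero => simp
  | succ i ih =>
    rw [pow_succ', Module.End.mul_apply]
    change (-1 : ℂ) ^ m • (opT m ^ i) φ (fun k => a ((finRotate (m + 1)).symm k)) = _
    rw [ih, smul_smul, pow_succ', pow_succ']
    rfl

theorem opT_pow_eq_one (m : ℕ) : opT (A := A) (F := F) m ^ (m + 1) = 1 := by
  refine LinearMap.ext fun φ => MultilinearMap.ext fun a => ?_
  have h : ((finRotate (m + 1)).symm) ^ (m + 1) = 1 := by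
    change (finRotate (m + 1))⁻¹ ^ (m + 1) = 1
    rw [inv_pow, finRotate_pow, inv_one]
  have h2 : ((-1 : ℂ) ^ m) ^ (m + 1) = 1 := by
    rw [← pow_mul]
    exact (Nat.even_mul_succ_self m).neg_one_pow
  rw [opT_pow_apply, h, h2, one_smul]
  rfl

theorem opT_opA (m : ℕ) : opT (A := A) (F := F) m * opA m = opA m := by
  have h := Finset.sum_range_succ' (fun i => opT (A := A) (F := F) m ^ i) (m + 1)
  rw [Finset.sum_range_succ, opT_pow_eq_one, pow_zero] at h
  rw [opA, Finset.mul_sum]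
  simp only [← pow_succ']
  exact (add_right_cancel h).symm

theorem opA_opT (m : ℕ) : opA m * opT (A := A) (F := F) m = opA m := by
  have h : Commute (opA m) (opT (A := A) (F := F) m) :=
    Commute.sum_left _ _ _ fun i _ => (Commute.refl _).pow_left i
  rw [h.eq, opT_opA]

theorem opT_opA_apply {m : ℕ} (φ : MultiForm A m F) : opT m (opA m φ) = opA m φ :=
  congrArg (fun f => f φ) (opT_opA (A := A) (F := F) m)

theorem opA_opT_apply {m : ℕ} (φ : MultiForm A m F) : opA m (opT m φ) = opA m φ :=
  congrArg (fun f => f φ) (opA_opT (A := A) (F := F) m)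

/-- `B` vanishes on cyclic cochains, since it contains the factor `1 - T`. -/
theorem opB_opA {m : ℕ} (φ : MultiForm A (m + 1) F) : opB m (opA (m + 1) φ) = 0 := by
  have h : (LinearMap.id - opT (m + 1) : MultiForm A (m + 1) F →ₗ[ℂ] MultiForm A (m + 1) F)
      (opA (m + 1) φ) = 0 := by
    rw [LinearMap.sub_apply, opT_opA_apply]
    exact sub_self _
  exact (congrArg (opA m ∘ₗ opB₀ m) h).trans (map_zero _)

theorem opA_of_opT_eq {m : ℕ} {φ : MultiForm A m F} (h : opT m φ = φ) :
    opA m φ = ((m + 1 : ℕ) : ℂ) • φ := by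
  have h1 : ∀ i, (opT m ^ i) φ = φ := fun i => by
    induction i with
    | zero => rfl
    | succ i ih => rw [pow_succ, Module.End.mul_apply, h, ih]
  rw [opA, LinearMap.sum_apply, Finset.sum_congr rfl fun i _ => h1 i, Finset.sum_const,
    Finset.card_range, Nat.cast_smul_eq_nsmul]

/-- The sum `b'` of the faces that do not involve the cyclic permutation. -/
def opb' (m : ℕ) : MultiForm A m F →ₗ[ℂ] MultiForm A (m + 1) F :=
  ∑ j : Fin (m + 1), (-1 : ℂ) ^ (j : ℕ) • face j

theorem opb'_apply {m : ℕ} (φ : MultiForm A m F) (a : Fin (m + 2) → A) : opb' m φ a =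
    ∑ j : Fin (m + 1), (-1 : ℂ) ^ (j : ℕ) • φ (Fin.contractNth j.castSucc (· * ·) a) := by
  rw [opb', LinearMap.sum_apply, sum_apply]
  rfl

theorem rot_face_succ {m : ℕ} (j : Fin (m + 1)) (φ : MultiForm A (m + 1) F) :
    rot (m + 2) (face j.succ φ) = face j.castSucc (rot (m + 1) φ) := by
  refine MultilinearMap.ext fun a => ?_
  rw [rot_apply, comp_finRotate_symm]
  change φ (Fin.contractNth (j.succ.castSucc : Fin (m + 3)) _ _) =
    φ fun i => Fin.contractNth (j.castSucc.castSucc : Fin (m + 3)) _ a ((finRotate (m + 2)).symm i)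
  rw [comp_finRotate_symm, contractNth_succ]
  congr 1
  refine congrArg₂ (fun x y => (Fin.cons x y : Fin (m + 2) → A)) ?_ ?_
  · rw [Fin.contractNth_apply_of_gt _ _ _ _ (by simp; omega)]
    rfl
  · funext i
    rw [Fin.tail_cons]
    change _ = Fin.contractNth (j.castSucc.castSucc : Fin (m + 3)) _ a i.castSucc
    rcases lt_trichotomy (i : ℕ) (j : ℕ) with h | h | h
    · rw [Fin.contractNth_apply_of_lt _ _ _ _ (by simpa using h),
        Fin.contractNth_apply_of_lt _ _ _ _ (by simpa using h)]
      rfl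
    · rw [Fin.contractNth_apply_of_eq _ _ _ _ (by simpa using h),
        Fin.contractNth_apply_of_eq _ _ _ _ (by simpa using h)]
      rfl
    · rw [Fin.contractNth_apply_of_gt _ _ _ _ (by simpa using h),
        Fin.contractNth_apply_of_gt _ _ _ _ (by simpa using h)]
      rfl

/-- With `d_j = (-1)^j face j`, one has `T d_{j+1} = d_j T`. -/
theorem opT_face_succ {m : ℕ} (j : Fin (m + 1)) (φ : MultiForm A (m + 1) F) :
    opT (m + 2) ((-1 : ℂ) ^ (j.succ : ℕ) • face j.succ φ) =
      (-1 : ℂ) ^ (j.castSucc : ℕ) • face j.castSucc (opT (m + 1) φ) := by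
  rw [opT, opT, LinearMap.smul_apply, LinearMap.smul_apply, map_smul, rot_face_succ, map_smul,
    smul_smul, smul_smul, Fin.val_succ, Fin.val_castSucc]
  congr 1
  ring

/-- `b A = A b'`. -/
theorem opb_opA {m : ℕ} (φ : MultiForm A (m + 1) F) :
    opb (m + 1) (opA (m + 1) φ) = opA (m + 2) (opb' (m + 1) φ) := by
  set d : Fin (m + 2) → MultiForm A (m + 1) F → MultiForm A (m + 2) F :=
    fun j φ => (-1 : ℂ) ^ (j : ℕ) • face j φ with hd
  have hT : ∀ (j : Fin (m + 1)) (φ : MultiForm A (m + 1) F),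
      opT (m + 2) (d j.succ φ) = d j.castSucc (opT (m + 1) φ) := opT_face_succ
  -- Both sides are `A d₀` applied to an invariant cochain: modulo the image of `1 - T`, on which
  -- `A` vanishes, `d_{j+1}` may be replaced by `d_j T`.
  have h1 : ∀ (j : ℕ) (hj : j < m + 2) (φ : MultiForm A (m + 1) F),
      opA (m + 2) (d ⟨j, hj⟩ φ) = opA (m + 2) (d 0 ((opT (m + 1) ^ j) φ)) := by
    intro j
    induction j with
    | zero => intro hj φ; rfl
    | succ j ih =>
      intro hj φ
      have h := hT ⟨j, by omega⟩ φ
      rw [← opA_opT_apply]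
      refine (congrArg (opA (m + 2)) h).trans ?_
      refine (ih (by omega) _).trans ?_
      rw [pow_succ]
      rfl
  have hadd : ∀ j, ∀ s : Finset ℕ, ∀ f : ℕ → MultiForm A (m + 1) F,
      d j (∑ i ∈ s, f i) = ∑ i ∈ s, d j (f i) := fun j s f => by
    simp only [hd, map_sum, Finset.smul_sum]
  have h2 : opA (m + 2) (opb' (m + 1) φ) = opA (m + 2) (d 0 (opA (m + 1) φ)) := by
    have e : d 0 (opA (m + 1) φ) = ∑ i ∈ Finset.range (m + 2), d 0 ((opT (m + 1) ^ i) φ) := by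
      rw [opA, LinearMap.sum_apply, hadd]
    rw [opb', LinearMap.sum_apply, map_sum, e, map_sum, Finset.sum_range]
    exact Finset.sum_congr rfl fun j _ => h1 j.1 j.2 φ
  set ψ := opA (m + 1) φ with hψ
  have hψT : opT (m + 1) ψ = ψ := opT_opA_apply φ
  -- On a `T`-invariant cochain the `d_j`, in decreasing order of `j`, form an orbit of `T`
  -- beginning with `d_{m+1}`; the cyclic face is the last member of the orbit.
  have h3 : ∀ (i : ℕ) (hi : i ≤ m + 1), d ⟨m + 1 - i, by omega⟩ ψ =
      (opT (m + 2) ^ i) (d (Fin.last (m + 1)) ψ) := by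
    intro i
    induction i with
    | zero => intro _; rfl
    | succ i ih =>
      intro hi
      have h := hT ⟨m + 1 - (i + 1), by omega⟩ ψ
      rw [hψT] at h
      refine h.symm.trans ?_
      rw [pow_succ', Module.End.mul_apply, ← ih (by omega)]
      congr 2
      exact Fin.ext (by simp only [Fin.val_succ]; omega)
  have h4 : opb (m + 1) ψ = opA (m + 2) (d (Fin.last (m + 1)) ψ) := by
    have e0 : opT (m + 2) (d 0 ψ) = (-1 : ℂ) ^ (m + 1 + 1) • rot (m + 1 + 1) (face 0 ψ) := by
      simp only [hd, opT, Fin.val_zero, pow_zero, one_smul]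
      rfl
    have e1 : opb (m + 1) ψ = ∑ j : Fin (m + 2), d j ψ + opT (m + 2) (d 0 ψ) := by
      rw [e0, opb, LinearMap.add_apply, LinearMap.sum_apply]
      rfl
    have e2 := h3 (m + 1) le_rfl
    have e3 : d 0 ψ = (opT (m + 2) ^ (m + 1)) (d (Fin.last (m + 1)) ψ) := by
      rw [← e2]
      congr 1
      exact Fin.ext (by simp)
    have e4 : ∑ j : Fin (m + 2), d j ψ = ∑ i ∈ Finset.range (m + 2),
        (opT (m + 2) ^ i) (d (Fin.last (m + 1)) ψ) := by
      rw [Finset.sum_range, ← Equiv.sum_comp Fin.revPerm]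
      refine Finset.sum_congr rfl fun j _ => ?_
      rw [← h3 j (by omega)]
      congr 1
      exact Fin.ext (by simp [Fin.val_rev])
    rw [e1, e3, e4, ← Module.End.mul_apply, ← pow_succ', opA, LinearMap.sum_apply,
      ← Finset.sum_range_succ]
  rw [h4, h2]
  refine (h1 (m + 1) (by omega) ψ).trans ?_
  have h5 : ∀ i, (opT (m + 1) ^ i) ψ = ψ := fun i => by
    induction i with
    | zero => rfl
    | succ i ih => rw [pow_succ, Module.End.mul_apply, hψT, ih]
  rw [h5]

end Operators

/-! ### Cyclic cocycles of quasi-homomorphisms -/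

section QuasiHom

/-- A filtered algebra with a functional that is a trace in filtration degrees `≥ n`. -/
structure FilteredTrace (𝓑 : Type*) [Ring 𝓑] [Algebra ℂ 𝓑] (n : ℕ) where
  F : ℕ → Submodule ℂ 𝓑
  θ : 𝓑 →ₗ[ℂ] ℂ
  one_mem : 1 ∈ F 0
  mul_mem : ∀ {j k x y}, x ∈ F j → y ∈ F k → x * y ∈ F (j + k)
  trace : ∀ {j k x y}, n ≤ j + k → x ∈ F j → y ∈ F k → θ (x * y) = θ (y * x)

/-- A pair of (not necessarily unital) homomorphisms that are equal modulo filtration degree `1`. -/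
structure QuasiHom (A : Type*) [Ring A] [Algebra ℂ A] {𝓑 : Type*} [Ring 𝓑] [Algebra ℂ 𝓑] {n : ℕ}
    (𝓕 : FilteredTrace 𝓑 n) where
  ρ₀ : A →ₗ[ℂ] 𝓑
  ρ₁ : A →ₗ[ℂ] 𝓑
  ρ₀_mul : ∀ a b, ρ₀ (a * b) = ρ₀ a * ρ₀ b
  ρ₁_mul : ∀ a b, ρ₁ (a * b) = ρ₁ a * ρ₁ b
  ρ₀_mem : ∀ a, ρ₀ a ∈ 𝓕.F 0
  ρ₁_mem : ∀ a, ρ₁ a ∈ 𝓕.F 0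
  sub_mem : ∀ a, ρ₀ a - ρ₁ a ∈ 𝓕.F 1

namespace QuasiHom

variable {A : Type*} [Ring A] [Algebra ℂ A] {𝓑 : Type*} [Ring 𝓑] [Algebra ℂ 𝓑] {n : ℕ}
  {𝓕 : FilteredTrace 𝓑 n} (X : QuasiHom A 𝓕)

/-- The difference of the two homomorphisms. -/
def ω : A →ₗ[ℂ] 𝓑 := X.ρ₀ - X.ρ₁

theorem ω_apply (a : A) : X.ω a = X.ρ₀ a - X.ρ₁ a := rfl

theorem ω_mem (a : A) : X.ω a ∈ 𝓕.F 1 := X.sub_mem a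

/-- `ω(a⁰) ⋯ ω(aˡ⁻¹)`. -/
def W (l : ℕ) : MultilinearMap ℂ (fun _ : Fin l => A) 𝓑 :=
  (MultilinearMap.mkPiAlgebraFin ℂ l 𝓑).compLinearMap fun _ => X.ω

theorem W_apply {l : ℕ} (a : Fin l → A) : X.W l a = (List.ofFn fun j => X.ω (a j)).prod := rfl

theorem W_zero (a : Fin 0 → A) : X.W 0 a = 1 := by rw [W_apply, List.ofFn_zero, List.prod_nil]

theorem W_succ {l : ℕ} (a : Fin (l + 1) → A) : X.W (l + 1) a = X.ω (a 0) * X.W l (Fin.tail a) := by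
  rw [W_apply, List.ofFn_succ, List.prod_cons]
  rfl

theorem W_last {l : ℕ} (a : Fin (l + 1) → A) :
    X.W (l + 1) a = X.W l (Fin.init a) * X.ω (a (Fin.last l)) := by
  rw [W_apply, List.ofFn_succ', List.prod_concat]
  rfl

theorem W_cons {l : ℕ} (x : A) (a : Fin l → A) :
    X.W (l + 1) (Fin.cons x a) = X.ω x * X.W l a := by
  rw [W_succ, Fin.cons_zero, Fin.tail_cons]

theorem W_mem {l : ℕ} (a : Fin l → A) : X.W l a ∈ 𝓕.F l := by
  induction l with
  | zero => rw [W_zero]; exact 𝓕.one_mem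
  | succ l ih => rw [W_last]; exact 𝓕.mul_mem (ih _) (X.ω_mem _)

theorem ω_mul (a b : A) : X.ω (a * b) = X.ρ₀ a * X.ω b + X.ω a * X.ρ₁ b := by
  simp only [ω_apply, X.ρ₀_mul, X.ρ₁_mul]
  noncomm_ring

theorem ω_mul' (a b : A) : X.ω (a * b) = X.ρ₁ a * X.ω b + X.ω a * X.ρ₀ b := by
  simp only [ω_apply, X.ρ₀_mul, X.ρ₁_mul]
  noncomm_ring

/-- The alternating sum of the products with two adjacent letters multiplied. -/
def faces {l : ℕ} (a : Fin (l + 2) → A) : 𝓑 :=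
  ∑ j : Fin (l + 1), (-1 : ℂ) ^ (j : ℕ) • X.W (l + 1) (Fin.contractNth j.castSucc (· * ·) a)

theorem faces_succ {l : ℕ} (a : Fin (l + 3) → A) : X.faces a =
    X.ω (a 0 * a 1) * X.W (l + 1) (Fin.tail (Fin.tail a)) - X.ω (a 0) * X.faces (Fin.tail a) := by
  rw [faces, Fin.sum_univ_succ, Fin.castSucc_zero, contractNth_zero, W_cons, faces, Finset.mul_sum,
    sub_eq_add_neg, ← Finset.sum_neg_distrib]
  simp only [contractNth_succ, W_cons, Fin.val_zero, pow_zero, one_smul, Fin.val_succ, pow_succ,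
    mul_neg, mul_one, neg_smul, mul_smul_comm]

theorem faces_zero (a : Fin 2 → A) : X.faces a = X.ω (a 0 * a 1) := by
  rw [faces, Fin.sum_univ_succ, Fin.castSucc_zero, contractNth_zero, W_cons, W_zero]
  simp

/-- The alternating sum of faces telescopes; the result depends on the parity of the number of
letters. -/
theorem faces_eq (q : ℕ) :
    (∀ a : Fin (2 * q + 2) → A, X.faces a = X.ρ₀ (a 0) * X.W (2 * q + 1) (Fin.tail a) +
      X.W (2 * q + 1) (Fin.init a) * X.ρ₁ (a (Fin.last _))) ∧
    (∀ a : Fin (2 * q + 3) → A, X.faces a = X.ρ₁ (a 0) * X.W (2 * q + 2) (Fin.tail a) -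
      X.W (2 * q + 2) (Fin.init a) * X.ρ₁ (a (Fin.last _))) := by
  have hinit : ∀ (l : ℕ) (a : Fin (l + 3) → A), X.ω (a 0) * X.W (l + 1) (Fin.init (Fin.tail a)) =
      X.W (l + 2) (Fin.init a) := fun l a => by
    rw [X.W_succ (Fin.init a), ← Fin.tail_init_eq_init_tail]
    rfl
  have h01 : ∀ (l : ℕ) (a : Fin (l + 3) → A), X.W (l + 2) (Fin.tail a) =
      X.ω (a 1) * X.W (l + 1) (Fin.tail (Fin.tail a)) := fun l a => X.W_succ _
  -- Removing the first letter: one of the two forms of the Leibniz rule of `ω` is used according to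
  -- parity, so that the terms in which `ω(a⁰)` precedes a value of `ρ₀` or `ρ₁` cancel.
  have step : ∀ q, (∀ a : Fin (2 * q + 2) → A, X.faces a =
      X.ρ₀ (a 0) * X.W (2 * q + 1) (Fin.tail a) +
      X.W (2 * q + 1) (Fin.init a) * X.ρ₁ (a (Fin.last _))) →
    (∀ a : Fin (2 * q + 3) → A, X.faces a = X.ρ₁ (a 0) * X.W (2 * q + 2) (Fin.tail a) -
      X.W (2 * q + 2) (Fin.init a) * X.ρ₁ (a (Fin.last _))) := fun q h a => by
    rw [faces_succ, h, X.ω_mul', mul_add (X.ω (a 0)), ← mul_assoc (X.ω (a 0)) (X.W _ _), hinit, h01]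
    have e1 : Fin.tail a 0 = a 1 := rfl
    have e2 : Fin.tail a (Fin.last _) = a (Fin.last _) := rfl
    rw [e1, e2]
    noncomm_ring
  have step' : ∀ q, (∀ a : Fin (2 * q + 3) → A, X.faces a =
      X.ρ₁ (a 0) * X.W (2 * q + 2) (Fin.tail a) -
      X.W (2 * q + 2) (Fin.init a) * X.ρ₁ (a (Fin.last _))) →
    (∀ a : Fin (2 * q + 4) → A, X.faces a = X.ρ₀ (a 0) * X.W (2 * q + 3) (Fin.tail a) +
      X.W (2 * q + 3) (Fin.init a) * X.ρ₁ (a (Fin.last _))) := fun q h a => by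
    rw [faces_succ, h, X.ω_mul, mul_sub (X.ω (a 0)), ← mul_assoc (X.ω (a 0)) (X.W _ _), hinit,
      h01 (2 * q + 1) a]
    have e1 : Fin.tail a 0 = a 1 := rfl
    have e2 : Fin.tail a (Fin.last _) = a (Fin.last _) := rfl
    rw [e1, e2]
    noncomm_ring
  have h0 : ∀ a : Fin (2 * 0 + 2) → A, X.faces a =
      X.ρ₀ (a 0) * X.W (2 * 0 + 1) (Fin.tail a) +
      X.W (2 * 0 + 1) (Fin.init a) * X.ρ₁ (a (Fin.last _)) := fun a => by
    refine (X.faces_zero a).trans ?_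
    rw [W_succ, W_succ, W_zero, W_zero, mul_one, mul_one, X.ω_mul]
    rfl
  have hall : ∀ q, ∀ a : Fin (2 * q + 2) → A, X.faces a =
      X.ρ₀ (a 0) * X.W (2 * q + 1) (Fin.tail a) +
      X.W (2 * q + 1) (Fin.init a) * X.ρ₁ (a (Fin.last _)) := fun q => by
    induction q with
    | zero => exact h0
    | succ q ih => exact step' q (step q ih)
  exact ⟨hall q, step q (hall q)⟩

/-- `θ(ω(a⁰) ⋯ ω(aᵐ))`. -/
def form (m : ℕ) : MultiForm A m ℂ := 𝓕.θ.compMultilinearMap (X.W (m + 1))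

theorem form_apply {m : ℕ} (a : Fin (m + 1) → A) : X.form m a = 𝓕.θ (X.W (m + 1) a) := rfl

theorem opT_form {q : ℕ} (hn : n ≤ 2 * q + 1) : opT (2 * q) (X.form (2 * q)) = X.form (2 * q) := by
  refine MultilinearMap.ext fun a => ?_
  rw [opT_apply, form_apply, form_apply, W_cons, W_last, pow_mul, neg_one_sq, one_pow, one_smul]
  exact 𝓕.trace (by omega) (X.ω_mem _) (X.W_mem _)

/-- By `faces_eq`, the faces of `θ(ω ⋯ ω)` add up to two boundary terms, which cancel the cyclic
face by the trace property and the Leibniz rule of `ω`. -/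
theorem opb_form {q : ℕ} (hn : n ≤ 2 * q + 1) : opb (2 * q) (X.form (2 * q)) = 0 := by
  refine MultilinearMap.ext fun a => ?_
  rw [opb_apply, zero_apply]
  have h1 : ∑ j : Fin (2 * q + 1), (-1 : ℂ) ^ (j : ℕ) •
      X.form (2 * q) (Fin.contractNth j.castSucc (· * ·) a) = 𝓕.θ (X.faces a) := by
    rw [faces, map_sum]
    exact Finset.sum_congr rfl fun j _ => (map_smul 𝓕.θ _ _).symm
  have e : X.W (2 * q + 1) (Fin.tail a) =
      X.W (2 * q) (Fin.tail (Fin.init a)) * X.ω (a (Fin.last _)) := by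
    rw [W_last, ← Fin.tail_init_eq_init_tail]
    rfl
  have e' : X.W (2 * q + 1) (Fin.init a) = X.ω (a 0) * X.W (2 * q) (Fin.tail (Fin.init a)) := by
    rw [W_succ]
    rfl
  have h2 : (-1 : ℂ) ^ (2 * q + 1) = -1 := by rw [pow_succ, pow_mul]; simp
  rw [h1, (X.faces_eq q).1, form_apply, W_cons, X.ω_mul', map_add, add_mul, map_add, h2,
    𝓕.trace (by omega) (X.W_mem (Fin.init a)) (X.ρ₁_mem _), e, ← mul_assoc,
    𝓕.trace (j := 0 + 2 * q) (k := 1) (by omega) (𝓕.mul_mem (X.ρ₀_mem _) (X.W_mem _)) (X.ω_mem _),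
    e', mul_assoc, mul_assoc, neg_one_smul]
  abel

theorem isCyclicCocycle_form {q : ℕ} (hn : n ≤ 2 * q + 1) : IsCyclicCocycle (X.form (2 * q)) :=
  ⟨X.opT_form hn, X.opb_form hn⟩

/-- The cochain `θ((ρ₀ + ρ₁)(a⁰) ω(a¹) ⋯ ω(aᵐ))`, which relates the cocycles in degrees `m - 1` and
`m + 1`. -/
def transgression (m : ℕ) : MultiForm A m ℂ :=
  𝓕.θ.compMultilinearMap ((MultilinearMap.mkPiAlgebraFin ℂ (m + 1) 𝓑).compLinearMap
    (Fin.cons (X.ρ₀ + X.ρ₁) fun _ => X.ω))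

theorem transgression_apply {m : ℕ} (a : Fin (m + 1) → A) :
    X.transgression m a = 𝓕.θ ((X.ρ₀ (a 0) + X.ρ₁ (a 0)) * X.W m (Fin.tail a)) := by
  rw [transgression, LinearMap.compMultilinearMap_apply, MultilinearMap.compLinearMap_apply,
    MultilinearMap.mkPiAlgebraFin_apply, List.ofFn_succ, List.prod_cons]
  rfl

theorem transgression_cons {m : ℕ} (x : A) (a : Fin m → A) :
    X.transgression m (Fin.cons x a) = 𝓕.θ ((X.ρ₀ x + X.ρ₁ x) * X.W m a) := by
  rw [transgression_apply, Fin.cons_zero, Fin.tail_cons]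

/-- The transgression cochain satisfies `b χ = θ(ω ⋯ ω)` in the degree above it, and by
`opB_transgression` it satisfies `B χ = 2 (2q + 1) θ(ω ⋯ ω)` in the degree below. Hence the cocycles
of degrees `2q` and `2q + 2`, suitably normalized, are cohomologous for `b + B`. -/
theorem opb_transgression {q : ℕ} (hn : n ≤ 2 * q + 1) :
    opb (2 * q + 1) (X.transgression (2 * q + 1)) = X.form (2 * q + 2) := by
  refine MultilinearMap.ext fun a => ?_
  rw [opb_apply]
  set x := a (Fin.last (2 * q + 2)) with hx
  set w := X.W (2 * q + 1) (Fin.tail (Fin.init a)) with hw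
  have h2 : (-1 : ℂ) ^ (2 * q + 1 + 1) = 1 := by
    rw [pow_succ, pow_succ, pow_mul]; simp
  have h1 : ∑ j : Fin (2 * q + 2), (-1 : ℂ) ^ (j : ℕ) •
      X.transgression (2 * q + 1) (Fin.contractNth j.castSucc (· * ·) a) =
      𝓕.θ ((X.ρ₀ (a 0 * a 1) + X.ρ₁ (a 0 * a 1)) * X.W (2 * q + 1) (Fin.tail (Fin.tail a)) -
        (X.ρ₀ (a 0) + X.ρ₁ (a 0)) * X.faces (Fin.tail a)) := by
    rw [Fin.sum_univ_succ, Fin.castSucc_zero, contractNth_zero, transgression_cons, faces,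
      Finset.mul_sum, sub_eq_add_neg, ← Finset.sum_neg_distrib, map_add, map_sum]
    simp only [contractNth_succ, transgression_cons, Fin.val_zero, pow_zero, one_smul, Fin.val_succ,
      pow_succ, mul_neg, mul_one, neg_smul, mul_smul_comm, map_neg, map_smul]
  have e1 : Fin.tail a 0 = a 1 := rfl
  have e2 : Fin.tail a (Fin.last _) = x := rfl
  have e3 : X.W (2 * q + 1) (Fin.init (Fin.tail a)) = w := by rw [hw, Fin.tail_init_eq_init_tail]
  have e4 : X.W (2 * q + 2) (Fin.tail a) = X.ω (a 1) * X.W (2 * q + 1) (Fin.tail (Fin.tail a)) :=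
    X.W_succ _
  have e5 : X.W (2 * q + 2) (Fin.tail a) = w * X.ω x := by rw [W_last, e3, e2]
  have e6 : X.W (2 * q + 2 + 1) a = (X.ρ₀ (a 0) - X.ρ₁ (a 0)) * X.W (2 * q + 2) (Fin.tail a) :=
    X.W_succ a
  have hwm : w ∈ 𝓕.F (2 * q + 1) := X.W_mem _
  -- The faces away from the cyclic one; `faces_eq` is applied to the `2q + 2` letters `a¹, …`.
  have h3 : (X.ρ₀ (a 0 * a 1) + X.ρ₁ (a 0 * a 1)) * X.W (2 * q + 1) (Fin.tail (Fin.tail a)) -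
        (X.ρ₀ (a 0) + X.ρ₁ (a 0)) * X.faces (Fin.tail a) =
      -(X.ρ₁ (a 0) * X.W (2 * q + 2) (Fin.tail a)) -
        (X.ρ₀ (a 0) + X.ρ₁ (a 0)) * w * X.ρ₁ x := by
    rw [(X.faces_eq q).1, e1, e2, e3, e4, X.ρ₀_mul, X.ρ₁_mul, ω_apply]
    noncomm_ring
  have h4 : 𝓕.θ ((X.ρ₀ (a 0) + X.ρ₁ (a 0)) * w * X.ρ₁ x) =
      𝓕.θ (X.ρ₁ x * ((X.ρ₀ (a 0) + X.ρ₁ (a 0)) * w)) :=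
    𝓕.trace (j := 0 + (2 * q + 1)) (k := 0) (by omega)
      (𝓕.mul_mem (add_mem (X.ρ₀_mem _) (X.ρ₁_mem _)) hwm) (X.ρ₁_mem _)
  have h5 : 𝓕.θ (X.ρ₀ (a 0) * X.W (2 * q + 2) (Fin.tail a)) =
      𝓕.θ (X.ω x * (X.ρ₀ (a 0) * w)) := by
    rw [e5, ← mul_assoc]
    exact 𝓕.trace (j := 0 + (2 * q + 1)) (k := 1) (by omega)
      (𝓕.mul_mem (X.ρ₀_mem _) hwm) (X.ω_mem _)
  have h6 : (X.ρ₀ (x * a 0) + X.ρ₁ (x * a 0)) * w =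
      X.ρ₁ x * ((X.ρ₀ (a 0) + X.ρ₁ (a 0)) * w) + X.ω x * (X.ρ₀ (a 0) * w) := by
    rw [X.ρ₀_mul, X.ρ₁_mul, ω_apply]
    noncomm_ring
  rw [h1, h3, transgression_cons, h2, one_smul, h6, map_add, map_sub, h4, form_apply, e6, sub_mul,
    map_sub, h5, map_neg]
  abel

theorem opB_transgression {q : ℕ} (hn : n ≤ 2 * q + 1) :
    opB (2 * q) (X.transgression (2 * q + 1)) = (2 * (2 * q + 1) : ℂ) • X.form (2 * q) := by
  -- `B₀ (1 - T) χ = 2 θ(ω ⋯ ω)`; as this form is already cyclic, the cyclic sum gives `2q + 1`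
  -- copies.
  have h : opB₀ (2 * q) ((LinearMap.id - opT (2 * q + 1) :
      MultiForm A (2 * q + 1) ℂ →ₗ[ℂ] MultiForm A (2 * q + 1) ℂ) (X.transgression (2 * q + 1))) =
      (2 : ℂ) • X.form (2 * q) := by
    refine MultilinearMap.ext fun a => ?_
    set x := a (Fin.last (2 * q)) with hx
    set w := X.W (2 * q) (Fin.init a) with hw
    have hwm : w ∈ 𝓕.F (2 * q) := X.W_mem _
    have h2 : (-1 : ℂ) ^ (2 * q + 1) = -1 := by rw [pow_succ, pow_mul]; simp
    have e1 : (Fin.cons 1 a : Fin (2 * q + 2) → A) (Fin.last (2 * q + 1)) = x := rfl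
    have e2 : (Fin.init (Fin.cons 1 a : Fin (2 * q + 2) → A) : Fin (2 * q + 1) → A) =
        Fin.cons 1 (Fin.init a) := by
      funext i
      refine Fin.cases rfl (fun i => ?_) i
      rw [Fin.cons_succ, Fin.init, ← Fin.succ_castSucc, Fin.cons_succ]
      rfl
    have e3 : X.W (2 * q + 1) a = w * X.ω x := X.W_last a
    have h3 : (X.ρ₀ x + X.ρ₁ x) * (X.ω 1 * w) = (2 : ℂ) • (X.ω x * w) -
        X.ω x * ((X.ρ₀ 1 + X.ρ₁ 1) * w) := by
      have h0 : X.ρ₀ x * X.ρ₀ 1 = X.ρ₀ x := by rw [← X.ρ₀_mul, mul_one]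
      have h1 : X.ρ₁ x * X.ρ₁ 1 = X.ρ₁ x := by rw [← X.ρ₁_mul, mul_one]
      have h4 : (X.ρ₀ x + X.ρ₁ x) * X.ω 1 = (2 : ℂ) • X.ω x - X.ω x * (X.ρ₀ 1 + X.ρ₁ 1) := by
        rw [ω_apply, ω_apply, two_smul]
        simp only [add_mul, mul_sub, sub_mul, mul_add, h0, h1]
        abel
      rw [← mul_assoc, h4, sub_mul, smul_mul_assoc, mul_assoc]
    have h4 : 𝓕.θ (X.ω x * ((X.ρ₀ 1 + X.ρ₁ 1) * w)) =
        𝓕.θ ((X.ρ₀ 1 + X.ρ₁ 1) * w * X.ω x) :=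
      (𝓕.trace (j := 0 + 2 * q) (k := 1) (by omega)
        (𝓕.mul_mem (add_mem (X.ρ₀_mem _) (X.ρ₁_mem _)) hwm) (X.ω_mem _)).symm
    have h5 : 𝓕.θ (X.ω x * w) = 𝓕.θ (w * X.ω x) :=
      𝓕.trace (by omega) (X.ω_mem _) hwm
    rw [opB₀_apply]
    change X.transgression (2 * q + 1) (Fin.cons 1 a) -
      opT (2 * q + 1) (X.transgression (2 * q + 1)) (Fin.cons 1 a) = 2 * X.form (2 * q) a
    rw [opT_apply, e1, e2, transgression_cons, transgression_cons, h2, W_cons, h3, map_sub,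
      map_smul,
      h4, h5, form_apply, e3, ← mul_assoc, smul_eq_mul, smul_eq_mul]
    ring
  rw [opB, LinearMap.comp_apply, LinearMap.comp_apply, h, map_smul, opA_of_opT_eq (X.opT_form hn),
    smul_smul]
  push_cast
  rfl

/-- `θ(Y ω(a⁰) ⋯ ω(aᵐ))`. -/
def insertForm (Y : 𝓑) (m : ℕ) : MultiForm A m ℂ :=
  (𝓕.θ ∘ₗ LinearMap.mulLeft ℂ Y).compMultilinearMap (X.W (m + 1))

theorem insertForm_apply (Y : 𝓑) {m : ℕ} (a : Fin (m + 1) → A) :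
    X.insertForm Y m a = 𝓕.θ (Y * X.W (m + 1) a) := rfl

/-- `θ(δ(a⁰) ω(a¹) ⋯ ω(aᵐ))`. -/
def derivForm (δ : A →ₗ[ℂ] 𝓑) (m : ℕ) : MultiForm A m ℂ :=
  𝓕.θ.compMultilinearMap ((MultilinearMap.mkPiAlgebraFin ℂ (m + 1) 𝓑).compLinearMap
    (Fin.cons δ fun _ => X.ω))

theorem derivForm_apply (δ : A →ₗ[ℂ] 𝓑) {m : ℕ} (a : Fin (m + 1) → A) :
    X.derivForm δ m a = 𝓕.θ (δ (a 0) * X.W m (Fin.tail a)) := by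
  rw [derivForm, LinearMap.compMultilinearMap_apply, MultilinearMap.compLinearMap_apply,
    MultilinearMap.mkPiAlgebraFin_apply, List.ofFn_succ, List.prod_cons]
  rfl

/-- The infinitesimal variation of the cocycle along `δ = [Y, ρ₁]` is a coboundary. -/
theorem opb_opA_insertForm {q : ℕ} (hn : n ≤ 2 * q + 3) {Y : 𝓑} (hY : Y ∈ 𝓕.F 1)
    {δ : A →ₗ[ℂ] 𝓑} (hδ : ∀ a, δ a = Y * X.ρ₁ a - X.ρ₁ a * Y) :
    opb (2 * q + 1) (opA (2 * q + 1) (X.insertForm Y (2 * q + 1))) =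
      opA (2 * q + 2) (X.derivForm δ (2 * q + 2)) := by
  -- `κ` is the form with first letter `ρ₁(a⁰) Y`. The faces of `θ(Y ω ⋯ ω)` add up to the form with
  -- first letter `Y ρ₁(a⁰)` minus `T κ`, and `A` does not distinguish `T κ` from `κ`.
  set κ := X.derivForm (LinearMap.mulRight ℂ Y ∘ₗ X.ρ₁) (2 * q + 2) with hκ
  have hsign : (-1 : ℂ) ^ (2 * q + 2) = 1 := by rw [pow_succ, pow_succ, pow_mul]; simp
  have h1 : opb' (2 * q + 1) (X.insertForm Y (2 * q + 1)) =
      X.derivForm (LinearMap.mulLeft ℂ Y ∘ₗ X.ρ₁) (2 * q + 2) - opT (2 * q + 2) κ := by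
    refine MultilinearMap.ext fun a => ?_
    have e : opb' (2 * q + 1) (X.insertForm Y (2 * q + 1)) a = 𝓕.θ (Y * X.faces a) := by
      rw [opb'_apply, faces, Finset.mul_sum, map_sum]
      refine Finset.sum_congr rfl fun j _ => ?_
      rw [mul_smul_comm, map_smul]
      rfl
    rw [e, (X.faces_eq q).2, mul_sub, map_sub, sub_apply, opT_apply, hsign, one_smul, hκ,
      derivForm_apply, derivForm_apply, Fin.cons_zero, Fin.tail_cons]
    simp only [LinearMap.comp_apply, LinearMap.mulLeft_apply, LinearMap.mulRight_apply]
    rw [← mul_assoc Y, ← mul_assoc Y, mul_assoc (X.ρ₁ _) Y]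
    congr 1
    exact 𝓕.trace (j := 1 + (2 * q + 2)) (k := 0) (by omega)
      (𝓕.mul_mem hY (X.W_mem _)) (X.ρ₁_mem _)
  rw [opb_opA, h1, map_sub, opA_opT_apply, ← map_sub]
  congr 1
  refine MultilinearMap.ext fun a => ?_
  rw [sub_apply, hκ, derivForm_apply, derivForm_apply, derivForm_apply, hδ, sub_mul, map_sub]
  rfl

end QuasiHom

end QuasiHom

/-! ### Supertraces of products -/

section TraceFiltration

variable {K : Type*} [NormedAddCommGroup K] [InnerProductSpace ℂ K] [CompleteSpace K]

/-- The functional `T ↦ Tr(γT)` on operators with summable approximation numbers. -/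
def superTraceAux (γ : K →L[ℂ] K) {n : ℕ} (hn : 1 ≤ n) : schattenPow n n K K →ₗ[ℂ] ℂ where
  toFun x := opTrace (γ ∘L (x : K →L[ℂ] K))
  map_add' x y := by
    rw [Submodule.coe_add, ContinuousLinearMap.comp_add]
    exact opTrace_add ((isNuc_of_mem_schattenPow hn le_rfl x.2).comp_left _)
      ((isNuc_of_mem_schattenPow hn le_rfl y.2).comp_left _)
  map_smul' z x := by
    rw [Submodule.coe_smul, ContinuousLinearMap.comp_smul, opTrace_smul]
    rfl

/-- A linear functional on all bounded operators that extends `T ↦ Tr(γT)`. Only its values on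
nuclear operators matter; a total functional spares the bookkeeping of domains. -/
def superTrace (γ : K →L[ℂ] K) {n : ℕ} (hn : 1 ≤ n) : (K →L[ℂ] K) →ₗ[ℂ] ℂ :=
  (LinearMap.exists_extend (superTraceAux γ hn)).choose

theorem superTrace_apply (γ : K →L[ℂ] K) {n r : ℕ} (hn : 1 ≤ n) (hr : n ≤ r) {x : K →L[ℂ] K}
    (hx : x ∈ schattenPow n r K K) : superTrace γ hn x = opTrace (γ * x) :=
  congrArg (fun f => f ⟨x, schattenPow_anti hr hx⟩)
    (LinearMap.exists_extend (superTraceAux γ hn)).choose_spec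

/-- The filtration of the even operators by the decay of approximation numbers, with the
supertrace. -/
def traceFiltration (γ : K →L[ℂ] K) {n : ℕ} (hn : 1 ≤ n) : FilteredTrace (K →L[ℂ] K) n where
  F k := schattenPow n k K K ⊓ (Subalgebra.centralizer ℂ {γ}).toSubmodule
  θ := superTrace γ hn
  one_mem := ⟨mem_schattenPow_zero n 1, Subalgebra.one_mem _⟩
  mul_mem hx hy := ⟨comp_mem_schattenPow hx.1 hy.1, Subalgebra.mul_mem _ hx.2 hy.2⟩
  trace {j k x y} h hx hy := by
    have hc : γ * y = y * γ := (Subalgebra.mem_centralizer_iff ℂ).1 hy.2 γ rfl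
    have h1 : x * y ∈ schattenPow n (j + k) K K := comp_mem_schattenPow hx.1 hy.1
    have h2 : y * x ∈ schattenPow n (k + j) K K := comp_mem_schattenPow hy.1 hx.1
    rw [superTrace_apply γ hn h h1, superTrace_apply γ hn (by omega) h2, ← mul_assoc, ← mul_assoc,
      hc,
      mul_assoc y]
    exact opTrace_comm_of_mem_schattenPow hn h (comp_left_mem_schattenPow γ hx.1) hy.1

theorem mem_traceFiltration {γ : K →L[ℂ] K} {n : ℕ} (hn : 1 ≤ n) {k : ℕ} {x : K →L[ℂ] K} :
    x ∈ (traceFiltration γ hn).F k ↔ x ∈ schattenPow n k K K ∧ γ * x = x * γ := by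
  refine and_congr Iff.rfl ⟨fun h => (Subalgebra.mem_centralizer_iff ℂ).1 h γ rfl, fun h => ?_⟩
  refine (Subalgebra.mem_centralizer_iff ℂ).2 ?_
  rintro _ rfl
  exact h

/-- A product of operators `Q S₁, …, Q S_l` is approximated at the exponent `l`, linearly in each
`Sⱼ`. -/
theorem Approximable.listProd {N : ℕ → ℕ} {c : ℝ} {Q : K →L[ℂ] K} (h : Approximable 1 N c Q) (l : ℕ)
    (S : Fin l → K →L[ℂ] K) : Approximable l (l • N) (c ^ l * ∏ j, ‖S j‖)
      (List.ofFn fun j => Q * S j).prod := by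
  induction l with
  | zero =>
    have h1 := approximable_zero (1 : K →L[ℂ] K)
    rw [List.ofFn_zero, List.prod_nil, zero_smul, pow_zero, Fin.prod_univ_zero, one_mul]
    exact h1.mono ContinuousLinearMap.norm_id_le
  | succ l ih =>
    have h1 := ((h.comp (approximable_zero (S 0))).comp (ih fun j => S j.succ))
    rw [List.ofFn_succ, List.prod_cons, Fin.prod_univ_succ]
    convert h1 using 1
    · omega
    · rw [add_zero, succ_nsmul']
    · ring
    · rfl

theorem RankWeight.nsmul {n : ℕ} {N : ℕ → ℕ} (h : RankWeight n N) (l : ℕ) :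
    RankWeight n (l • N) := by
  induction l with
  | zero => rw [zero_smul]; exact rankWeight_zero n
  | succ l ih => rw [succ_nsmul]; exact ih.add h

/-- `(S₀, …, Sₘ) ↦ Tr(γ Q S₀ ⋯ Q Sₘ)`. -/
def prodTrace (γ : K →L[ℂ] K) {n : ℕ} (hn : 1 ≤ n) {Q : K →L[ℂ] K} (hQ : Q ∈ schattenPow n 1 K K)
    {m : ℕ} (hm : n ≤ m + 1) :
    ContinuousMultilinearMap ℂ (fun _ : Fin (m + 1) => K →L[ℂ] K) ℂ :=
  MultilinearMap.mkContinuous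
    ((superTrace γ hn).compMultilinearMap ((MultilinearMap.mkPiAlgebraFin ℂ (m + 1)
      (K →L[ℂ] K)).compLinearMap fun _ => LinearMap.mulLeft ℂ Q))
    (‖γ‖ * (hQ.choose_spec.choose ^ (m + 1) * nucConst n ((m + 1) • hQ.choose))) (by
      intro S
      obtain ⟨h1, h2⟩ := hQ.choose_spec.choose_spec
      have h3 := h2.listProd (m + 1) S
      have h4 := (h3.anti hm).hasNuc hn (h1.nsmul _)
      have h5 := opTrace_norm_le (h4.comp_left γ)
      have h6 := superTrace_apply γ hn hm (x := (List.ofFn fun j => Q * S j).prod)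
        ⟨_, _, h1.nsmul _, h3⟩
      change ‖superTrace γ hn (List.ofFn fun j => Q * S j).prod‖ ≤ _
      rw [h6]
      refine h5.trans (le_of_eq ?_)
      ring)

theorem prodTrace_apply (γ : K →L[ℂ] K) {n : ℕ} (hn : 1 ≤ n) {Q : K →L[ℂ] K}
    (hQ : Q ∈ schattenPow n 1 K K) {m : ℕ} (hm : n ≤ m + 1) (S : Fin (m + 1) → K →L[ℂ] K) :
    prodTrace γ hn hQ hm S = superTrace γ hn (List.ofFn fun j => Q * S j).prod := rfl

theorem prod_mem_schattenPow {n : ℕ} {Q : K →L[ℂ] K} (hQ : Q ∈ schattenPow n 1 K K) {l : ℕ}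
    (S : Fin l → K →L[ℂ] K) : (List.ofFn fun j => Q * S j).prod ∈ schattenPow n l K K := by
  obtain ⟨N, c, h1, h2⟩ := hQ
  exact ⟨_, _, h1.nsmul l, h2.listProd l S⟩

end TraceFiltration

/-! ### The cyclic cocycles of bounded data -/

namespace BddTriple

variable {A : Type*} [Ring A] [Algebra ℂ A]
variable {K : Type*} [NormedAddCommGroup K] [InnerProductSpace ℂ K] [CompleteSpace K]
variable (X : BddTriple A K) {n : ℕ} (hn : 1 ≤ n) (hQ : X.Q ∈ schattenPow n 1 K K)

theorem γ_QC (a : A) : X.γ * (X.Q * X.C a) = X.Q * X.C a * X.γ := by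
  rw [← mul_assoc, X.γ_Q, neg_mul, mul_assoc, X.γ_C, mul_neg, neg_neg, mul_assoc]

/-- The homomorphisms `π` and `a ↦ π(a) - Q C(a)`, the latter being `a ↦ D⁻¹ π'(a) D`. -/
def quasiHom (hn : 1 ≤ n) (hQ : X.Q ∈ schattenPow n 1 K K) :
    QuasiHom A (traceFiltration X.γ hn) where
  ρ₀ := X.π
  ρ₁ := X.π - LinearMap.mulLeft ℂ X.Q ∘ₗ X.C
  ρ₀_mul := X.π_mul
  ρ₁_mul a b := by
    simp only [LinearMap.sub_apply, LinearMap.comp_apply, LinearMap.mulLeft_apply, X.π_mul, X.C_mul]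
    have h : X.Q * (X.π' a * X.C b) = X.π a * X.Q * X.C b - X.Q * X.C a * X.Q * X.C b := by
      rw [← mul_assoc, ← X.rel, sub_mul]
    rw [mul_add, h]
    noncomm_ring
  ρ₀_mem a := (mem_traceFiltration hn).2 ⟨mem_schattenPow_zero _ _, X.γ_π a⟩
  ρ₁_mem a := (mem_traceFiltration hn).2 ⟨mem_schattenPow_zero _ _, by
    change X.γ * (X.π a - X.Q * X.C a) = (X.π a - X.Q * X.C a) * X.γ
    rw [mul_sub, sub_mul, X.γ_π, X.γ_QC]⟩
  sub_mem a := (mem_traceFiltration hn).2 (by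
    have : X.π a - (X.π - LinearMap.mulLeft ℂ X.Q ∘ₗ X.C) a = X.Q * X.C a := sub_sub_cancel _ _
    rw [this]
    exact ⟨comp_right_mem_schattenPow _ hQ, X.γ_QC a⟩)

theorem quasiHom_ω (a : A) : (X.quasiHom hn hQ).ω a = X.Q * X.C a := sub_sub_cancel _ _

theorem quasiHom_W {l : ℕ} (a : Fin l → A) :
    (X.quasiHom hn hQ).W l a = (List.ofFn fun j => X.Q * X.C (a j)).prod := by
  rw [QuasiHom.W_apply]
  simp only [quasiHom_ω]

theorem form_eq_prodTrace {m : ℕ} (hm : n ≤ m + 1) (a : Fin (m + 1) → A) :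
    (X.quasiHom hn hQ).form m a = prodTrace X.γ hn hQ hm fun j => X.C (a j) := by
  rw [QuasiHom.form_apply, quasiHom_W, prodTrace_apply]
  rfl

theorem form_eq_opTrace {m : ℕ} (hm : n ≤ m + 1) (a : Fin (m + 1) → A) :
    (X.quasiHom hn hQ).form m a = opTrace (X.γ * (List.ofFn fun j => X.Q * X.C (a j)).prod) := by
  rw [QuasiHom.form_apply, quasiHom_W]
  exact superTrace_apply _ hn hm (prod_mem_schattenPow hQ _)

theorem continuous_form [TopologicalSpace A] (hC : Continuous X.C) {m : ℕ} (hm : n ≤ m + 1) :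
    Continuous ((X.quasiHom hn hQ).form m) := by
  have : ⇑((X.quasiHom hn hQ).form m) = fun a => prodTrace X.γ hn hQ hm fun j => X.C (a j) :=
    funext fun a => X.form_eq_prodTrace hn hQ hm a
  rw [this]
  exact (prodTrace X.γ hn hQ hm).cont.comp
    (continuous_pi fun j => hC.comp (continuous_apply j))

/-- The first factor of the transgression cochain carries no `Q`; it is moved to the end by the
trace property, which makes `prodTrace` applicable. -/
theorem continuous_transgression [TopologicalSpace A] (hπ : Continuous X.π) (hC : Continuous X.C)
    {m : ℕ} (hm : n ≤ m + 1) : Continuous ((X.quasiHom hn hQ).transgression (m + 1)) := by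
  let g : A → K →L[ℂ] K := fun a => X.π a + (X.π a - X.Q * X.C a)
  have hg : Continuous g := hπ.add (hπ.sub (continuous_const.mul hC))
  have : ⇑((X.quasiHom hn hQ).transgression (m + 1)) = fun a => prodTrace X.γ hn hQ hm
      (Fin.snoc (fun j => X.C (a j.castSucc.succ)) (X.C (a (Fin.last (m + 1))) * g (a 0))) := by
    funext a
    rw [QuasiHom.transgression_apply, prodTrace_apply, List.ofFn_succ', List.prod_concat]
    have h1 := (X.quasiHom hn hQ).W_mem (Fin.tail a)
    have h2 := (traceFiltration X.γ hn).trace (j := 0) (k := m + 1) (by omega)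
      (add_mem ((X.quasiHom hn hQ).ρ₀_mem (a 0)) ((X.quasiHom hn hQ).ρ₁_mem (a 0))) h1
    refine h2.trans ?_
    rw [quasiHom_W, List.ofFn_succ', List.prod_concat]
    simp only [Fin.snoc_castSucc, Fin.snoc_last]
    rw [← mul_assoc X.Q, ← mul_assoc]
    rfl
  rw [this]
  refine (prodTrace X.γ hn hQ hm).cont.comp (continuous_pi fun j => ?_)
  refine Fin.lastCases ?_ (fun j => ?_) j
  · simp only [Fin.snoc_last]
    exact (hC.comp (continuous_apply _)).mul (hg.comp (continuous_apply _))
  · simp only [Fin.snoc_castSucc]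
    exact hC.comp (continuous_apply _)

end BddTriple

/-! ### Comparison of periodic classes -/

section Classes

variable {A : Type*} [Ring A] [Algebra ℂ A]

theorem IsCyclicCocycle.smul {m : ℕ} {φ : MultiForm A m ℂ} (h : IsCyclicCocycle φ) (z : ℂ) :
    IsCyclicCocycle (z • φ) := by
  refine ⟨?_, ?_⟩
  · rw [map_smul, h.1]
  · rw [map_smul, h.2, smul_zero]

/-- The differential `b + B` of a cochain concentrated in degree `2q + 1`. -/
theorem dOdd_single_self (q : ℕ) (ψ : MultiForm A (2 * q + 1) ℂ) :
    dOdd (Pi.single q ψ : OddForms A) =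
      (Pi.single q (opB (2 * q) ψ) : EvenForms A) +
        (Pi.single (q + 1) (opb (2 * q + 1) ψ) : EvenForms A) := by
  funext r
  cases r with
  | zero =>
    change opB 0 ((Pi.single q ψ : OddForms A) 0) = _
    rw [Pi.add_apply, Pi.single_eq_of_ne (i := q + 1) (by omega), add_zero]
    rcases eq_or_ne q 0 with rfl | hq
    · rw [Pi.single_eq_same, Pi.single_eq_same]
    · rw [Pi.single_eq_of_ne hq.symm, Pi.single_eq_of_ne hq.symm, map_zero]
  | succ r =>
    refine (add_comm (opb (2 * r + 1) ((Pi.single q ψ : OddForms A) r)) (opB (2 * r + 2)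
      ((Pi.single q ψ : OddForms A) (r + 1)))).trans (congrArg₂ (· + ·) ?_ ?_)
    · rcases eq_or_ne q (r + 1) with rfl | hq
      · rw [Pi.single_eq_same, Pi.single_eq_same]
        rfl
      · rw [Pi.single_eq_of_ne hq.symm, Pi.single_eq_of_ne hq.symm]
        exact map_zero _
    · rcases eq_or_ne q r with rfl | hq
      · rw [Pi.single_eq_same, Pi.single_eq_same]
      · rw [Pi.single_eq_of_ne hq.symm, Pi.single_eq_of_ne (by omega)]
        exact map_zero _

theorem single_mem_oddCochains {S : ∀ m, Submodule ℂ (MultiForm A m ℂ)} {q : ℕ}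
    {ψ : MultiForm A (2 * q + 1) ℂ} (hψ : ψ ∈ S (2 * q + 1)) :
    (Pi.single q ψ : OddForms A) ∈ oddCochains S := by
  refine ⟨fun r => ?_, q + 1, fun r hr => Pi.single_eq_of_ne (by omega) _⟩
  rcases eq_or_ne r q with rfl | hr
  · rwa [Pi.single_eq_same]
  · rw [Pi.single_eq_of_ne hr]
    exact zero_mem _

theorem cyclicClass_eq_iff {S : ∀ m, Submodule ℂ (MultiForm A m ℂ)} {q r : ℕ}
    {φ : MultiForm A (2 * q) ℂ} (h : IsCyclicCocycle φ) (hS : φ ∈ S (2 * q))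
    {φ' : MultiForm A (2 * r) ℂ} (h' : IsCyclicCocycle φ') (hS' : φ' ∈ S (2 * r)) :
    cyclicClass φ h hS = cyclicClass φ' h' hS' ↔
      (Pi.single q φ : EvenForms A) - Pi.single r φ' ∈ evenCoboundaries S := by
  rw [cyclicClass, cyclicClass, Submodule.Quotient.eq]
  rfl

/-- A cyclic cocycle and its image under the periodicity operator, through a transgression
cochain. -/
theorem cyclicClass_eq_of_transgression {S : ∀ m, Submodule ℂ (MultiForm A m ℂ)} {q : ℕ}
    {φ : MultiForm A (2 * q) ℂ} (h : IsCyclicCocycle φ) (hS : φ ∈ S (2 * q))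
    {φ' : MultiForm A (2 * (q + 1)) ℂ} (h' : IsCyclicCocycle φ') (hS' : φ' ∈ S (2 * (q + 1)))
    {ψ : MultiForm A (2 * q + 1) ℂ} (hψ : ψ ∈ S (2 * q + 1)) (hB : opB (2 * q) ψ = φ)
    (hb : opb (2 * q + 1) ψ = -φ') : cyclicClass φ h hS = cyclicClass φ' h' hS' := by
  rw [cyclicClass_eq_iff]
  refine ⟨Pi.single q ψ, single_mem_oddCochains hψ, ?_⟩
  rw [dOdd_single_self, hB, hb, sub_eq_add_neg]
  congr 1
  exact Pi.single_neg (f := fun q => MultiForm A (2 * q) ℂ) (q + 1) φ'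

/-- Cyclic cocycles of the same degree that differ by `bψ` with `Bψ = 0`. -/
theorem cyclicClass_eq_of_opb {S : ∀ m, Submodule ℂ (MultiForm A m ℂ)} {q : ℕ}
    {φ φ' : MultiForm A (2 * (q + 1)) ℂ} (h : IsCyclicCocycle φ) (hS : φ ∈ S (2 * (q + 1)))
    (h' : IsCyclicCocycle φ') (hS' : φ' ∈ S (2 * (q + 1)))
    {ψ : MultiForm A (2 * q + 1) ℂ} (hψ : ψ ∈ S (2 * q + 1)) (hB : opB (2 * q) ψ = 0)
    (hb : opb (2 * q + 1) ψ = φ - φ') : cyclicClass φ h hS = cyclicClass φ' h' hS' := by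
  rw [cyclicClass_eq_iff]
  refine ⟨Pi.single q ψ, single_mem_oddCochains hψ, ?_⟩
  rw [dOdd_single_self, hB, hb, Pi.single_zero, zero_add]
  exact Pi.single_sub (f := fun q => MultiForm A (2 * q) ℂ) (q + 1) φ φ'

/-- The recursion `c_{q+1} = -c_q / (2 (2q + 1))` matches the factor in
`QuasiHom.opB_transgression`. -/
theorem cst_succ (q : ℕ) : cst (q + 1) = -(cst q / (2 * (2 * q + 1))) := by
  have h1 : ((2 * q).factorial : ℂ) ≠ 0 := by exact_mod_cast (2 * q).factorial_ne_zero
  have h2 : (2 * (q : ℂ) + 1) ≠ 0 := by exact_mod_cast (2 * q).succ_ne_zero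
  have h3 : ((q : ℂ) + 1) ≠ 0 := by exact_mod_cast q.succ_ne_zero
  have h4 : (2 * (q : ℂ) + 1 + 1) ≠ 0 := by exact_mod_cast (2 * q + 1).succ_ne_zero
  rw [cst, cst, show 2 * (q + 1) = 2 * q + 1 + 1 by ring, Nat.factorial_succ (2 * q + 1),
    Nat.factorial_succ (2 * q), Nat.factorial_succ q]
  push_cast
  field_simp
  ring

/-- The normalized cyclic cocycles of a quasi-homomorphism in successive even degrees define the
same periodic class. -/
theorem QuasiHom.cyclicClass_succ {𝓑 : Type*} [Ring 𝓑] [Algebra ℂ 𝓑] {n : ℕ}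
    {𝓕 : FilteredTrace 𝓑 n} (X : QuasiHom A 𝓕) {S : ∀ m, Submodule ℂ (MultiForm A m ℂ)} {q : ℕ}
    (hn : n ≤ 2 * q + 1) (h : IsCyclicCocycle (cst q • X.form (2 * q)))
    (hS : cst q • X.form (2 * q) ∈ S (2 * q))
    (h' : IsCyclicCocycle (cst (q + 1) • X.form (2 * (q + 1))))
    (hS' : cst (q + 1) • X.form (2 * (q + 1)) ∈ S (2 * (q + 1)))
    (hψ : X.transgression (2 * q + 1) ∈ S (2 * q + 1)) :
    cyclicClass _ h hS = cyclicClass _ h' hS' := by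
  have h2 : (2 * (q : ℂ) + 1) ≠ 0 := by exact_mod_cast (2 * q).succ_ne_zero
  refine cyclicClass_eq_of_transgression h hS h' hS'
    (ψ := (cst q / (2 * (2 * q + 1))) • X.transgression (2 * q + 1))
    (Submodule.smul_mem _ _ hψ) ?_ ?_
  · rw [map_smul, X.opB_transgression hn, smul_smul, div_mul_cancel₀]
    exact mul_ne_zero two_ne_zero h2
  · rw [map_smul, X.opb_transgression hn, cst_succ, neg_smul, neg_neg]
    rfl

end Classes

/-! ### Variation of a cyclic cocycle -/

namespace QuasiHom

variable {A : Type*} [Ring A] [Algebra ℂ A] {𝓑 : Type*} [Ring 𝓑] [Algebra ℂ 𝓑] {n : ℕ}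
  {𝓕 : FilteredTrace 𝓑 n} (X : QuasiHom A 𝓕)

theorem _root_.CyclicTheory.FilteredTrace.prod_mem (𝓕 : FilteredTrace 𝓑 n) {l : ℕ} {x : Fin l → 𝓑}
    (hx : ∀ j, x j ∈ 𝓕.F 1) : (List.ofFn x).prod ∈ 𝓕.F l := by
  induction l with
  | zero => rw [List.ofFn_zero, List.prod_nil]; exact 𝓕.one_mem
  | succ l ih =>
    rw [List.ofFn_succ', List.prod_concat]
    exact 𝓕.mul_mem (ih fun j => hx _) (hx _)

/-- `θ(ω(a⁰) ⋯ δ(aⁱ) ⋯ ω(aᵐ))`. -/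
def variation (δ : A →ₗ[ℂ] 𝓑) (m : ℕ) (i : Fin (m + 1)) : MultiForm A m ℂ :=
  𝓕.θ.compMultilinearMap ((MultilinearMap.mkPiAlgebraFin ℂ (m + 1) 𝓑).compLinearMap
    (Function.update (fun _ => X.ω) i δ))

theorem variation_apply (δ : A →ₗ[ℂ] 𝓑) {m : ℕ} (i : Fin (m + 1)) (a : Fin (m + 1) → A) :
    X.variation δ m i a =
      𝓕.θ (List.ofFn fun j => Function.update (fun _ => X.ω) i δ j (a j)).prod := rfl

theorem variation_zero (δ : A →ₗ[ℂ] 𝓑) (m : ℕ) : X.variation δ m 0 = X.derivForm δ m := by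
  refine MultilinearMap.ext fun a => ?_
  rw [variation_apply, derivForm_apply, List.ofFn_succ, List.prod_cons, Function.update_self]
  rfl

/-- The cyclic operator moves the slot in which the variation takes place. -/
theorem opT_variation {q : ℕ} (hn : n ≤ 2 * q + 1) {δ : A →ₗ[ℂ] 𝓑} (hδ : ∀ a, δ a ∈ 𝓕.F 1)
    (i : Fin (2 * q)) :
    opT (2 * q) (X.variation δ (2 * q) i.succ) = X.variation δ (2 * q) i.castSucc := by
  have hmem : ∀ {l : ℕ} (i : Fin l) (a : Fin l → A) (j : Fin l),
      Function.update (fun _ => X.ω) i δ j (a j) ∈ 𝓕.F 1 := fun i a j => by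
    rcases eq_or_ne j i with rfl | h
    · rw [Function.update_self]; exact hδ _
    · rw [Function.update_of_ne h]; exact X.ω_mem _
  refine MultilinearMap.ext fun a => ?_
  rw [opT_apply, pow_mul, neg_one_sq, one_pow, one_smul, variation_apply, variation_apply,
    List.ofFn_succ, List.prod_cons, List.ofFn_succ', List.prod_concat, Fin.cons_zero,
    Function.update_of_ne (Fin.succ_ne_zero i).symm,
    Function.update_of_ne (Fin.castSucc_lt_last i).ne']
  have e1 : (fun j : Fin (2 * q) => Function.update (fun _ => X.ω) i.succ δ j.succ
      ((Fin.cons (a (Fin.last (2 * q))) (Fin.init a) : Fin (2 * q + 1) → A) j.succ)) =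
      fun j => Function.update (fun _ => X.ω) i δ j (a j.castSucc) := by
    funext j
    rw [Fin.cons_succ]
    rcases eq_or_ne j i with rfl | h
    · rw [Function.update_self, Function.update_self]; rfl
    · rw [Function.update_of_ne h, Function.update_of_ne ((Fin.succ_injective _).ne h)]; rfl
  have e2 : (fun j : Fin (2 * q) => Function.update (fun _ : Fin (2 * q + 1) => X.ω) i.castSucc δ
      j.castSucc (a j.castSucc)) =
      fun j => Function.update (fun _ => X.ω) i δ j (a j.castSucc) := by
    funext j
    rcases eq_or_ne j i with rfl | h
    · rw [Function.update_self, Function.update_self]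
    · rw [Function.update_of_ne h, Function.update_of_ne ((Fin.castSucc_injective _).ne h)]
  rw [e1, e2]
  exact 𝓕.trace (by omega) (X.ω_mem _) (𝓕.prod_mem (hmem i fun j => a j.castSucc))

/-- The variation of the cocycle along `δ`, summed over all slots, is the cyclic symmetrization of
the variation in slot `0`. -/
theorem sum_variation {q : ℕ} (hn : n ≤ 2 * q + 1) {δ : A →ₗ[ℂ] 𝓑} (hδ : ∀ a, δ a ∈ 𝓕.F 1) :
    ∑ i, X.variation δ (2 * q) i = opA (2 * q) (X.derivForm δ (2 * q)) := by
  have h1 : ∀ (i : ℕ) (hi : i ≤ 2 * q), X.variation δ (2 * q) ⟨2 * q - i, by omega⟩ =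
      (opT (2 * q) ^ i) (X.variation δ (2 * q) (Fin.last _)) := by
    intro i
    induction i with
    | zero => intro _; rfl
    | succ i ih =>
      intro hi
      have h := X.opT_variation hn hδ ⟨2 * q - (i + 1), by omega⟩
      refine h.symm.trans ?_
      rw [pow_succ', Module.End.mul_apply, ← ih (by omega)]
      congr 2
      exact Fin.ext (by simp only [Fin.val_succ]; omega)
  have h2 : ∀ (i : ℕ) (φ : MultiForm A (2 * q) ℂ), opA (2 * q) ((opT (2 * q) ^ i) φ) =
      opA (2 * q) φ := fun i => by
    induction i with
    | zero => intro φ; rfl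
    | succ i ih => intro φ; rw [pow_succ, Module.End.mul_apply, ih, opA_opT_apply]
  have h3 := h1 (2 * q) le_rfl
  have h4 : X.derivForm δ (2 * q) =
      (opT (2 * q) ^ (2 * q)) (X.variation δ (2 * q) (Fin.last _)) := by
    rw [← h3, ← variation_zero]
    congr 1
    exact Fin.ext (by simp)
  rw [h4, h2, opA, LinearMap.sum_apply, Finset.sum_range, ← Equiv.sum_comp Fin.revPerm]
  refine Finset.sum_congr rfl fun j _ => ?_
  rw [← h1 j (by omega)]
  congr 1
  exact Fin.ext (by simp [Fin.val_rev])

end QuasiHom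

theorem opA_comp {A : Type*} [Ring A] [Algebra ℂ A] {F G : Type*} [AddCommGroup F] [Module ℂ F]
    [AddCommGroup G] [Module ℂ G] (f : F →ₗ[ℂ] G) {m : ℕ} (φ : MultiForm A m F) :
    opA m (f.compMultilinearMap φ) = f.compMultilinearMap (opA m φ) := by
  have h : ∀ i, (opT m ^ i) (f.compMultilinearMap φ) = f.compMultilinearMap ((opT m ^ i) φ) :=
    fun i => by
      induction i with
      | zero => rfl
      | succ i ih =>
        rw [pow_succ', Module.End.mul_apply, ih, opT_comp, pow_succ', Module.End.mul_apply]
  refine MultilinearMap.ext fun a => ?_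
  rw [opA, LinearMap.sum_apply, LinearMap.compMultilinearMap_apply, opA, LinearMap.sum_apply,
    sum_apply, sum_apply, map_sum]
  exact Finset.sum_congr rfl fun i _ => by rw [h]; rfl

/-! ### Homotopy invariance -/

namespace BddTriple

variable {A : Type*} [Ring A] [Algebra ℂ A]
variable {K : Type*} [NormedAddCommGroup K] [InnerProductSpace ℂ K] [CompleteSpace K]
variable (X : BddTriple A K) {M : K →L[ℂ] K}

/-- `(1 + t M D⁻¹)⁻¹`. -/
def pathInv (M : K →L[ℂ] K) (t : ℝ) : K →L[ℂ] K := Ring.inverse (1 + (t : ℂ) • (M * X.Q))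

variable {X} in
theorem pathInv_spec (hU : ∀ t : ℝ, IsUnit (1 + (t : ℂ) • (M * X.Q))) (t : ℝ) :
    (1 + (t : ℂ) • (M * X.Q)) * X.pathInv M t = 1 ∧ X.pathInv M t * (1 + (t : ℂ) • (M * X.Q)) = 1 :=
  ⟨Ring.mul_inverse_cancel _ (hU t), Ring.inverse_mul_cancel _ (hU t)⟩

/-- The data of `D + t M`. -/
def path (hM : X.γ * M = -(M * X.γ)) (hU : ∀ t : ℝ, IsUnit (1 + (t : ℂ) • (M * X.Q))) (t : ℝ) :
    BddTriple A K :=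
  X.perturb M hM t (X.pathInv M t) (pathInv_spec hU t).1 (pathInv_spec hU t).2

theorem hasDerivAt_pathInv (hU : ∀ t : ℝ, IsUnit (1 + (t : ℂ) • (M * X.Q))) (t : ℝ) :
    HasDerivAt (X.pathInv M) (-(X.pathInv M t * (M * X.Q) * X.pathInv M t)) t := by
  have h1 : HasDerivAt (fun t : ℝ => 1 + (t : ℂ) • (M * X.Q)) (M * X.Q) t := by
    have := (Complex.ofRealCLM.hasDerivAt (x := t)).smul_const (M * X.Q)
    simpa using this.const_add (1 : K →L[ℂ] K)
  have h2 := hasFDerivAt_ringInverse (𝕜 := ℝ) (hU t).unit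
  have h3 := h2.comp_hasDerivAt t h1
  refine h3.congr_deriv ?_
  rw [neg_apply, ContinuousLinearMap.mulLeftRight_apply, ← Ring.inverse_unit]
  rfl

variable (hM : X.γ * M = -(M * X.γ)) (hU : ∀ t : ℝ, IsUnit (1 + (t : ℂ) • (M * X.Q)))

theorem path_C (t : ℝ) (a : A) :
    (X.path hM hU t).C a = X.C a + (t : ℂ) • (M * X.π a - X.π' a * M) := rfl

theorem path_Q (t : ℝ) : (X.path hM hU t).Q = X.Q * X.pathInv M t := rfl

theorem hasDerivAt_pathInv_C (t : ℝ) (a : A) :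
    HasDerivAt (fun t => X.pathInv M t * (X.path hM hU t).C a)
      (X.pathInv M t * (M * (X.π a - (X.path hM hU t).Q * (X.path hM hU t).C a) -
        X.π' a * M)) t := by
  have h1 : HasDerivAt (fun t : ℝ => X.C a + (t : ℂ) • (M * X.π a - X.π' a * M))
      (M * X.π a - X.π' a * M) t := by
    have := (Complex.ofRealCLM.hasDerivAt (x := t)).smul_const (M * X.π a - X.π' a * M)
    simpa using this.const_add (X.C a)
  refine ((X.hasDerivAt_pathInv hU t).mul h1).congr_deriv ?_
  rw [path_Q, path_C]
  simp only [mul_add, mul_sub, mul_smul_comm, mul_assoc, neg_mul, smul_sub]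
  module

/-- The derivative of `ω_t = D_t⁻¹ [D_t, ·]_σ` is the commutator of `D_t⁻¹ M` with `ρ₁`. -/
theorem Q_mul_deriv (t : ℝ) (a : A) :
    X.Q * (X.pathInv M t * (M * (X.π a - (X.path hM hU t).Q * (X.path hM hU t).C a) - X.π' a * M)) =
      (X.path hM hU t).Q * M * (X.π a - (X.path hM hU t).Q * (X.path hM hU t).C a) -
        (X.π a - (X.path hM hU t).Q * (X.path hM hU t).C a) * ((X.path hM hU t).Q * M) := by
  have h : (X.π a - (X.path hM hU t).Q * (X.path hM hU t).C a) * (X.path hM hU t).Q =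
      (X.path hM hU t).Q * X.π' a := by
    rw [sub_mul]
    exact (X.path hM hU t).rel a
  rw [← mul_assoc (X.π a - (X.path hM hU t).Q * (X.path hM hU t).C a) (X.path hM hU t).Q M, h,
    path_Q]
  noncomm_ring

variable {n : ℕ} (hn : 1 ≤ n) (hQ : X.Q ∈ schattenPow n 1 K K)

theorem path_Q_mem (hQ : X.Q ∈ schattenPow n 1 K K) (t : ℝ) :
    (X.path hM hU t).Q ∈ schattenPow n 1 K K :=
  comp_right_mem_schattenPow _ hQ

/-- The quasi-homomorphism of `D + t M`. -/
def pathHom (t : ℝ) : QuasiHom A (traceFiltration X.γ hn) :=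
  (X.path hM hU t).quasiHom hn (X.path_Q_mem hM hU hQ t)

theorem pathHom_W (t : ℝ) {l : ℕ} (a : Fin l → A) : (X.pathHom hM hU hn hQ t).W l a =
    (List.ofFn fun j => X.Q * (X.pathInv M t * (X.path hM hU t).C (a j))).prod := by
  refine (quasiHom_W _ hn _ a).trans ?_
  simp only [path_Q, mul_assoc]

/-- The kernel of the homotopy cochain as a function of operators. -/
def homotopyKernel {m : ℕ} (hm : n ≤ m + 1) (s : Fin m → (K →L[ℂ] K) × (K →L[ℂ] K) × (K →L[ℂ] K))
    (t : ℝ) : ℂ :=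
  prodTrace X.γ hn hQ hm (Fin.cons (X.pathInv M t * M) fun j =>
    X.pathInv M t * ((s j).1 + (t : ℂ) • (M * (s j).2.1 - (s j).2.2 * M)))

theorem continuous_homotopyKernel {m : ℕ} (hm : n ≤ m + 1)
    (hU : ∀ t : ℝ, IsUnit (1 + (t : ℂ) • (M * X.Q))) :
    Continuous (Function.uncurry (X.homotopyKernel (M := M) hn hQ hm)) := by
  have hV : Continuous (X.pathInv M) :=
    continuous_iff_continuousAt.2 fun t => (X.hasDerivAt_pathInv hU t).continuousAt
  refine (prodTrace X.γ hn hQ hm).cont.comp (continuous_pi fun j => ?_)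
  refine Fin.cases ?_ (fun j => ?_) j
  · simp only [Fin.cons_zero]
    exact (hV.comp continuous_snd).mul continuous_const
  · simp only [Fin.cons_succ]
    have hs : Continuous fun x : (Fin m → (K →L[ℂ] K) × (K →L[ℂ] K) × (K →L[ℂ] K)) × ℝ => x.1 j :=
      (continuous_apply j).comp continuous_fst
    refine (hV.comp continuous_snd).mul (hs.fst.add ?_)
    exact (Complex.continuous_ofReal.comp continuous_snd).smul
      ((continuous_const.mul hs.snd.fst).sub (hs.snd.snd.mul continuous_const))

theorem insertForm_pathHom {m : ℕ} (hm : n ≤ m + 2) (t : ℝ) (a : Fin (m + 1) → A) :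
    (X.pathHom hM hU hn hQ t).insertForm ((X.path hM hU t).Q * M) m a =
      X.homotopyKernel (M := M) hn hQ hm (fun j => (X.C (a j), X.π (a j), X.π' (a j))) t := by
  rw [QuasiHom.insertForm_apply, pathHom_W, homotopyKernel, prodTrace_apply, path_Q]
  conv_rhs => rw [List.ofFn_succ, List.prod_cons, Fin.cons_zero, ← mul_assoc]
  simp only [Fin.cons_succ]
  rfl

theorem continuous_insertForm {m : ℕ} (hm : n ≤ m + 2) (a : Fin (m + 1) → A) :
    Continuous fun t => (X.pathHom hM hU hn hQ t).insertForm ((X.path hM hU t).Q * M) m a := by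
  have h := (X.continuous_homotopyKernel hn hQ (m := m + 1) hm hU).comp
    (Continuous.prodMk_right fun j => (X.C (a j), X.π (a j), X.π' (a j)))
  exact h.congr fun t => (X.insertForm_pathHom hM hU hn hQ hm t a).symm

/-- The homotopy cochain before integration, with values in continuous functions of the
parameter. -/
def homotopyForm {m : ℕ} (hm : n ≤ m + 2) : MultiForm A m C(ℝ, ℂ) where
  toFun a := ⟨_, X.continuous_insertForm hM hU hn hQ hm a⟩
  map_update_add' a i x y := by
    ext t
    exact ((X.pathHom hM hU hn hQ t).insertForm ((X.path hM hU t).Q * M) m).map_update_add a i x y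
  map_update_smul' a i z x := by
    ext t
    exact ((X.pathHom hM hU hn hQ t).insertForm ((X.path hM hU t).Q * M) m).map_update_smul a i z x

/-- Integration over `[0, 1]`. -/
def unitIntegral : C(ℝ, ℂ) →ₗ[ℂ] ℂ where
  toFun f := ∫ t in (0 : ℝ)..1, f t
  map_add' f g := intervalIntegral.integral_add (f.continuous.intervalIntegrable _ _)
    (g.continuous.intervalIntegrable _ _)
  map_smul' z f := intervalIntegral.integral_smul z _

/-- Evaluation at a point. -/
def evalAt (t : ℝ) : C(ℝ, ℂ) →ₗ[ℂ] ℂ where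
  toFun f := f t
  map_add' _ _ := rfl
  map_smul' _ _ := rfl

/-- The cocycle of `D + t M` is differentiable in `t`: by the product rule its derivative is the sum
over all slots of the variation along `δ = [D_t⁻¹ M, ρ₁]`. -/
theorem hasDerivAt_form {q : ℕ} (hm : n ≤ 2 * q + 1) (t : ℝ) (a : Fin (2 * q + 1) → A)
    {δ : A →ₗ[ℂ] (K →L[ℂ] K)} (hδ : ∀ a, δ a = (X.path hM hU t).Q * M *
      (X.pathHom hM hU hn hQ t).ρ₁ a - (X.pathHom hM hU hn hQ t).ρ₁ a * ((X.path hM hU t).Q * M))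
    (hδF : ∀ a, δ a ∈ (traceFiltration X.γ hn).F 1) :
    HasDerivAt (fun t => (X.pathHom hM hU hn hQ t).form (2 * q) a)
      (opA (2 * q) ((X.pathHom hM hU hn hQ t).derivForm δ (2 * q)) a) t := by
  set S : ℝ → Fin (2 * q + 1) → K →L[ℂ] K :=
    fun t j => X.pathInv M t * (X.path hM hU t).C (a j) with hS
  set S' : Fin (2 * q + 1) → K →L[ℂ] K := fun j => X.pathInv M t *
    (M * (X.π (a j) - (X.path hM hU t).Q * (X.path hM hU t).C (a j)) - X.π' (a j) * M) with hS'
  have h0 : ∀ t, (X.pathHom hM hU hn hQ t).form (2 * q) a = prodTrace X.γ hn hQ hm (S t) :=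
    fun t => by
      rw [QuasiHom.form_apply, pathHom_W, prodTrace_apply]
      rfl
  have h1 : HasDerivAt S S' t := hasDerivAt_pi.2 fun j => X.hasDerivAt_pathInv_C hM hU t (a j)
  have h2 := (((prodTrace X.γ hn hQ hm).hasFDerivAt (S t)).restrictScalars ℝ).comp_hasDerivAt t h1
  simp only [h0]
  refine h2.congr_deriv ?_
  rw [← QuasiHom.sum_variation _ hm hδF, sum_apply]
  refine (ContinuousMultilinearMap.linearDeriv_apply _ _ _).trans ?_
  refine Finset.sum_congr rfl fun i _ => ?_
  rw [prodTrace_apply, QuasiHom.variation_apply]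
  congr 3
  funext j
  rcases eq_or_ne j i with rfl | h
  · rw [Function.update_self, Function.update_self, hδ]
    exact X.Q_mul_deriv hM hU t (a j)
  · rw [Function.update_of_ne h, Function.update_of_ne h]
    exact ((quasiHom_ω _ hn _ _).trans (mul_assoc _ _ _)).symm

/-- The cyclic cocycles at the ends of the path `D + t M` differ by the Hochschild coboundary of a
cyclic cochain. -/
theorem exists_homotopy [TopologicalSpace A] (hC : Continuous X.C) (hπ : Continuous X.π)
    (hπ' : Continuous X.π') {q : ℕ} (hm : n ≤ 2 * q + 3) :
    ∃ ψ : MultiForm A (2 * q + 1) ℂ, Continuous ψ ∧ opB (2 * q) ψ = 0 ∧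
      opb (2 * q + 1) ψ = (X.pathHom hM hU hn hQ 1).form (2 * (q + 1)) -
        (X.pathHom hM hU hn hQ 0).form (2 * (q + 1)) := by
  set χ := X.homotopyForm hM hU hn hQ (m := 2 * q + 1) (by omega) with hχ
  have hsign : ∀ t, (X.path hM hU t).Q * M ∈ (traceFiltration X.γ hn).F 1 := fun t => by
    refine (mem_traceFiltration hn).2
      ⟨comp_right_mem_schattenPow _ (X.path_Q_mem hM hU hQ t), ?_⟩
    have h := (X.path hM hU t).γ_Q
    change X.γ * _ = -(_ * X.γ) at h
    rw [← mul_assoc, h, neg_mul, mul_assoc, hM, mul_neg, neg_neg, mul_assoc]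
  -- The derivative of the cocycle at `t` is `b A` of the cochain `θ(Y ω ⋯ ω)` with `Y = D_t⁻¹ M`.
  have hder : ∀ (t : ℝ) (a : Fin (2 * q + 3) → A),
      HasDerivAt (fun t => (X.pathHom hM hU hn hQ t).form (2 * (q + 1)) a)
        (opb (2 * q + 1) (opA (2 * q + 1) χ) a t) t := fun t a => by
    set Y := (X.path hM hU t).Q * M with hY
    set Z := X.pathHom hM hU hn hQ t with hZ
    set δ : A →ₗ[ℂ] (K →L[ℂ] K) := (LinearMap.mulLeft ℂ Y - LinearMap.mulRight ℂ Y) ∘ₗ Z.ρ₁ with hδ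
    have h1 := X.hasDerivAt_form hM hU hn hQ (q := q + 1) (by omega) t a (δ := δ) (fun _ => rfl)
      fun a => sub_mem ((traceFiltration X.γ hn).mul_mem (hsign t) (Z.ρ₁_mem a))
        (by simpa using (traceFiltration X.γ hn).mul_mem (Z.ρ₁_mem a) (hsign t))
    refine h1.congr_deriv ?_
    have h2 := Z.opb_opA_insertForm hm (hsign t) (δ := δ) fun _ => rfl
    have h3 : Z.insertForm Y (2 * q + 1) = (evalAt t).compMultilinearMap χ := rfl
    rw [h3, opA_comp, opb_comp] at h2
    exact (congrArg (fun f => f a) h2).symm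
  -- The homotopy is the integral of this cochain over `[0, 1]`; `B` vanishes on it because of the
  -- factor `A`.
  refine ⟨opA (2 * q + 1) (unitIntegral.compMultilinearMap χ), ?_, opB_opA _, ?_⟩
  · have h1 : Continuous (unitIntegral.compMultilinearMap χ) := by
      have h2 : Continuous fun s : Fin (2 * q + 2) → (K →L[ℂ] K) × (K →L[ℂ] K) × (K →L[ℂ] K) =>
          ∫ t in (0 : ℝ)..1, X.homotopyKernel (M := M) hn hQ (by omega) s t :=
        intervalIntegral.continuous_parametric_intervalIntegral_of_continuous'
          (X.continuous_homotopyKernel hn hQ (by omega) hU) 0 1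
      have h3 : ⇑(unitIntegral.compMultilinearMap χ) = fun a => ∫ t in (0 : ℝ)..1,
          X.homotopyKernel (M := M) hn hQ (m := 2 * q + 2) (by omega)
            (fun j => (X.C (a j), X.π (a j), X.π' (a j))) t := by
        funext a
        refine intervalIntegral.integral_congr fun t _ => ?_
        exact X.insertForm_pathHom hM hU hn hQ (by omega) t a
      rw [h3]
      refine h2.comp (continuous_pi fun j => ?_)
      have hj : Continuous fun a : Fin (2 * q + 2) → A => a j := continuous_apply j
      exact (hC.comp hj).prodMk ((hπ.comp hj).prodMk (hπ'.comp hj))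
    have h4 : ⇑(opA (2 * q + 1) (unitIntegral.compMultilinearMap χ)) =
        fun a => ∑ i ∈ Finset.range (2 * q + 1 + 1), ((-1 : ℂ) ^ (2 * q + 1)) ^ i •
          (unitIntegral.compMultilinearMap χ)
            (fun k => a (((finRotate (2 * q + 2)).symm ^ i) k)) := by
      funext a
      rw [opA, LinearMap.sum_apply, sum_apply]
      exact Finset.sum_congr rfl fun i _ => opT_pow_apply _ i a
    rw [h4]
    refine continuous_finsetSum _ fun i _ => ?_
    have h5 : Continuous fun (a : Fin (2 * q + 2) → A) (k : Fin (2 * q + 2)) =>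
        a (((finRotate (2 * q + 2)).symm ^ i) k) := continuous_pi fun k => continuous_apply _
    have h6 := h1.comp h5
    exact continuous_const.mul h6
  · rw [opA_comp, opb_comp]
    refine MultilinearMap.ext fun a => ?_
    exact intervalIntegral.integral_eq_sub_of_hasDerivAt (fun t _ => hder t a)
      ((ContinuousMap.continuous _).intervalIntegrable _ _)

end BddTriple

/-! ### The Connes–Chern character -/

namespace BddTriple

variable {A : Type*} [Ring A] [Algebra ℂ A]
variable {K : Type*} [NormedAddCommGroup K] [InnerProductSpace ℂ K] [CompleteSpace K]
variable (X : BddTriple A K) {n : ℕ} (hn : 1 ≤ n) (hQ : X.Q ∈ schattenPow n 1 K K)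

/-- The normalized cyclic cocycle in degree `2q`. -/
def character (q : ℕ) : MultiForm A (2 * q) ℂ := cst q • (X.quasiHom hn hQ).form (2 * q)

theorem isCyclicCocycle_character {q : ℕ} (hq : n ≤ 2 * q + 1) :
    IsCyclicCocycle (X.character hn hQ q) :=
  ((X.quasiHom hn hQ).isCyclicCocycle_form hq).smul _

theorem coe_character {q : ℕ} (hq : n ≤ 2 * q + 1) (a : Fin (2 * q + 1) → A) :
    X.character hn hQ q a =
      cst q * opTrace (X.γ * (List.ofFn fun j => X.Q * X.C (a j)).prod) :=
  congrArg (cst q * ·) (X.form_eq_opTrace hn hQ hq a)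

variable [TopologicalSpace A]

theorem continuous_character (hC : Continuous X.C) {q : ℕ} (hq : n ≤ 2 * q + 1) :
    Continuous (X.character hn hQ q) :=
  (X.continuous_form hn hQ hC hq).const_smul (cst q)

variable {S : ∀ m, Submodule ℂ (MultiForm A m ℂ)}
  (hS : ∀ (m : ℕ) (φ : MultiForm A m ℂ), Continuous φ → φ ∈ S m)

theorem cyclicClass_character_eq (hπ : Continuous X.π) (hC : Continuous X.C) {q r : ℕ}
    (hq : n ≤ 2 * q + 1) (hqr : q ≤ r) :
    cyclicClass _ (X.isCyclicCocycle_character hn hQ (hq.trans (by omega : 2 * q + 1 ≤ 2 * r + 1)))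
      (hS _ _ (X.continuous_character hn hQ hC (hq.trans (by omega)))) =
    cyclicClass _ (X.isCyclicCocycle_character hn hQ hq)
      (hS _ _ (X.continuous_character hn hQ hC hq)) := by
  induction r, hqr using Nat.le_induction with
  | base => rfl
  | succ r hr ih =>
    rw [← ih]
    exact ((X.quasiHom hn hQ).cyclicClass_succ (hq.trans (by omega)) _ _ _ _
      (hS _ _ (X.continuous_transgression hn hQ hπ hC (hq.trans (by omega))))).symm

end BddTriple

namespace TwistedSpectralTriple

variable {A : Type*} [Ring A] [Algebra ℂ A] [StarRing A]
variable {H : Type*} [NormedAddCommGroup H] [InnerProductSpace ℂ H] [CompleteSpace H]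
variable (T : TwistedSpectralTriple A H)

/-- For invertible `D`, the data of `D ⊕ -D` with `A` acting on the first summand. -/
def splitTriple {P : H →L[ℂ] H} (hP : IsBoundedInverse T.D P) : BddTriple A (WithLp 2 (H × H)) where
  γ := T.doubleγ
  Q := block P 0 0 (-P)
  π := T.doublePiLin
  π' := T.doublePiLin ∘ₗ T.σ.toLinearMap
  C :=
    { toFun := fun a => block (T.comm a) 0 0 0
      map_add' := fun a b => by simp only [block_add, T.comm_add, add_zero]
      map_smul' := fun z a => by simp only [block_smul, T.comm_smul, smul_zero, RingHom.id_apply] }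
  π_mul := T.doubleπ_mul
  π'_mul a b := (congrArg T.doubleπ (map_mul T.σ a b)).trans (T.doubleπ_mul _ _)
  C_mul a b := by
    change block (T.comm (a * b)) 0 0 0 =
      block (T.comm a) 0 0 0 * T.doubleπ b + T.doubleπ (T.σ a) * block (T.comm b) 0 0 0
    simp only [doubleπ, diag_eq_block, block_mul, block_add, T.comm_mul]
    congr 1 <;> simp
  rel a := by
    change T.doubleπ a * block P 0 0 (-P) - block P 0 0 (-P) * block (T.comm a) 0 0 0 *
      block P 0 0 (-P) = block P 0 0 (-P) * T.doubleπ (T.σ a)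
    have h : T.π a * P - P * T.comm a * P = P * T.π (T.σ a) :=
      rel_of_isTwComm hP (T.isTwComm_comm a)
    simp only [doubleπ, diag_eq_block, block_mul, sub_eq_add_neg, block_neg, block_add, ← h]
    congr 1 <;> simp
  γ_sq := T.doubleTriple.γ_sq
  γ_π := T.doubleγ_doubleπ
  γ_π' a := T.doubleγ_doubleπ _
  γ_Q := by
    have h : T.γ * P = -(P * T.γ) := odd_inverse hP fun _ _ h => T.graph_odd h
    simp only [doubleγ, diag_eq_block, block_mul, block_neg]
    congr 1 <;> simp [h]
  γ_C a := by
    change T.doubleγ * block (T.comm a) 0 0 0 = -(block (T.comm a) 0 0 0 * T.doubleγ)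
    simp only [doubleγ, diag_eq_block, block_mul, block_neg]
    congr 1 <;> simp [T.comm_odd]

/-- The operator that exchanges the summands. -/
def swap (H : Type*) [NormedAddCommGroup H] [InnerProductSpace ℂ H] [CompleteSpace H] :
    WithLp 2 (H × H) →L[ℂ] WithLp 2 (H × H) := block 0 1 1 0

theorem doubleγ_swap : T.doubleγ * swap H = -(swap H * T.doubleγ) := by
  simp only [doubleγ, swap, diag_eq_block, block_mul, block_neg]
  congr 1 <;> simp

/-- `Re ⟨(1 + tG) x, x⟩ = ‖x‖²` if `G` is skew-adjoint. -/
theorem isUnit_one_add_of_skewAdjoint {K : Type*} [NormedAddCommGroup K] [InnerProductSpace ℂ K]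
    [CompleteSpace K] {G : K →L[ℂ] K} (hG : star G = -G) (t : ℝ) : IsUnit (1 + (t : ℂ) • G) := by
  refine ContinuousLinearMap.isUnit_of_forall_le_norm_inner_map _ (c := 1) one_pos fun x => ?_
  have h1 : (⟪G x, x⟫_ℂ).re = 0 := by
    have h2 : ⟪G x, x⟫_ℂ = -(starRingEnd ℂ) ⟪G x, x⟫_ℂ := by
      rw [inner_conj_symm, ← inner_neg_right, ← neg_apply, ← hG,
        ContinuousLinearMap.star_eq_adjoint,
        ContinuousLinearMap.adjoint_inner_right]
    have h3 := congrArg Complex.re h2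
    rw [Complex.neg_re, Complex.conj_re] at h3
    linarith
  have h2 : (⟪(1 + (t : ℂ) • G) x, x⟫_ℂ).re = ‖x‖ ^ 2 := by
    rw [add_apply, one_apply_eq_self, inner_add_left, _root_.smul_apply, inner_smul_left,
      Complex.conj_ofReal, Complex.add_re, Complex.re_ofReal_mul, h1, mul_zero, add_zero]
    exact inner_self_eq_norm_sq (𝕜 := ℂ) x
  rw [NNReal.coe_one, mul_one, ← h2]
  exact Complex.re_le_norm _

variable {T} {P : H →L[ℂ] H} (hP : IsBoundedInverse T.D P)

/-- With `D⁻¹` selfadjoint, the product of the swap and of `D⁻¹ ⊕ -D⁻¹` is skew-adjoint; hence `(D,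
t; t, -D)` is invertible for all real `t`. -/
theorem isUnit_split (t : ℝ) : IsUnit (1 + (t : ℂ) • (swap H * (T.splitTriple hP).Q)) := by
  refine isUnit_one_add_of_skewAdjoint ?_ t
  have h : star P = P := isSelfAdjoint_of_isBoundedInverse T.D_selfAdjoint hP
  change star (block 0 1 1 0 * block P 0 0 (-P)) = -(block 0 1 1 0 * block P 0 0 (-P))
  rw [block_mul, block_adjoint, block_neg]
  congr 1 <;> simp [h]

theorem splitγ_swap : (T.splitTriple hP).γ * swap H = -(swap H * (T.splitTriple hP).γ) :=
  T.doubleγ_swap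

/-- At `t = 1` the path `(D, t; t, -D)` ends at `D̃`. -/
theorem path_one_Q : ((T.splitTriple hP).path (splitγ_swap hP) (isUnit_split hP) 1).Q =
    T.doubleInv := by
  refine ContinuousLinearMap.ext fun x => ?_
  have hu := (BddTriple.pathInv_spec (isUnit_split hP) 1).1
  set V := (T.splitTriple hP).pathInv (swap H) 1 with hV
  have h1 : (V x).fst - P (V x).snd = x.fst ∧ (V x).snd + P (V x).fst = x.snd := by
    have h2 := congrArg (fun f : WithLp 2 (H × H) →L[ℂ] WithLp 2 (H × H) => f x) hu
    have h3 : (1 + ((1 : ℝ) : ℂ) • (swap H * (T.splitTriple hP).Q)) = block 1 (-P) P 1 := by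
      change 1 + ((1 : ℝ) : ℂ) • (block 0 1 1 0 * block P 0 0 (-P)) = _
      rw [Complex.ofReal_one, one_smul, block_mul, ← block_one, block_add]
      congr 1 <;> simp
    rw [h3] at h2
    simp only [mul_apply_eq_comp, block_apply, one_apply_eq_self] at h2
    refine ⟨?_, ?_⟩
    · rw [sub_eq_add_neg]
      exact congrArg WithLp.fst h2
    · rw [add_comm]
      exact congrArg WithLp.snd h2
  have h4 := (isBoundedInverse_iff.1 hP).1
  have h5 : ((block P 0 0 (-P)) (V x), x) ∈ T.doubleD.graph := by
    rw [T.mem_graph_doubleD, block_apply]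
    simp only [WithLp.toLp_fst, WithLp.toLp_snd, zero_apply, neg_apply, add_zero, zero_add, ← h1.1,
      ← h1.2]
    constructor
    · convert h4 (V x).fst using 2
      abel
    · convert T.D.graph.neg_mem (h4 (V x).snd) using 1
      rw [Prod.neg_mk]
      congr 1
      abel
  exact ((isBoundedInverse_iff.1 T.isBoundedInverse_doubleInv).2 _ _ h5).symm

theorem path_one_C (a : A) : ((T.splitTriple hP).path (splitγ_swap hP) (isUnit_split hP) 1).C a =
    T.doubleComm a := by
  rw [BddTriple.path_C, T.doubleComm_eq]
  change block (T.comm a) 0 0 0 + ((1 : ℝ) : ℂ) •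
    (block 0 1 1 0 * T.doubleπ a - T.doubleπ (T.σ a) * block 0 1 1 0) = _
  rw [Complex.ofReal_one, one_smul, doubleπ, doubleπ, diag_eq_block, diag_eq_block, block_mul,
    block_mul, sub_eq_add_neg, block_neg, block_add, block_add]
  congr 1 <;> simp

theorem block_prod {m : ℕ} (S : Fin (m + 1) → H →L[ℂ] H) :
    (List.ofFn fun j => block (S j) 0 0 0).prod = block (List.ofFn S).prod 0 0 0 := by
  induction m with
  | zero => simp
  | succ m ih =>
    rw [List.ofFn_succ, List.prod_cons, ih fun j => S j.succ, block_mul, List.ofFn_succ,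
      List.prod_cons]
    congr 1 <;> simp

theorem opTrace_block {a : H →L[ℂ] H} (ha : IsNuc a) : opTrace (block a 0 0 0) = opTrace a := by
  have h1 : block a 0 0 0 = blockInl ∘L (a ∘L blockFst) := by
    rw [block_eq_sum]
    simp
  have h2 : (a ∘L blockFst) ∘L blockInl = a := ContinuousLinearMap.ext fun x => rfl
  rw [h1, opTrace_comp_comm (ha.comp_right blockFst) blockInl, h2]

/-- At the start of the path, `D ⊕ -D` has the same cocycles as `D`, since `A` acts on the first
summand only. -/
theorem path_zero_form {n : ℕ} (hn : 1 ≤ n) (hQ : (T.splitTriple hP).Q ∈ schattenPow n 1 _ _)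
    (hQP : (T.baseTriple hP).Q ∈ schattenPow n 1 H H) {q : ℕ} (hq : n ≤ 2 * q + 1) :
    ((T.splitTriple hP).pathHom (splitγ_swap hP) (isUnit_split hP) hn hQ 0).form (2 * q) =
      ((T.baseTriple hP).quasiHom hn hQP).form (2 * q) := by
  refine MultilinearMap.ext fun a => ?_
  have h0 : (T.splitTriple hP).pathInv (swap H) 0 = 1 := by
    rw [BddTriple.pathInv, Complex.ofReal_zero, zero_smul, add_zero, Ring.inverse_one]
  have h1 : ∀ a, (T.splitTriple hP).Q * ((T.splitTriple hP).pathInv (swap H) 0 *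
      ((T.splitTriple hP).path (splitγ_swap hP) (isUnit_split hP) 0).C a) =
      block (P * T.comm a) 0 0 0 := fun a => by
    rw [h0, one_mul, BddTriple.path_C, Complex.ofReal_zero, zero_smul, add_zero]
    change block P 0 0 (-P) * block (T.comm a) 0 0 0 = _
    rw [block_mul]
    congr 1 <;> simp
  rw [BddTriple.form_eq_opTrace _ _ _ hq, QuasiHom.form_apply, BddTriple.pathHom_W]
  simp only [h1]
  have h2 : (List.ofFn fun j => P * T.comm (a j)).prod ∈ schattenPow n (2 * q + 1) H H :=
    prod_mem_schattenPow hQP _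
  rw [block_prod]
  have h3 : block (List.ofFn fun j => P * T.comm (a j)).prod 0 0 0 ∈
      schattenPow n (2 * q + 1) (WithLp 2 (H × H)) (WithLp 2 (H × H)) :=
    block_mem_schattenPow h2 (zero_mem _) (zero_mem _) (zero_mem _)
  refine (superTrace_apply _ hn hq h3).trans ?_
  change opTrace (T.doubleγ * _) = opTrace (T.γ * (List.ofFn fun j => P * T.comm (a j)).prod)
  refine Eq.trans ?_ (opTrace_block ((isNuc_of_mem_schattenPow hn hq h2).comp_left T.γ))
  rw [doubleγ, diag_eq_block, block_mul]
  congr 1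
  simp

/-- At the end of the path, the cocycles are those of `D̃`. -/
theorem path_one_form {n : ℕ} (hn : 1 ≤ n) (hQ : (T.splitTriple hP).Q ∈ schattenPow n 1 _ _)
    (hQ' : T.doubleTriple.Q ∈ schattenPow n 1 _ _) (m : ℕ) :
    ((T.splitTriple hP).pathHom (splitγ_swap hP) (isUnit_split hP) hn hQ 1).form m =
      (T.doubleTriple.quasiHom hn hQ').form m := by
  refine MultilinearMap.ext fun a => ?_
  rw [QuasiHom.form_apply, QuasiHom.form_apply, BddTriple.quasiHom_W]
  refine congrArg (superTrace T.doubleγ hn) ((BddTriple.quasiHom_W _ _ _ _).trans ?_)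
  simp only [path_one_C, path_one_Q]
  rfl

theorem _root_.Continuous.block {X : Type*} [TopologicalSpace X] {a b c d : X → H →L[ℂ] H}
    (ha : Continuous a) (hb : Continuous b) (hc : Continuous c) (hd : Continuous d) :
    Continuous fun x => block (a x) (b x) (c x) (d x) := by
  simp only [block_eq_sum]
  fun_prop

theorem tauBar_eq_character {n : ℕ} (hn : 1 ≤ n) (hQ : T.doubleTriple.Q ∈ schattenPow n 1 _ _)
    {q : ℕ} (hq : n ≤ 2 * q + 1) : ⇑(T.doubleTriple.character hn hQ q) = T.tauBar q := by
  funext a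
  rw [T.doubleTriple.coe_character hn hQ hq, tauBar, tauBarProd, boundedInverse_doubleD]
  rfl

theorem tau_eq_character {n : ℕ} (hn : 1 ≤ n) (hQ : (T.baseTriple hP).Q ∈ schattenPow n 1 _ _)
    {q : ℕ} (hq : n ≤ 2 * q + 1) : ⇑((T.baseTriple hP).character hn hQ q) = T.tau q := by
  funext a
  rw [BddTriple.coe_character _ hn hQ hq, tau, tauProd, boundedInverse_eq hP]
  rfl

theorem le_two_mul_ceil (p : ℝ) : p ≤ (2 * ⌈(p - 1) / 2⌉₊ + 1 : ℕ) := by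
  have h := Nat.le_ceil ((p - 1) / 2)
  push_cast
  linarith

variable {p : ℝ}

theorem doubleQ_mem (hp : 1 ≤ p) (hsum : T.IsSummable p) :
    T.doubleTriple.Q ∈ schattenPow (2 * ⌈(p - 1) / 2⌉₊ + 1) 1 _ _ :=
  T.doubleInv_mem_schattenPow hp hsum (le_two_mul_ceil p)

theorem baseQ_mem (hp : 1 ≤ p) (hsum : T.IsSummable p) :
    (T.baseTriple hP).Q ∈ schattenPow (2 * ⌈(p - 1) / 2⌉₊ + 1) 1 _ _ :=
  T.inverse_mem_schattenPow hP hp hsum (le_two_mul_ceil p)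

theorem isTraceClass_of_mem {K : Type*} [NormedAddCommGroup K] [InnerProductSpace ℂ K]
    [CompleteSpace K] {n r : ℕ} (hn : 1 ≤ n) (hr : n ≤ r) {x : K →L[ℂ] K}
    (hx : x ∈ schattenPow n r K K) : IsTraceClass x :=
  (isNuc_of_mem_schattenPow hn hr hx).isTraceClass

theorem tauWellDefined (hp : 1 ≤ p) (hsum : T.IsSummable p) : T.TauWellDefined p := by
  refine ⟨⟨_, T.isBoundedInverse_doubleInv⟩, fun a => ⟨_, T.isTwComm_double a⟩, fun q hq => ?_⟩
  have hq' : 2 * ⌈(p - 1) / 2⌉₊ + 1 ≤ 2 * q + 1 := by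
    have := Nat.ceil_le.2 hq
    omega
  refine ⟨fun a => ?_, fun ⟨P, hP⟩ a => ?_⟩
  · rw [tauBarProd, boundedInverse_doubleD]
    exact isTraceClass_of_mem (by omega) hq' (prod_mem_schattenPow (doubleQ_mem hp hsum) _)
  · rw [tauProd, boundedInverse_eq hP]
    exact isTraceClass_of_mem (by omega) hq' (prod_mem_schattenPow (baseQ_mem hP hp hsum) _)

section Character

variable [TopologicalSpace A] (hT : T.IsSmooth)

theorem continuous_doubleComm (hT : T.IsSmooth) : Continuous T.doubleTriple.C := by
  have h : ⇑T.doubleTriple.C = fun a => block (T.comm a) (-T.π (T.σ a)) (T.π a) 0 :=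
    funext T.doubleComm_eq
  rw [h]
  have h2 : Continuous fun a => -T.π (T.σ a) := (hT.continuous_π.comp hT.continuous_σ).neg
  exact hT.continuous_comm.block h2 hT.continuous_π continuous_const

theorem continuous_doublePi (hT : T.IsSmooth) : Continuous T.doublePiLin := by
  have h : ⇑T.doublePiLin = fun a => block (T.π a) 0 0 0 := funext fun a => diag_eq_block _ _
  rw [h]
  exact hT.continuous_π.block continuous_const continuous_const continuous_const

theorem continuous_splitComm (hT : T.IsSmooth) : Continuous (T.splitTriple hP).C :=
  hT.continuous_comm.block continuous_const continuous_const continuous_const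

/-- The cocycles of `D̃` and, for invertible `D`, of `D` define the same periodic class. -/
theorem cyclicClass_double_eq (hT : T.IsSmooth) {S : ∀ m, Submodule ℂ (MultiForm A m ℂ)}
    (hS : ∀ (m : ℕ) (φ : MultiForm A m ℂ), Continuous φ → φ ∈ S m) {n : ℕ} (hn : 1 ≤ n)
    (hQ' : T.doubleTriple.Q ∈ schattenPow n 1 _ _) (hQP : (T.baseTriple hP).Q ∈ schattenPow n 1 H H)
    {q : ℕ} (hq : n ≤ 2 * (q + 1) + 1) :
    cyclicClass _ (T.doubleTriple.isCyclicCocycle_character hn hQ' hq)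
      (hS _ _ (T.doubleTriple.continuous_character hn hQ' (continuous_doubleComm hT) hq)) =
    cyclicClass _ ((T.baseTriple hP).isCyclicCocycle_character hn hQP hq)
      (hS _ _ ((T.baseTriple hP).continuous_character hn hQP hT.continuous_comm hq)) := by
  have hQ : (T.splitTriple hP).Q ∈ schattenPow n 1 _ _ :=
    block_mem_schattenPow hQP (zero_mem _) (zero_mem _) (neg_mem hQP)
  obtain ⟨ψ, h1, h2, h3⟩ := (T.splitTriple hP).exists_homotopy (splitγ_swap hP)
      (isUnit_split hP) hn hQ
    (continuous_splitComm hP hT) (continuous_doublePi hT)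
    ((continuous_doublePi hT).comp hT.continuous_σ) (q := q) (by omega)
  refine cyclicClass_eq_of_opb _ _ _ _ (Submodule.smul_mem _ (cst (q + 1)) (hS _ _ h1)) ?_ ?_
  · rw [map_smul, h2, smul_zero]
  · rw [map_smul, h3, path_one_form hP hn hQ hQ', path_zero_form hP hn hQ hQP hq, smul_sub]
    rfl

/-- The cocycles `τ̄`, and `τ` if `D` is invertible, share one class in the cohomology of any
complex of cochains that contains the continuous ones. -/
theorem exists_isConnesChern (hT : T.IsSmooth) (hp : 1 ≤ p) (hsum : T.IsSummable p)
    {S : ∀ m, Submodule ℂ (MultiForm A m ℂ)}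
    (hS : ∀ (m : ℕ) (φ : MultiForm A m ℂ), Continuous φ → φ ∈ S m) :
    ∃ c, T.IsConnesChern p S c := by
  have hn : 1 ≤ 2 * ⌈(p - 1) / 2⌉₊ + 1 := by omega
  have hQ := doubleQ_mem hp hsum
  have hC := continuous_doubleComm hT
  have hle : ∀ q : ℕ, (p - 1) / 2 ≤ q → ⌈(p - 1) / 2⌉₊ ≤ q := fun q hq => Nat.ceil_le.2 hq
  generalize hq0 : ⌈(p - 1) / 2⌉₊ = q0 at hn hQ hle
  have hbar := fun (q : ℕ) (hq : q0 ≤ q) => T.doubleTriple.cyclicClass_character_eq hn hQ hS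
    (continuous_doublePi hT) hC le_rfl hq
  refine ⟨cyclicClass _ (T.doubleTriple.isCyclicCocycle_character hn hQ le_rfl)
    (hS _ _ (T.doubleTriple.continuous_character hn hQ hC le_rfl)), fun q hq => ?_⟩
  have hq' := hle q hq
  have hq1 : 2 * q0 + 1 ≤ 2 * q + 1 := by omega
  refine ⟨⟨_, _, _, tauBar_eq_character hn hQ hq1, hbar q hq'⟩, fun ⟨P, hP⟩ => ?_⟩
  have hQP := baseQ_mem hP hp hsum
  rw [hq0] at hQP
  have hbase := fun (q : ℕ) (hq : q0 ≤ q) => (T.baseTriple hP).cyclicClass_character_eq hn hQP hS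
    hT.continuous_π hT.continuous_comm le_rfl hq
  refine ⟨_, _, _, tau_eq_character hP hn hQP hq1, (hbase q hq').trans ?_⟩
  -- The homotopy connects the two families in degrees `≥ 2`; both classes are independent of the
  -- degree.
  rw [← hbase (q0 + 1) (by omega), ← hbar (q0 + 1) (by omega)]
  exact (cyclicClass_double_eq hP hT hS hn hQ hQP (by omega)).symm

/-- A class with the defining property is the class of any one `τ̄`, hence unique. -/
theorem IsConnesChern.unique {S : ∀ m, Submodule ℂ (MultiForm A m ℂ)} {c c' : PeriodicCohomology S}
    (h : T.IsConnesChern p S c) (h' : T.IsConnesChern p S c') : c = c' := by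
  obtain ⟨φ, h1, h2, h3, rfl⟩ := (h _ (Nat.le_ceil _)).1
  obtain ⟨φ', h1', h2', h3', rfl⟩ := (h' _ (Nat.le_ceil _)).1
  obtain rfl : φ = φ' := DFunLike.coe_injective (h3.trans h3'.symm)
  rfl

theorem forgetContinuity_cyclicClass {q : ℕ} {φ : MultiForm A (2 * q) ℂ} (h : IsCyclicCocycle φ)
    (hS : φ ∈ contForms A (2 * q)) : forgetContinuity A (cyclicClass φ h hS) =
      cyclicClass φ h (Submodule.mem_top : φ ∈ allForms A (2 * q)) := rfl

theorem IsConnesChern.forget {c : ContHPUpper A} (h : T.IsConnesChern p (contForms A) c) :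
    T.IsConnesChern p (allForms A) (forgetContinuity A c) := fun q hq => by
  obtain ⟨⟨φ, h1, h2, h3, h4⟩, h5⟩ := h q hq
  refine ⟨⟨φ, h1, Submodule.mem_top, h3, ?_⟩, fun hD => ?_⟩
  · rw [← h4, forgetContinuity_cyclicClass]
  · obtain ⟨φ', h1', h2', h3', h4'⟩ := h5 hD
    exact ⟨φ', h1', Submodule.mem_top, h3', by rw [← h4', forgetContinuity_cyclicClass]⟩

end Character

end TwistedSpectralTriple

/-! ### Fredholm operators and the trace formula for the index -/

section Fredholm

open LinearMap.FiniteRangeSetoid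

variable {V W : Type*} [NormedAddCommGroup V] [InnerProductSpace ℂ V] [CompleteSpace V]
  [NormedAddCommGroup W] [InnerProductSpace ℂ W] [CompleteSpace W]

theorem opTrace_one [FiniteDimensional ℂ V] :
    opTrace (ContinuousLinearMap.id ℂ V) = Module.finrank ℂ V := by
  have b := stdOrthonormalBasis ℂ V
  have h : HasSum (fun i => InnerProductSpace.rankOne ℂ (b i) (b i))
      (ContinuousLinearMap.id ℂ V) := by
    have := hasSum_fintype fun i => InnerProductSpace.rankOne ℂ (b i) (b i)
    rwa [b.sum_rankOne_eq_id] at this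
  rw [opTrace_eq (hasSum_fintype _).summable h, tsum_fintype]
  simp

/-- The trace of a projection onto a finite-dimensional subspace is the dimension. -/
theorem opTrace_of_isIdempotentElem {P : V →L[ℂ] V} (hP : IsIdempotentElem P)
    [FiniteDimensional ℂ (LinearMap.range (P : V →ₗ[ℂ] V))] :
    opTrace P = Module.finrank ℂ (LinearMap.range (P : V →ₗ[ℂ] V)) := by
  set U := LinearMap.range (P : V →ₗ[ℂ] V)
  let r : V →L[ℂ] U := P.codRestrict U fun x => LinearMap.mem_range_self _ x
  have h1 : U.subtypeL ∘L r = P := ContinuousLinearMap.ext fun x => rfl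
  have h2 : r ∘L U.subtypeL = ContinuousLinearMap.id ℂ U := by
    refine ContinuousLinearMap.ext fun x => Subtype.ext ?_
    obtain ⟨_, y, rfl⟩ := x
    exact congrArg (fun f : V →L[ℂ] V => f y) hP
  have h3 : IsNuc r := by
    refine (hasNuc_of_rank_le (r := Module.finrank ℂ U) ?_).isNuc
    rw [Module.finrank_eq_rank]
    exact LinearMap.rank_le_range _
  rw [← h1, opTrace_comp_comm h3, h2, opTrace_one]

theorem isNuc_of_finite {T : V →L[ℂ] W}
    (h : FiniteDimensional ℂ (LinearMap.range (T : V →ₗ[ℂ] W))) : IsNuc T :=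
  isNuc_of_mem_schattenPow le_rfl le_rfl (mem_schattenPow_of_finite le_rfl 1 h)

/-- A Fredholm operator has a bounded generalized inverse. -/
theorem exists_comp_comp_eq {a : V →L[ℂ] W} (ha : a.IsFredholm) :
    ∃ b : W →L[ℂ] V, a ∘L b ∘L a = a := by
  obtain ⟨pkg⟩ := ha.nonempty_fredholmPackage
  refine ⟨pkg.quasiInverse, ContinuousLinearMap.ext fun x => ?_⟩
  have h : ∀ x, a x = pkg.equiv (pkg.decDom.proj x) := fun x => by
    conv_lhs => rw [pkg.eq_equiv]
    rfl
  have h1 : ∀ y : pkg.decDom.X₁, pkg.decDom.proj y = y := fun y => by simp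
  have h2 : ∀ y : pkg.decCodom.X₁, pkg.decCodom.proj y = y := fun y => by simp
  have h3 : pkg.quasiInverse (a x) = pkg.decDom.proj x := by
    change ((pkg.equiv.symm (pkg.decCodom.proj (a x)) : pkg.decDom.X₁) : V) = _
    rw [h x, h2, ContinuousLinearEquiv.symm_apply_apply]
  change a (pkg.quasiInverse (a x)) = a x
  rw [h3, h, h1, h x]

/-- The index of a Fredholm operator in terms of an inverse modulo nuclear operators. -/
theorem index_eq_opTrace_sub {a : V →L[ℂ] W} {b : W →L[ℂ] V} (ha : a.IsFredholm)
    (h1 : IsNuc (ContinuousLinearMap.id ℂ V - b ∘L a))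
    (h2 : IsNuc (ContinuousLinearMap.id ℂ W - a ∘L b)) :
    ((a : V →ₗ[ℂ] W).index : ℂ) = opTrace (ContinuousLinearMap.id ℂ V - b ∘L a) -
      opTrace (ContinuousLinearMap.id ℂ W - a ∘L b) := by
  obtain ⟨c, hc⟩ := exists_comp_comp_eq ha
  have hc' : ∀ x, a (c (a x)) = a x := fun x => congrArg (fun f : V →L[ℂ] W => f x) hc
  have := ha.finite_ker
  have := ha.finite_coker
  -- For the exact generalized inverse `c`, the operators `P = 1 - c a` and `R = 1 - a c` are
  -- projections onto the kernel and onto a complement of the range.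
  set P := ContinuousLinearMap.id ℂ V - c ∘L a with hP
  set R := ContinuousLinearMap.id ℂ W - a ∘L c with hR
  have hPx : ∀ x, P x = x - c (a x) := fun x => rfl
  have hRx : ∀ x, R x = x - a (c x) := fun x => rfl
  have hPi : IsIdempotentElem P := ContinuousLinearMap.ext fun x => by
    rw [mul_apply_eq_comp, hPx (P x), hPx, map_sub, hc', sub_self, map_zero, sub_zero]
  have hRi : IsIdempotentElem R := ContinuousLinearMap.ext fun x => by
    rw [mul_apply_eq_comp, hRx (R x), hRx, map_sub, map_sub, hc', sub_self, sub_zero]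
  have hPr : LinearMap.range (P : V →ₗ[ℂ] V) = LinearMap.ker (a : V →ₗ[ℂ] W) := by
    refine le_antisymm ?_ fun x hx => ⟨x, ?_⟩
    · rintro _ ⟨x, rfl⟩
      change a (P x) = 0
      rw [hPx, map_sub, hc', sub_self]
    · change P x = x
      rw [hPx, show a x = 0 from hx, map_zero, sub_zero]
  have hRk : LinearMap.ker (R : W →ₗ[ℂ] W) = LinearMap.range (a : V →ₗ[ℂ] W) := by
    refine le_antisymm ?_ ?_
    · intro x hx
      refine ⟨c x, ?_⟩
      exact (sub_eq_zero.1 (show x - a (c x) = 0 from hx)).symm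
    · rintro _ ⟨x, rfl⟩
      change R (a x) = 0
      rw [hRx, hc', sub_self]
  have e := (Submodule.quotEquivOfEq _ _ hRk).symm.trans
    (LinearMap.quotKerEquivRange (R : W →ₗ[ℂ] W))
  have hPf : FiniteDimensional ℂ (LinearMap.range (P : V →ₗ[ℂ] V)) := by rw [hPr]; infer_instance
  have hRf : FiniteDimensional ℂ (LinearMap.range (R : W →ₗ[ℂ] W)) := Module.Finite.equiv e
  have h0 : ((a : V →ₗ[ℂ] W).index : ℂ) = opTrace P - opTrace R := by
    rw [opTrace_of_isIdempotentElem hPi, opTrace_of_isIdempotentElem hRi, hPr, ← e.finrank_eq,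
      LinearMap.index_eq_finrank_sub]
    push_cast
    rfl
  -- `N = c - b` is nuclear, and passing from `c` to `b` changes the two traces by `Tr(N a) = Tr(a
  -- N)`.
  set N := c - b with hN
  have hN1 : N = c ∘L (ContinuousLinearMap.id ℂ W - a ∘L b) - P ∘L b := by
    refine ContinuousLinearMap.ext fun x => ?_
    change c x - b x = c (x - a (b x)) - (b x - c (a (b x)))
    rw [map_sub]
    abel
  have hNn : IsNuc N := by
    rw [hN1]
    exact (h2.comp_left c).sub ((isNuc_of_finite hPf).comp_right b)
  have e1 : ContinuousLinearMap.id ℂ V - b ∘L a = P + N ∘L a := by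
    refine ContinuousLinearMap.ext fun x => ?_
    change x - b (a x) = x - c (a x) + (c (a x) - b (a x))
    abel
  have e2 : ContinuousLinearMap.id ℂ W - a ∘L b = R + a ∘L N := by
    refine ContinuousLinearMap.ext fun x => ?_
    change x - a (b x) = x - a (c x) + a (c x - b x)
    rw [map_sub]
    abel
  rw [h0, e1, e2, opTrace_add (isNuc_of_finite hPf) (hNn.comp_right a),
    opTrace_add (isNuc_of_finite hRf) (hNn.comp_left a), opTrace_comp_comm hNn a]
  ring

theorem exists_finite_norm_sub_lt {n r : ℕ} (hr : 1 ≤ r) {T : V →L[ℂ] W}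
    (hT : T ∈ schattenPow n r V W) {ε : ℝ} (hε : 0 < ε) :
    ∃ F : V →L[ℂ] W, FiniteDimensional ℂ (LinearMap.range (F : V →ₗ[ℂ] W)) ∧ ‖T - F‖ < ε := by
  obtain ⟨N, c, -, h1, h2⟩ := schattenPow_anti hr hT
  have h3 : Filter.Tendsto (fun k : ℕ => c * (1 / 2 : ℝ) ^ k) Filter.atTop (nhds (c * 0)) :=
    (tendsto_pow_atTop_nhds_zero_of_lt_one (by norm_num) (by norm_num)).const_mul c
  rw [mul_zero] at h3
  obtain ⟨k, hk⟩ := (h3.eventually_lt_const hε).exists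
  obtain ⟨F, h4, h5⟩ := h2 k
  refine ⟨F, Module.rank_lt_aleph0_iff.1 (h4.trans_lt Cardinal.natCast_lt_aleph0), ?_⟩
  rw [one_mul] at h5
  exact h5.trans_lt hk

/-- `1 - x` is invertible modulo operators of finite rank. -/
theorem exists_finite_inverse {n r : ℕ} (hr : 1 ≤ r) {x : V →L[ℂ] V}
    (hx : x ∈ schattenPow n r V V) :
    ∃ (U : (V →L[ℂ] V)ˣ) (F : V →L[ℂ] V), FiniteDimensional ℂ (LinearMap.range (F : V →ₗ[ℂ] V)) ∧
      1 - x = U - F := by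
  obtain ⟨F, h1, h2⟩ := exists_finite_norm_sub_lt hr hx one_pos
  refine ⟨Units.oneSub (x - F) h2, F, h1, ?_⟩
  rw [Units.val_oneSub]
  abel

/-- A left inverse modulo finite rank is also a right inverse modulo finite rank, if there is some
right inverse modulo finite rank. -/
theorem isFredholm_of_left_right {a : V →L[ℂ] W} {b c : W →L[ℂ] V} {F : V →L[ℂ] V} {G : W →L[ℂ] W}
    (hF : FiniteDimensional ℂ (LinearMap.range (F : V →ₗ[ℂ] V)))
    (hG : FiniteDimensional ℂ (LinearMap.range (G : W →ₗ[ℂ] W)))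
    (h1 : b ∘L a = ContinuousLinearMap.id ℂ V - F) (h2 : a ∘L c = ContinuousLinearMap.id ℂ W - G) :
    a.IsFredholm := by
  have hF' : (F : V →ₗ[ℂ] V).HasNoetherianRange := isNoetherian_of_isNoetherianRing_of_finite ℂ _
  have hG' : (G : W →ₗ[ℂ] W).HasNoetherianRange := isNoetherian_of_isNoetherianRing_of_finite ℂ _
  refine ContinuousLinearMap.IsFredholm.of_isQuasiInverse (v := b) ⟨?_, ?_⟩
  · change (b : W →ₗ[ℂ] V) ∘ₗ (a : V →ₗ[ℂ] W) ≈ LinearMap.id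
    rw [equiv_iff_hasNoetherianRange]
    have : (b : W →ₗ[ℂ] V) ∘ₗ (a : V →ₗ[ℂ] W) - LinearMap.id = -(F : V →ₗ[ℂ] V) := by
      refine LinearMap.ext fun x => ?_
      have := congrArg (fun f : V →L[ℂ] V => f x) h1
      change b (a x) - x = -F x
      rw [show b (a x) = x - F x from this]
      abel
    rw [this]
    exact hF'.neg
  · change (a : V →ₗ[ℂ] W) ∘ₗ (b : W →ₗ[ℂ] V) ≈ LinearMap.id
    rw [equiv_iff_hasNoetherianRange]
    have : (a : V →ₗ[ℂ] W) ∘ₗ (b : W →ₗ[ℂ] V) - LinearMap.id =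
        ((a : V →ₗ[ℂ] W) ∘ₗ (b : W →ₗ[ℂ] V)) ∘ₗ (G : W →ₗ[ℂ] W) -
          (a : V →ₗ[ℂ] W) ∘ₗ (F : V →ₗ[ℂ] V) ∘ₗ (c : W →ₗ[ℂ] V) - (G : W →ₗ[ℂ] W) := by
      refine LinearMap.ext fun x => ?_
      have e1 : b (a (c x)) = c x - F (c x) := congrArg (fun f : V →L[ℂ] V => f (c x)) h1
      have e2 : a (c x) = x - G x := congrArg (fun f : W →L[ℂ] W => f x) h2
      change a (b x) - x = a (b (G x)) - a (F (c x)) - G x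
      have e3 : G x = x - a (c x) := by rw [e2]; abel
      rw [e3, map_sub, map_sub, e1, map_sub]
      abel
    rw [this]
    exact ((hG'.comp_left _).sub ((hF'.comp_right _).comp_left _)).sub hG'

/-- An operator that is invertible modulo operators with summable approximation numbers is
Fredholm. -/
theorem isFredholm_of_mem_schattenPow {n r : ℕ} (hr : 1 ≤ r) {a : V →L[ℂ] W} {b : W →L[ℂ] V}
    (h1 : ContinuousLinearMap.id ℂ V - b ∘L a ∈ schattenPow n r V V)
    (h2 : ContinuousLinearMap.id ℂ W - a ∘L b ∈ schattenPow n r W W) : a.IsFredholm := by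
  obtain ⟨U, F, hF, e1⟩ := exists_finite_inverse hr h1
  obtain ⟨U', G, hG, e2⟩ := exists_finite_inverse hr h2
  have hba : b ∘L a = (U : V →L[ℂ] V) - F := by
    rw [← e1]
    exact (sub_sub_cancel _ _).symm
  have hab : a ∘L b = (U' : W →L[ℂ] W) - G := by
    rw [← e2]
    exact (sub_sub_cancel _ _).symm
  refine isFredholm_of_left_right (b := (↑U⁻¹ : V →L[ℂ] V) ∘L b) (c := b ∘L (↑U'⁻¹ : W →L[ℂ] W))
    (F := ↑U⁻¹ * F) (G := G * ↑U'⁻¹) ?_ ?_ ?_ ?_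
  · have : LinearMap.range ((↑U⁻¹ * F : V →L[ℂ] V) : V →ₗ[ℂ] V) =
        (LinearMap.range (F : V →ₗ[ℂ] V)).map ((↑U⁻¹ : V →L[ℂ] V) : V →ₗ[ℂ] V) :=
      LinearMap.range_comp _ _
    rw [this]
    infer_instance
  · exact Submodule.finiteDimensional_of_le (LinearMap.range_comp_le_range
      ((↑U'⁻¹ : W →L[ℂ] W) : W →ₗ[ℂ] W) (G : W →ₗ[ℂ] W))
  · rw [ContinuousLinearMap.comp_assoc, hba]
    change (↑U⁻¹ : V →L[ℂ] V) * (U - F) = 1 - ↑U⁻¹ * F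
    rw [mul_sub, Units.inv_mul]
  · rw [← ContinuousLinearMap.comp_assoc, hab]
    change ((U' : W →L[ℂ] W) - G) * ↑U'⁻¹ = 1 - G * ↑U'⁻¹
    rw [sub_mul, Units.mul_inv]

theorem index_comp_of_isFredholm {Z : Type*} [NormedAddCommGroup Z] [InnerProductSpace ℂ Z]
    [CompleteSpace Z] {a : V →L[ℂ] W} {b : W →L[ℂ] Z} (ha : a.IsFredholm) (hb : b.IsFredholm) :
    ((b ∘L a : V →L[ℂ] Z) : V →ₗ[ℂ] Z).index =
      (b : W →ₗ[ℂ] Z).index + (a : V →ₗ[ℂ] W).index := by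
  have := ha.finite_ker
  have := hb.finite_ker
  have := ha.finite_coker
  have := hb.finite_coker
  exact LinearMap.index_comp (f := (a : V →ₗ[ℂ] W)) (b : W →ₗ[ℂ] Z)

/-- Operators of the form `1 - x`, where `x` has summable approximation numbers, have index `0`. -/
theorem index_one_sub {n r : ℕ} (hr : 1 ≤ r) {x : V →L[ℂ] V} (hx : x ∈ schattenPow n r V V) :
    ((ContinuousLinearMap.id ℂ V - x : V →L[ℂ] V) : V →ₗ[ℂ] V).index = 0 := by
  obtain ⟨U, F, hF, e⟩ := exists_finite_inverse hr hx
  set G : V →L[ℂ] V := ↑U⁻¹ * F with hG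
  have hGf : FiniteDimensional ℂ (LinearMap.range (G : V →ₗ[ℂ] V)) := by
    have : LinearMap.range (G : V →ₗ[ℂ] V) =
        (LinearMap.range (F : V →ₗ[ℂ] V)).map ((↑U⁻¹ : V →L[ℂ] V) : V →ₗ[ℂ] V) :=
      LinearMap.range_comp _ _
    rw [this]
    infer_instance
  have h0 : FiniteDimensional ℂ (LinearMap.range ((0 : V →L[ℂ] V) : V →ₗ[ℂ] V)) := by
    rw [show ((0 : V →L[ℂ] V) : V →ₗ[ℂ] V) = 0 from rfl, LinearMap.range_zero]
    infer_instance
  have e1 : ContinuousLinearMap.id ℂ V - x =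
      (U : V →L[ℂ] V) ∘L (ContinuousLinearMap.id ℂ V - G) := by
    refine e.trans ?_
    change (U : V →L[ℂ] V) - F = U * (1 - G)
    rw [hG, mul_sub, mul_one, Units.mul_inv_cancel_left]
  have h1 : (↑U⁻¹ : V →L[ℂ] V) ∘L (U : V →L[ℂ] V) = ContinuousLinearMap.id ℂ V := U.inv_mul
  have h2 : (U : V →L[ℂ] V) ∘L (↑U⁻¹ : V →L[ℂ] V) = ContinuousLinearMap.id ℂ V := U.mul_inv
  have hU : (U : V →L[ℂ] V).IsFredholm :=
    isFredholm_of_left_right h0 h0 (h1.trans (sub_zero _).symm) (h2.trans (sub_zero _).symm)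
  have hFr : (ContinuousLinearMap.id ℂ V - G).IsFredholm :=
    isFredholm_of_left_right (b := ContinuousLinearMap.id ℂ V) (c := ContinuousLinearMap.id ℂ V)
      hGf hGf rfl rfl
  -- Both factors `U` and `1 - U⁻¹F` of `1 - x = U - F` have index `0` by the trace formula.
  have i1 : ((U : V →L[ℂ] V) : V →ₗ[ℂ] V).index = 0 := by
    have := index_eq_opTrace_sub hU (b := ↑U⁻¹) (by rw [h1, sub_self]; exact isNuc_zero)
      (by rw [h2, sub_self]; exact isNuc_zero)
    rw [h1, h2, sub_self] at this
    exact_mod_cast this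
  have i2 : ((ContinuousLinearMap.id ℂ V - G : V →L[ℂ] V) : V →ₗ[ℂ] V).index = 0 := by
    have h3 : ContinuousLinearMap.id ℂ V -
        ContinuousLinearMap.id ℂ V ∘L (ContinuousLinearMap.id ℂ V - G) = G := sub_sub_cancel _ _
    have h4 : ContinuousLinearMap.id ℂ V -
        (ContinuousLinearMap.id ℂ V - G) ∘L ContinuousLinearMap.id ℂ V = G := sub_sub_cancel _ _
    have := index_eq_opTrace_sub hFr (b := ContinuousLinearMap.id ℂ V)
      (by rw [h3]; exact isNuc_of_finite hGf) (by rw [h4]; exact isNuc_of_finite hGf)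
    rw [h3, h4, sub_self] at this
    exact_mod_cast this
  rw [e1, index_comp_of_isFredholm hFr hU, i1, i2, add_zero]

/-- The index does not change under perturbations with summable approximation numbers. -/
theorem index_eq_of_sub_mem {n r : ℕ} (hr : 1 ≤ r) {a a' : V →L[ℂ] W} {b : W →L[ℂ] V}
    (h1 : ContinuousLinearMap.id ℂ V - b ∘L a ∈ schattenPow n r V V)
    (h2 : ContinuousLinearMap.id ℂ W - a ∘L b ∈ schattenPow n r W W)
    (h : a' - a ∈ schattenPow n r V W) :
    a'.IsFredholm ∧ (a' : V →ₗ[ℂ] W).index = (a : V →ₗ[ℂ] W).index := by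
  have e1 : ContinuousLinearMap.id ℂ V - b ∘L a' =
      ContinuousLinearMap.id ℂ V - b ∘L a - b ∘L (a' - a) := by
    rw [ContinuousLinearMap.comp_sub]
    abel
  have e2 : ContinuousLinearMap.id ℂ W - a' ∘L b =
      ContinuousLinearMap.id ℂ W - a ∘L b - (a' - a) ∘L b := by
    rw [ContinuousLinearMap.sub_comp]
    abel
  have h1' : ContinuousLinearMap.id ℂ V - b ∘L a' ∈ schattenPow n r V V := by
    rw [e1]
    exact sub_mem h1 (comp_left_mem_schattenPow b h)
  have h2' : ContinuousLinearMap.id ℂ W - a' ∘L b ∈ schattenPow n r W W := by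
    rw [e2]
    exact sub_mem h2 (comp_right_mem_schattenPow b h)
  have hb := isFredholm_of_mem_schattenPow hr h2 h1
  -- Every Fredholm operator inverted by `b` up to small operators has the negative of the index of
  -- `b` as its index.
  have key : ∀ {c : V →L[ℂ] W}, c.IsFredholm →
      ContinuousLinearMap.id ℂ V - b ∘L c ∈ schattenPow n r V V →
      (b : W →ₗ[ℂ] V).index + (c : V →ₗ[ℂ] W).index = 0 := fun {c} hc h => by
    rw [← index_comp_of_isFredholm hc hb, ← index_one_sub hr h, sub_sub_cancel]
  have ha' := isFredholm_of_mem_schattenPow hr h1' h2'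
  refine ⟨ha', ?_⟩
  have k1 := key ha' h1'
  have k2 := key (isFredholm_of_mem_schattenPow hr h1 h2) h1
  omega

end Fredholm

/-! ### The index of a pair of idempotents -/

section Idempotents

variable {K : Type*} [NormedAddCommGroup K] [InnerProductSpace ℂ K] [CompleteSpace K]

/-- The range of an idempotent `g`, as the closed subspace of the vectors fixed by `g`. -/
def fixedSpace (g : K →L[ℂ] K) : Submodule ℂ K := LinearMap.ker ((1 - g : K →L[ℂ] K) : K →ₗ[ℂ] K)

theorem mem_fixedSpace {g : K →L[ℂ] K} {x : K} : x ∈ fixedSpace g ↔ g x = x := by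
  rw [fixedSpace, LinearMap.mem_ker]
  change x - g x = 0 ↔ _
  rw [sub_eq_zero, eq_comm]

instance (g : K →L[ℂ] K) : CompleteSpace (fixedSpace g) :=
  (1 - g).isClosed_ker.completeSpace_coe

/-- The projection onto the range of an idempotent. -/
def fixedProj {g : K →L[ℂ] K} (hg : g * g = g) : K →L[ℂ] fixedSpace g :=
  g.codRestrict _ fun x => mem_fixedSpace.2 (congrArg (fun f : K →L[ℂ] K => f x) hg)

/-- The compression of an operator to the ranges of two idempotents. -/
def compress (g : K →L[ℂ] K) {h : K →L[ℂ] K} (hh : h * h = h) (Y : K →L[ℂ] K) :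
    fixedSpace g →L[ℂ] fixedSpace h := fixedProj hh ∘L Y ∘L (fixedSpace g).subtypeL

theorem compress_mem_schattenPow {n r : ℕ} {g h : K →L[ℂ] K} (hh : h * h = h) {Y : K →L[ℂ] K}
    (hY : Y ∈ schattenPow n r K K) :
    compress g hh Y ∈ schattenPow n r (fixedSpace g) (fixedSpace h) :=
  comp_left_mem_schattenPow _ (comp_right_mem_schattenPow _ hY)

theorem opTrace_compress {g : K →L[ℂ] K} (hg : g * g = g) {Y : K →L[ℂ] K} (hY : IsNuc Y) :
    opTrace (compress g hg Y) = opTrace (Y * g) :=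
  (opTrace_comp_comm (hY.comp_right (fixedSpace g).subtypeL) (fixedProj hg)).trans
    (congrArg opTrace (ContinuousLinearMap.ext fun _ => rfl))

/-- The index of `hg : ran g → ran h` for idempotents `g` and `h` with small difference, also after
a small perturbation. Here `(g - h)²` commutes with `g` and `h`, and it is `1 - ghg` on `ran g` and
`1 - hgh` on `ran h`; therefore `(1 + (g - h)² + ⋯ + (g - h)²ᵐ⁻²) g` inverts `hg` modulo `(g -
h)²ᵐ`. -/
theorem index_of_idempotents {n : ℕ} (hn : 1 ≤ n) {g h : K →L[ℂ] K} (hg : g * g = g)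
    (hh : h * h = h)
    (hgh : g - h ∈ schattenPow n 1 K K) {Z : K →L[ℂ] K} (hZ : Z ∈ schattenPow n 1 K K)
    (f : fixedSpace g →ₗ[ℂ] fixedSpace h) (hf : ∀ z, (f z : K) = h (z + Z z)) {m : ℕ}
    (hm : n ≤ 2 * m) :
    FiniteDimensional ℂ (LinearMap.ker f) ∧ FiniteDimensional ℂ (_ ⧸ LinearMap.range f) ∧
      (f.index : ℂ) = opTrace ((g - h) ^ (2 * m + 1)) := by
  -- `S = (g - h)²` commutes with `g` and `h`, and `g h g = g (1 - S)`, `h g h = h (1 - S)`.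
  set S := (g - h) ^ 2 with hS
  have hSeq : S = g + h - g * h - h * g := by
    rw [hS, sq, sub_mul, mul_sub, mul_sub, hg, hh]
    abel
  have hSg : g * S = S * g := by
    rw [hSeq]
    simp only [mul_sub, mul_add, sub_mul, add_mul, hg, ← mul_assoc]
    rw [mul_assoc h g g, hg]
    abel
  have hSh : h * S = S * h := by
    rw [hSeq]
    simp only [mul_sub, mul_add, sub_mul, add_mul, hh, ← mul_assoc]
    rw [mul_assoc g h h, hh]
    abel
  have hg1 : g * h * g = g * (1 - S) := by
    rw [hSeq]
    simp only [mul_sub, mul_add, hg, ← mul_assoc, mul_one]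
    abel
  have hh1 : h * g * h = h * (1 - S) := by
    rw [hSeq]
    simp only [mul_sub, mul_add, hh, ← mul_assoc, mul_one]
    abel
  -- A truncated Neumann series for the inverse of `1 - S`.
  set G := ∑ i ∈ Finset.range m, S ^ i with hG
  have hGS : G * (1 - S) = 1 - S ^ m := geom_sum_mul_neg S m
  have hGg : g * G = G * g :=
      (Commute.sum_right _ _ _ fun i _ => (show Commute g S from hSg).pow_right i)
  have hGh : h * G = G * h :=
      (Commute.sum_right _ _ _ fun i _ => (show Commute h S from hSh).pow_right i)
  have hSmem : S ^ m ∈ schattenPow n (2 * m) K K := by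
    rw [hS, ← pow_mul]
    have h1 := (prod_mem_schattenPow hgh (l := 2 * m) fun _ => (1 : K →L[ℂ] K))
    simpa using h1
  set a := compress g hh 1 with ha
  set b := compress h hg G with hb
  have hba : ContinuousLinearMap.id ℂ _ - b ∘L a = compress g hg (S ^ m) := by
    refine ContinuousLinearMap.ext fun z => Subtype.ext ?_
    have hz : g z = z := mem_fixedSpace.1 z.2
    change (z : K) - (g * G * h) z = (g * S ^ m) z
    have h1 : (g * G * h) z = (g - g * S ^ m) (z : K) := by
      conv_lhs => rw [← hz]
      change (g * G * h * g) z = _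
      rw [hGg, mul_assoc G, mul_assoc G, hg1, ← mul_assoc, ← hGg, mul_assoc, hGS, mul_sub, mul_one]
    rw [h1, sub_apply, hz, sub_sub_cancel]
  have hab : ContinuousLinearMap.id ℂ _ - a ∘L b = compress h hh (S ^ m) := by
    refine ContinuousLinearMap.ext fun z => Subtype.ext ?_
    have hz : h z = z := mem_fixedSpace.1 z.2
    change (z : K) - (h * g * G) z = (h * S ^ m) z
    have h1 : (h * g * G) z = (h - h * S ^ m) (z : K) := by
      conv_lhs => rw [← hz]
      change (h * g * G * h) z = _
      rw [mul_assoc _ G, ← hGh, ← mul_assoc, hh1, mul_assoc, sub_mul, one_mul,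
        ← (show Commute G S from Commute.sum_left _ _ _ fun i _ => (Commute.refl S).pow_left i).eq,
        ← mul_one_sub, hGS, mul_sub, mul_one]
    rw [h1, sub_apply, hz, sub_sub_cancel]
  have h1 : ContinuousLinearMap.id ℂ _ - b ∘L a ∈ schattenPow n (2 * m) _ _ := by
    rw [hba]; exact compress_mem_schattenPow hg hSmem
  have h2 : ContinuousLinearMap.id ℂ _ - a ∘L b ∈ schattenPow n (2 * m) _ _ := by
    rw [hab]; exact compress_mem_schattenPow hh hSmem
  have hm1 : 1 ≤ 2 * m := hn.trans hm
  -- The perturbation by `Z` changes neither the Fredholm property nor the index.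
  set a' := compress g hh (1 + Z) with ha'
  have h3 : a' - a ∈ schattenPow n 1 (fixedSpace g) (fixedSpace h) := by
    have : a' - a = compress g hh Z := by
      refine ContinuousLinearMap.ext fun z => Subtype.ext ?_
      change h (z + Z z) - h z = h (Z z)
      rw [map_add, add_sub_cancel_left]
    rw [this]
    exact compress_mem_schattenPow hh hZ
  obtain ⟨h4, h5⟩ := index_eq_of_sub_mem le_rfl (schattenPow_anti hm1 h1)
      (schattenPow_anti hm1 h2) h3
  have hfa : f = (a' : fixedSpace g →ₗ[ℂ] fixedSpace h) :=
    LinearMap.ext fun z => Subtype.ext (hf z)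
  rw [hfa]
  refine ⟨h4.finite_ker, h4.finite_coker, ?_⟩
  have hSn := isNuc_of_mem_schattenPow hn hm hSmem
  rw [h5, index_eq_opTrace_sub (b := b) (isFredholm_of_mem_schattenPow hm1 h1 h2)
    (isNuc_of_mem_schattenPow hn hm h1) (isNuc_of_mem_schattenPow hn hm h2), hba, hab,
    opTrace_compress hg hSn, opTrace_compress hh hSn]
  -- The index is `Tr(Sᵐ g) - Tr(Sᵐ h)`.
  have e : (g - h) ^ (2 * m + 1) = S ^ m * g - S ^ m * h := by
    rw [pow_succ, pow_mul, mul_sub]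
  rw [e]
  exact (opTrace_sub (hSn.comp_right g) (hSn.comp_right h)).symm

/-- Kernel, cokernel and index are transported by isomorphisms. -/
theorem index_of_linearEquiv {V V' W W' : Type*} [AddCommGroup V] [Module ℂ V] [AddCommGroup V']
    [Module ℂ V'] [AddCommGroup W] [Module ℂ W] [AddCommGroup W'] [Module ℂ W'] {c : V →ₗ[ℂ] W}
    {f : V' →ₗ[ℂ] W'} (α : V ≃ₗ[ℂ] V') (β : W ≃ₗ[ℂ] W') (h : ∀ x, β (c x) = f (α x))
    (h1 : FiniteDimensional ℂ (LinearMap.ker f))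
    (h2 : FiniteDimensional ℂ (_ ⧸ LinearMap.range f)) :
    FiniteDimensional ℂ (LinearMap.ker c) ∧ FiniteDimensional ℂ (_ ⧸ LinearMap.range c) ∧
      c.index = f.index := by
  have hk : (LinearMap.ker c).map (α : V →ₗ[ℂ] V') = LinearMap.ker f := by
    ext y
    constructor
    · rintro ⟨x, hx, rfl⟩
      change f (α x) = 0
      rw [← h, show c x = 0 from hx, map_zero]
    · intro hy
      refine ⟨α.symm y, ?_, α.apply_symm_apply y⟩
      refine β.injective ?_
      rw [h, α.apply_symm_apply, show f y = 0 from hy, map_zero]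
  have hr : (LinearMap.range c).map (β : W →ₗ[ℂ] W') = LinearMap.range f := by
    ext y
    constructor
    · rintro ⟨_, ⟨x, rfl⟩, rfl⟩
      exact ⟨α x, (h x).symm⟩
    · rintro ⟨x, rfl⟩
      refine ⟨_, ⟨α.symm x, rfl⟩, ?_⟩
      change β (c _) = _
      rw [h, α.apply_symm_apply]
  have e1 : LinearMap.ker c ≃ₗ[ℂ] LinearMap.ker f := LinearEquiv.ofSubmodules α _ _ hk
  have e2 : (W ⧸ LinearMap.range c) ≃ₗ[ℂ] (W' ⧸ LinearMap.range f) :=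
    Submodule.Quotient.equiv _ _ β hr
  refine ⟨Module.Finite.equiv e1.symm, Module.Finite.equiv e2.symm, ?_⟩
  rw [LinearMap.index_eq_finrank_sub, LinearMap.index_eq_finrank_sub, e1.finrank_eq, e2.finrank_eq]

end Idempotents

/-! ### Matrices of operators -/

section Matrices

variable {K : Type*} [NormedAddCommGroup K] [InnerProductSpace ℂ K] [CompleteSpace K] {N : ℕ}

/-- The inclusion of the `i`-th summand of `Kᴺ`. -/
def inclL (K : Type*) [NormedAddCommGroup K] [InnerProductSpace ℂ K] (i : Fin N) :
    K →L[ℂ] PiLp 2 (fun _ : Fin N => K) :=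
  (PiLp.continuousLinearEquiv 2 ℂ fun _ : Fin N => K).symm.toContinuousLinearMap ∘L
    ContinuousLinearMap.single ℂ (fun _ : Fin N => K) i

theorem inclL_apply (i j : Fin N) (x : K) : inclL K i x j = if j = i then x else 0 := by
  change (Pi.single i x : Fin N → K) j = _
  rw [Pi.single_apply]

/-- The operator on `Kᴺ` with a given matrix of operators. -/
def matOp (M : Matrix (Fin N) (Fin N) (K →L[ℂ] K)) :
    PiLp 2 (fun _ : Fin N => K) →L[ℂ] PiLp 2 (fun _ : Fin N => K) :=
  ∑ i, ∑ j, inclL K i ∘L M i j ∘L PiLp.proj 2 (fun _ : Fin N => K) j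

theorem matOp_apply (M : Matrix (Fin N) (Fin N) (K →L[ℂ] K)) (x : PiLp 2 (fun _ : Fin N => K))
    (i : Fin N) : matOp M x i = ∑ j, M i j (x j) := by
  simp only [matOp, sum_apply, ContinuousLinearMap.comp_apply, PiLp.proj_apply]
  rw [← PiLp.proj_apply (𝕜 := ℂ) 2 (fun _ : Fin N => K) i, map_sum]
  simp only [map_sum, PiLp.proj_apply, inclL_apply]
  simp [Finset.sum_comm]

theorem matOp_ext {S T : PiLp 2 (fun _ : Fin N => K) →L[ℂ] PiLp 2 (fun _ : Fin N => K)}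
    (h : ∀ x i, S x i = T x i) : S = T :=
  ContinuousLinearMap.ext fun x => PiLp.ext fun i => h x i

theorem matOp_sub (M M' : Matrix (Fin N) (Fin N) (K →L[ℂ] K)) :
    matOp (M - M') = matOp M - matOp M' := matOp_ext fun x i => by
  rw [sub_apply, PiLp.sub_apply, matOp_apply, matOp_apply, matOp_apply, ← Finset.sum_sub_distrib]
  rfl

theorem matOp_mul (M M' : Matrix (Fin N) (Fin N) (K →L[ℂ] K)) :
    matOp (M * M') = matOp M * matOp M' := matOp_ext fun x i => by
  rw [mul_apply_eq_comp, matOp_apply, matOp_apply]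
  simp only [matOp_apply, Matrix.mul_apply, sum_apply, map_sum]
  rw [Finset.sum_comm]
  rfl

theorem matOp_one : matOp (1 : Matrix (Fin N) (Fin N) (K →L[ℂ] K)) = 1 := matOp_ext fun x i => by
  rw [matOp_apply, Finset.sum_eq_single i]
  · rw [Matrix.one_apply_eq]
    rfl
  · intro j _ hj
    rw [Matrix.one_apply_ne hj.symm]
    rfl
  · intro h
    exact absurd (Finset.mem_univ _) h

theorem matOp_pow (M : Matrix (Fin N) (Fin N) (K →L[ℂ] K)) (k : ℕ) :
    matOp (M ^ k) = matOp M ^ k := by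
  induction k with
  | zero => rw [pow_zero, pow_zero, matOp_one]
  | succ k ih => rw [pow_succ, pow_succ, matOp_mul, ih]

theorem matOp_mem_schattenPow {n r : ℕ} {M : Matrix (Fin N) (Fin N) (K →L[ℂ] K)}
    (h : ∀ i j, M i j ∈ schattenPow n r K K) : matOp M ∈ schattenPow n r _ _ :=
  sum_mem fun i _ => sum_mem fun j _ =>
    comp_left_mem_schattenPow _ (comp_right_mem_schattenPow _ (h i j))

theorem opTrace_matOp {M : Matrix (Fin N) (Fin N) (K →L[ℂ] K)} (h : ∀ i j, IsNuc (M i j)) :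
    opTrace (matOp M) = ∑ i, opTrace (M i i) := by
  have h1 : ∀ i j, IsNuc (inclL K i ∘L M i j ∘L PiLp.proj 2 (fun _ : Fin N => K) j) :=
    fun i j => ((h i j).comp_right _).comp_left _
  rw [matOp, opTrace_sum _ fun i _ => IsNuc.sum _ fun j _ => h1 i j]
  refine Finset.sum_congr rfl fun i _ => ?_
  rw [opTrace_sum _ fun j _ => h1 i j]
  have h2 : ∀ j, opTrace (inclL K i ∘L M i j ∘L PiLp.proj 2 (fun _ : Fin N => K) j) =
      if j = i then opTrace (M i j) else 0 := fun j => by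
    rw [opTrace_comp_comm ((h i j).comp_right _)]
    split_ifs with hj
    · congr 1
      refine ContinuousLinearMap.ext fun x => ?_
      change M i j (inclL K i x j) = _
      rw [inclL_apply, if_pos hj]
    · rw [← opTrace_zero (H := K)]
      congr 1
      refine ContinuousLinearMap.ext fun x => ?_
      change M i j (inclL K i x j) = 0
      rw [inclL_apply, if_neg hj, map_zero]
  simp only [h2]
  rw [Finset.sum_ite_eq' Finset.univ i, if_pos (Finset.mem_univ _)]

end Matrices

/-! ### Traces of products of matrices as sums over closed paths -/

section Paths

variable {R : Type*} [Ring R] {N : ℕ}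

/-- An entry of a product of matrices is a sum over the paths that join its indices. -/
theorem prod_apply_eq_sum_paths {m : ℕ} (M : Fin (m + 1) → Matrix (Fin N) (Fin N) R) (a b : Fin N) :
    (List.ofFn M).prod a b = ∑ i : Fin m → Fin N, (List.ofFn fun k =>
      M k ((Fin.cons a i : Fin (m + 1) → Fin N) k)
        ((Fin.snoc i b : Fin (m + 1) → Fin N) k)).prod := by
  induction m generalizing a with
  | zero =>
    rw [Fintype.sum_unique, List.ofFn_succ, List.ofFn_zero, List.prod_cons, List.prod_nil, mul_one,
      List.ofFn_succ, List.ofFn_zero, List.prod_cons, List.prod_nil, mul_one]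
    rfl
  | succ m ih =>
    rw [List.ofFn_succ, List.prod_cons, Matrix.mul_apply,
      ← (Fin.consEquiv fun _ : Fin (m + 1) => Fin N).sum_comp, Fintype.sum_prod_type]
    refine Finset.sum_congr rfl fun c _ => ?_
    rw [ih, Finset.mul_sum]
    refine Finset.sum_congr rfl fun i _ => ?_
    conv_rhs => rw [List.ofFn_succ, List.prod_cons]
    have e0 : (Fin.consEquiv fun _ : Fin (m + 1) => Fin N) (c, i) = Fin.cons c i := rfl
    rw [e0, ← Fin.cons_snoc_eq_snoc_cons]
    simp only [Fin.cons_zero, Fin.cons_succ]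

/-- The trace of a product of matrices is a sum over closed paths; this is the form in which
`matTrace` evaluates a cochain on matrices. -/
theorem sum_closed_paths {F : Type*} [AddCommMonoid F] {m : ℕ} (θ : R →+ F)
    (M : Fin (m + 1) → Matrix (Fin N) (Fin N) R) :
    ∑ i : Fin (m + 1) → Fin N, θ (List.ofFn fun k => M k (i k) (i (finRotate (m + 1) k))).prod =
      ∑ a, θ ((List.ofFn M).prod a a) := by
  rw [← (Fin.consEquiv fun _ : Fin (m + 1) => Fin N).sum_comp, Fintype.sum_prod_type]
  refine Finset.sum_congr rfl fun a _ => ?_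
  rw [prod_apply_eq_sum_paths, map_sum]
  refine Finset.sum_congr rfl fun i _ => ?_
  congr 3
  funext k
  have e0 : (Fin.consEquiv fun _ : Fin (m + 1) => Fin N) (a, i) = Fin.cons a i := rfl
  rw [e0]
  congr 1
  refine Fin.lastCases ?_ (fun k => ?_) k
  · rw [finRotate_last, Fin.cons_zero, Fin.snoc_last]
  · rw [Fin.snoc_castSucc]
    have : finRotate (m + 1) k.castSucc = k.succ := Fin.ext (by
      rw [val_finRotate]
      simp [k.2.ne])
    rw [this, Fin.cons_succ]

end Paths

/-! ### The pairing with the Chern character -/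

section Pairing

variable {A : Type*} [Ring A] [Algebra ℂ A] {N : ℕ}

theorem linearize_trChain {m : ℕ} (φ : MultiForm A m ℂ) (x : Chain (Matrix (Fin N) (Fin N) A) m) :
    linearize φ (trChain N m x) = linearize (matTrace N m φ) x := by
  have h : linearize φ ∘ₗ trChain N m = linearize (matTrace N m φ) := by
    rw [trChain, ← linearize_comp, ← matTrace_comp, linearize_comp_tens]
  exact congrArg (fun f => f x) h

/-- The part `(1 - T)(1 ⊗ e ⊗ ⋯ ⊗ e)` of the Chern character is not seen by cyclic cochains. -/
theorem linearize_chernChain {q : ℕ} {φ : MultiForm A (2 * q) ℂ} (h : opT (2 * q) φ = φ)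
    (e : Matrix (Fin N) (Fin N) A) : linearize φ (chernChain e q) =
      (-1 : ℂ) ^ q * ((2 * q).factorial / q.factorial) * matTrace N (2 * q) φ fun _ => e := by
  have h1 : opT (2 * q) (matTrace N (2 * q) φ) = matTrace N (2 * q) φ := by
    conv_rhs => rw [← h]
    rw [opT, opT, LinearMap.smul_apply, LinearMap.smul_apply, map_smul, matTrace_rot]
  have h2 := congrArg (fun f => f (onePowChain e (2 * q))) (linearize_opT (matTrace N (2 * q) φ))
  rw [h1] at h2
  rw [chernChain, map_smul, linearize_trChain, map_sub, map_smul, map_sub, powChain, linearize_tens]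
  have h3 : linearize (matTrace N (2 * q) φ) (onePowChain e (2 * q)) =
    linearize (matTrace N (2 * q) φ) (chainT (2 * q) (onePowChain e (2 * q))) := h2
  rw [h3, sub_self, smul_zero, sub_zero, smul_eq_mul]

/-- The pairing of the class of a cyclic cocycle of degree `2q` with a Chern character involves the
component of degree `2q` only. -/
theorem duality_cyclicClass [TopologicalSpace A] [IsTopologicalRing A] [ContinuousSMul ℂ A]
    [LocallyConvexSpace ℝ A] {q : ℕ} {φ : MultiForm A (2 * q) ℂ}
    (h : IsCyclicCocycle φ) (hS : φ ∈ contForms A (2 * q)) {e : Matrix (Fin N) (Fin N) A}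
    (he : e * e = e) :
    duality A (cyclicClass φ h hS) (homologyToTop A (chernClass e he)) =
      (-1 : ℂ) ^ q * ((2 * q).factorial / q.factorial) * matTrace N (2 * q) φ fun _ => e := by
  change pairCochain ⟨Pi.single q φ, (h.single_mem hS).1⟩
    (fun q => toTop (2 * q) (chernChain e q)) = _
  rw [pairCochain_eq _ _ (q + 1) fun r hr => Pi.single_eq_of_ne (by omega) _, Finset.sum_range_succ,
    Finset.sum_eq_zero, zero_add, topEval_toTop, ← linearize_chernChain h.1 e]
  · have : (Pi.single q φ : EvenForms A) q = φ := Pi.single_eq_same _ _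
    exact congrArg (fun ψ => linearize ψ (chernChain e q)) this
  · intro r hr
    rw [topEval_toTop]
    have : (Pi.single q φ : EvenForms A) r = 0 :=
      Pi.single_eq_of_ne (Finset.mem_range.1 hr).ne _
    exact (congrArg (fun ψ => linearize ψ (chernChain e r)) this).trans (by rw [map_zero]; rfl)

end Pairing

/-! ### Graded idempotents -/

section Graded

variable {K : Type*} [NormedAddCommGroup K] [InnerProductSpace ℂ K] [CompleteSpace K]

/-- For an involution `Γ` and `ε = ±1`, the projection onto the `-ε`-eigenspace of `Γ`. -/
def gradProj (Γ : K →L[ℂ] K) (ε : ℂ) : K →L[ℂ] K := (1 / 2 : ℂ) • (1 - ε • Γ)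

variable {Γ : K →L[ℂ] K} {ε : ℂ}

theorem gradProj_apply (Γ : K →L[ℂ] K) (ε : ℂ) (x : K) :
    gradProj Γ ε x = (1 / 2 : ℂ) • (x - ε • Γ x) := rfl

theorem gradProj_mul_self (hΓ : Γ * Γ = 1) (hε : ε * ε = 1) :
    gradProj Γ ε * gradProj Γ ε = gradProj Γ ε := by
  have h : (1 - ε • Γ) * (1 - ε • Γ) = (2 : ℂ) • (1 - ε • Γ) := by
    rw [mul_sub, sub_mul, sub_mul, one_mul, one_mul, mul_one, smul_mul_smul_comm, hΓ, hε, one_smul,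
      two_smul]
    abel
  rw [gradProj, smul_mul_smul_comm, h, smul_smul]
  norm_num

theorem gradProj_comm {g : K →L[ℂ] K} (hg : Γ * g = g * Γ) :
    gradProj Γ ε * g = g * gradProj Γ ε := by
  rw [gradProj, smul_mul_assoc, mul_smul_comm, sub_mul, mul_sub, one_mul, mul_one, smul_mul_assoc,
    mul_smul_comm, hg]

theorem gradProj_mul_idem (hΓ : Γ * Γ = 1) (hε : ε * ε = 1) {g : K →L[ℂ] K} (hΓg : Γ * g = g * Γ)
    (hg : g * g = g) : (gradProj Γ ε * g) * (gradProj Γ ε * g) = gradProj Γ ε * g := by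
  rw [mul_assoc, ← mul_assoc g, ← gradProj_comm hΓg, mul_assoc (gradProj Γ ε) g, hg, ← mul_assoc,
    gradProj_mul_self hΓ hε]

theorem gradProj_mul_pow (hΓ : Γ * Γ = 1) (hε : ε * ε = 1) {g : K →L[ℂ] K} (hΓg : Γ * g = g * Γ)
    (k : ℕ) : (gradProj Γ ε * g) ^ (k + 1) = gradProj Γ ε * g ^ (k + 1) := by
  rw [(show Commute (gradProj Γ ε) g from gradProj_comm hΓg).mul_pow,
    (show IsIdempotentElem (gradProj Γ ε) from gradProj_mul_self hΓ hε).pow_succ_eq]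

theorem gradProj_eq_self_iff (hε : ε * ε = 1) {x : K} : gradProj Γ ε x = x ↔ Γ x = -ε • x := by
  rw [gradProj_apply]
  constructor
  · intro h
    have h1 : x - ε • Γ x = (2 : ℂ) • x := by
      conv_rhs => rw [← h]
      rw [smul_smul]
      norm_num
    have h2 : ε • Γ x = -x := by
      rw [← sub_sub_cancel x (ε • Γ x), h1, two_smul, sub_add_cancel_left]
    rw [← one_smul ℂ (Γ x), ← hε, mul_smul, h2, smul_neg, neg_smul]
  · intro h
    rw [h, smul_smul, mul_neg, hε, neg_smul, one_smul, sub_neg_eq_add, ← two_smul ℂ x, smul_smul]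
    norm_num

theorem mem_fixedSpace_gradProj (hΓ : Γ * Γ = 1) (hε : ε * ε = 1) {g : K →L[ℂ] K}
    (hΓg : Γ * g = g * Γ) (hg : g * g = g) {x : K} :
    x ∈ fixedSpace (gradProj Γ ε * g) ↔ g x = x ∧ Γ x = -ε • x := by
  rw [mem_fixedSpace, ← gradProj_eq_self_iff hε, mul_apply_eq_comp]
  constructor
  · intro h
    constructor
    · conv_lhs => rw [← h]
      rw [← mul_apply_eq_comp, ← gradProj_comm hΓg, mul_apply_eq_comp, ← mul_apply_eq_comp g g, hg,
        h]
    · conv_lhs => rw [← h]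
      rw [← mul_apply_eq_comp, gradProj_mul_self hΓ hε, h]
  · rintro ⟨h1, h2⟩
    rw [h1, h2]

/-- The graded index of a pair of idempotents that commute with the grading `Γ`, as a
supertrace. -/
theorem index_of_graded_idempotents {n : ℕ} (hn : 1 ≤ n) {g h : K →L[ℂ] K} (hΓ : Γ * Γ = 1)
    (hΓg : Γ * g = g * Γ) (hΓh : Γ * h = h * Γ) (hg : g * g = g) (hh : h * h = h)
    (hgh : g - h ∈ schattenPow n 1 K K) {Z : K →L[ℂ] K} (hZ : Z ∈ schattenPow n 1 K K)
    (f₁ : fixedSpace (gradProj Γ 1 * g) →ₗ[ℂ] fixedSpace (gradProj Γ 1 * h))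
    (hf₁ : ∀ z, (f₁ z : K) = h (z + Z z))
    (f₂ : fixedSpace (gradProj Γ (-1) * g) →ₗ[ℂ] fixedSpace (gradProj Γ (-1) * h))
    (hf₂ : ∀ z, (f₂ z : K) = h (z + Z z)) {m : ℕ} (hm : n ≤ 2 * m) :
    (FiniteDimensional ℂ (LinearMap.ker f₁) ∧ FiniteDimensional ℂ (_ ⧸ LinearMap.range f₁)) ∧
    (FiniteDimensional ℂ (LinearMap.ker f₂) ∧ FiniteDimensional ℂ (_ ⧸ LinearMap.range f₂)) ∧
      (f₁.index : ℂ) - f₂.index = -opTrace (Γ * (g - h) ^ (2 * m + 1)) := by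
  have h1 : (1 : ℂ) * 1 = 1 := one_mul 1
  have h2 : (-1 : ℂ) * -1 = 1 := by norm_num
  have hΓd : Γ * (g - h) = (g - h) * Γ := by rw [mul_sub, sub_mul, hΓg, hΓh]
  have key : ∀ ε : ℂ, ε * ε = 1 →
      ∀ f : fixedSpace (gradProj Γ ε * g) →ₗ[ℂ] fixedSpace (gradProj Γ ε * h),
      (∀ z, (f z : K) = h (z + Z z)) →
      FiniteDimensional ℂ (LinearMap.ker f) ∧ FiniteDimensional ℂ (_ ⧸ LinearMap.range f) ∧
        (f.index : ℂ) = opTrace (gradProj Γ ε * (g - h) ^ (2 * m + 1)) := by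
    intro ε hε f hf
    have hd : gradProj Γ ε * g - gradProj Γ ε * h = gradProj Γ ε * (g - h) := (mul_sub _ _ _).symm
    have := index_of_idempotents hn (gradProj_mul_idem hΓ hε hΓg hg)
      (gradProj_mul_idem hΓ hε hΓh hh)
      (by rw [hd]; exact comp_left_mem_schattenPow _ hgh) hZ f (fun z => by
        have h3 := ((mem_fixedSpace_gradProj hΓ hε hΓh hh).1 (f z).2).2
        rw [mul_apply_eq_comp, ← hf, (gradProj_eq_self_iff hε).2 h3]) hm
    rwa [hd, gradProj_mul_pow hΓ hε hΓd] at this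
  obtain ⟨a1, a2, a3⟩ := key 1 h1 f₁ hf₁
  obtain ⟨b1, b2, b3⟩ := key (-1) h2 f₂ hf₂
  refine ⟨⟨a1, a2⟩, ⟨b1, b2⟩, ?_⟩
  have hnuc : IsNuc ((g - h) ^ (2 * m + 1)) := by
    refine isNuc_of_mem_schattenPow hn (hm.trans (Nat.le_succ _)) ?_
    have := prod_mem_schattenPow hgh (l := 2 * m + 1) fun _ => (1 : K →L[ℂ] K)
    rwa [List.ofFn_const, List.prod_replicate, mul_one] at this
  rw [a3, b3, ← opTrace_neg, ← neg_mul]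
  refine (opTrace_sub (hnuc.comp_left _) (hnuc.comp_left _)).symm.trans (congrArg opTrace ?_)
  refine (sub_mul (gradProj Γ 1) _ _).symm.trans (congrArg (· * _) ?_)
  rw [gradProj, gradProj, ← smul_sub]
  -- The difference of the projections onto the `-1`- and the `1`-eigenspaces of `Γ` is `-Γ`.
  have : (1 - (1 : ℂ) • Γ) - (1 - (-1 : ℂ) • Γ) = (2 : ℂ) • -Γ := by
    rw [two_smul, neg_smul, one_smul]
    abel
  rw [this, smul_smul]
  norm_num

/-- Moving the odd factor `c` around the supertrace produces a sign and turns `(c Q)²ᑫ⁺¹` into `(Q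
c)²ᑫ⁺¹`. -/
theorem opTrace_anticomm {n q : ℕ} {c Q : K →L[ℂ] K} (hc : Γ * c = -(c * Γ)) (hn : 1 ≤ n)
    (hQ : Q ∈ schattenPow n 1 K K) (hq : n ≤ 2 * q + 1) :
    -opTrace (Γ * (c * Q) ^ (2 * q + 1)) = opTrace (Γ * (Q * c) ^ (2 * q + 1)) := by
  have hY : (Q * c) ^ (2 * q) * Q ∈ schattenPow n (2 * q + 1) K K := by
    have h1 := prod_mem_schattenPow hQ (l := 2 * q) fun _ => c
    rw [List.ofFn_const, List.prod_replicate] at h1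
    exact comp_mem_schattenPow h1 hQ
  -- `(c Q)²ᑫ⁺¹ = c Y` and `(Q c)²ᑫ⁺¹ = Y c`, where `Y = (Q c)²ᑫ Q` is nuclear.
  have h1 : (c * Q) ^ (2 * q + 1) = c * ((Q * c) ^ (2 * q) * Q) := by
    have h2 : (c * Q) ^ (2 * q) * c = c * (Q * c) ^ (2 * q) := mul_pow_mul _ _ _
    rw [pow_succ, ← mul_assoc, h2, mul_assoc]
  rw [h1, ← mul_assoc, hc, neg_mul, opTrace_neg, neg_neg, mul_assoc]
  refine (opTrace_comp_comm ((isNuc_of_mem_schattenPow hn hq hY).comp_left Γ) c).trans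
    (congrArg opTrace ?_)
  change Γ * ((Q * c) ^ (2 * q) * Q) * c = _
  rw [mul_assoc, mul_assoc, ← pow_succ]

end Graded

/-! ### The index pairing for bounded data -/

namespace BddTriple

variable {A : Type*} [Ring A] [Algebra ℂ A]
variable {K : Type*} [NormedAddCommGroup K] [InnerProductSpace ℂ K] [CompleteSpace K]
variable (X : BddTriple A K) {N : ℕ}

/-- `a ↦ DaD⁻¹ = π'(a) + C(a)Q`, where `Q = D⁻¹`. -/
def conj : A →ₗ[ℂ] (K →L[ℂ] K) := X.π' + LinearMap.mulRight ℂ X.Q ∘ₗ X.C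

theorem conj_apply (a : A) : X.conj a = X.π' a + X.C a * X.Q := rfl

theorem conj_mul (a b : A) : X.conj (a * b) = X.conj a * X.conj b := by
  have h : X.π b * X.Q = X.Q * X.π' b + X.Q * X.C b * X.Q := by
    rw [← X.rel, sub_add_cancel]
  have h' := congrArg (X.C a * ·) h
  simp only [conj_apply, X.π'_mul, X.C_mul, add_mul, mul_add, mul_assoc] at h' ⊢
  rw [h']
  abel

theorem γ_conj (a : A) : X.γ * X.conj a = X.conj a * X.γ := by
  rw [conj_apply, mul_add, add_mul, X.γ_π', ← mul_assoc, X.γ_C, neg_mul, mul_assoc, X.γ_Q, mul_neg,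
    neg_neg, ← mul_assoc]

/-- The diagonal amplification of an operator to `Kᴺ`. -/
def ampl (N : ℕ) (S : K →L[ℂ] K) :
    PiLp 2 (fun _ : Fin N => K) →L[ℂ] PiLp 2 (fun _ : Fin N => K) :=
  matOp (Matrix.diagonal fun _ => S)

theorem ampl_mul_matOp (S : K →L[ℂ] K) (M : Matrix (Fin N) (Fin N) (K →L[ℂ] K)) :
    ampl N S * matOp M = matOp (M.map (S * ·)) := by
  rw [ampl, ← matOp_mul]
  congr 1
  ext i j : 1
  exact Matrix.diagonal_mul _ _ _ _

theorem matOp_mul_ampl (S : K →L[ℂ] K) (M : Matrix (Fin N) (Fin N) (K →L[ℂ] K)) :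
    matOp M * ampl N S = matOp (M.map (· * S)) := by
  rw [ampl, ← matOp_mul]
  congr 1
  ext i j : 1
  exact Matrix.mul_diagonal _ _ _ _

theorem ampl_apply (S : K →L[ℂ] K) (x : PiLp 2 (fun _ : Fin N => K)) (i : Fin N) :
    ampl N S x i = S (x i) := by
  rw [ampl, matOp_apply, Finset.sum_eq_single i]
  · rw [Matrix.diagonal_apply_eq]
  · intro j _ hj
    rw [Matrix.diagonal_apply_ne _ hj.symm]
    rfl
  · intro h
    exact absurd (Finset.mem_univ _) h

theorem ampl_γ_sq : ampl N X.γ * ampl N X.γ = 1 := matOp_ext fun x i => by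
  rw [mul_apply_eq_comp, ampl_apply, ampl_apply, ← mul_apply_eq_comp, X.γ_sq]
  rfl

theorem ampl_mem_schattenPow {n r : ℕ} {S : K →L[ℂ] K} (hS : S ∈ schattenPow n r K K) :
    ampl N S ∈ schattenPow n r _ _ := matOp_mem_schattenPow fun i j => by
  rw [Matrix.diagonal_apply]
  split_ifs
  · exact hS
  · exact zero_mem _

/-- A multiplicative map takes idempotent matrices to idempotent operators on `Kᴺ`. -/
theorem matOp_map_mul_self {f : A →ₗ[ℂ] (K →L[ℂ] K)} (hf : ∀ a b, f (a * b) = f a * f b)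
    {e : Matrix (Fin N) (Fin N) A} (he : e * e = e) :
    matOp (e.map f) * matOp (e.map f) = matOp (e.map f) := by
  rw [← matOp_mul]
  congr 1
  ext i j : 1
  conv_rhs => rw [← he]
  rw [Matrix.mul_apply, Matrix.map_apply, Matrix.mul_apply, map_sum]
  exact Finset.sum_congr rfl fun k _ => (hf _ _).symm

theorem ampl_γ_comm {f : A →ₗ[ℂ] (K →L[ℂ] K)} (hf : ∀ a, X.γ * f a = f a * X.γ)
    (e : Matrix (Fin N) (Fin N) A) :
    ampl N X.γ * matOp (e.map f) = matOp (e.map f) * ampl N X.γ := by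
  rw [ampl_mul_matOp, matOp_mul_ampl]
  congr 1
  ext i j : 1
  exact hf _

theorem matOp_conj_sub (e : Matrix (Fin N) (Fin N) A) :
    matOp (e.map X.conj) - matOp (e.map X.π') = matOp (e.map X.C) * ampl N X.Q := by
  rw [matOp_mul_ampl, ← matOp_sub]
  congr 1
  ext i j : 1
  exact add_sub_cancel_left _ _

variable {n : ℕ} (hn : 1 ≤ n) (hQ : X.Q ∈ schattenPow n 1 K K)

theorem entry_mem_schattenPow {r : ℕ} {M : Matrix (Fin N) (Fin N) (K →L[ℂ] K)}
    (h : matOp M ∈ schattenPow n r _ _) (i j : Fin N) : M i j ∈ schattenPow n r K K := by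
  have : M i j = PiLp.proj 2 (fun _ : Fin N => K) i ∘L matOp M ∘L inclL K j := by
    refine ContinuousLinearMap.ext fun x => ?_
    change _ = matOp M (inclL K j x) i
    rw [matOp_apply, Finset.sum_eq_single j]
    · rw [inclL_apply, if_pos rfl]
    · intro k _ hk
      rw [inclL_apply, if_neg hk, map_zero]
    · intro h
      exact absurd (Finset.mem_univ _) h
  rw [this]
  exact comp_left_mem_schattenPow _ (comp_right_mem_schattenPow _ h)

/-- The trace of the matrix of operators `γ(D⁻¹[D, e])²ᑫ⁺¹` is the sum over closed paths that
defines the pairing of the character with `e`. -/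
theorem matTrace_character {q : ℕ} (hq : n ≤ 2 * q + 1) (e : Matrix (Fin N) (Fin N) A) :
    matTrace N (2 * q) (X.character hn hQ q) (fun _ => e) = cst q *
      opTrace (ampl N X.γ * (ampl N X.Q * matOp (e.map X.C)) ^ (2 * q + 1)) := by
  set M : Matrix (Fin N) (Fin N) (K →L[ℂ] K) := (e.map X.C).map (X.Q * ·) with hM
  have hprod : (List.ofFn fun _ : Fin (2 * q + 1) => M).prod = M ^ (2 * q + 1) := by
    rw [List.ofFn_const, List.prod_replicate]
  have hmem : matOp (M ^ (2 * q + 1)) ∈ schattenPow n (2 * q + 1) _ _ := by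
    have := prod_mem_schattenPow (ampl_mem_schattenPow (N := N) hQ) (l := 2 * q + 1)
      fun _ => matOp (e.map X.C)
    rwa [List.ofFn_const, List.prod_replicate, ampl_mul_matOp, ← matOp_pow] at this
  have h1 := sum_closed_paths (superTrace X.γ hn).toAddMonoidHom fun _ : Fin (2 * q + 1) => M
  rw [ampl_mul_matOp, ← hM, ← matOp_pow, ampl_mul_matOp, opTrace_matOp fun i j => by
    rw [Matrix.map_apply]
    exact (isNuc_of_mem_schattenPow hn hq (entry_mem_schattenPow hmem i j)).comp_left X.γ]
  have h2 : ∀ i, opTrace (((M ^ (2 * q + 1)).map (X.γ * ·)) i i) =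
      superTrace X.γ hn ((M ^ (2 * q + 1)) i i) := fun i =>
    (superTrace_apply X.γ hn hq (entry_mem_schattenPow hmem i i)).symm
  rw [Finset.sum_congr rfl fun i _ => h2 i, ← hprod]
  refine Eq.trans ?_ (congrArg (cst q * ·) h1)
  rw [matTrace_apply, Finset.mul_sum]
  refine Finset.sum_congr rfl fun i _ => ?_
  rw [X.coe_character hn hQ hq]
  congr 1
  exact (superTrace_apply X.γ hn hq (prod_mem_schattenPow hQ _)).symm

/-- The supertrace in the index formula, with `g - h = [D, e]_σ D⁻¹`, is that of a power of `D⁻¹[D,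
e]_σ`. -/
theorem opTrace_conj_sub {q : ℕ} (hn : 1 ≤ n) (hQ : X.Q ∈ schattenPow n 1 K K) (hq : n ≤ 2 * q + 1)
    (e : Matrix (Fin N) (Fin N) A) :
    -opTrace (ampl N X.γ * (matOp (e.map X.conj) - matOp (e.map X.π')) ^ (2 * q + 1)) =
      opTrace (ampl N X.γ * (ampl N X.Q * matOp (e.map X.C)) ^ (2 * q + 1)) := by
  rw [matOp_conj_sub]
  refine opTrace_anticomm ?_ hn (ampl_mem_schattenPow hQ) hq
  rw [ampl_mul_matOp, matOp_mul_ampl]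
  refine matOp_ext fun x i => ?_
  rw [neg_apply, PiLp.neg_apply, matOp_apply, matOp_apply, ← Finset.sum_neg_distrib]
  exact Finset.sum_congr rfl fun j _ => congrArg (fun S : K →L[ℂ] K => S (x j)) (X.γ_C (e i j))

end BddTriple

/-! ### Coordinates on `E ⊗_A V` -/

section Coordinates

variable {A : Type*} [Ring A] [Algebra ℂ A] {N : ℕ} {e : Matrix (Fin N) (Fin N) A}
variable {E : Type*} [AddCommGroup E] [Module ℂ E] [Module Aᵐᵒᵖ E] [IsScalarTower ℂ Aᵐᵒᵖ E]
variable {V : Type*} [AddCommGroup V] [Module ℂ V]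

/-- The `i`-th coordinate of an element of `E ≃ eAᴺ`. -/
def coord (φ : E ≃ₗ[Aᵐᵒᵖ] eModule e) (i : Fin N) : E →ₗ[ℂ] A where
  toFun ξ := (φ ξ : Fin N → A) i
  map_add' ξ ξ' := by rw [map_add]; rfl
  map_smul' c ξ := by
    rw [← algebraMap_smul Aᵐᵒᵖ c ξ, map_smul]
    change (φ ξ : Fin N → A) i * algebraMap ℂ A c = c • (φ ξ : Fin N → A) i
    rw [← Algebra.commutes, Algebra.smul_def]

theorem coord_smul (φ : E ≃ₗ[Aᵐᵒᵖ] eModule e) (i : Fin N) (ξ : E) (a : A) :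
    coord φ i (op a • ξ) = coord φ i ξ * a := by
  change (φ (op a • ξ) : Fin N → A) i = _
  rw [map_smul]
  rfl

/-- The columns of `e`, which generate `eAᴺ`. -/
def column (e : Matrix (Fin N) (Fin N) A) (j : Fin N) : eModule e :=
  ⟨fun i => e i j, Pi.single j 1, Matrix.mulVec_single_one e j⟩

theorem coord_symm_column (φ : E ≃ₗ[Aᵐᵒᵖ] eModule e) (i j : Fin N) :
    coord φ i (φ.symm (column e j)) = e i j := by
  change (φ (φ.symm _) : Fin N → A) i = _
  rw [φ.apply_symm_apply]
  rfl

theorem sum_coord_smul (he : e * e = e) (φ : E ≃ₗ[Aᵐᵒᵖ] eModule e) (ξ : E) :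
    ∑ j, op (coord φ j ξ) • φ.symm (column e j) = ξ := by
  refine φ.injective (Subtype.ext ?_)
  rw [map_sum, Submodule.coe_sum]
  funext i
  rw [Finset.sum_apply]
  obtain ⟨v, hv⟩ := (φ ξ).2
  have h : e *ᵥ (φ ξ : Fin N → A) = φ ξ := by rw [← hv, Matrix.mulVec_mulVec, he]
  refine Eq.trans (Finset.sum_congr rfl fun j _ => ?_) (congrFun h i)
  rw [map_smul, φ.apply_symm_apply]
  rfl

/-- The vectors `v ∈ Vᴺ` with `ev = v`. -/
def fixedVectors (ρ : A →ₐ[ℂ] Module.End ℂ V) (e : Matrix (Fin N) (Fin N) A) :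
    Submodule ℂ (Fin N → V) where
  carrier := {v | ∀ i, ∑ j, ρ (e i j) (v j) = v i}
  add_mem' {v w} hv hw i := by
    simp only [Pi.add_apply, map_add, Finset.sum_add_distrib]
    rw [hv i, hw i]
  zero_mem' i := by simp
  smul_mem' c v hv i := by
    simp only [Pi.smul_apply, map_smul, ← Finset.smul_sum]
    rw [hv i]

theorem coord_balanced (φ : E ≃ₗ[Aᵐᵒᵖ] eModule e) (ρ : A →ₐ[ℂ] Module.End ℂ V) (i : Fin N) (ξ : E)
    (a : A) (v : V) : (ρ.toLinearMap ∘ₗ coord φ i) (op a • ξ) v =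
      (ρ.toLinearMap ∘ₗ coord φ i) ξ (ρ a v) := by
  change ρ (coord φ i (op a • ξ)) v = ρ (coord φ i ξ) (ρ a v)
  rw [coord_smul, map_mul]
  rfl

/-- The coordinates `ρ(φ(ξ)ᵢ)v` of `ξ ⊗ v`. -/
def tensorCoord (φ : E ≃ₗ[Aᵐᵒᵖ] eModule e) (ρ : A →ₐ[ℂ] Module.End ℂ V) :
    BalTensor E ρ →ₗ[ℂ] (Fin N → V) :=
  LinearMap.pi fun i => BalTensor.lift ρ (ρ.toLinearMap ∘ₗ coord φ i) (coord_balanced φ ρ i)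

theorem tensorCoord_mk (φ : E ≃ₗ[Aᵐᵒᵖ] eModule e) (ρ : A →ₐ[ℂ] Module.End ℂ V) (ξ : E) (v : V)
    (i : Fin N) : tensorCoord φ ρ (BalTensor.mk ρ ξ v) i = ρ (coord φ i ξ) v :=
  BalTensor.lift_mk (A := A) ρ (ρ.toLinearMap ∘ₗ coord φ i) (coord_balanced φ ρ i) ξ v

/-- The element of `E ⊗_A V` with given coordinates. -/
def ofCoord (φ : E ≃ₗ[Aᵐᵒᵖ] eModule e) (ρ : A →ₐ[ℂ] Module.End ℂ V) :
    (Fin N → V) →ₗ[ℂ] BalTensor E ρ :=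
  ∑ j, BalTensor.mk ρ (φ.symm (column e j)) ∘ₗ LinearMap.proj j

theorem ofCoord_apply (φ : E ≃ₗ[Aᵐᵒᵖ] eModule e) (ρ : A →ₐ[ℂ] Module.End ℂ V) (v : Fin N → V) :
    ofCoord φ ρ v = ∑ j, BalTensor.mk ρ (φ.symm (column e j)) (v j) := by
  rw [ofCoord, LinearMap.sum_apply]
  rfl

theorem ofCoord_tensorCoord (he : e * e = e) (φ : E ≃ₗ[Aᵐᵒᵖ] eModule e)
    (ρ : A →ₐ[ℂ] Module.End ℂ V) (x : BalTensor E ρ) : ofCoord φ ρ (tensorCoord φ ρ x) = x := by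
  have h : ofCoord φ ρ ∘ₗ tensorCoord φ ρ = LinearMap.id := BalTensor.hom_ext fun ξ v => by
    rw [LinearMap.comp_apply, ofCoord_apply, LinearMap.id_apply]
    conv_rhs => rw [← sum_coord_smul he φ ξ, map_sum, LinearMap.sum_apply]
    refine Finset.sum_congr rfl fun j _ => ?_
    rw [tensorCoord_mk, BalTensor.mk_smul]
  exact congrArg (fun f => f x) h

theorem tensorCoord_ofCoord (φ : E ≃ₗ[Aᵐᵒᵖ] eModule e) (ρ : A →ₐ[ℂ] Module.End ℂ V) (v : Fin N → V)
    (i : Fin N) : tensorCoord φ ρ (ofCoord φ ρ v) i = ∑ j, ρ (e i j) (v j) := by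
  rw [ofCoord_apply, map_sum, Finset.sum_apply]
  refine Finset.sum_congr rfl fun j _ => ?_
  rw [tensorCoord_mk, coord_symm_column]

theorem tensorCoord_mem (he : e * e = e) (φ : E ≃ₗ[Aᵐᵒᵖ] eModule e) (ρ : A →ₐ[ℂ] Module.End ℂ V)
    (x : BalTensor E ρ) : tensorCoord φ ρ x ∈ fixedVectors ρ e := fun i => by
  rw [← tensorCoord_ofCoord φ, ofCoord_tensorCoord he]

/-- `E ⊗_A V ≃ eVᴺ`. -/
def tensorEquiv (he : e * e = e) (φ : E ≃ₗ[Aᵐᵒᵖ] eModule e) (ρ : A →ₐ[ℂ] Module.End ℂ V) :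
    BalTensor E ρ ≃ₗ[ℂ] fixedVectors ρ e :=
  LinearEquiv.ofLinearMap ((tensorCoord φ ρ).codRestrict _ (tensorCoord_mem he φ ρ))
    (ofCoord φ ρ ∘ₗ (fixedVectors ρ e).subtype)
    (LinearMap.ext fun v => Subtype.ext (funext fun i =>
      (tensorCoord_ofCoord φ ρ v i).trans (v.2 i)))
    (LinearMap.ext fun x => ofCoord_tensorCoord he φ ρ x)

end Coordinates

/-! ### Coupled operators in coordinates -/

namespace TwistedSpectralTriple

variable {A : Type*} [Ring A] [Algebra ℂ A] [StarRing A]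
variable {H : Type*} [NormedAddCommGroup H] [InnerProductSpace ℂ H] [CompleteSpace H]
variable (T : TwistedSpectralTriple A H)
variable {N : ℕ} {e : Matrix (Fin N) (Fin N) A}

/-- The idempotent `D̃π(e)D̃⁻¹` on `(H ⊕ H)ᴺ`. -/
def gIdem (e : Matrix (Fin N) (Fin N) A) := matOp (e.map T.doubleTriple.conj)

/-- The idempotent `π(σ(e))` on `(H ⊕ H)ᴺ`. -/
def hIdem (e : Matrix (Fin N) (Fin N) A) := matOp (e.map T.doubleTriple.π')

theorem double_inv_conj (a : A) (z : WithLp 2 (H × H)) :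
    T.doubleInv (T.doubleTriple.conj a z) = block (T.π a) 0 0 0 (T.doubleInv z) := by
  have h := T.doubleTriple.rel a
  have h1 : T.doubleTriple.Q * T.doubleTriple.conj a = T.doubleTriple.π a * T.doubleTriple.Q := by
    rw [BddTriple.conj_apply, mul_add, ← h, ← mul_assoc, sub_add_cancel]
  rw [← diag_eq_block]
  exact congrArg (fun S : _ →L[ℂ] _ => S z) h1

theorem doubleInv_injective : Function.Injective T.doubleInv := by
  intro x y h
  have h1 := (isBoundedInverse_iff.1 T.isBoundedInverse_doubleInv).1 x
  have h2 := (isBoundedInverse_iff.1 T.isBoundedInverse_doubleInv).1 y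
  rw [h] at h1
  exact T.doubleD.mem_graph_snd_inj' h1 h2 rfl

theorem doubleInv_eq_iff {x y : WithLp 2 (H × H)} :
    T.doubleInv y = x ↔ (x, y) ∈ T.doubleD.graph := by
  constructor
  · rintro rfl
    exact (isBoundedInverse_iff.1 T.isBoundedInverse_doubleInv).1 y
  · intro h
    exact (isBoundedInverse_iff.1 T.isBoundedInverse_doubleInv).2 _ _ h

theorem doubleInv_graph (x : T.D.domain) :
    T.doubleInv (WithLp.toLp 2 (T.D x, (x : H))) = WithLp.toLp 2 ((x : H), 0) := by
  refine T.doubleInv_eq_iff.2 (T.mem_graph_doubleD.2 ⟨?_, ?_⟩)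
  · change ((x : H), T.D x - 0) ∈ _
    rw [sub_zero]
    exact T.D.mem_graph x
  · change ((0 : H), (x : H) - x) ∈ _
    rw [sub_self]
    exact T.D.graph.zero_mem

/-- `v ↦ (Dv, v)` on `(dom D)ᴺ`. -/
def graphMap (N : ℕ) : (Fin N → T.D.domain) →ₗ[ℂ] PiLp 2 fun _ : Fin N => WithLp 2 (H × H) where
  toFun v := WithLp.toLp 2 fun i => WithLp.toLp 2 (T.D (v i), (v i : H))
  map_add' v w := PiLp.ext fun i =>
    congrArg (WithLp.toLp 2) (Prod.ext (T.D.map_add (v i) (w i)) rfl)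
  map_smul' c v := PiLp.ext fun i =>
    congrArg (WithLp.toLp 2) (Prod.ext (T.D.map_smul c (v i)) rfl)

theorem graphMap_apply (v : Fin N → T.D.domain) (i : Fin N) :
    T.graphMap N v i = WithLp.toLp 2 (T.D (v i), (v i : H)) := rfl

theorem sum_block_apply (M : Fin N → H →L[ℂ] H) (x : Fin N → WithLp 2 (H × H)) :
    ∑ j, block (M j) 0 0 0 (x j) = WithLp.toLp 2 (∑ j, M j (x j).fst, 0) := by
  have h := map_sum (WithLp.linearEquiv 2 ℂ (H × H)).symm (fun j => (M j (x j).fst, (0 : H)))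
    Finset.univ
  refine Eq.trans (Finset.sum_congr rfl fun j _ => ?_) (h.symm.trans ?_)
  · rw [block_apply]
    exact congrArg (WithLp.toLp 2) (Prod.ext (by simp) (by simp))
  · exact congrArg (WithLp.toLp 2) (Prod.ext Prod.fst_sum (Prod.snd_sum.trans (by simp)))

theorem doubleInv_gIdem (e : Matrix (Fin N) (Fin N) A)
    (z : PiLp 2 fun _ : Fin N => WithLp 2 (H × H))
    (i : Fin N) : T.doubleInv (T.gIdem e z i) =
      WithLp.toLp 2 (∑ j, T.π (e i j) (T.doubleInv (z j)).fst, 0) := by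
  rw [gIdem, matOp_apply, map_sum, ← sum_block_apply]
  exact Finset.sum_congr rfl fun j _ => T.double_inv_conj _ _

theorem hIdem_apply (e : Matrix (Fin N) (Fin N) A) (z : PiLp 2 fun _ : Fin N => WithLp 2 (H × H))
    (i : Fin N) : T.hIdem e z i = WithLp.toLp 2 (∑ j, T.π (T.σ (e i j)) (z j).fst, 0) := by
  rw [hIdem, matOp_apply, ← sum_block_apply]
  refine Finset.sum_congr rfl fun j _ => ?_
  rw [← diag_eq_block]
  rfl

theorem graphMap_mem {v : Fin N → T.D.domain} (hv : v ∈ fixedVectors T.repDom e) :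
    T.graphMap N v ∈ fixedSpace (T.gIdem e) := by
  refine mem_fixedSpace.2 (PiLp.ext fun i => T.doubleInv_injective ?_)
  rw [doubleInv_gIdem, graphMap_apply, doubleInv_graph]
  refine congrArg (WithLp.toLp 2) (Prod.ext ?_ rfl)
  change ∑ j, T.π (e i j) (T.doubleInv (T.graphMap N v j)).fst = v i
  refine Eq.trans (Finset.sum_congr rfl fun j _ => ?_)
    ((map_sum T.D.domain.subtype _ _).symm.trans (congrArg Subtype.val (hv i)))
  rw [graphMap_apply, doubleInv_graph]
  rfl

/-- If `D̃π(e)D̃⁻¹ z = z`, then `D̃⁻¹ z = π(e) D̃⁻¹ z` has second components `0`, so it is of the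
form `(v, 0)` with `ev = v`, and `z = D̃(v, 0) = (Dv, v)`. -/
theorem exists_graphMap_eq {z : PiLp 2 fun _ : Fin N => WithLp 2 (H × H)}
    (hz : z ∈ fixedSpace (T.gIdem e)) : ∃ v ∈ fixedVectors T.repDom e, T.graphMap N v = z := by
  have h1 : ∀ i, T.doubleInv (z i) = WithLp.toLp 2 (∑ j, T.π (e i j) (T.doubleInv (z j)).fst, 0) :=
    fun i => by
      rw [← doubleInv_gIdem, mem_fixedSpace.1 hz]
  have h2 : ∀ i, ((T.doubleInv (z i)).fst, (z i).fst) ∈ T.D.graph ∧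
      (T.doubleInv (z i)).fst = (z i).snd := fun i => by
    have h3 := T.mem_graph_doubleD.1 (T.doubleInv_eq_iff.1 rfl : (T.doubleInv (z i), z i) ∈ _)
    have h4 : (T.doubleInv (z i)).snd = 0 := by rw [h1 i, WithLp.toLp_snd]
    rw [h4, sub_zero] at h3
    refine ⟨h3.1, ?_⟩
    have := T.D.graph_fst_eq_zero_snd h3.2 rfl
    exact sub_eq_zero.1 this
  choose h3 h4 using fun i => mem_graph_iff_exists.1 (h2 i).1
  refine ⟨fun i => ⟨_, h3 i⟩, fun i => ?_, PiLp.ext fun i => ?_⟩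
  · refine Subtype.ext ((map_sum T.D.domain.subtype _ _).trans ?_)
    exact (congrArg WithLp.fst (h1 i)).symm
  · rw [graphMap_apply]
    change WithLp.toLp 2 (T.D _, (T.doubleInv (z i)).fst) = z i
    rw [h4, (h2 i).2]
    rfl

/-- `e(dom D)ᴺ ≃ ran D̃π(e)D̃⁻¹`. -/
def graphEquiv (e : Matrix (Fin N) (Fin N) A) :
    fixedVectors T.repDom e ≃ₗ[ℂ] fixedSpace (T.gIdem e) :=
  LinearEquiv.ofBijective ((T.graphMap N).restrict fun _ hv => T.graphMap_mem hv) <| by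
    constructor
    · intro v w h
      refine Subtype.ext (funext fun i => Subtype.ext ?_)
      exact congrArg (fun z : PiLp 2 fun _ : Fin N => WithLp 2 (H × H) => (z i).snd)
        (congrArg Subtype.val h)
    · intro z
      obtain ⟨v, hv, h⟩ := T.exists_graphMap_eq z.2
      exact ⟨⟨v, hv⟩, Subtype.ext h⟩

/-- `w ↦ (w, 0)` on `Hᴺ`. -/
def inlMap (H : Type*) [NormedAddCommGroup H] [InnerProductSpace ℂ H] (N : ℕ) :
    (Fin N → H) →ₗ[ℂ] PiLp 2 fun _ : Fin N => WithLp 2 (H × H) where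
  toFun w := WithLp.toLp 2 fun i => WithLp.toLp 2 (w i, 0)
  map_add' v w := PiLp.ext fun i => congrArg (WithLp.toLp 2) (Prod.ext rfl (add_zero 0).symm)
  map_smul' c v := PiLp.ext fun i => congrArg (WithLp.toLp 2) (Prod.ext rfl (smul_zero c).symm)

theorem hIdem_eq_inlMap (e : Matrix (Fin N) (Fin N) A)
    (z : PiLp 2 fun _ : Fin N => WithLp 2 (H × H)) :
    T.hIdem e z = inlMap H N fun i => ∑ j, T.π (T.σ (e i j)) (z j).fst :=
  PiLp.ext fun i => T.hIdem_apply e z i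

/-- `σ(e)Hᴺ ≃ ran π(σ(e))`. -/
def inlEquiv (e : Matrix (Fin N) (Fin N) A) :
    fixedVectors T.repH (e.map T.σ) ≃ₗ[ℂ] fixedSpace (T.hIdem e) :=
  LinearEquiv.ofBijective ((inlMap H N).restrict fun w (hw : w ∈ fixedVectors T.repH (e.map T.σ)) =>
      mem_fixedSpace.2 ((T.hIdem_eq_inlMap e _).trans (congrArg (inlMap H N) (funext hw)))) <| by
    constructor
    · intro v w h
      refine Subtype.ext (funext fun i => ?_)
      exact congrArg (fun z : PiLp 2 fun _ : Fin N => WithLp 2 (H × H) => (z i).fst)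
        (congrArg Subtype.val h)
    · intro z
      have hz := (T.hIdem_eq_inlMap e _).symm.trans (mem_fixedSpace.1 z.2)
      refine ⟨⟨fun i => ∑ j, T.π (T.σ (e i j)) (z.1 j).fst, fun i => ?_⟩, Subtype.ext hz⟩
      refine Finset.sum_congr rfl fun j _ => ?_
      exact congrArg (fun y : PiLp 2 fun _ : Fin N => WithLp 2 (H × H) =>
        T.π (T.σ (e i j)) (y j).fst) hz

end TwistedSpectralTriple

/-! ### The coupled operator as a compression -/

namespace TwistedSpectralTriple

variable {A : Type*} [Ring A] [Algebra ℂ A] [StarRing A]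
variable {H : Type*} [NormedAddCommGroup H] [InnerProductSpace ℂ H] [CompleteSpace H]
variable {T : TwistedSpectralTriple A H}
variable {E : Type*} [AddCommGroup E] [Module ℂ E] [Module Aᵐᵒᵖ E] [IsScalarTower ℂ Aᵐᵒᵖ E]
  {F : Type*} [AddCommGroup F] [Module ℂ F] [Module Aᵐᵒᵖ F] [IsScalarTower ℂ Aᵐᵒᵖ F]

section FormCoordinates

variable {N : ℕ} {e : Matrix (Fin N) (Fin N) A}

theorem formCoord_balanced (ψ : F ≃ₗ[Aᵐᵒᵖ] eModule e) (i : Fin N) (η : F) (a : A) (ω : T.forms) :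
    ((LinearMap.mul ℂ (H →L[ℂ] H) ∘ₗ T.piLin ∘ₗ coord ψ i).compl₂ T.forms.subtype) (op a • η) ω =
      ((LinearMap.mul ℂ (H →L[ℂ] H) ∘ₗ T.piLin ∘ₗ coord ψ i).compl₂ T.forms.subtype) η
        (T.repForms a ω) := by
  change T.π (coord ψ i (op a • η)) * (ω : H →L[ℂ] H) = T.π (coord ψ i η) * (T.π a * ω)
  rw [coord_smul, map_mul, mul_assoc]

/-- The bounded operator `π(ψ(η)ᵢ)ω` attached to `η ⊗ ω`. -/
def formCoord (ψ : F ≃ₗ[Aᵐᵒᵖ] eModule e) (i : Fin N) :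
    BalTensor F T.repForms →ₗ[ℂ] (H →L[ℂ] H) :=
  BalTensor.lift T.repForms
    ((LinearMap.mul ℂ (H →L[ℂ] H) ∘ₗ T.piLin ∘ₗ coord ψ i).compl₂ T.forms.subtype)
    (formCoord_balanced ψ i)

theorem tensorCoord_clifford (ψ : F ≃ₗ[Aᵐᵒᵖ] eModule e) (ζ : H) (s : BalTensor F T.repForms)
    (i : Fin N) : tensorCoord ψ T.repH (T.clifford F ζ s) i = formCoord ψ i s ζ := by
  have h : (LinearMap.proj i ∘ₗ tensorCoord ψ T.repH) ∘ₗ T.clifford F ζ =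
      (ContinuousLinearMap.apply ℂ H ζ).toLinearMap ∘ₗ formCoord ψ i :=
    BalTensor.hom_ext fun η ω => by
      change tensorCoord ψ T.repH (T.clifford F ζ (BalTensor.mk T.repForms η ω)) i =
        formCoord ψ i (BalTensor.mk T.repForms η ω) ζ
      rw [clifford_mk, tensorCoord_mk, formCoord, BalTensor.lift_mk]
      rfl
  exact congrArg (fun f => f s) h

end FormCoordinates

variable {t : SigmaTranslate T.σ E F} (nab : T.SigmaConnection t)

/-- The matrix of the zeroth order part of `D_∇` in the coordinates of `E ≃ eAᴺ`. -/
def connMatrix : Matrix (Fin t.N) (Fin t.N) (H →L[ℂ] H) := fun i j =>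
  formCoord t.φσ i (nab.nabla (t.φ.symm (column t.e j)))

theorem tensorCoord_coupled (v : Fin t.N → T.D.domain) (i : Fin t.N) :
    tensorCoord t.φσ T.repH (coupled nab (ofCoord t.φ T.repDom v)) i =
      ∑ j, (T.π (T.σ (t.e i j)) (T.D (v j)) + connMatrix nab i j (v j)) := by
  rw [ofCoord_apply, map_sum, map_sum, Finset.sum_apply]
  refine Finset.sum_congr rfl fun j _ => ?_
  rw [coupled_mk, map_add, Pi.add_apply, tensorCoord_clifford, tensorCoord_mk]
  have h : coord t.φσ i (t.tr (t.φ.symm (column t.e j))) = T.σ (t.e i j) := by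
    rw [← coord_symm_column t.φ i j]
    exact t.φ_tr _ _
  rw [h]
  rfl

/-- The perturbation `(∇, 0; 0, 0) D̃⁻¹` of the identity of `(H ⊕ H)ᴺ`. -/
def connOp : PiLp 2 (fun _ : Fin t.N => WithLp 2 (H × H)) →L[ℂ]
    PiLp 2 (fun _ : Fin t.N => WithLp 2 (H × H)) :=
  matOp ((connMatrix nab).map fun S => block S 0 0 0) * BddTriple.ampl t.N T.doubleInv

theorem connOp_graphMap (v : Fin t.N → T.D.domain) :
    connOp nab (T.graphMap t.N v) = inlMap H t.N fun i => ∑ j, connMatrix nab i j (v j) := by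
  refine PiLp.ext fun i => ?_
  rw [connOp, mul_apply_eq_comp, matOp_apply]
  refine (sum_block_apply (fun j => connMatrix nab i j) fun j =>
    BddTriple.ampl t.N T.doubleInv (T.graphMap t.N v) j).trans
      (congrArg (WithLp.toLp 2) (Prod.ext ?_ rfl))
  change ∑ j, connMatrix nab i j (BddTriple.ampl t.N T.doubleInv (T.graphMap t.N v) j).fst =
    ∑ j, connMatrix nab i j (v j)
  refine Finset.sum_congr rfl fun j _ => ?_
  rw [BddTriple.ampl_apply, graphMap_apply, doubleInv_graph, WithLp.toLp_fst]

/-- `E ⊗_A dom D ≃ ran D̃π(e)D̃⁻¹`. -/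
def domEquiv (t : SigmaTranslate T.σ E F) : BalTensor E T.repDom ≃ₗ[ℂ] fixedSpace (T.gIdem t.e) :=
  (tensorEquiv t.idem t.φ T.repDom).trans (T.graphEquiv t.e)

theorem SigmaTranslate.map_idem (t : SigmaTranslate T.σ E F) :
    t.e.map T.σ * t.e.map T.σ = t.e.map T.σ := by
  have h := congrArg (fun M : Matrix (Fin t.N) (Fin t.N) A => M.map T.σ) t.idem
  rwa [Matrix.map_mul] at h

/-- `E^σ ⊗_A H ≃ ran π(σ(e))`. -/
def codEquiv (t : SigmaTranslate T.σ E F) : BalTensor F T.repH ≃ₗ[ℂ] fixedSpace (T.hIdem t.e) :=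
  (tensorEquiv (SigmaTranslate.map_idem t) t.φσ T.repH).trans (T.inlEquiv t.e)

theorem coe_domEquiv (x : BalTensor E T.repDom) :
    (domEquiv t x : PiLp 2 fun _ : Fin t.N => WithLp 2 (H × H)) =
      T.graphMap t.N (tensorCoord t.φ T.repDom x) := rfl

theorem coe_codEquiv (y : BalTensor F T.repH) :
    (codEquiv t y : PiLp 2 fun _ : Fin t.N => WithLp 2 (H × H)) =
      inlMap H t.N (tensorCoord t.φσ T.repH y) := rfl

theorem gIdem_mul_self : T.gIdem t.e * T.gIdem t.e = T.gIdem t.e :=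
  BddTriple.matOp_map_mul_self T.doubleTriple.conj_mul t.idem

theorem hIdem_mul_self : T.hIdem t.e * T.hIdem t.e = T.hIdem t.e :=
  BddTriple.matOp_map_mul_self T.doubleTriple.π'_mul t.idem

/-- In coordinates, `D_∇` is the compression of `1 + ∇D̃⁻¹` to the ranges of `D̃π(e)D̃⁻¹` and
`π(σ(e))`. -/
theorem codEquiv_coupled (x : BalTensor E T.repDom) :
    (codEquiv t (coupled nab x) : PiLp 2 fun _ : Fin t.N => WithLp 2 (H × H)) =
      T.hIdem t.e ((domEquiv t x : PiLp 2 fun _ : Fin t.N => WithLp 2 (H × H)) +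
        connOp nab (domEquiv t x)) := by
  set v := tensorCoord t.φ T.repDom x with hv
  have hx : ofCoord t.φ T.repDom v = x := ofCoord_tensorCoord t.idem _ _ _
  have h1 : (codEquiv t (coupled nab x) : PiLp 2 fun _ : Fin t.N => WithLp 2 (H × H)) =
      T.hIdem t.e (T.graphMap t.N v) + connOp nab (T.graphMap t.N v) := by
    rw [coe_codEquiv, ← hx, connOp_graphMap, hIdem_eq_inlMap, ← map_add]
    refine congrArg (inlMap H t.N) (funext fun i => ?_)
    rw [tensorCoord_coupled, Finset.sum_add_distrib]
    rfl
  have h2 := mem_fixedSpace.1 (codEquiv t (coupled nab x)).2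
  rw [← h2, h1, coe_domEquiv, map_add, map_add, ← mul_apply_eq_comp, hIdem_mul_self]

/-! ### Compatibility with the gradings -/

/-- The grading of `(H ⊕ H)ᴺ`. -/
def amplγ (T : TwistedSpectralTriple A H) (N : ℕ) : PiLp 2 (fun _ : Fin N => WithLp 2 (H × H)) →L[ℂ]
    PiLp 2 (fun _ : Fin N => WithLp 2 (H × H)) := BddTriple.ampl N T.doubleTriple.γ

theorem tensorCoord_map {V : Type*} [AddCommGroup V] [Module ℂ V] {ρ : A →ₐ[ℂ] Module.End ℂ V}
    {N : ℕ} {e : Matrix (Fin N) (Fin N) A} (φ : E ≃ₗ[Aᵐᵒᵖ] eModule e) (f : V →ₗ[ℂ] V)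
    (hf : ∀ a v, f (ρ a v) = ρ a (f v)) (x : BalTensor E ρ) (i : Fin N) :
    tensorCoord φ ρ (BalTensor.map E f hf x) i = f (tensorCoord φ ρ x i) := by
  have h : (LinearMap.proj i ∘ₗ tensorCoord φ ρ) ∘ₗ BalTensor.map E f hf =
      f ∘ₗ LinearMap.proj i ∘ₗ tensorCoord φ ρ := BalTensor.hom_ext fun ξ v => by
    change tensorCoord φ ρ (BalTensor.map E f hf (BalTensor.mk ρ ξ v)) i =
      f (tensorCoord φ ρ (BalTensor.mk ρ ξ v) i)
    rw [BalTensor.map_mk, tensorCoord_mk, tensorCoord_mk, hf]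
  exact congrArg (fun f => f x) h

theorem doubleγ_toLp (x y : H) :
    T.doubleγ (WithLp.toLp 2 (x, y)) = WithLp.toLp 2 (T.γ x, -T.γ y) := rfl

/-- The identification of the domain reverses the grading: if `γv = ±v`, then
`γ̃(Dv, v) = (γDv, -γv) = ∓(Dv, v)`. -/
theorem amplγ_domEquiv (x : BalTensor E T.repDom) :
    amplγ T t.N (domEquiv t x) =
      -(domEquiv t (T.gradDom E x) : PiLp 2 fun _ : Fin t.N => WithLp 2 (H × H)) := by
  refine PiLp.ext fun i => ?_
  rw [amplγ, BddTriple.ampl_apply, coe_domEquiv, coe_domEquiv, PiLp.neg_apply, graphMap_apply,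
    graphMap_apply, gradDom, tensorCoord_map]
  refine (doubleγ_toLp _ _).trans (congrArg (WithLp.toLp 2) (Prod.ext ?_ rfl))
  obtain ⟨_, h⟩ := T.D_odd (tensorCoord t.φ T.repDom x i)
  exact (neg_eq_iff_eq_neg.2 h).symm

theorem amplγ_codEquiv (y : BalTensor F T.repH) :
    amplγ T t.N (codEquiv t y) =
      (codEquiv t (T.gradH F y) : PiLp 2 fun _ : Fin t.N => WithLp 2 (H × H)) := by
  refine PiLp.ext fun i => ?_
  rw [amplγ, BddTriple.ampl_apply, coe_codEquiv, coe_codEquiv, gradH]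
  refine (doubleγ_toLp _ _).trans (congrArg (WithLp.toLp 2) (Prod.ext ?_ ?_))
  · exact (tensorCoord_map t.φσ T.γ.toLinearMap _ y i).symm
  · change -T.γ 0 = 0
    rw [map_zero, neg_zero]

theorem amplγ_sq (N : ℕ) : amplγ T N * amplγ T N = 1 := T.doubleTriple.ampl_γ_sq

theorem amplγ_gIdem : amplγ T t.N * T.gIdem t.e = T.gIdem t.e * amplγ T t.N :=
  T.doubleTriple.ampl_γ_comm T.doubleTriple.γ_conj t.e

theorem amplγ_hIdem : amplγ T t.N * T.hIdem t.e = T.hIdem t.e * amplγ T t.N :=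
  T.doubleTriple.ampl_γ_comm T.doubleTriple.γ_π' t.e

end TwistedSpectralTriple

/-- A linear isomorphism onto the range of an idempotent that intertwines `G` and `sΓ`, for a sign
`s`, restricts to the eigenspaces. -/
def eigenspaceEquiv {K : Type*} [NormedAddCommGroup K] [InnerProductSpace ℂ K] [CompleteSpace K]
    {V : Type*} [AddCommGroup V] [Module ℂ V] {Γ g : K →L[ℂ] K} (hΓ : Γ * Γ = 1)
    (hΓg : Γ * g = g * Γ) (hg : g * g = g) (α : V ≃ₗ[ℂ] fixedSpace g) (G : Module.End ℂ V)
    {s μ ε : ℂ} (hs : s * s = 1) (hε : ε * ε = 1) (hμ : s * μ = -ε)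
    (h : ∀ x, Γ (α x) = s • (α (G x) : K)) :
    G.eigenspace μ ≃ₗ[ℂ] fixedSpace (gradProj Γ ε * g) :=
  have key : ∀ x, (α x : K) ∈ fixedSpace (gradProj Γ ε * g) ↔ x ∈ G.eigenspace μ := fun x => by
    rw [mem_fixedSpace_gradProj hΓ hε hΓg hg, and_iff_right (mem_fixedSpace.1 (α x).2), h, ← hμ,
      Module.End.mem_eigenspace_iff, mul_smul]
    constructor
    · intro h1
      have h2 := congrArg (s • ·) h1
      simp only [smul_smul, ← mul_assoc, hs, one_mul, one_smul] at h2
      exact α.injective (Subtype.ext (h2.trans (congrArg Subtype.val (map_smul α μ x)).symm))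
    · intro h1
      rw [h1, map_smul]
      rfl
  LinearEquiv.ofBijective ((((fixedSpace g).subtype ∘ₗ α.toLinearMap) ∘ₗ
      (G.eigenspace μ).subtype).codRestrict _ fun x => (key x).2 x.2) <| by
    constructor
    · intro x y hxy
      have hxy' : (α x : K) = α y := congrArg (fun z : fixedSpace (gradProj Γ ε * g) => (z : K)) hxy
      exact Subtype.ext (α.injective (Subtype.ext hxy'))
    · intro z
      obtain ⟨x, hx⟩ := α.surjective
        ⟨z, mem_fixedSpace.2 ((mem_fixedSpace_gradProj hΓ hε hΓg hg).1 z.2).1⟩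
      have hx' : (α x : K) = z := congrArg Subtype.val hx
      exact ⟨⟨x, (key x).1 (hx' ▸ z.2)⟩, Subtype.ext hx'⟩

/-! ### The index formula -/

namespace TwistedSpectralTriple

variable {A : Type*} [Ring A] [Algebra ℂ A] [StarRing A]
variable {H : Type*} [NormedAddCommGroup H] [InnerProductSpace ℂ H] [CompleteSpace H]
variable {T : TwistedSpectralTriple A H}
variable {E : Type*} [AddCommGroup E] [Module ℂ E] [Module Aᵐᵒᵖ E] [IsScalarTower ℂ Aᵐᵒᵖ E]
  {F : Type*} [AddCommGroup F] [Module ℂ F] [Module Aᵐᵒᵖ F] [IsScalarTower ℂ Aᵐᵒᵖ F]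
variable {t : SigmaTranslate T.σ E F} (nab : T.SigmaConnection t)

/-- The domain of `D_∇^±` in coordinates. -/
def domPart (t : SigmaTranslate T.σ E F) {ε : ℂ} (hε : ε * ε = 1) :
    (T.gradDom E).eigenspace ε ≃ₗ[ℂ] fixedSpace (gradProj (amplγ T t.N) ε * T.gIdem t.e) :=
  eigenspaceEquiv (amplγ_sq t.N) amplγ_gIdem gIdem_mul_self (domEquiv t) (T.gradDom E) (s := -1)
    (by norm_num) hε (neg_one_mul ε) fun x => by rw [amplγ_domEquiv, neg_one_smul]

/-- The target of `D_∇^±` in coordinates. -/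
def codPart (t : SigmaTranslate T.σ E F) {ε : ℂ} (hε : ε * ε = 1) :
    (T.gradH F).eigenspace (-ε) ≃ₗ[ℂ] fixedSpace (gradProj (amplγ T t.N) ε * T.hIdem t.e) :=
  eigenspaceEquiv (amplγ_sq t.N) amplγ_hIdem hIdem_mul_self (codEquiv t) (T.gradH F) (s := 1)
    (by norm_num) hε (one_mul _) fun x => by rw [amplγ_codEquiv, one_smul]

/-- `D_∇^±` in coordinates. -/
def coupledCoord {ε : ℂ} (hε : ε * ε = 1) :
    fixedSpace (gradProj (amplγ T t.N) ε * T.gIdem t.e) →ₗ[ℂ]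
      fixedSpace (gradProj (amplγ T t.N) ε * T.hIdem t.e) :=
  (codPart t hε).toLinearMap ∘ₗ coupledPart nab ε ∘ₗ (domPart t hε).symm.toLinearMap

theorem coe_coupledCoord {ε : ℂ} (hε : ε * ε = 1)
    (z : fixedSpace (gradProj (amplγ T t.N) ε * T.gIdem t.e)) :
    (coupledCoord nab hε z : PiLp 2 fun _ : Fin t.N => WithLp 2 (H × H)) =
      T.hIdem t.e ((z : PiLp 2 fun _ : Fin t.N => WithLp 2 (H × H)) + connOp nab z) := by
  obtain ⟨x, rfl⟩ := (domPart t hε).surjective z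
  change ((codPart t hε (coupledPart nab ε ((domPart t hε).symm (domPart t hε x))) :
    fixedSpace (gradProj (amplγ T t.N) ε * T.hIdem t.e)) :
      PiLp 2 fun _ : Fin t.N => WithLp 2 (H × H)) = _
  rw [LinearEquiv.symm_apply_apply]
  exact codEquiv_coupled nab x

/-- The graded index of `D_∇` is the supertrace of a power of `D̃π(e)D̃⁻¹ - π(σ(e))`. -/
theorem index_coupled {n : ℕ} (hn : 1 ≤ n) (hQ : T.doubleTriple.Q ∈ schattenPow n 1 _ _) {q : ℕ}
    (hq : n ≤ 2 * q) : nab.IsFredholmPart 1 ∧ nab.IsFredholmPart (-1) ∧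
      (indexPart nab 1 : ℂ) - indexPart nab (-1) =
        -opTrace (amplγ T t.N * (T.gIdem t.e - T.hIdem t.e) ^ (2 * q + 1)) := by
  have h1 : (1 : ℂ) * 1 = 1 := one_mul 1
  have h2 : (-1 : ℂ) * -1 = 1 := by norm_num
  have hQ' := BddTriple.ampl_mem_schattenPow (N := t.N) hQ
  obtain ⟨⟨a1, a2⟩, ⟨b1, b2⟩, h⟩ := index_of_graded_idempotents hn (amplγ_sq t.N) amplγ_gIdem
    amplγ_hIdem gIdem_mul_self hIdem_mul_self
    (by
      rw [gIdem, hIdem, BddTriple.matOp_conj_sub]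
      exact comp_left_mem_schattenPow _ hQ')
    (Z := connOp nab) (comp_left_mem_schattenPow _ hQ') (coupledCoord nab h1)
    (coe_coupledCoord nab h1) (coupledCoord nab h2) (coe_coupledCoord nab h2) hq
  have key : ∀ {ε : ℂ} (hε : ε * ε = 1) (x : (T.gradDom E).eigenspace ε),
      codPart t hε (coupledPart nab ε x) = coupledCoord nab hε (domPart t hε x) := fun hε x => by
    change _ = codPart t hε (coupledPart nab _ ((domPart t hε).symm (domPart t hε x)))
    rw [LinearEquiv.symm_apply_apply]
  obtain ⟨c1, c2, c3⟩ := index_of_linearEquiv (domPart t h1) (codPart t h1) (key h1) a1 a2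
  obtain ⟨d1, d2, d3⟩ := index_of_linearEquiv (domPart t h2) (codPart t h2) (key h2) b1 b2
  refine ⟨⟨c1, c2⟩, ⟨d1, d2⟩, ?_⟩
  rw [← h, ← c3, ← d3]
  rfl

/-- The index formula for the idempotent of the `σ`-translate. -/
theorem index_eq_matTrace {n : ℕ} (hn : 1 ≤ n) (hQ : T.doubleTriple.Q ∈ schattenPow n 1 _ _) {q : ℕ}
    (hq : n ≤ 2 * q) : ((nab.index : ℚ) : ℂ) = (-1 : ℂ) ^ q * ((2 * q).factorial / q.factorial) *
      matTrace t.N (2 * q) (T.doubleTriple.character hn hQ q) fun _ => t.e := by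
  have hq' : n ≤ 2 * q + 1 := hq.trans (Nat.le_succ _)
  rw [BddTriple.matTrace_character _ hn hQ hq', ← BddTriple.opTrace_conj_sub _ hn hQ hq']
  have h := (index_coupled nab hn hQ hq).2.2
  have h' : (indexPart nab 1 : ℂ) - indexPart nab (-1) = -opTrace (BddTriple.ampl t.N
    T.doubleTriple.γ * (matOp (t.e.map T.doubleTriple.conj) -
      matOp (t.e.map T.doubleTriple.π')) ^ (2 * q + 1)) := h
  rw [← h', SigmaConnection.index, cst]
  push_cast
  have f1 : ((2 * q).factorial : ℂ) ≠ 0 := Nat.cast_ne_zero.2 (Nat.factorial_ne_zero _)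
  have f2 : (q.factorial : ℂ) ≠ 0 := Nat.cast_ne_zero.2 (Nat.factorial_ne_zero _)
  have f3 : (-1 : ℂ) ^ q * (-1) ^ q = 1 := by rw [← mul_pow, neg_one_mul, neg_neg, one_pow]
  field_simp
  linear_combination (-1 : ℂ) * ((indexPart nab 1 : ℂ) - indexPart nab (-1)) * f3

end TwistedSpectralTriple

/-! ### Independence of the idempotent -/

section Translate

variable {A : Type*} [Ring A] [Algebra ℂ A] {σ : A ≃ₐ[ℂ] A} {N : ℕ} {e : Matrix (Fin N) (Fin N) A}

/-- The map `σ : eAᴺ → σ(e)Aᴺ`. -/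
def twistVec (σ : A ≃ₐ[ℂ] A) (e : Matrix (Fin N) (Fin N) A) (w : eModule e) :
    eModule (e.map σ) :=
  ⟨fun i => σ ((w : Fin N → A) i), by
    obtain ⟨v, hv⟩ := w.2
    refine ⟨fun i => σ (v i), funext fun i => ?_⟩
    rw [← hv, Matrix.mulVec, Matrix.mulVec, dotProduct, dotProduct, map_sum]
    exact Finset.sum_congr rfl fun j _ => (map_mul σ _ _).symm⟩

theorem twistVec_apply (w : eModule e) (i : Fin N) :
    (twistVec σ e w : Fin N → A) i = σ ((w : Fin N → A) i) := rfl

theorem twistVec_bijective : Function.Bijective (twistVec σ e) := by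
  constructor
  · intro w w' h
    refine Subtype.ext (funext fun i => σ.injective ?_)
    rw [← twistVec_apply, h, twistVec_apply]
  · rintro ⟨w, v, hv⟩
    refine ⟨⟨_, fun i => σ.symm (v i), rfl⟩, Subtype.ext (funext fun i => ?_)⟩
    change σ (∑ j, e i j * σ.symm (v j)) = w i
    rw [← hv, map_sum]
    refine Finset.sum_congr rfl fun j _ => ?_
    rw [map_mul, σ.apply_symm_apply]
    rfl

variable {E F : Type*} [AddCommGroup E] [Module ℂ E] [Module Aᵐᵒᵖ E] [AddCommGroup F] [Module ℂ F]
  [Module Aᵐᵒᵖ F]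

theorem SigmaTranslate.tr_symm_smul (t : SigmaTranslate σ E F) (y : F) (a : A) :
    t.tr.symm (op a • y) = op (σ.symm a) • t.tr.symm y := by
  rw [LinearEquiv.symm_apply_eq, t.tr_smul, σ.apply_symm_apply, t.tr.apply_symm_apply]

/-- The `F`-side presentation that goes with a presentation `E ≃ eAᴺ`. -/
def twistLin (t : SigmaTranslate σ E F) (φ : E ≃ₗ[Aᵐᵒᵖ] eModule e) :
    F →ₗ[Aᵐᵒᵖ] eModule (e.map σ) where
  toFun y := twistVec σ e (φ (t.tr.symm y))
  map_add' y z := Subtype.ext (funext fun i => by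
    change σ ((φ (t.tr.symm (y + z)) : Fin N → A) i) =
      σ ((φ (t.tr.symm y) : Fin N → A) i) + σ ((φ (t.tr.symm z) : Fin N → A) i)
    rw [map_add, map_add, ← map_add σ]
    rfl)
  map_smul' a y := Subtype.ext (funext fun i => by
    change σ ((φ (t.tr.symm (op a.unop • y)) : Fin N → A) i) =
      σ ((φ (t.tr.symm y) : Fin N → A) i) * a.unop
    rw [t.tr_symm_smul, map_smul]
    change σ ((φ (t.tr.symm y) : Fin N → A) i * σ.symm a.unop) = _
    rw [map_mul, σ.apply_symm_apply])

/-- The same `σ`-translate, with another presentation of the module by an idempotent. -/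
def SigmaTranslate.changeIdem (t : SigmaTranslate σ E F) (he : e * e = e)
    (φ : E ≃ₗ[Aᵐᵒᵖ] eModule e) : SigmaTranslate σ E F where
  tr := t.tr
  N := N
  e := e
  idem := he
  φ := φ
  φσ := LinearEquiv.ofBijective (twistLin t φ)
    (twistVec_bijective.comp (φ.bijective.comp t.tr.symm.bijective))
  φ_tr ξ i := by
    change σ ((φ (t.tr.symm (t.tr ξ)) : Fin N → A) i) = _
    rw [t.tr.symm_apply_apply]

end Translate

namespace TwistedSpectralTriple

variable {A : Type*} [Ring A] [Algebra ℂ A] [StarRing A]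
variable {H : Type*} [NormedAddCommGroup H] [InnerProductSpace ℂ H] [CompleteSpace H]
variable {T : TwistedSpectralTriple A H}
variable {E : Type*} [AddCommGroup E] [Module ℂ E] [Module Aᵐᵒᵖ E] [IsScalarTower ℂ Aᵐᵒᵖ E]
  {F : Type*} [AddCommGroup F] [Module ℂ F] [Module Aᵐᵒᵖ F] [IsScalarTower ℂ Aᵐᵒᵖ F]

/-- A `σ`-connection does not see the presentation of the module. -/
def SigmaConnection.changeIdem {t : SigmaTranslate T.σ E F} (nab : T.SigmaConnection t) {N : ℕ}
    {e : Matrix (Fin N) (Fin N) A} (he : e * e = e) (φ : E ≃ₗ[Aᵐᵒᵖ] eModule e) :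
    T.SigmaConnection (t.changeIdem he φ) where
  nabla := nab.nabla
  leibniz := nab.leibniz

theorem two_mul_succ_le (p : ℝ) : 2 * ⌈(p - 1) / 2⌉₊ + 1 ≤ 2 * (⌈(p - 1) / 2⌉₊ + 1) := by omega

variable {p : ℝ}

theorem SigmaConnection.isFredholmPart (hp : 1 ≤ p) (hsum : T.IsSummable p)
    {t : SigmaTranslate T.σ E F} (nab : T.SigmaConnection t) :
    nab.IsFredholmPart 1 ∧ nab.IsFredholmPart (-1) :=
  have h := index_coupled nab (Nat.le_add_left 1 _) (doubleQ_mem hp hsum) (two_mul_succ_le p)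
  ⟨h.1, h.2.1⟩

/-- The index formula for an arbitrary presentation `E ≃ eAᴺ`, evaluated with a representing cocycle
of a degree `2q` at which even `(g - h)²ᑫ` is nuclear. -/
theorem SigmaConnection.index_eq_duality [TopologicalSpace A] [IsTopologicalRing A]
    [ContinuousSMul ℂ A] [LocallyConvexSpace ℝ A] (hp : 1 ≤ p)
    (hsum : T.IsSummable p) {c : ContHPUpper A} (hc : T.IsConnesChern p (contForms A) c)
    {t : SigmaTranslate T.σ E F} (nab : T.SigmaConnection t) {N : ℕ}
    {e : Matrix (Fin N) (Fin N) A} (he : e * e = e) (φ : E ≃ₗ[Aᵐᵒᵖ] eModule e) :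
    ((nab.index : ℚ) : ℂ) = duality A c (homologyToTop A (chernClass e he)) := by
  set q := ⌈(p - 1) / 2⌉₊ + 1 with hq
  have hQ := doubleQ_mem hp hsum
  have hn : 1 ≤ 2 * ⌈(p - 1) / 2⌉₊ + 1 := Nat.le_add_left 1 _
  have hq' := two_mul_succ_le p
  obtain ⟨ψ, h, hS, h1, rfl⟩ := (hc q ((Nat.le_ceil _).trans (by rw [hq]; push_cast; linarith))).1
  have h2 : ψ = T.doubleTriple.character hn hQ q := DFunLike.coe_injective
    (h1.trans (tauBar_eq_character hn hQ (hq'.trans (Nat.le_succ _))).symm)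
  rw [duality_cyclicClass, h2]
  exact index_eq_matTrace (nab.changeIdem he φ) hn hQ hq'

end TwistedSpectralTriple

end CyclicTheory

end

theorem mainTheorem5 {A : Type*} [Ring A] [Algebra ℂ A] [StarRing A] [StarModule ℂ A]
    [TopologicalSpace A] [IsTopologicalRing A] [ContinuousSMul ℂ A] [LocallyConvexSpace ℝ A]
    [ContinuousStar A]
    {H : Type*} [NormedAddCommGroup H] [InnerProductSpace ℂ H] [CompleteSpace H]
    (T : CyclicTheory.TwistedSpectralTriple A H) (hT : T.IsSmooth)
    (p : ℝ) (hp : 1 ≤ p) (hsum : T.IsSummable p) :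
    T.TauWellDefined p ∧
    (∃! Ch : CyclicTheory.ContHPUpper A, T.IsConnesChern p (CyclicTheory.contForms A) Ch) ∧
    (∃! ch : CyclicTheory.HPUpper A, T.IsConnesChern p (CyclicTheory.allForms A) ch) ∧
    ∀ Ch : CyclicTheory.ContHPUpper A, T.IsConnesChern p (CyclicTheory.contForms A) Ch →
      T.IsConnesChern p (CyclicTheory.allForms A) (CyclicTheory.forgetContinuity A Ch) ∧
      ∀ (E : Type*) [AddCommGroup E] [Module ℂ E] [Module Aᵐᵒᵖ E] [IsScalarTower ℂ Aᵐᵒᵖ E]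
        (F : Type*) [AddCommGroup F] [Module ℂ F] [Module Aᵐᵒᵖ F] [IsScalarTower ℂ Aᵐᵒᵖ F]
        (t : CyclicTheory.SigmaTranslate T.σ E F) (nab : T.SigmaConnection t),
        nab.IsFredholmPart 1 ∧ nab.IsFredholmPart (-1) ∧
        ∀ (N : ℕ) (e : Matrix (Fin N) (Fin N) A) (he : e * e = e),
          Nonempty (E ≃ₗ[Aᵐᵒᵖ] CyclicTheory.eModule e) →
          ((nab.index : ℚ) : ℂ) = CyclicTheory.duality A Ch
            (CyclicTheory.homologyToTop A (CyclicTheory.chernClass e he)) := by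
  have hcont : ∀ (m : ℕ) (φ : CyclicTheory.MultiForm A m ℂ), Continuous φ →
      φ ∈ CyclicTheory.contForms A m := fun _ _ h => h
  obtain ⟨c, hc⟩ := CyclicTheory.TwistedSpectralTriple.exists_isConnesChern hT hp hsum hcont
  refine ⟨CyclicTheory.TwistedSpectralTriple.tauWellDefined hp hsum,
    ⟨c, hc, fun c' hc' => hc'.unique hc⟩, ⟨_, hc.forget, fun c' hc' => hc'.unique hc.forget⟩,
    fun Ch hCh => ⟨hCh.forget, fun E _ _ _ _ F _ _ _ _ t nab => ?_⟩⟩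
  have h := nab.isFredholmPart hp hsum
  exact ⟨h.1, h.2, fun N e he ⟨φ⟩ => nab.index_eq_duality hp hsum hCh he φ⟩
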